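/- **Notation.** Let $n\ge 2$ and $0\le p\le n/2$ be integers and let $a\in\mathbb R$. Write $x=(x',x_n)\in\mathbb R^{n-1}\times\mathbb R=\mathbb R^n$. For a vector $v$ let $\varepsilon_v$ and $i_v$ be the exterior and interior multiplication by $v$ on $\bigwedge\mathbb C^n$. A tempered distributional $p$-form on $\mathbb R^n$ is an element of $\mathcal S'(\mathbb R^n)\otimes\bigwedge^p\mathbb C^n$. Put $d'=\sum_{j<n}\varepsilon_{e_j}\partial_{x_j}$, $\delta'=-\sum_{j<n}i_{e_j}\partial_{x_j}$, $\Delta=\sum_{j=1}^n\partial_{x_j}^2$ and $$\Delta_{a,p}=x_n^2\Delta+a\,x_n\partial_{x_n}+2x_n\,(i_{e_n}d'-\varepsilon_{e_n}\delta')-(n-2p)\,\varepsilon_{e_n}i_{e_n}.$$ For integers $m\ge 1$ and real $s$ with $|s|<m/2-p$, let $\dot H^{s,p}(\mathbb R^m)$ be the Hilbert space of the tempered distributional $p$-forms $u$ on $\mathbb R^m$ whose Fourier transform $\hat u$ is a locally integrable function with $\int_{\mathbb R^m}|\xi|^{2s}\|\hat u(\xi)\|^2d\xi<\infty$, with the conformally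 invariant norm $$\|u\|^2=\int_{\mathbb R^m}|\xi|^{2s}\Big\langle\Big(\big(\tfrac m2-p+s\big)\,i_{\xi/|\xi|}\varepsilon_{\xi/|\xi|}+\big(\tfrac m2-p-s\big)\,\varepsilon_{\xi/|\xi|}i_{\xi/|\xi|}\Big)\hat u(\xi),\hat u(\xi)\Big\rangle\,d\xi ,$$ where $\hat u(\xi)=(2\pi)^{-m/2}\int e^{-ix\cdot\xi}u(x)\,dx$. **Theorem.** (1) Let $2-n+2p<a\le 2$. Then $\Delta_{a,p}$, with the smooth compactly supported $p$-forms as domain, is essentially self-adjoint on the Hilbert space $\dot H^{\frac{2-a}2,p}(\mathbb R^n)$, and the point spectrum of its closure contains $k(k+a-1)$ for every $k\in\{0,1,2,\dots\}$ with $k<\frac{1-a}2$. (2) Let $2-n+2p<a<1$. The pullback of smooth compactly supported $p$-forms on $\mathbb R^n$ to $\mathbb R^{n-1}=\{x_n=0\}$ extends uniquely to a continuous linear map $u\mapsto u|_{\mathbb R^{n-1}}$ from $\dot H^{\frac{2-a}2,p}(\mathbb R^n)$ to $\dot H^{\frac{1-a}2,p}(\mathbb R^{n-1})$, and for every $f\in\dot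 H^{\frac{1-a}2,p}(\mathbb R^{n-1})$ the Dirichlet problem $$\Delta_{a,p}u=0,\qquad u|_{\mathbb R^{n-1}}=f$$ (the equation in the sense of tempered distributions) has exactly one solution $u\in\dot H^{\frac{2-a}2,p}(\mathbb R^n)$. -/

import Mathlib

open MeasureTheory
open scoped SchwartzMap FourierTransform

noncomputable section

namespace DiffForms

/-- Euclidean space `ℝⁿ`. -/
abbrev Space (n : ℕ) : Type := EuclideanSpace ℝ (Fin n)

/-- The exterior algebra `⋀ ℂⁿ`, through its orthonormal basis `e_I = e_{i₁} ∧ … ∧ e_{iₖ}`,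
`I = {i₁ < … < iₖ}`. -/
abbrev Ext (n : ℕ) : Type := EuclideanSpace ℂ (Finset (Fin n))

/-- The exterior power `⋀ᵖ ℂⁿ`, through its orthonormal basis `e_I`, `|I| = p`. -/
abbrev Form (n p : ℕ) : Type := EuclideanSpace ℂ {I : Finset (Fin n) // I.card = p}

/-- The sign of moving `e_j` past the factors `e_i`, `i ∈ I`, `i < j`. -/
def sgn {n : ℕ} (j : Fin n) (I : Finset (Fin n)) : ℝ := (-1) ^ (I.filter (· < j)).card

/-- Exterior multiplication `ε_{e_j}`: `e_I ↦ e_j ∧ e_I`. -/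
def extMul {n : ℕ} (j : Fin n) : Ext n →L[ℂ] Ext n :=
  LinearMap.toContinuousLinearMap
    { toFun := fun v => WithLp.toLp 2 fun J => if j ∈ J then (sgn j J : ℂ) * v (J.erase j) else 0
      map_add' := by
        intro v w; ext J; by_cases h : j ∈ J <;> simp [h, mul_add]
      map_smul' := by
        intro c v; ext J; by_cases h : j ∈ J <;> simp [h, mul_left_comm] }

/-- Interior multiplication `i_{e_j}` (contraction with `e_j`). -/
def intMul {n : ℕ} (j : Fin n) : Ext n →L[ℂ] Ext n :=
  LinearMap.toContinuousLinearMap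
    { toFun := fun v => WithLp.toLp 2 fun J => if j ∈ J then 0 else (sgn j J : ℂ) * v (insert j J)
      map_add' := by
        intro v w; ext J; by_cases h : j ∈ J <;> simp [h, mul_add]
      map_smul' := by
        intro c v; ext J; by_cases h : j ∈ J <;> simp [h, mul_left_comm] }

/-- Exterior multiplication `ε_x` by the vector `x ∈ ℝⁿ`. -/
def extVec {n : ℕ} (x : Space n) : Ext n →L[ℂ] Ext n := ∑ j, (x j : ℂ) • extMul j

/-- Interior multiplication `i_x` by the vector `x ∈ ℝⁿ`. -/
def intVec {n : ℕ} (x : Space n) : Ext n →L[ℂ] Ext n := ∑ j, (x j : ℂ) • intMul j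

/-- The inclusion `⋀ᵖ ℂⁿ ⊆ ⋀ ℂⁿ`. -/
def incl (n p : ℕ) : Form n p →L[ℂ] Ext n :=
  LinearMap.toContinuousLinearMap
    { toFun := fun v => WithLp.toLp 2 fun J => if h : J.card = p then v ⟨J, h⟩ else 0
      map_add' := by
        intro v w; ext J; by_cases h : J.card = p <;> simp [h]
      map_smul' := by
        intro c v; ext J; by_cases h : J.card = p <;> simp [h] }

/-- The projection `⋀ ℂⁿ → ⋀ᵖ ℂⁿ`. -/
def proj (n p : ℕ) : Ext n →L[ℂ] Form n p :=
  LinearMap.toContinuousLinearMap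
    { toFun := fun v => WithLp.toLp 2 fun I => v I.1
      map_add' := by intro v w; ext J; simp
      map_smul' := by intro c v; ext J; simp }

/-- The pullback `⋀ᵖ ℂ^{d+1} → ⋀ᵖ ℂᵈ` of `p`-forms along the inclusion `x' ↦ (x', 0)`. -/
def pullForm (d p : ℕ) : Form (d + 1) p →L[ℂ] Form d p :=
  LinearMap.toContinuousLinearMap
    { toFun := fun v => WithLp.toLp 2 fun I =>
        v ⟨I.1.map Fin.castSuccEmb, by rw [Finset.card_map, I.2]⟩
      map_add' := by intro v w; ext J; simp
      map_smul' := by intro c v; ext J; simp }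

@[simp] lemma extMul_apply {n : ℕ} (j : Fin n) (v : Ext n) (J : Finset (Fin n)) :
    extMul j v J = if j ∈ J then (sgn j J : ℂ) * v (J.erase j) else 0 := rfl

@[simp] lemma intMul_apply {n : ℕ} (j : Fin n) (v : Ext n) (J : Finset (Fin n)) :
    intMul j v J = if j ∈ J then 0 else (sgn j J : ℂ) * v (insert j J) := rfl

@[simp] lemma incl_apply {n p : ℕ} (v : Form n p) (J : Finset (Fin n)) :
    incl n p v J = if h : J.card = p then v ⟨J, h⟩ else 0 := rfl

@[simp] lemma proj_apply {n p : ℕ} (v : Ext n) (I : {I : Finset (Fin n) // I.card = p}) :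
    proj n p v I = v I.1 := rfl

lemma sgn_insert {n : ℕ} (j k : Fin n) {I : Finset (Fin n)} (hk : k ∉ I) :
    sgn j (insert k I) = (if k < j then -1 else 1) * sgn j I := by
  unfold sgn
  rw [Finset.filter_insert]
  split_ifs with h
  · rw [Finset.card_insert_of_notMem (by simp [hk]), pow_succ]; ring
  · simp

lemma sgn_sq {n : ℕ} (j : Fin n) (I : Finset (Fin n)) : sgn j I * sgn j I = 1 := by
  unfold sgn; rw [← pow_add, ← two_mul]; simp

lemma sgn_erase_self {n : ℕ} (j : Fin n) (I : Finset (Fin n)) :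
    sgn j (I.erase j) = sgn j I := by
  unfold sgn
  congr 2
  ext i; simp only [Finset.mem_filter, Finset.mem_erase]
  constructor
  · rintro ⟨⟨-, h⟩, h'⟩; exact ⟨h, h'⟩
  · rintro ⟨h, h'⟩; exact ⟨⟨h'.ne, h⟩, h'⟩

/-- The Clifford relations `i_{e_j} ε_{e_k} + ε_{e_k} i_{e_j} = δ_{jk}`. -/
lemma clifford {n : ℕ} (j k : Fin n) (v : Ext n) :
    intMul j (extMul k v) + extMul k (intMul j v) = if j = k then v else 0 := by
  ext J
  by_cases hjk : j = k
  · subst hjk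
    by_cases hj : j ∈ J
    · have h1 : ((sgn j J : ℝ) : ℂ) * sgn j J = 1 := by exact_mod_cast sgn_sq j J
      simp [hj, sgn_erase_self, ← mul_assoc, h1]
    · have h1 : ((sgn j J : ℝ) : ℂ) * sgn j J = 1 := by exact_mod_cast sgn_sq j J
      simp [hj, sgn_insert j j hj, ← mul_assoc, h1]
  · have hkj : k ≠ j := fun h => hjk h.symm
    by_cases hj : j ∈ J
    · by_cases hk : k ∈ J <;> simp [hj, hk, hjk]
    · by_cases hk : k ∈ J
      · obtain ⟨I, hkI, rfl⟩ : ∃ I, k ∉ I ∧ J = insert k I :=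
          ⟨J.erase k, by simp, by simp [hk]⟩
        have hjI : j ∉ I := fun h => hj (by simp [h])
        have e1 : (insert j (insert k I)).erase k = insert j I := by
          rw [Finset.insert_comm, Finset.erase_insert (by simp [hkI, hkj])]
        have e2 : sgn k (insert j (insert k I)) = (if j < k then -1 else 1) * sgn k I := by
          rw [sgn_insert k j hj, sgn_insert k k hkI]; simp
        have e3 : sgn j (insert k I) = (if k < j then -1 else 1) * sgn j I := sgn_insert j k hkI
        have e4 : sgn k (insert k I) = sgn k I := by rw [sgn_insert k k hkI]; simp
        rcases lt_or_gt_of_ne hjk with h | h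
        · simp [hjk, hjI, hkI, e1, e2, e3, e4, h, h.not_gt]
          ring
        · simp [hjk, hjI, hkI, e1, e2, e3, e4, h, h.not_gt]
          ring
      · simp [hj, hk, hjk, hkj]

lemma inner_extMul {n : ℕ} (j : Fin n) (v w : Ext n) :
    inner ℂ (extMul j v) w = inner ℂ v (intMul j w) := by
  simp only [PiLp.inner_apply, extMul_apply, intMul_apply]
  rw [← Finset.sum_filter_add_sum_filter_not Finset.univ (fun J => j ∈ J)]
  conv_rhs => rw [← Finset.sum_filter_add_sum_filter_not Finset.univ (fun J => j ∈ J)]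
  have z1 : ∑ J with j ∉ J, inner ℂ (if j ∈ J then (sgn j J : ℂ) * v (J.erase j) else 0) (w J)
      = 0 := Finset.sum_eq_zero fun J hJ => by
    rw [if_neg (Finset.mem_filter.1 hJ).2, inner_zero_left]
  have z2 : ∑ J with j ∈ J, inner ℂ (v J) (if j ∈ J then 0 else (sgn j J : ℂ) * w (insert j J))
      = 0 := Finset.sum_eq_zero fun J hJ => by
    rw [if_pos (Finset.mem_filter.1 hJ).2, inner_zero_right]
  rw [z1, z2, add_zero, zero_add]
  refine Finset.sum_bij' (fun J _ => J.erase j) (fun J _ => insert j J) ?_ ?_ ?_ ?_ ?_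
  · intro J hJ; simp
  · intro J hJ; simp
  · intro J hJ; simp [(Finset.mem_filter.1 hJ).2]
  · intro J hJ
    have := (Finset.mem_filter.1 hJ).2
    simp [this]
  · intro J hJ
    have h := (Finset.mem_filter.1 hJ).2
    simp [h, sgn_erase_self]
    ring

lemma inner_extVec {n : ℕ} (x : Space n) (v w : Ext n) :
    inner ℂ (extVec x v) w = inner ℂ v (intVec x w) := by
  simp only [extVec, intVec, _root_.sum_apply, _root_.smul_apply,
    sum_inner, inner_sum, inner_smul_left, inner_smul_right, inner_extMul, Complex.conj_ofReal]

lemma intVec_extVec {n : ℕ} (x : Space n) (v : Ext n) :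
    intVec x (extVec x v) + extVec x (intVec x v) = ((‖x‖ ^ 2 : ℝ) : ℂ) • v := by
  have h : intVec x (extVec x v) + extVec x (intVec x v) =
      ∑ j, ∑ k, ((x j : ℂ) * x k) • (intMul j (extMul k v) + extMul k (intMul j v)) := by
    have h1 : intVec x (extVec x v) = ∑ j, ∑ k, ((x j : ℂ) * x k) • intMul j (extMul k v) := by
      simp only [extVec, intVec, _root_.sum_apply, _root_.smul_apply, map_sum, map_smul,
        Finset.smul_sum, smul_smul]
      rw [Finset.sum_comm]
      simp only [mul_comm]
    have h2 : extVec x (intVec x v) = ∑ j, ∑ k, ((x j : ℂ) * x k) • extMul k (intMul j v) := by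
      simp only [extVec, intVec, _root_.sum_apply, _root_.smul_apply, map_sum, map_smul,
        Finset.smul_sum, smul_smul]
    rw [h1, h2]
    simp only [smul_add, Finset.sum_add_distrib]
  rw [h]
  simp only [clifford, smul_ite, smul_zero, Finset.sum_ite_eq, Finset.mem_univ, if_true]
  rw [← Finset.sum_smul, EuclideanSpace.real_norm_sq_eq]
  push_cast
  simp [sq]

lemma inner_incl {n p : ℕ} (v : Form n p) (w : Ext n) :
    inner ℂ (incl n p v) w = inner ℂ v (proj n p w) := by
  simp only [PiLp.inner_apply, incl_apply, proj_apply]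
  rw [← Finset.sum_filter_add_sum_filter_not Finset.univ (fun J => J.card = p)]
  have z1 : ∑ J : Finset (Fin n) with ¬ J.card = p,
      inner ℂ (if h : J.card = p then v ⟨J, h⟩ else 0) (w J) = 0 :=
    Finset.sum_eq_zero fun J hJ => by
      rw [dif_neg (Finset.mem_filter.1 hJ).2, inner_zero_left]
  rw [z1, add_zero]
  refine Finset.sum_bij' (fun J hJ => ⟨J, (Finset.mem_filter.1 hJ).2⟩) (fun I _ => I.1)
    ?_ ?_ ?_ ?_ ?_
  · intro J hJ; simp
  · intro I hI; simp [I.2]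
  · intro J hJ; simp
  · intro I hI; simp
  · intro J hJ; simp [(Finset.mem_filter.1 hJ).2]

lemma norm_incl {n p : ℕ} (v : Form n p) : ‖incl n p v‖ = ‖v‖ := by
  have h : proj n p (incl n p v) = v := by ext I; simp [I.2]
  have := inner_incl v (incl n p v)
  rw [h, inner_self_eq_norm_sq_to_K, inner_self_eq_norm_sq_to_K] at this
  have h2 : ‖incl n p v‖ ^ 2 = ‖v‖ ^ 2 := by exact_mod_cast this
  exact (sq_eq_sq₀ (norm_nonneg _) (norm_nonneg _)).1 h2

/-- The operator `(n/2 - p + s) i_ξ̂ ε_ξ̂ + (n/2 - p - s) ε_ξ̂ i_ξ̂` on `⋀ᵖ ℂⁿ`, where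
`ξ̂ = ξ / |ξ|`. -/
def symbol (n p : ℕ) (s : ℝ) (ξ : Space n) : Form n p →L[ℂ] Form n p :=
  proj n p ∘L
    ((((n : ℝ) / 2 - p + s : ℝ) : ℂ) • (intVec (‖ξ‖⁻¹ • ξ) ∘L extVec (‖ξ‖⁻¹ • ξ)) +
      (((n : ℝ) / 2 - p - s : ℝ) : ℂ) • (extVec (‖ξ‖⁻¹ • ξ) ∘L intVec (‖ξ‖⁻¹ • ξ))) ∘L
    incl n p

lemma inner_symbol {n p : ℕ} {s : ℝ} (ξ : Space n) (v w : Form n p) :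
    inner ℂ (symbol n p s ξ v) w =
      (((n : ℝ) / 2 - p + s : ℝ) : ℂ) *
        inner ℂ (extVec (‖ξ‖⁻¹ • ξ) (incl n p v)) (extVec (‖ξ‖⁻¹ • ξ) (incl n p w)) +
      (((n : ℝ) / 2 - p - s : ℝ) : ℂ) *
        inner ℂ (intVec (‖ξ‖⁻¹ • ξ) (incl n p v)) (intVec (‖ξ‖⁻¹ • ξ) (incl n p w)) := by
  have hp : ∀ (a : Ext n) (b : Form n p), inner ℂ (proj n p a) b = inner ℂ a (incl n p b) := by
    intro a b; rw [← inner_conj_symm, ← inner_incl, inner_conj_symm]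
  have hi : ∀ (x : Space n) (a b : Ext n), inner ℂ (intVec x a) b = inner ℂ a (extVec x b) := by
    intro x a b; rw [← inner_conj_symm, ← inner_extVec, inner_conj_symm]
  simp only [symbol, ContinuousLinearMap.comp_apply, hp, _root_.add_apply,
    _root_.smul_apply, inner_add_left, inner_smul_left, Complex.conj_ofReal]
  rw [hi, inner_extVec _ (intVec _ _)]

lemma inner_symbol_symm {n p : ℕ} {s : ℝ} (ξ : Space n) (v w : Form n p) :
    starRingEnd ℂ (inner ℂ (symbol n p s ξ w) v) = inner ℂ (symbol n p s ξ v) w := by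
  rw [inner_symbol, inner_symbol]
  simp only [map_add, map_mul, Complex.conj_ofReal, inner_conj_symm]

lemma symbol_lower {n p : ℕ} {s c : ℝ} (h1 : c ≤ (n : ℝ) / 2 - p + s)
    (h2 : c ≤ (n : ℝ) / 2 - p - s) {ξ : Space n} (hξ : ξ ≠ 0) (v : Form n p) :
    c * ‖v‖ ^ 2 ≤ (inner ℂ (symbol n p s ξ v) v).re := by
  rw [inner_symbol, inner_self_eq_norm_sq_to_K, inner_self_eq_norm_sq_to_K]
  set x := ‖ξ‖⁻¹ • ξ with hx
  have hn : ‖x‖ = 1 := by rw [hx, norm_smul, norm_inv, norm_norm, inv_mul_cancel₀ (by simpa)]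
  have hi : ∀ (x : Space n) (a b : Ext n), inner ℂ (intVec x a) b = inner ℂ a (extVec x b) := by
    intro x a b; rw [← inner_conj_symm, ← inner_extVec, inner_conj_symm]
  have key : ‖extVec x (incl n p v)‖ ^ 2 + ‖intVec x (incl n p v)‖ ^ 2 = ‖v‖ ^ 2 := by
    have h := congrArg (fun a => inner ℂ a (incl n p v)) (intVec_extVec x (incl n p v))
    rw [inner_add_left, hn] at h
    rw [hi, inner_extVec _ (intVec _ _)] at h
    simp only [inner_smul_left, inner_self_eq_norm_sq_to_K] at h
    simp [norm_incl] at h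
    exact_mod_cast h
  have : ((((n : ℝ) / 2 - p + s : ℝ) : ℂ) * ((‖extVec x (incl n p v)‖ : ℝ) : ℂ) ^ 2 +
      (((n : ℝ) / 2 - p - s : ℝ) : ℂ) * ((‖intVec x (incl n p v)‖ : ℝ) : ℂ) ^ 2).re =
      ((n : ℝ) / 2 - p + s) * ‖extVec x (incl n p v)‖ ^ 2 +
        ((n : ℝ) / 2 - p - s) * ‖intVec x (incl n p v)‖ ^ 2 := by
    norm_cast
  refine le_of_le_of_eq ?_ this.symm
  rw [← key]
  nlinarith [sq_nonneg ‖extVec x (incl n p v)‖, sq_nonneg ‖intVec x (incl n p v)‖]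

lemma measurable_symbol (n p : ℕ) (s : ℝ) : Measurable (symbol n p s) := by
  have h1 : Continuous (fun x : Space n => extVec x) := by unfold extVec; fun_prop
  have h2 : Continuous (fun x : Space n => intVec x) := by unfold intVec; fun_prop
  have h3 : Continuous (fun x : Space n => proj n p ∘L
    ((((n : ℝ) / 2 - p + s : ℝ) : ℂ) • (intVec x ∘L extVec x) +
      (((n : ℝ) / 2 - p - s : ℝ) : ℂ) • (extVec x ∘L intVec x)) ∘L incl n p) := by fun_prop
  have h4 : Measurable (fun x : Space n => ‖x‖⁻¹ • x) := by fun_prop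
  exact h3.measurable.comp h4

lemma symbol_bounded (n p : ℕ) (s : ℝ) : ∃ C, ∀ ξ, ‖symbol n p s ξ‖ ≤ C := by
  have h1 : Continuous (fun x : Space n => extVec x) := by unfold extVec; fun_prop
  have h2 : Continuous (fun x : Space n => intVec x) := by unfold intVec; fun_prop
  have h3 : Continuous (fun x : Space n => proj n p ∘L
    ((((n : ℝ) / 2 - p + s : ℝ) : ℂ) • (intVec x ∘L extVec x) +
      (((n : ℝ) / 2 - p - s : ℝ) : ℂ) • (extVec x ∘L intVec x)) ∘L incl n p) := by fun_prop
  obtain ⟨C, hC⟩ := (isCompact_closedBall (0 : Space n) 1).exists_bound_of_continuousOn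
    h3.continuousOn
  refine ⟨C, fun ξ => hC (‖ξ‖⁻¹ • ξ) ?_⟩
  rw [mem_closedBall_zero_iff, norm_smul, norm_inv, norm_norm]
  exact inv_mul_le_one

/-- The tempered distribution `T` is given by the (locally integrable) function `g`. -/
def IsRep {n : ℕ} {F : Type*} [NormedAddCommGroup F] [NormedSpace ℂ F]
    (T : 𝓢'(Space n, F)) (g : Space n → F) : Prop :=
  AEStronglyMeasurable g volume ∧
    ∀ ψ : 𝓢(Space n, ℂ), Integrable (fun x => ψ x • g x) ∧ T ψ = ∫ x, ψ x • g x

namespace IsRep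

variable {n : ℕ} {F : Type*} [NormedAddCommGroup F] [NormedSpace ℂ F]
  {T T' : 𝓢'(Space n, F)} {g g' : Space n → F}

lemma zero : IsRep (0 : 𝓢'(Space n, F)) (fun _ => 0) :=
  ⟨aestronglyMeasurable_const, fun ψ => by simp⟩

lemma add (h : IsRep T g) (h' : IsRep T' g') : IsRep (T + T') (fun x => g x + g' x) := by
  refine ⟨h.1.add h'.1, fun ψ => ?_⟩
  simp only [smul_add]
  refine ⟨(h.2 ψ).1.add (h'.2 ψ).1, ?_⟩
  rw [integral_add (h.2 ψ).1 (h'.2 ψ).1, ← (h.2 ψ).2, ← (h'.2 ψ).2]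
  rfl

lemma smul (c : ℂ) (h : IsRep T g) : IsRep (c • T) (fun x => c • g x) := by
  refine ⟨h.1.const_smul c, fun ψ => ?_⟩
  simp only [smul_comm _ c]
  refine ⟨(h.2 ψ).1.smul c, ?_⟩
  rw [integral_smul, ← (h.2 ψ).2]
  rfl

lemma schwartz (φ : 𝓢(Space n, F)) : IsRep (φ : 𝓢'(Space n, F)) φ := by
  refine ⟨φ.continuous.aestronglyMeasurable, fun ψ => ⟨?_, SchwartzMap.coe_apply φ ψ⟩⟩
  exact (SchwartzMap.pairing (ContinuousLinearMap.lsmul ℂ ℂ) ψ φ).integrable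

lemma locallyIntegrable (h : IsRep T g) : LocallyIntegrable g volume := by
  rw [locallyIntegrable_iff]
  intro K hK
  obtain ⟨R, hR0, hR⟩ := hK.isBounded.subset_closedBall_lt 0 (0 : Space n)
  let b : ContDiffBump (0 : Space n) := ⟨R, R + 1, hR0, by linarith⟩
  have hc : HasCompactSupport (Complex.ofRealCLM ∘ b) := b.hasCompactSupport.comp_left rfl
  have hd : ContDiff ℝ (⊤ : ℕ∞) (Complex.ofRealCLM ∘ b) :=
    Complex.ofRealCLM.contDiff.comp b.contDiff
  have h1 := (h.2 (hc.toSchwartzMap hd)).1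
  refine (h1.integrableOn (s := K)).congr_fun ?_ hK.measurableSet
  intro x hx
  have : b x = 1 := b.one_of_mem_closedBall (hR hx)
  simp [this]

lemma ae_eq_zero [CompleteSpace F] (h : IsRep (0 : 𝓢'(Space n, F)) g) : g =ᵐ[volume] 0 := by
  refine ae_eq_zero_of_integral_contDiff_smul_eq_zero h.locallyIntegrable fun b hb hbc => ?_
  have hc : HasCompactSupport (Complex.ofRealCLM ∘ b) := hbc.comp_left rfl
  have hd : ContDiff ℝ (⊤ : ℕ∞) (Complex.ofRealCLM ∘ b) := Complex.ofRealCLM.contDiff.comp hb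
  have h1 := (h.2 (hc.toSchwartzMap hd)).2
  simpa using h1.symm

lemma ae_eq [CompleteSpace F] (h : IsRep T g) (h' : IsRep T g') : g =ᵐ[volume] g' := by
  have h0 : IsRep (0 : 𝓢'(Space n, F)) (fun x => g x + (-1 : ℂ) • g' x) := by
    have := h.add (h'.smul (-1))
    simpa using this
  filter_upwards [h0.ae_eq_zero] with x hx
  simpa [add_neg_eq_zero] using hx

lemma ext (h : IsRep T g) (h' : IsRep T' g') (hg : g =ᵐ[volume] g') : T = T' := by
  ext ψ
  rw [(h.2 ψ).2, (h'.2 ψ).2]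
  exact integral_congr_ae (hg.mono fun x hx => by simp [hx])

end IsRep

/-- The weight `|2πξ|ˢ`. -/
def wt {n : ℕ} (s : ℝ) (ξ : Space n) : ℝ := (2 * Real.pi * ‖ξ‖) ^ s

lemma wt_nonneg {n : ℕ} (s : ℝ) (ξ : Space n) : 0 ≤ wt s ξ :=
  Real.rpow_nonneg (by positivity) _

lemma wt_sq {n : ℕ} (s : ℝ) (ξ : Space n) : wt (2 * s) ξ = wt s ξ ^ 2 := by
  unfold wt
  rw [mul_comm 2 s, Real.rpow_mul (by positivity), Real.rpow_two]

lemma wt_pos {n : ℕ} (s : ℝ) {ξ : Space n} (h : ξ ≠ 0) : 0 < wt s ξ :=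
  Real.rpow_pos_of_pos (by have := norm_pos_iff.2 h; positivity) _

lemma measurable_wt {n : ℕ} (s : ℝ) : Measurable (wt s : Space n → ℝ) := by
  unfold wt; fun_prop

lemma memLp_iff {n p : ℕ} {s : ℝ} {g : Space n → Form n p} (hg : AEStronglyMeasurable g volume) :
    Integrable (fun ξ => wt (2 * s) ξ * ‖g ξ‖ ^ 2) ↔
      MemLp (fun ξ => (wt s ξ : ℂ) • g ξ) 2 volume := by
  have hm : AEStronglyMeasurable (fun ξ => (wt s ξ : ℂ) • g ξ) volume :=
    (Complex.measurable_ofReal.comp (measurable_wt s)).aestronglyMeasurable.smul hg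
  rw [memLp_two_iff_integrable_sq_norm hm]
  refine integrable_congr (Filter.Eventually.of_forall fun ξ => ?_)
  simp only [norm_smul, Complex.norm_real, Real.norm_eq_abs, mul_pow, sq_abs, wt_sq]

/-- The homogeneous Sobolev space of `p`-forms on `ℝⁿ` of order `s`: the tempered distributional
`p`-forms `u` whose Fourier transform is a function with `∫ |ξ|^{2s} ‖û(ξ)‖² dξ < ∞`. The Fourier
transform is `𝓕 u(ξ) = ∫ e^{-2πi x·ξ} u(x) dx`, so that the frequency is `2πξ`. -/
def homSobolev (n p : ℕ) (s : ℝ) : Submodule ℂ 𝓢'(Space n, Form n p) where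
  carrier := {u | ∃ g : Space n → Form n p, IsRep (𝓕 u) g ∧
    Integrable (fun ξ => (2 * Real.pi * ‖ξ‖) ^ (2 * s) * ‖g ξ‖ ^ 2)}
  zero_mem' := ⟨fun _ => 0, by rw [FourierTransform.fourier_zero]; exact IsRep.zero, by simp⟩
  add_mem' := by
    rintro u v ⟨g, hg, hgi⟩ ⟨g', hg', hgi'⟩
    refine ⟨fun x => g x + g' x, ?_, ?_⟩
    · rw [FourierTransform.fourier_add]; exact hg.add hg'
    · have h1 := (memLp_iff (s := s) hg.1).1 hgi
      have h2 := (memLp_iff (s := s) hg'.1).1 hgi'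
      refine (memLp_iff (s := s) (hg.add hg').1).2 ?_
      simp only [smul_add]
      exact h1.add h2
  smul_mem' := by
    rintro c u ⟨g, hg, hgi⟩
    refine ⟨fun x => c • g x, ?_, ?_⟩
    · rw [FourierTransform.fourier_smul]; exact hg.smul c
    · have h1 := (memLp_iff (s := s) hg.1).1 hgi
      refine (memLp_iff (s := s) (hg.smul c).1).2 ?_
      simp only [smul_comm _ c]
      exact h1.const_smul c

/-- The homogeneous Sobolev space `Ḣ^{s,p}(ℝⁿ)` for `|s| < n/2 - p`, as a type that will carry the
conformally invariant inner product. -/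
def HSob (n p : ℕ) (s : ℝ) (_ : |s| < (n : ℝ) / 2 - p) : Type := homSobolev n p s

variable {n p : ℕ} {s : ℝ} {hs : |s| < (n : ℝ) / 2 - p}

instance : AddCommGroup (HSob n p s hs) := inferInstanceAs (AddCommGroup (homSobolev n p s))

instance : Module ℂ (HSob n p s hs) := inferInstanceAs (Module ℂ (homSobolev n p s))

/-- The underlying tempered distribution. -/
def HSob.toDist : HSob n p s hs →ₗ[ℂ] 𝓢'(Space n, Form n p) := (homSobolev n p s).subtype

lemma HSob.toDist_injective : Function.Injective (HSob.toDist (hs := hs)) :=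
  Subtype.val_injective

lemma HSob.toDist_mem (u : HSob n p s hs) : u.toDist ∈ homSobolev n p s := u.2

/-- The Fourier transform of `u ∈ Ḣ^{s,p}(ℝⁿ)`, as a function. -/
def HSob.hat (u : HSob n p s hs) : Space n → Form n p := u.toDist_mem.choose

lemma HSob.isRep_hat (u : HSob n p s hs) : IsRep (𝓕 u.toDist) u.hat := u.toDist_mem.choose_spec.1

lemma HSob.memLp_hat (u : HSob n p s hs) :
    MemLp (fun ξ => (wt s ξ : ℂ) • u.hat ξ) 2 volume :=
  (memLp_iff u.isRep_hat.1).1 u.toDist_mem.choose_spec.2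

lemma HSob.hat_add (u v : HSob n p s hs) : (u + v).hat =ᵐ[volume] fun ξ => u.hat ξ + v.hat ξ := by
  refine (u + v).isRep_hat.ae_eq ?_
  rw [map_add, FourierTransform.fourier_add]
  exact u.isRep_hat.add v.isRep_hat

lemma HSob.hat_smul (c : ℂ) (u : HSob n p s hs) : (c • u).hat =ᵐ[volume] fun ξ => c • u.hat ξ := by
  refine (c • u).isRep_hat.ae_eq ?_
  rw [map_smul, FourierTransform.fourier_smul]
  exact u.isRep_hat.smul c

/-- The conformally invariant inner product
`⟨u, v⟩ = ∫ |ξ|^{2s} ⟨((n/2 - p + s) i_ξ̂ ε_ξ̂ + (n/2 - p - s) ε_ξ̂ i_ξ̂) û(ξ), v̂(ξ)⟩ dξ`.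
The substitution `ξ ↦ 2πξ` turns this integral for the unitary Fourier transform
`û(ξ) = (2π)^{-n/2} ∫ e^{-i x·ξ} u(x) dx` into the integral below for `𝓕 u`. -/
instance : Inner ℂ (HSob n p s hs) :=
  ⟨fun u v => ∫ ξ, (((2 * Real.pi * ‖ξ‖) ^ (2 * s) : ℝ) : ℂ) *
    inner ℂ (symbol n p s ξ (u.hat ξ)) (v.hat ξ)⟩

lemma HSob.inner_def (u v : HSob n p s hs) :
    inner ℂ u v = ∫ ξ, (((2 * Real.pi * ‖ξ‖) ^ (2 * s) : ℝ) : ℂ) *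
      inner ℂ (symbol n p s ξ (u.hat ξ)) (v.hat ξ) := rfl

lemma HSob.integrand_eq (u v : HSob n p s hs) (ξ : Space n) :
    (((2 * Real.pi * ‖ξ‖) ^ (2 * s) : ℝ) : ℂ) * inner ℂ (symbol n p s ξ (u.hat ξ)) (v.hat ξ) =
      inner ℂ (symbol n p s ξ ((wt s ξ : ℂ) • u.hat ξ)) ((wt s ξ : ℂ) • v.hat ξ) := by
  have := wt_sq s ξ
  unfold wt at this ⊢
  rw [this, map_smul, inner_smul_left, inner_smul_right, Complex.conj_ofReal]
  push_cast
  ring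

lemma HSob.memLp_symbol (u : HSob n p s hs) :
    MemLp (fun ξ => symbol n p s ξ ((wt s ξ : ℂ) • u.hat ξ)) 2 volume := by
  obtain ⟨C, hC⟩ := symbol_bounded n p s
  refine MemLp.of_le_mul (c := C) u.memLp_hat ?_ (Filter.Eventually.of_forall fun ξ => ?_)
  · exact (ContinuousLinearMap.apply ℂ (Form n p)).flip.aestronglyMeasurable_comp₂
      (measurable_symbol n p s).aestronglyMeasurable u.memLp_hat.1
  · exact (symbol n p s ξ).le_of_opNorm_le (hC ξ) _

lemma HSob.integrable_inner (u v : HSob n p s hs) :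
    Integrable fun ξ => (((2 * Real.pi * ‖ξ‖) ^ (2 * s) : ℝ) : ℂ) *
      inner ℂ (symbol n p s ξ (u.hat ξ)) (v.hat ξ) := by
  simp only [HSob.integrand_eq]
  have h := u.memLp_symbol.norm.integrable_mul v.memLp_hat.norm
  refine h.mono' (u.memLp_symbol.1.inner v.memLp_hat.1) (Filter.Eventually.of_forall fun ξ => ?_)
  exact norm_inner_le_norm _ _

lemma HSob.normSq_eq (u : HSob n p s hs) :
    (inner ℂ u u).re = ∫ ξ, wt (2 * s) ξ * (inner ℂ (symbol n p s ξ (u.hat ξ)) (u.hat ξ)).re := by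
  rw [HSob.inner_def]
  refine (integral_re (𝕜 := ℂ) (HSob.integrable_inner u u)).symm.trans ?_
  refine integral_congr_ae (Filter.Eventually.of_forall fun ξ => ?_)
  simp [wt]

lemma dim_pos (hs : |s| < (n : ℝ) / 2 - p) : 0 < n := by
  rcases Nat.eq_zero_or_pos n with rfl | h
  · have h1 := abs_nonneg s
    have h2 : (0 : ℝ) ≤ p := p.cast_nonneg
    norm_num at hs
    linarith
  · exact h

lemma ae_ne_zero (hn : 0 < n) : ∀ᵐ ξ : Space n, ξ ≠ 0 := by
  have : Nonempty (Fin n) := ⟨⟨0, hn⟩⟩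
  simp [ae_iff]

lemma symbol_nonneg (hs : |s| < (n : ℝ) / 2 - p) (ξ : Space n) (v : Form n p) :
    0 ≤ (inner ℂ (symbol n p s ξ v) v).re := by
  have h := abs_lt.1 hs
  rcases eq_or_ne ξ 0 with rfl | hξ
  · simp [inner_symbol, extVec, intVec]
  · simpa using symbol_lower (c := 0) (by linarith) (by linarith) hξ v

lemma HSob.lower (u : HSob n p s hs) :
    ((n : ℝ) / 2 - p - |s|) * ∫ ξ, ‖(wt s ξ : ℂ) • u.hat ξ‖ ^ 2 ≤ (inner ℂ u u).re := by
  rw [HSob.normSq_eq, ← integral_const_mul]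
  have hI := (HSob.integrable_inner u u).re
  refine integral_mono_ae ?_ ?_ ?_
  · exact ((memLp_two_iff_integrable_sq_norm u.memLp_hat.1).1 u.memLp_hat).const_mul _
  · simpa [wt] using hI
  · filter_upwards [ae_ne_zero (dim_pos hs)] with ξ hξ
    have h := symbol_lower (p := p) (s := s) (c := (n : ℝ) / 2 - p - |s|)
      (by linarith [neg_abs_le s]) (by linarith [le_abs_self s]) hξ (u.hat ξ)
    have h2 := mul_le_mul_of_nonneg_left h (wt_nonneg (2 * s) ξ)
    refine le_trans (le_of_eq ?_) h2
    rw [norm_smul, Complex.norm_real, Real.norm_eq_abs, mul_pow, sq_abs, wt_sq]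
    ring

lemma HSob.upper : ∃ C : ℝ, ∀ u : HSob n p s hs,
    (inner ℂ u u).re ≤ C * ∫ ξ, ‖(wt s ξ : ℂ) • u.hat ξ‖ ^ 2 := by
  obtain ⟨C, hC⟩ := symbol_bounded n p s
  refine ⟨C, fun u => ?_⟩
  rw [HSob.normSq_eq, ← integral_const_mul]
  have hI := (HSob.integrable_inner u u).re
  refine integral_mono ?_ ?_ fun ξ => ?_
  · simpa [wt] using hI
  · exact ((memLp_two_iff_integrable_sq_norm u.memLp_hat.1).1 u.memLp_hat).const_mul _
  · have h1 : (inner ℂ (symbol n p s ξ (u.hat ξ)) (u.hat ξ)).re ≤ C * ‖u.hat ξ‖ ^ 2 := by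
      refine (Complex.re_le_norm _).trans ((norm_inner_le_norm _ _).trans ?_)
      rw [sq, ← mul_assoc]
      exact mul_le_mul_of_nonneg_right ((symbol n p s ξ).le_of_opNorm_le (hC ξ) _) (norm_nonneg _)
    have h2 := mul_le_mul_of_nonneg_left h1 (wt_nonneg (2 * s) ξ)
    refine h2.trans (le_of_eq ?_)
    simp only [norm_smul, Complex.norm_real, Real.norm_eq_abs, mul_pow, sq_abs, wt_sq]
    ring

lemma HSob.eq_of_hat {u v : HSob n p s hs} (h : u.hat =ᵐ[volume] v.hat) : u = v := by
  apply HSob.toDist_injective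
  have := u.isRep_hat.ext v.isRep_hat h
  have h2 := congrArg (fun T : 𝓢'(Space n, Form n p) => 𝓕⁻ T) this
  simpa using h2

/-- The conformally invariant inner product is an inner product. -/
instance HSob.core : InnerProductSpace.Core ℂ (HSob n p s hs) where
  inner := inner ℂ
  conj_inner_symm u v := by
    rw [HSob.inner_def, HSob.inner_def, ← integral_conj]
    refine integral_congr_ae (Filter.Eventually.of_forall fun ξ => ?_)
    simp only [map_mul, Complex.conj_ofReal, inner_symbol_symm]
  re_inner_nonneg u := by
    change 0 ≤ (inner ℂ u u).re
    rw [HSob.normSq_eq]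
    exact integral_nonneg fun ξ => mul_nonneg (wt_nonneg _ _) (symbol_nonneg hs _ _)
  add_left u v w := by
    rw [HSob.inner_def, HSob.inner_def, HSob.inner_def,
      ← integral_add (HSob.integrable_inner u w) (HSob.integrable_inner v w)]
    refine integral_congr_ae ?_
    filter_upwards [HSob.hat_add u v] with ξ hξ
    rw [hξ, map_add, inner_add_left, mul_add]
  smul_left u v c := by
    rw [HSob.inner_def, HSob.inner_def, ← integral_const_mul]
    refine integral_congr_ae ?_
    filter_upwards [HSob.hat_smul c u] with ξ hξ
    rw [hξ, map_smul, inner_smul_left, mul_left_comm]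
  definite u hu := by
    have h1 := HSob.lower u
    have hc : 0 < (n : ℝ) / 2 - p - |s| := by linarith
    have hu' : inner ℂ u u = 0 := hu
    rw [hu', Complex.zero_re] at h1
    have h2 : ∫ ξ, ‖(wt s ξ : ℂ) • u.hat ξ‖ ^ 2 = 0 :=
      le_antisymm (by nlinarith) (integral_nonneg fun ξ => by positivity)
    rw [integral_eq_zero_iff_of_nonneg (fun ξ => by positivity)
      ((memLp_two_iff_integrable_sq_norm u.memLp_hat.1).1 u.memLp_hat)] at h2
    apply HSob.eq_of_hat
    have h0 : (0 : HSob n p s hs).hat =ᵐ[volume] fun _ => 0 := by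
      refine (0 : HSob n p s hs).isRep_hat.ae_eq ?_
      rw [map_zero, FourierTransform.fourier_zero]
      exact IsRep.zero
    filter_upwards [h2, h0, ae_ne_zero (dim_pos hs)] with ξ h hz hξ
    have h3 := (wt_pos s hξ).ne'
    rw [hz]
    simpa [h3] using h

instance : NormedAddCommGroup (HSob n p s hs) := HSob.core.toNormedAddCommGroup

instance : InnerProductSpace ℂ (HSob n p s hs) := InnerProductSpace.ofCore HSob.core.toCore

lemma HSob.norm_sq (u : HSob n p s hs) : ‖u‖ ^ 2 = (inner ℂ u u).re :=
  InnerProductSpace.norm_sq_eq_re_inner (𝕜 := ℂ) u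

lemma integrable_wt {t : ℝ} (hn : 0 < n) (ht : -(n : ℝ) < t) (ht' : t < n) :
    Integrable fun ξ : Space n => wt t ξ * (1 + ‖ξ‖) ^ (-((2 * n + 1 : ℕ) : ℝ)) := by
  have : Nonempty (Fin n) := ⟨⟨0, hn⟩⟩
  refine (integrable_fun_norm_addHaar (volume : Measure (Space n))
    (f := fun r : ℝ => (2 * Real.pi * r) ^ t * (1 + r) ^ (-((2 * n + 1 : ℕ) : ℝ)))).2 ?_
  simp only [finrank_euclideanSpace, Fintype.card_fin, smul_eq_mul]
  have hn1 : ((n - 1 : ℕ) : ℝ) = n - 1 := by rw [Nat.cast_sub hn]; simp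
  have heq : ∀ r : ℝ, 0 < r → r ^ (n - 1) * ((2 * Real.pi * r) ^ t *
      (1 + r) ^ (-((2 * n + 1 : ℕ) : ℝ))) = (2 * Real.pi) ^ t * (r ^ ((n : ℝ) - 1 + t) *
      (1 + r) ^ (-((2 * n + 1 : ℕ) : ℝ))) := by
    intro r hr
    rw [Real.mul_rpow (by positivity) hr.le, Real.rpow_add hr, ← hn1, Real.rpow_natCast]
    ring
  have hmeas : Measurable fun r : ℝ => r ^ (n - 1) * ((2 * Real.pi * r) ^ t *
      (1 + r) ^ (-((2 * n + 1 : ℕ) : ℝ))) := by fun_prop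
  rw [← Set.Ioc_union_Ioi_eq_Ioi zero_le_one, integrableOn_union]
  constructor
  · have h1 : IntegrableOn (fun r : ℝ => (2 * Real.pi) ^ t * r ^ ((n : ℝ) - 1 + t))
        (Set.Ioc 0 1) := by
      have := (intervalIntegral.intervalIntegrable_rpow' (a := 0) (b := 1)
        (r := (n : ℝ) - 1 + t) (by linarith)).const_mul ((2 * Real.pi) ^ t)
      rwa [intervalIntegrable_iff_integrableOn_Ioc_of_le zero_le_one] at this
    refine h1.mono' hmeas.aestronglyMeasurable ?_
    filter_upwards [ae_restrict_mem measurableSet_Ioc] with r hr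
    have hr0 := hr.1
    rw [heq r hr0, Real.norm_of_nonneg (by positivity)]
    refine mul_le_mul_of_nonneg_left (mul_le_of_le_one_right (by positivity) ?_) (by positivity)
    exact Real.rpow_le_one_of_one_le_of_nonpos (by linarith) (neg_nonpos.2 (Nat.cast_nonneg _))
  · have h1 : IntegrableOn (fun r : ℝ => (2 * Real.pi) ^ t *
        r ^ ((n : ℝ) - 1 + t - ((2 * n + 1 : ℕ) : ℝ))) (Set.Ioi 1) :=
      (integrableOn_Ioi_rpow_of_lt (by push_cast; linarith) zero_lt_one).const_mul _
    refine h1.mono' hmeas.aestronglyMeasurable ?_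
    filter_upwards [ae_restrict_mem measurableSet_Ioi] with r hr
    have hr0 : 0 < r := zero_lt_one.trans hr
    rw [heq r hr0, Real.norm_of_nonneg (by positivity),
      sub_eq_add_neg ((n : ℝ) - 1 + t), Real.rpow_add hr0 ((n : ℝ) - 1 + t)]
    have hle : (1 + r) ^ (-((2 * n + 1 : ℕ) : ℝ)) ≤ r ^ (-((2 * n + 1 : ℕ) : ℝ)) :=
      Real.rpow_le_rpow_of_nonpos hr0 (by linarith) (neg_nonpos.2 (Nat.cast_nonneg _))
    exact mul_le_mul_of_nonneg_left (mul_le_mul_of_nonneg_left hle (by positivity))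
      (by positivity)

/-- The measure `|2πξ|ᵗ dξ`. -/
def wtMeasure (n : ℕ) (t : ℝ) : Measure (Space n) :=
  volume.withDensity fun ξ => ((Real.toNNReal (wt t ξ) : NNReal) : ENNReal)

lemma measurable_wtNN (t : ℝ) : Measurable fun ξ : Space n => Real.toNNReal (wt t ξ) :=
  (measurable_wt t).real_toNNReal

lemma integrable_wtMeasure {F : Type*} [NormedAddCommGroup F] [NormedSpace ℂ F] {t : ℝ}
    {g : Space n → F} :
    Integrable g (wtMeasure n t) ↔ Integrable (fun ξ => (wt t ξ : ℂ) • g ξ) := by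
  rw [wtMeasure, integrable_withDensity_iff_integrable_smul (measurable_wtNN t)]
  refine integrable_congr (Filter.Eventually.of_forall fun ξ => ?_)
  simp [NNReal.smul_def, wt_nonneg]

lemma integrable_wtMeasure_real {t : ℝ} {g : Space n → ℝ} :
    Integrable g (wtMeasure n t) ↔ Integrable (fun ξ => wt t ξ * g ξ) := by
  rw [wtMeasure, integrable_withDensity_iff_integrable_smul (measurable_wtNN t)]
  refine integrable_congr (Filter.Eventually.of_forall fun ξ => ?_)
  simp [NNReal.smul_def, wt_nonneg]

lemma integral_wtMeasure {F : Type*} [NormedAddCommGroup F] [NormedSpace ℂ F] {t : ℝ}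
    {g : Space n → F} : ∫ ξ, g ξ ∂(wtMeasure n t) = ∫ ξ, (wt t ξ : ℂ) • g ξ := by
  rw [wtMeasure, integral_withDensity_eq_integral_smul (measurable_wtNN t)]
  refine integral_congr_ae (Filter.Eventually.of_forall fun ξ => ?_)
  simp [NNReal.smul_def, wt_nonneg]

lemma temperate_wtMeasure {t : ℝ} (hn : 0 < n) (ht : -(n : ℝ) < t) (ht' : t < n) :
    (wtMeasure n t).HasTemperateGrowth := by
  refine ⟨2 * n + 1, ?_⟩
  rw [wtMeasure, integrable_withDensity_iff_integrable_smul (measurable_wtNN t)]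
  refine (integrable_wt hn ht ht').congr (Filter.Eventually.of_forall fun ξ => ?_)
  simp [NNReal.smul_def, wt_nonneg]

lemma range_two (hs : |s| < (n : ℝ) / 2 - p) : -(n : ℝ) < 2 * s ∧ 2 * s < n := by
  have := abs_lt.1 hs
  have h2 : (0 : ℝ) ≤ p := p.cast_nonneg
  constructor <;> linarith

lemma integrable_schwartz_smul {μ : Measure (Space n)} [μ.HasTemperateGrowth]
    {k : Space n → Form n p} (hk : MemLp k 2 μ) (ψ : 𝓢(Space n, ℂ)) :
    Integrable (fun ξ => ψ ξ • k ξ) μ := by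
  have h := (ψ.memLp 2 μ).norm.integrable_mul hk.norm
  refine h.mono' (ψ.continuous.aestronglyMeasurable.smul hk.1)
    (Filter.Eventually.of_forall fun ξ => ?_)
  simp [norm_smul]

/-- Every square integrable function `h` is `|2πξ|ˢ û` for some `u ∈ Ḣ^{s,p}(ℝⁿ)`. -/
lemma HSob.exists_hat (hs : |s| < (n : ℝ) / 2 - p) {h : Space n → Form n p}
    (hh : MemLp h 2 volume) :
    ∃ u : HSob n p s hs, (fun ξ => (wt s ξ : ℂ) • u.hat ξ) =ᵐ[volume] h := by
  have hn := dim_pos hs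
  have hr := range_two hs
  have hT : (wtMeasure n (-(2 * s))).HasTemperateGrowth :=
    temperate_wtMeasure hn (by linarith) (by linarith)
  have hmul : ∀ ξ : Space n, ξ ≠ 0 → wt (-(2 * s)) ξ * wt s ξ = wt (-s) ξ := by
    intro ξ hξ
    unfold wt
    rw [← Real.rpow_add (by have := norm_pos_iff.2 hξ; positivity)]
    congr 1; ring
  have hmul' : ∀ ξ : Space n, ξ ≠ 0 → wt s ξ * wt (-s) ξ = 1 := by
    intro ξ hξ
    unfold wt
    rw [← Real.rpow_add (by have := norm_pos_iff.2 hξ; positivity)]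
    simp
  have hwm : ∀ t : ℝ, AEStronglyMeasurable (fun ξ : Space n => (wt t ξ : ℂ)) volume := fun t =>
    (Complex.measurable_ofReal.comp (measurable_wt t)).aestronglyMeasurable
  have hac : wtMeasure n (-(2 * s)) ≪ volume := withDensity_absolutelyContinuous _ _
  have hk : MemLp (fun ξ => (wt s ξ : ℂ) • h ξ) 2 (wtMeasure n (-(2 * s))) := by
    have hm : AEStronglyMeasurable (fun ξ => (wt s ξ : ℂ) • h ξ) volume := (hwm s).smul hh.1
    rw [memLp_two_iff_integrable_sq_norm (hm.mono_ac hac), integrable_wtMeasure_real]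
    refine ((memLp_two_iff_integrable_sq_norm hh.1).1 hh).congr ?_
    filter_upwards [ae_ne_zero hn] with ξ hξ
    rw [norm_smul, Complex.norm_real, Real.norm_of_nonneg (wt_nonneg _ _)]
    have h1 : wt (-(2 * s)) ξ * wt s ξ ^ 2 = 1 := by
      rw [sq, ← mul_assoc, hmul ξ hξ, mul_comm, hmul' ξ hξ]
    rw [mul_pow, ← mul_assoc, h1, one_mul]
  have hrep : IsRep (Lp.toTemperedDistribution hk.toLp) (fun ξ => (wt (-s) ξ : ℂ) • h ξ) := by
    refine ⟨(hwm (-s)).smul hh.1, fun ψ => ?_⟩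
    have hcongr : (fun ξ => (wt (-(2 * s)) ξ : ℂ) • (ψ ξ • ((wt s ξ : ℂ) • h ξ))) =ᵐ[volume]
        fun ξ => ψ ξ • ((wt (-s) ξ : ℂ) • h ξ) := by
      filter_upwards [ae_ne_zero hn] with ξ hξ
      rw [smul_comm, smul_smul (wt (-(2 * s)) ξ : ℂ), ← Complex.ofReal_mul, hmul ξ hξ]
    constructor
    · refine Integrable.congr ?_ hcongr
      rw [← integrable_wtMeasure]
      exact integrable_schwartz_smul hk ψ
    · rw [Lp.toTemperedDistribution_apply, ← integral_congr_ae hcongr, ← integral_wtMeasure]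
      refine integral_congr_ae ?_
      filter_upwards [hk.coeFn_toLp] with ξ hξ
      rw [hξ]
  set T : 𝓢'(Space n, Form n p) := Lp.toTemperedDistribution hk.toLp with hTdef
  have hF : 𝓕 (𝓕⁻ T) = T := FourierTransform.fourier_fourierInv_eq T
  have hback : (fun ξ => (wt s ξ : ℂ) • ((wt (-s) ξ : ℂ) • h ξ)) =ᵐ[volume] h := by
    filter_upwards [ae_ne_zero hn] with ξ hξ
    rw [smul_smul, ← Complex.ofReal_mul, hmul' ξ hξ, Complex.ofReal_one, one_smul]
  have hmem : 𝓕⁻ T ∈ homSobolev n p s := by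
    refine ⟨fun ξ => (wt (-s) ξ : ℂ) • h ξ, by rwa [hF], ?_⟩
    exact (memLp_iff hrep.1).2 ((memLp_congr_ae hback).2 hh)
  let u : HSob n p s hs := ⟨𝓕⁻ T, hmem⟩
  have hu : 𝓕 u.toDist = T := hF
  refine ⟨u, ?_⟩
  have h1 : u.hat =ᵐ[volume] fun ξ => (wt (-s) ξ : ℂ) • h ξ := by
    refine u.isRep_hat.ae_eq ?_
    rwa [hu]
  filter_upwards [h1, hback] with ξ h2 h3
  rw [h2, h3]

/-- The isomorphism `u ↦ |2πξ|ˢ û` of `Ḣ^{s,p}(ℝⁿ)` with `L²`. -/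
def HSob.toL2 (hs : |s| < (n : ℝ) / 2 - p) :
    HSob n p s hs →ₗ[ℂ] Lp (Form n p) 2 (volume : Measure (Space n)) where
  toFun u := u.memLp_hat.toLp
  map_add' u v := by
    rw [← MemLp.toLp_add]
    refine MemLp.toLp_congr _ _ ?_
    filter_upwards [HSob.hat_add u v] with ξ hξ
    simp [hξ]
  map_smul' c u := by
    rw [RingHom.id_apply, ← MemLp.toLp_const_smul]
    refine MemLp.toLp_congr _ _ ?_
    filter_upwards [HSob.hat_smul c u] with ξ hξ
    simp [hξ, smul_comm c]

lemma HSob.norm_toL2_sq (u : HSob n p s hs) :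
    ‖HSob.toL2 hs u‖ ^ 2 = ∫ ξ, ‖(wt s ξ : ℂ) • u.hat ξ‖ ^ 2 := by
  have h := congrArg Complex.re (L2.inner_def (𝕜 := ℂ) (HSob.toL2 hs u) (HSob.toL2 hs u))
  rw [inner_self_eq_norm_sq_to_K] at h
  have h1 : (((‖HSob.toL2 hs u‖ : ℝ) : ℂ) ^ 2).re = ‖HSob.toL2 hs u‖ ^ 2 := by norm_cast
  refine h1.symm.trans (h.trans ?_)
  refine (integral_re (𝕜 := ℂ) (L2.integrable_inner _ _)).symm.trans ?_
  refine integral_congr_ae ?_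
  filter_upwards [u.memLp_hat.coeFn_toLp] with ξ hξ
  have h2 : (HSob.toL2 hs u : Space n → Form n p) ξ = (wt s ξ : ℂ) • u.hat ξ := hξ
  rw [h2]
  exact inner_self_eq_norm_sq _

/-- `Ḣ^{s,p}(ℝⁿ)` is a Hilbert space. -/
instance : CompleteSpace (HSob n p s hs) := by
  have hc : 0 < (n : ℝ) / 2 - p - |s| := by linarith
  obtain ⟨C, hC⟩ := HSob.upper (hs := hs)
  have hlow : ∀ u : HSob n p s hs,
      ‖HSob.toL2 hs u‖ ≤ (Real.sqrt ((n : ℝ) / 2 - p - |s|))⁻¹ * ‖u‖ := by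
    intro u
    have h1 := HSob.lower u
    rw [← HSob.norm_toL2_sq, ← HSob.norm_sq] at h1
    rw [inv_mul_eq_div, le_div_iff₀ (Real.sqrt_pos.2 hc)]
    refine (sq_le_sq₀ (by positivity) (norm_nonneg u)).1 ?_
    rw [mul_pow, Real.sq_sqrt hc.le]
    linarith
  have hup : ∀ u : HSob n p s hs, ‖u‖ ≤ Real.sqrt |C| * ‖HSob.toL2 hs u‖ := by
    intro u
    have h1 := hC u
    rw [← HSob.norm_toL2_sq, ← HSob.norm_sq] at h1
    refine (sq_le_sq₀ (norm_nonneg u) (by positivity)).1 ?_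
    rw [mul_pow, Real.sq_sqrt (abs_nonneg C)]
    exact h1.trans (mul_le_mul_of_nonneg_right (le_abs_self C) (by positivity))
  have hinj : Function.Injective (HSob.toL2 hs) := by
    rw [injective_iff_map_eq_zero]
    intro u hu
    have := hup u
    rw [hu, norm_zero, mul_zero] at this
    exact norm_le_zero_iff.1 this
  have hsurj : Function.Surjective (HSob.toL2 hs) := by
    intro h
    obtain ⟨u, hu⟩ := HSob.exists_hat hs (Lp.memLp h)
    refine ⟨u, ?_⟩
    apply Lp.ext
    exact u.memLp_hat.coeFn_toLp.trans hu
  let e := LinearEquiv.ofBijective (HSob.toL2 hs) ⟨hinj, hsurj⟩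
  let e' : HSob n p s hs ≃L[ℂ] Lp (Form n p) 2 (volume : Measure (Space n)) :=
    e.toContinuousLinearEquivOfBounds _ _ hlow (fun x => by
      have := hup (e.symm x)
      rwa [show HSob.toL2 hs (e.symm x) = x from e.apply_symm_apply x] at this)
  exact (completeSpace_congr (e := e'.toEquiv) e'.isUniformEmbedding).2 inferInstance

lemma schwartz_mem (hs : |s| < (n : ℝ) / 2 - p) (φ : 𝓢(Space n, Form n p)) :
    (φ : 𝓢'(Space n, Form n p)) ∈ homSobolev n p s := by
  have hn := dim_pos hs
  have hr := range_two hs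
  have hT : (wtMeasure n (2 * s)).HasTemperateGrowth := temperate_wtMeasure hn hr.1 hr.2
  refine ⟨(𝓕 φ : 𝓢(Space n, Form n p)), ?_, ?_⟩
  · rw [TemperedDistribution.fourier_toTemperedDistributionCLM_eq]
    exact IsRep.schwartz _
  · have h := (memLp_two_iff_integrable_sq_norm
      ((𝓕 φ : 𝓢(Space n, Form n p)).continuous.aestronglyMeasurable (μ := wtMeasure n (2 * s)))).1 ((𝓕 φ : 𝓢(Space n, Form n p)).memLp 2 _)
    rw [wtMeasure, integrable_withDensity_iff_integrable_smul (measurable_wtNN _)] at h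
    refine h.congr (Filter.Eventually.of_forall fun ξ => ?_)
    have := wt_nonneg (2 * s) ξ
    simp only [NNReal.smul_def, Real.coe_toNNReal _ this, smul_eq_mul]
    rfl

/-- The action of a linear map `A` on the values of a vector-valued distribution. -/
def mapVal {n : ℕ} {F G : Type*} [NormedAddCommGroup F] [NormedSpace ℂ F] [NormedAddCommGroup G]
    [NormedSpace ℂ G] (A : F →L[ℂ] G) : 𝓢'(Space n, F) →L[ℂ] 𝓢'(Space n, G) :=
  PointwiseConvergenceCLM.postcomp 𝓢(Space n, ℂ) A

/-- The partial derivative `∂/∂x_j` of tempered distributions. -/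
def pd {n : ℕ} (j : Fin n) : 𝓢'(Space n, Ext n) →L[ℂ] 𝓢'(Space n, Ext n) :=
  LineDeriv.lineDerivOpCLM ℂ 𝓢'(Space n, Ext n) (EuclideanSpace.single j (1 : ℝ))

/-- Multiplication of tempered distributions by the coordinate `x_j`. -/
def mulCoord {n : ℕ} (j : Fin n) : 𝓢'(Space n, Ext n) →L[ℂ] 𝓢'(Space n, Ext n) :=
  TemperedDistribution.smulLeftCLM (Ext n) (fun x : Space n => (x j : ℂ))

/-- The differential `d' = ∑_{j<n} ε_{e_j} ∂/∂x_j` in the directions of `ℝⁿ⁻¹`, where `n = d + 1`. -/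
def dPrime (d : ℕ) : 𝓢'(Space (d + 1), Ext (d + 1)) →L[ℂ] 𝓢'(Space (d + 1), Ext (d + 1)) :=
  ∑ j : Fin d, mapVal (extMul j.castSucc) ∘L pd j.castSucc

/-- The codifferential `δ' = -∑_{j<n} i_{e_j} ∂/∂x_j` in the directions of `ℝⁿ⁻¹`, `n = d + 1`. -/
def deltaPrime (d : ℕ) : 𝓢'(Space (d + 1), Ext (d + 1)) →L[ℂ] 𝓢'(Space (d + 1), Ext (d + 1)) :=
  -∑ j : Fin d, mapVal (intMul j.castSucc) ∘L pd j.castSucc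

/-- The operator `x_n² Δ + a x_n ∂/∂x_n + 2 x_n (i_{e_n} d' - ε_{e_n} δ') - (n - 2p) ε_{e_n} i_{e_n}`
on distributions with values in `⋀ ℂⁿ`, `n = d + 1`, with `Δ = ∑_j ∂²/∂x_j²`. -/
def deltaExt (d p : ℕ) (a : ℝ) :
    𝓢'(Space (d + 1), Ext (d + 1)) →L[ℂ] 𝓢'(Space (d + 1), Ext (d + 1)) :=
  mulCoord (Fin.last d) ∘L mulCoord (Fin.last d) ∘L (∑ j, pd j ∘L pd j) +
    (a : ℂ) • (mulCoord (Fin.last d) ∘L pd (Fin.last d)) +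
    (2 : ℂ) • (mulCoord (Fin.last d) ∘L
      (mapVal (intMul (Fin.last d)) ∘L dPrime d - mapVal (extMul (Fin.last d)) ∘L deltaPrime d)) -
    (((d + 1 : ℕ) : ℂ) - 2 * (p : ℂ)) •
      (mapVal (extMul (Fin.last d)) ∘L mapVal (intMul (Fin.last d)))

/-- The operator `Δ_{a,p}` on tempered distributional `p`-forms on `ℝⁿ`, `n = d + 1`. -/
def deltaOp (d p : ℕ) (a : ℝ) :
    𝓢'(Space (d + 1), Form (d + 1) p) →L[ℂ] 𝓢'(Space (d + 1), Form (d + 1) p) :=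
  mapVal (proj (d + 1) p) ∘L deltaExt d p a ∘L mapVal (incl (d + 1) p)

/-- The distributions given by Schwartz functions. -/
def schwartzRange (n : ℕ) (F : Type*) [NormedAddCommGroup F] [NormedSpace ℂ F] :
    Submodule ℂ 𝓢'(Space n, F) :=
  LinearMap.range (SchwartzMap.toTemperedDistributionCLM (Space n) F volume).toLinearMap

lemma mapVal_mem {n : ℕ} {F G : Type*} [NormedAddCommGroup F] [NormedSpace ℂ F]
    [NormedAddCommGroup G] [NormedSpace ℂ G] [CompleteSpace F] [CompleteSpace G]
    (A : F →L[ℂ] G) {u : 𝓢'(Space n, F)}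
    (hu : u ∈ schwartzRange n F) : mapVal A u ∈ schwartzRange n G := by
  obtain ⟨φ, rfl⟩ := hu
  refine ⟨SchwartzMap.postcompCLM A φ, ?_⟩
  ext ψ
  refine ((IsRep.schwartz (SchwartzMap.postcompCLM A φ)).2 ψ).2.trans ?_
  refine Eq.trans ?_ (congrArg A ((IsRep.schwartz φ).2 ψ).2.symm)
  rw [← A.integral_comp_comm ((IsRep.schwartz φ).2 ψ).1]
  simp

lemma pd_mem {n : ℕ} (j : Fin n) {u : 𝓢'(Space n, Ext n)} (hu : u ∈ schwartzRange n (Ext n)) :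
    pd j u ∈ schwartzRange n (Ext n) := by
  obtain ⟨φ, rfl⟩ := hu
  exact ⟨_, (TemperedDistribution.lineDerivOp_toTemperedDistributionCLM_eq φ _).symm⟩

lemma mulCoord_mem {n : ℕ} (j : Fin n) {u : 𝓢'(Space n, Ext n)}
    (hu : u ∈ schwartzRange n (Ext n)) : mulCoord j u ∈ schwartzRange n (Ext n) := by
  obtain ⟨φ, rfl⟩ := hu
  have hg : (fun x : Space n => (x j : ℂ)).HasTemperateGrowth := by
    have := (Complex.ofRealCLM ∘L (EuclideanSpace.proj j : Space n →L[ℝ] ℝ)).hasTemperateGrowth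
    exact this
  refine ⟨SchwartzMap.smulLeftCLM (Ext n) (fun x : Space n => (x j : ℂ)) φ, ?_⟩
  refine DFunLike.ext _ _ fun ψ => ?_
  refine ((IsRep.schwartz (SchwartzMap.smulLeftCLM (Ext n) (fun x : Space n => (x j : ℂ)) φ)).2
    ψ).2.trans ?_
  refine Eq.trans ?_ ((IsRep.schwartz φ).2
    (SchwartzMap.smulLeftCLM ℂ (fun x : Space n => (x j : ℂ)) ψ)).2.symm
  congr 1
  ext1 x
  rw [SchwartzMap.smulLeftCLM_apply_apply hg, SchwartzMap.smulLeftCLM_apply_apply hg,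
    smul_smul, smul_eq_mul, mul_comm]

lemma deltaOp_mem (d p : ℕ) (a : ℝ) {u : 𝓢'(Space (d + 1), Form (d + 1) p)}
    (hu : u ∈ schwartzRange (d + 1) (Form (d + 1) p)) :
    deltaOp d p a u ∈ schwartzRange (d + 1) (Form (d + 1) p) := by
  have h := mapVal_mem (incl (d + 1) p) hu
  refine mapVal_mem (proj (d + 1) p) (?_ : deltaExt d p a (mapVal (incl (d + 1) p) u) ∈ _)
  generalize mapVal (incl (d + 1) p) u = v at h
  have hd : dPrime d v ∈ schwartzRange (d + 1) (Ext (d + 1)) := by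
    simp only [dPrime, _root_.sum_apply]
    exact Submodule.sum_mem _ fun j _ => mapVal_mem _ (pd_mem _ h)
  have hδ : deltaPrime d v ∈ schwartzRange (d + 1) (Ext (d + 1)) := by
    simp only [deltaPrime, _root_.neg_apply, _root_.sum_apply]
    exact Submodule.neg_mem _ (Submodule.sum_mem _ fun j _ => mapVal_mem _ (pd_mem _ h))
  have hΔ : (∑ j, pd j ∘L pd j) v ∈ schwartzRange (d + 1) (Ext (d + 1)) := by
    simp only [_root_.sum_apply]
    exact Submodule.sum_mem _ fun j _ => pd_mem _ (pd_mem _ h)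
  refine Submodule.sub_mem _ (Submodule.add_mem _ (Submodule.add_mem _ ?_ ?_) ?_) ?_
  · exact mulCoord_mem _ (mulCoord_mem _ hΔ)
  · exact Submodule.smul_mem _ _ (mulCoord_mem _ (pd_mem _ h))
  · exact Submodule.smul_mem _ _ (mulCoord_mem _
      (Submodule.sub_mem _ (mapVal_mem _ hd) (mapVal_mem _ hδ)))
  · exact Submodule.smul_mem _ _ (mapVal_mem _ (mapVal_mem _ h))

/-- The smooth compactly supported `p`-forms, as a subspace of `Ḣ^{s,p}(ℝⁿ)`. -/
def testForms (n p : ℕ) {s : ℝ} (hs : |s| < (n : ℝ) / 2 - p) : Submodule ℂ (HSob n p s hs) where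
  carrier := {u | ∃ φ : 𝓢(Space n, Form n p), HasCompactSupport φ ∧
    u.toDist = (φ : 𝓢'(Space n, Form n p))}
  zero_mem' := ⟨0, HasCompactSupport.zero, by simp⟩
  add_mem' := by
    rintro u v ⟨φ, hφ, hu⟩ ⟨ψ, hψ, hv⟩
    exact ⟨φ + ψ, hφ.add hψ, by rw [map_add, map_add, hu, hv]⟩
  smul_mem' := by
    rintro c u ⟨φ, hφ, hu⟩
    exact ⟨c • φ, hφ.smul_left (f := fun _ => c), by rw [map_smul, map_smul, hu]⟩

/-- `Δ_{a,p}` as an unbounded operator on the Hilbert space `Ḣ^{(2-a)/2,p}(ℝⁿ)`, `n = d + 1`, with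
the smooth compactly supported `p`-forms as domain. -/
def deltaMin (d p : ℕ) (a : ℝ) (hs : |(2 - a) / 2| < ((d + 1 : ℕ) : ℝ) / 2 - p) :
    HSob (d + 1) p ((2 - a) / 2) hs →ₗ.[ℂ] HSob (d + 1) p ((2 - a) / 2) hs where
  domain := testForms (d + 1) p hs
  toFun :=
    { toFun := fun u => ⟨deltaOp d p a u.1.toDist, by
        obtain ⟨φ, -, hu⟩ := u.2
        obtain ⟨ψ, hψ⟩ := deltaOp_mem d p a (u := u.1.toDist) ⟨φ, hu.symm⟩
        rw [← hψ]
        exact schwartz_mem hs ψ⟩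
      map_add' := fun u v => HSob.toDist_injective (map_add (deltaOp d p a) u.1.toDist v.1.toDist)
      map_smul' := fun c u => HSob.toDist_injective (map_smul (deltaOp d p a) c u.1.toDist) }

/-- A densely defined operator on a Hilbert space is essentially self-adjoint if it is closable and
its closure is self-adjoint. -/
def IsEssentiallySelfAdjoint {H : Type*} [NormedAddCommGroup H] [InnerProductSpace ℂ H]
    [CompleteSpace H] (T : H →ₗ.[ℂ] H) : Prop :=
  Dense (T.domain : Set H) ∧ T.IsClosable ∧ IsSelfAdjoint T.closure

/-- The point spectrum (the set of eigenvalues) of an unbounded operator. -/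
def pointSpectrum {H : Type*} [AddCommGroup H] [Module ℂ H] (T : H →ₗ.[ℂ] H) : Set ℂ :=
  {κ | ∃ u : T.domain, (u : H) ≠ 0 ∧ T u = κ • (u : H)}

/-- `R` is the restriction map `u ↦ u|_{ℝᵈ}`, `ℝᵈ = {(x', 0)} ⊆ ℝ^{d+1}`: a continuous linear map
which on smooth compactly supported forms is the pullback along `x' ↦ (x', 0)`. -/
def IsRestriction {d p : ℕ} {s t : ℝ} {hs : |s| < ((d + 1 : ℕ) : ℝ) / 2 - p}
    {ht : |t| < (d : ℝ) / 2 - p} (R : HSob (d + 1) p s hs →L[ℂ] HSob d p t ht) : Prop :=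
  ∀ (φ : 𝓢(Space (d + 1), Form (d + 1) p)), HasCompactSupport φ →
    ∀ u : HSob (d + 1) p s hs, u.toDist = (φ : 𝓢'(Space (d + 1), Form (d + 1) p)) →
      IsRep (R u).toDist
        (fun x' : Space d => pullForm d p (φ (WithLp.toLp 2 (Fin.snoc (α := fun _ => ℝ) x' 0))))

lemma range_bulk {d p : ℕ} {a : ℝ} (h1 : 2 - ((d + 1 : ℕ) : ℝ) + 2 * p < a) (h2 : a ≤ 2) :
    |(2 - a) / 2| < ((d + 1 : ℕ) : ℝ) / 2 - p := by
  rw [abs_of_nonneg (by linarith)]; linarith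

lemma range_boundary {d p : ℕ} {a : ℝ} (h1 : 2 - ((d + 1 : ℕ) : ℝ) + 2 * p < a) (h2 : a < 1) :
    |(1 - a) / 2| < (d : ℝ) / 2 - p := by
  push_cast at h1
  rw [abs_of_nonneg (by linarith)]; linarith

end DiffForms

end

/-! The Fourier transform turns multiplication by x_n into differentiation in the last frequency, so
every term of the operator becomes an ordinary differential operator along the lines τ ↦ (x, τ) over
a fixed x in ℝ^d, d = n - 1. With r² = |x|² + τ², m = n - 2p, s = (2 - a)/2, B = i_{e_n} ε_x +
ε_{e_n} i_x and N = ε_{e_n} i_{e_n}, the line operator is L_σ V = r² V'' + (2 - 2σ) τ V' - 2 B V' -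
m N V. The transform û sees L_{-s} + (2 - a). The dual function U = |2πξ|^{2s} S_s(ξ) û, which
represents the inner product with u in the flat L² pairing, sees L_s, and an equation T* u = z u
becomes L_s U = z U (`deltaOp_dual_eq`, `ae_fiber_of_deltaOp_eq`). A priori this holds only weakly.
Separation of variables against a countable family of bumps (`ae_fiber_weak`) and the lemma of du
Bois-Reymond (`exists_classical_solution`) make it classical on almost every line.

Splitting forms by x/|x| and e_n decouples L_σ: B is |x| times a quarter turn of two of the four
components, and N projects to two of them. What remains are two scalar equations and one 2 × 2
system (`FiberEq.equations`). In these components the conformal inner product is an explicit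
quadratic form, and L_σ has a Green formula for it (`hasDerivAt_pairGreen`,
`hasDerivAt_scalarGreen`).

Essential self-adjointness. A solution of L_s U = z U that is square integrable for the weight
r^{-2s} has finite energy, by a Caccioppoli estimate (`integrable_energy`). The boundary form is
then at most (|x| + |τ|) times an integrable function. For nonreal z its imaginary part is monotone,
and a monotone function with such a bound is zero because 1/τ is not integrable
(`monotone_eq_zero`). The form is definite since |s| < m/2, so U = 0. Thus both deficiency spaces
vanish (`FiberEq.eq_zero`, `deltaMin_deficiency`), and as a by-product every solution of the adjoint
equation lies in the closure.

Eigenvalues. Take w without e_n and U = c(x) q(τ/|x|) i_x ε_x w. Both B and N kill this, and only (1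
+ t²) q'' + a t q' = κ q is left. It has a polynomial solution of degree k for κ = k(k + a - 1),
which is square integrable for the weight r^{-(2 - a)} when 2k < 1 - a.

Dirichlet problem. The restriction has Fourier transform ∫ û(x, τ) dτ, which by Cauchy-Schwarz costs
half a derivative when s > 1/2. For z = 0 a first integral and a second monotonicity argument
(`pair_kernel`) show that U is constant along the lines with values in the kernel of N. Conversely,
all such U give solutions. The trace of such a solution is an explicit line integral, a nonzero
constant times |x|^{1-2s} S_{-(s-1/2)}(x) applied to the pullback of U (`HSob.trace_of_const`). The
boundary symbol is invertible and the pullback is an isomorphism from the kernel of N, so solutions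
and boundary data correspond one to one. -/

noncomputable section

namespace DiffForms

/-! ### Deficiency criterion for essential self-adjointness -/

section Criterion

variable {H : Type*} [NormedAddCommGroup H] [InnerProductSpace ℂ H] [CompleteSpace H]

open Complex in
/-- A symmetric operator with trivial deficiency spaces contains all pairs `(u, g)` of its adjoint
in its closure. -/
lemma mem_closure_graph_of_deficiency {T : H →ₗ.[ℂ] H} (hc : T.IsClosable)
    (hsym : ∀ x y : T.domain, inner ℂ (T x) (y : H) = inner ℂ (x : H) (T y))
    (hdef : ∀ z : ℂ, z = I ∨ z = -I → ∀ u : H,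
      (∀ φ : T.domain, inner ℂ (T φ) u = z * inner ℂ (φ : H) u) → u = 0)
    {u g : H} (hu : ∀ φ : T.domain, inner ℂ (T φ) u = inner ℂ (φ : H) g) :
    (u, g) ∈ T.closure.graph := by
  have hgr : T.closure.graph = T.graph.topologicalClosure := hc.graph_closure_eq_closure_graph.symm
  -- For fixed u and g the relation is closed in the product space, so it passes from the graph of T
  -- to its closure.
  have hext : ∀ {u g : H}, (∀ φ : T.domain, inner ℂ (T φ) u = inner ℂ (φ : H) g) →
      ∀ q ∈ T.closure.graph, inner ℂ q.2 u = inner ℂ q.1 g := by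
    intro u g h q hq
    rw [hgr] at hq
    have hcl : IsClosed {q : H × H | inner ℂ q.2 u = inner ℂ q.1 g} :=
      isClosed_eq (by fun_prop) (by fun_prop)
    refine (closure_minimal (fun q hq => ?_) hcl) hq
    obtain ⟨x, hx1, hx2⟩ := (LinearPMap.mem_graph_iff T).1 hq
    have := h x
    rwa [hx1, hx2] at this
  have hsym' : ∀ q ∈ T.closure.graph, ∀ q' ∈ T.closure.graph,
      inner ℂ q.2 q'.1 = inner ℂ q.1 q'.2 := by
    intro q hq q' hq'
    refine hext (fun φ => ?_) q hq
    have h2 := hext (u := (φ : H)) (g := T φ) (fun ψ => hsym ψ φ) q' hq'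
    rw [← inner_conj_symm, ← h2, inner_conj_symm]
  -- Symmetry kills the cross term in ‖y - i x‖², so T̄ - i is bounded below on the closed graph and
  -- its range K is closed. A vector orthogonal to K lies in the deficiency space of -i, hence K is
  -- everything.
  let f : H × H →ₗ[ℂ] H := LinearMap.snd ℂ H H - I • LinearMap.fst ℂ H H
  have hf : ∀ q : H × H, f q = q.2 - I • q.1 := fun q => rfl
  let K : Submodule ℂ H := T.closure.graph.map f
  have hbound : ∀ q ∈ T.closure.graph, ‖q‖ ≤ ‖f q‖ := by
    intro q hq
    have h1 : ‖f q‖ ^ 2 = ‖q.2‖ ^ 2 + ‖q.1‖ ^ 2 := by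
      rw [hf, @norm_sub_sq ℂ]
      have h2 : (inner ℂ q.2 q.1).im = 0 := by
        have := hsym' q hq q hq
        rw [← inner_conj_symm q.1] at this
        exact Complex.conj_eq_iff_im.1 this.symm
      rw [inner_smul_right, norm_smul]
      simp [h2]
    rw [Prod.norm_def]
    refine max_le ?_ ?_ <;> refine (sq_le_sq₀ (norm_nonneg _) (norm_nonneg _)).1 ?_ <;>
      rw [h1] <;> nlinarith [sq_nonneg ‖q.1‖, sq_nonneg ‖q.2‖]
  have hKc : IsClosed (K : Set H) := by
    have hG : IsClosed (T.closure.graph : Set (H × H)) := by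
      rw [hgr]; exact Submodule.isClosed_topologicalClosure _
    have : CompleteSpace T.closure.graph := hG.completeSpace_coe
    have hanti : AntilipschitzWith 1 (fun q : T.closure.graph => f q) := by
      refine AddMonoidHomClass.antilipschitz_of_bound
        (f.comp T.closure.graph.subtype) (K := 1) fun q => ?_
      simpa using hbound q q.2
    have hcont : UniformContinuous (fun q : T.closure.graph => f q) := by
      have : UniformContinuous fun q : H × H => q.2 - I • q.1 :=
        uniformContinuous_snd.sub (uniformContinuous_fst.const_smul I)
      exact this.comp uniformContinuous_subtype_val
    have h := hanti.isClosed_range hcont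
    convert h using 1
    ext y; simp [K]
  have hKtop : K = ⊤ := by
    have : CompleteSpace K := hKc.completeSpace_coe
    rw [← Submodule.orthogonal_eq_bot_iff, Submodule.eq_bot_iff]
    intro v hv
    refine hdef (-I) (Or.inr rfl) v fun φ => ?_
    have hmem : T φ - I • (φ : H) ∈ K := ⟨((φ : H), T φ),
      LinearPMap.le_graph_of_le T.le_closure (T.mem_graph φ), rfl⟩
    have := hv _ hmem
    rw [inner_sub_left, inner_smul_left, sub_eq_zero, Complex.conj_I] at this
    exact this
  have hmem : g - I • u ∈ K := by rw [hKtop]; trivial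
  obtain ⟨q, hq, hqe⟩ := hmem
  rw [hf] at hqe
  -- The pair q solves T̄ q.1 - i q.1 = g - i u, so u - q.1 satisfies the adjoint equation with
  -- eigenvalue i and the other deficiency space applies.
  have hw : u - q.1 = 0 := by
    refine hdef I (Or.inl rfl) _ fun φ => ?_
    have h2 := hsym' ((φ : H), T φ) (LinearPMap.le_graph_of_le T.le_closure (T.mem_graph φ)) q hq
    simp only at h2
    rw [inner_sub_right, hu, h2, ← inner_sub_right, ← inner_smul_right]
    congr 1
    rw [smul_sub, ← sub_eq_zero]
    rw [← sub_eq_zero] at hqe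
    rw [← neg_eq_zero, ← hqe]
    abel
  have hq1 : q.1 = u := (sub_eq_zero.1 hw).symm
  have hq2 : q.2 = g := by rw [hq1] at hqe; exact sub_left_injective hqe
  rwa [← hq1, ← hq2]

open Complex in
/-- A densely defined symmetric operator with trivial deficiency spaces is essentially
self-adjoint. -/
lemma isEssentiallySelfAdjoint_of_deficiency {T : H →ₗ.[ℂ] H} (hd : Dense (T.domain : Set H))
    (hsym : ∀ x y : T.domain, inner ℂ (T x) (y : H) = inner ℂ (x : H) (T y))
    (hdef : ∀ z : ℂ, z = I ∨ z = -I → ∀ u : H,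
      (∀ φ : T.domain, inner ℂ (T φ) u = z * inner ℂ (φ : H) u) → u = 0) :
    IsEssentiallySelfAdjoint T := by
  have hle : T ≤ T.adjoint := LinearPMap.IsFormalAdjoint.le_adjoint hd fun x y => hsym x y
  have hc : T.IsClosable := (T.adjoint_isClosed hd).isClosable.leIsClosable hle
  refine ⟨hd, hc, ?_⟩
  have hgr : T.closure.graph = T.graph.topologicalClosure := hc.graph_closure_eq_closure_graph.symm
  have hdc : Dense (T.closure.domain : Set H) := hd.mono T.le_closure.1
  rw [LinearPMap.isSelfAdjoint_def]
  -- The adjoint lies in the closure by the preceding lemma. The reverse inclusion is the symmetry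
  -- of the closure, extended from T one argument at a time.
  refine LinearPMap.eq_of_eq_graph (le_antisymm ?_ ?_)
  · intro q hq
    obtain ⟨y, hy1, hy2⟩ := (LinearPMap.mem_graph_iff _).1 hq
    refine mem_closure_graph_of_deficiency hc hsym hdef (u := q.1) (g := q.2) fun φ => ?_
    have h := LinearPMap.adjoint_isFormalAdjoint hdc y ⟨φ, T.le_closure.1 φ.2⟩
    have h2 : T.closure ⟨φ, T.le_closure.1 φ.2⟩ = T φ := (T.le_closure.2 rfl).symm
    rw [h2] at h
    rw [← hy1, ← hy2, ← inner_conj_symm, ← h, inner_conj_symm]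
  · intro q hq
    have key : ∀ x : T.closure.domain, inner ℂ q.2 (x : H) = inner ℂ q.1 (T.closure x) := by
      have hq' := hq
      rw [hgr] at hq'
      intro x
      have hcl : IsClosed {q : H × H | inner ℂ q.2 (x : H) = inner ℂ q.1 (T.closure x)} :=
        isClosed_eq (by fun_prop) (by fun_prop)
      refine (closure_minimal (fun q hq => ?_) hcl) hq'
      obtain ⟨y, hy1, hy2⟩ := (LinearPMap.mem_graph_iff T).1 hq
      have hx := T.closure.mem_graph x
      rw [hgr] at hx
      have hcl2 : IsClosed {r : H × H | inner ℂ q.2 r.1 = inner ℂ q.1 r.2} :=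
        isClosed_eq (by fun_prop) (by fun_prop)
      refine (closure_minimal (fun r hr => ?_) hcl2) hx
      obtain ⟨w, hw1, hw2⟩ := (LinearPMap.mem_graph_iff T).1 hr
      have := hsym y w
      rwa [hy1, hy2, hw1, hw2] at this
    have hmem : q.1 ∈ T.closure.adjoint.domain :=
      LinearPMap.mem_adjoint_domain_of_exists _ ⟨q.2, key⟩
    rw [LinearPMap.mem_graph_iff]
    exact ⟨⟨q.1, hmem⟩, rfl, LinearPMap.adjoint_apply_eq hdc _ key⟩

end Criterion

/-! ### Compactly supported functions in the Schwartz space -/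

section CompactSupport

variable {n : ℕ}

/-- Compactly supported functions are dense in the Schwartz space. -/
lemma SchwartzMap_dense_compactSupport :
    Dense {φ : 𝓢(Space n, ℂ) | HasCompactSupport φ} := by
  intro φ
  let b : ContDiffBump (0 : Space n) := ⟨1, 2, one_pos, one_lt_two⟩
  let g : ℕ → Space n → Space n := fun k x => ((k : ℝ) + 1)⁻¹ • x
  have hk0 : ∀ k : ℕ, (0 : ℝ) < (k : ℝ) + 1 := fun k => by positivity
  let χ : ℕ → Space n → ℝ := fun k x => b (g k x)
  have hχd : ∀ k, ContDiff ℝ (⊤ : ℕ∞) (χ k) := fun k => by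
    refine b.contDiff.comp ?_
    fun_prop
  have hχc : ∀ k, HasCompactSupport (χ k) := fun k =>
    b.hasCompactSupport.comp_homeomorph (Homeomorph.smulOfNeZero _ (inv_ne_zero (hk0 k).ne'))
  have hcs : ∀ k, HasCompactSupport fun x => (χ k x : ℝ) • φ x := fun k => (hχc k).smul_right
  have hcd : ∀ k, ContDiff ℝ (⊤ : ℕ∞) fun x => (χ k x : ℝ) • φ x := fun k =>
    (hχd k).smul (φ.smooth _)
  let ψ : ℕ → 𝓢(Space n, ℂ) := fun k => (hcs k).toSchwartzMap (hcd k)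
  have hψ : ∀ k x, ψ k x = (χ k x : ℝ) • φ x := fun k x => rfl
  refine mem_closure_of_tendsto (f := ψ) (b := Filter.atTop) ?_
    (Filter.Eventually.of_forall fun k => hcs k)
  rw [(schwartz_withSeminorms ℂ (Space n) ℂ).tendsto_nhds]
  rintro ⟨q, l⟩ ε hε
  -- bounds for the derivatives of the cutoffs
  have hbd : ∀ i : ℕ, ∃ C : ℝ, 0 ≤ C ∧ ∀ k x,
      ‖iteratedFDeriv ℝ i (fun x => χ k x - 1) x‖ ≤ C := by
    intro i
    have hc : HasCompactSupport (iteratedFDeriv ℝ i (fun x => b x)) :=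
      b.hasCompactSupport.iteratedFDeriv i
    obtain ⟨C, hC⟩ := (b.contDiff (n := (⊤ : ℕ∞))).continuous_iteratedFDeriv
      (m := i) (by exact_mod_cast le_top) |>.bounded_above_of_compact_support hc
    refine ⟨C + 1, by linarith [(norm_nonneg _).trans (hC 0)], fun k x => ?_⟩
    have hsub : iteratedFDeriv ℝ i (fun x => χ k x - 1) x =
        iteratedFDeriv ℝ i (χ k) x - iteratedFDeriv ℝ i (fun _ : Space n => (1 : ℝ)) x :=
      iteratedFDeriv_sub_apply ((hχd k).of_le (by exact_mod_cast le_top)).contDiffAt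
        contDiffAt_const
    rw [hsub]
    refine (norm_sub_le _ _).trans (add_le_add ?_ ?_)
    · let G : Space n →L[ℝ] Space n := ((k : ℝ) + 1)⁻¹ • ContinuousLinearMap.id ℝ (Space n)
      have h1 : iteratedFDeriv ℝ i (χ k) x =
          (iteratedFDeriv ℝ i (fun x => b x) (G x)).compContinuousLinearMap fun _ => G :=
        G.iteratedFDeriv_comp_right (b.contDiff (n := (⊤ : ℕ∞))) x (by exact_mod_cast le_top)
      rw [h1]
      refine (ContinuousMultilinearMap.norm_compContinuousLinearMap_le _ _).trans ?_
      have hG : ‖G‖ ≤ 1 := by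
        refine (norm_smul_le (((k : ℝ) + 1)⁻¹) (ContinuousLinearMap.id ℝ (Space n))).trans ?_
        refine mul_le_one₀ ?_ (norm_nonneg _) ContinuousLinearMap.norm_id_le
        rw [norm_inv, Real.norm_of_nonneg (hk0 k).le]
        exact inv_le_one_of_one_le₀ (by linarith [(Nat.cast_nonneg k : (0 : ℝ) ≤ k)])
      refine (mul_le_of_le_one_right (norm_nonneg _) ?_).trans (hC _)
      exact Finset.prod_le_one (fun _ _ => norm_nonneg _) fun _ _ => hG
    · rcases Nat.eq_zero_or_pos i with rfl | hi
      · simp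
      · rw [iteratedFDeriv_const_of_ne hi.ne']; simp
  choose C hC0 hC using hbd
  -- The cutoff differs from 1 only where ‖x‖ ≥ k + 1. There one extra power of ‖x‖ buys the factor
  -- 1/(k + 1), which is why the seminorms with weight q + 1 appear.
  let K : ℝ := ∑ i ∈ Finset.range (l + 1), (l.choose i : ℝ) * C i *
    SchwartzMap.seminorm ℂ (q + 1) (l - i) φ
  have hK : 0 ≤ K := Finset.sum_nonneg fun i _ =>
    mul_nonneg (mul_nonneg (Nat.cast_nonneg _) (hC0 i)) (apply_nonneg _ _)
  have hmain : ∀ k, SchwartzMap.seminorm ℂ q l (ψ k - φ) ≤ K / ((k : ℝ) + 1) := by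
    intro k
    refine SchwartzMap.seminorm_le_bound _ _ _ _ (div_nonneg hK (hk0 k).le) fun x => ?_
    have hfun : (⇑(ψ k - φ) : Space n → ℂ) = fun x => (χ k x - 1) • φ x := by
      ext1 x
      rw [_root_.sub_apply, hψ, sub_smul, one_smul]
    rw [hfun]
    rcases lt_or_ge ‖x‖ ((k : ℝ) + 1) with hx | hx
    · have hz : (fun x => (χ k x - 1) • φ x) =ᶠ[nhds x] fun _ => 0 := by
        have hopen : Metric.ball (0 : Space n) ((k : ℝ) + 1) ∈ nhds x :=
          Metric.isOpen_ball.mem_nhds (by simpa using hx)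
        filter_upwards [hopen] with y hy
        have : χ k y = 1 := by
          refine b.one_of_mem_closedBall ?_
          rw [mem_closedBall_zero_iff, norm_smul, norm_inv, Real.norm_of_nonneg (hk0 k).le]
          rw [mem_ball_zero_iff] at hy
          exact inv_mul_le_one_of_le₀ hy.le (hk0 k).le
        simp [this]
      rw [(hz.iteratedFDeriv ℝ l).self_of_nhds]
      have h0 : iteratedFDeriv ℝ l (fun _ : Space n => (0 : ℂ)) x = 0 := by
        rw [iteratedFDeriv_fun_zero]; rfl
      rw [h0, norm_zero, mul_zero]
      exact div_nonneg hK (hk0 k).le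
    · have hleib := norm_iteratedFDeriv_smul_le (𝕜 := ℝ)
        (((hχd k).sub contDiff_const : ContDiff ℝ (⊤ : ℕ∞) fun x => χ k x - 1))
        (φ.smooth (⊤ : ℕ∞)) x (n := l) (by exact_mod_cast le_top)
      have hxq : ‖x‖ ^ q ≤ ‖x‖ ^ (q + 1) / ((k : ℝ) + 1) := by
        rw [le_div_iff₀ (hk0 k), pow_succ]
        exact mul_le_mul_of_nonneg_left hx (by positivity)
      refine (mul_le_mul hxq hleib (norm_nonneg _) (by positivity)).trans ?_
      rw [div_mul_eq_mul_div, div_le_div_iff_of_pos_right (hk0 k), Finset.mul_sum]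
      refine Finset.sum_le_sum fun i _ => ?_
      have h1 := SchwartzMap.le_seminorm ℂ (q + 1) (l - i) φ x
      calc ‖x‖ ^ (q + 1) * ((l.choose i : ℝ) * ‖iteratedFDeriv ℝ i (fun x => χ k x - 1) x‖ *
            ‖iteratedFDeriv ℝ (l - i) φ x‖)
          = (l.choose i : ℝ) * ‖iteratedFDeriv ℝ i (fun x => χ k x - 1) x‖ *
            (‖x‖ ^ (q + 1) * ‖iteratedFDeriv ℝ (l - i) φ x‖) := by ring
        _ ≤ _ := mul_le_mul (mul_le_mul_of_nonneg_left (hC i k x) (Nat.cast_nonneg _)) h1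
            (by positivity) (mul_nonneg (Nat.cast_nonneg _) (hC0 i))
  have hlim : Filter.Tendsto (fun k : ℕ => K / ((k : ℝ) + 1)) Filter.atTop (nhds 0) :=
    tendsto_const_div_atTop_nhds_zero_nat K |>.comp (Filter.tendsto_add_atTop_nat 1) |>.congr
      fun k => by simp
  filter_upwards [hlim.eventually (gt_mem_nhds hε)] with k hk
  exact (hmain k).trans_lt hk

/-- The test forms have compact support in x, whereas all equations are read in the frequency.
Continuity and bijectivity of the Fourier transform on Schwartz functions, together with the density
above, bridge the two. -/
lemma eq_zero_of_fourier_compactSupport {F : Type*} [NormedAddCommGroup F] [NormedSpace ℂ F]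
    {ℓ : 𝓢(Space n, ℂ) →L[ℂ] F}
    (h : ∀ ψ : 𝓢(Space n, ℂ), HasCompactSupport ψ → ℓ (𝓕 ψ) = 0) : ℓ = 0 := by
  have h2 : Dense {φ : 𝓢(Space n, ℂ) | HasCompactSupport φ} := SchwartzMap_dense_compactSupport
  have h1 : ∀ ψ : 𝓢(Space n, ℂ), ℓ (𝓕 ψ) = 0 := by
    have hc : Continuous fun ψ : 𝓢(Space n, ℂ) => ℓ (𝓕 ψ) :=
      ℓ.continuous.comp (FourierTransform.fourierCLM ℂ 𝓢(Space n, ℂ)).continuous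
    have := hc.ext_on h2 continuous_const (g := fun _ => (0 : F)) fun ψ hψ => h ψ hψ
    exact fun ψ => congrFun this ψ
  ext ψ
  have := h1 (𝓕⁻ ψ)
  rwa [FourierTransform.fourier_fourierInv_eq] at this

end CompactSupport

/-! ### Weak solutions of the line equation are classical -/

section WeakODE

variable {E : Type*} [NormedAddCommGroup E] [NormedSpace ℝ E]

lemma intervalIntegrable_of_locallyIntegrable {E : Type*} [NormedAddCommGroup E] {f : ℝ → E} (hf : LocallyIntegrable f volume)
    (a b : ℝ) : IntervalIntegrable f volume a b := by
  rw [intervalIntegrable_iff]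
  exact (hf.integrableOn_isCompact isCompact_uIcc).mono_set Set.uIoc_subset_uIcc

lemma locallyIntegrable_clm {F : Type*} [NormedAddCommGroup F] [NormedSpace ℝ F]
    {X : Type*} [TopologicalSpace X] [MeasurableSpace X] {μ : Measure X} (B : E →L[ℝ] F)
    {f : X → E} (hf : LocallyIntegrable f μ) :
    LocallyIntegrable (fun x => B (f x)) μ := fun x => by
  obtain ⟨s, hs, h⟩ := hf x
  exact ⟨s, hs, B.integrable_comp h⟩

lemma tsupport_subset_Icc {F : Type*} [Zero F] {β : ℝ → F} (hc : HasCompactSupport β) :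
    ∃ R : ℝ, 0 < R ∧ tsupport β ⊆ Set.Ioo (-R) R := by
  obtain ⟨R, hR0, hR⟩ := hc.isCompact.isBounded.subset_ball_lt 0 (0 : ℝ)
  refine ⟨R, hR0, hR.trans ?_⟩
  rw [Real.ball_eq_Ioo]; simp

lemma integral_deriv_eq_zero_of_compactSupport {β : ℝ → ℝ} (hβ : ContDiff ℝ (⊤ : ℕ∞) β)
    (hc : HasCompactSupport β) : ∫ τ, deriv β τ = 0 := by
  have hd := (contDiff_infty_iff_deriv.1 hβ)
  exact integral_eq_zero_of_hasDerivAt_of_integrable (fun x => (hd.1 x).hasDerivAt)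
    (hd.2.continuous.integrable_of_hasCompactSupport hc.deriv)
    (hβ.continuous.integrable_of_hasCompactSupport hc)

/-- Integration by parts against the primitive of a locally integrable function. -/
lemma integral_deriv_smul_primitive [CompleteSpace E] {f : ℝ → E}
    (hf : LocallyIntegrable f volume)
    {β : ℝ → ℝ} (hβ : ContDiff ℝ (⊤ : ℕ∞) β) (hc : HasCompactSupport β) :
    ∫ τ, deriv β τ • (∫ σ in (0 : ℝ)..τ, f σ) = -∫ τ, β τ • f τ := by
  obtain ⟨R, hR0, hR⟩ := tsupport_subset_Icc hc
  have hd := contDiff_infty_iff_deriv.1 hβ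
  have hint := intervalIntegrable_of_locallyIntegrable hf
  have hdR : tsupport (deriv β) ⊆ Set.Ioo (-R) R := tsupport_deriv_subset.trans hR
  set μ : Measure ℝ := volume.restrict (Set.Ioc (-R) R) with hμ
  have hfμ : Integrable f μ := (hint (-R) R).1
  have hsupp : ∀ {g : ℝ → ℝ} (h : ℝ → E), tsupport g ⊆ Set.Ioo (-R) R →
      ∫ τ, g τ • h τ = ∫ τ, g τ • h τ ∂μ := by
    intro g h hg
    refine (setIntegral_eq_integral_of_forall_compl_eq_zero fun x hx => ?_).symm
    have : x ∉ tsupport g := fun h' => hx (Set.Ioo_subset_Ioc_self (hg h'))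
    rw [image_eq_zero_of_notMem_tsupport this, zero_smul]
  -- move the base point to `-R`
  have h1 : ∫ τ, deriv β τ • (∫ σ in (0 : ℝ)..τ, f σ) =
      ∫ τ, deriv β τ • (∫ σ in (-R)..τ, f σ) := by
    have hcont : Continuous fun τ => ∫ σ in (-R)..τ, f σ :=
      intervalIntegral.continuous_primitive hint _
    have e : ∀ τ, deriv β τ • (∫ σ in (0 : ℝ)..τ, f σ) =
        deriv β τ • (∫ σ in (-R)..τ, f σ) + deriv β τ • (∫ σ in (0 : ℝ)..(-R), f σ) := by
      intro τ
      rw [← smul_add, add_comm (∫ σ in (-R)..τ, f σ),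
        intervalIntegral.integral_add_adjacent_intervals (hint _ _) (hint _ _)]
    simp_rw [e]
    rw [integral_add, integral_smul_const, integral_deriv_eq_zero_of_compactSupport hβ hc,
      zero_smul, add_zero]
    · exact (hd.2.continuous.smul hcont).integrable_of_hasCompactSupport hc.deriv.smul_right
    · exact (hd.2.continuous.integrable_of_hasCompactSupport hc.deriv).smul_const _
  rw [h1, hsupp _ hdR, hsupp _ hR]
  -- Fubini on the triangle
  have hk : ∀ τ ∈ Set.Ioc (-R) R, deriv β τ • (∫ σ in (-R)..τ, f σ) =
      ∫ σ, (Set.Ici σ).indicator (deriv β) τ • f σ ∂μ := by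
    intro τ hτ
    rw [intervalIntegral.integral_of_le hτ.1.le, ← integral_smul]
    rw [← integral_indicator measurableSet_Ioc]
    rw [hμ, ← integral_indicator measurableSet_Ioc]
    refine integral_congr_ae (Filter.Eventually.of_forall fun σ => ?_)
    by_cases h1 : σ ∈ Set.Ioc (-R) τ
    · have : σ ∈ Set.Ioc (-R) R := ⟨h1.1, h1.2.trans hτ.2⟩
      simp [Set.indicator_of_mem, h1, this, h1.2]
    · by_cases h2 : σ ∈ Set.Ioc (-R) R
      · have : ¬ σ ≤ τ := fun h => h1 ⟨h2.1, h⟩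
        simp [h1, h2, this]
      · simp [h1, h2]
  rw [setIntegral_congr_fun measurableSet_Ioc hk]
  rw [← hμ, integral_integral_swap]
  · have hk2 : ∀ σ ∈ Set.Ioc (-R) R,
        ∫ τ, (Set.Ici σ).indicator (deriv β) τ • f σ ∂μ = -(β σ • f σ) := by
      intro σ hσ
      rw [integral_smul_const, ← neg_smul]
      congr 1
      rw [integral_indicator measurableSet_Ici, hμ, Measure.restrict_restrict measurableSet_Ici]
      have : Set.Ici σ ∩ Set.Ioc (-R) R = Set.Icc σ R := by
        ext x; simp only [Set.mem_inter_iff, Set.mem_Ici, Set.mem_Ioc, Set.mem_Icc]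
        exact ⟨fun h => ⟨h.1, h.2.2⟩, fun h => ⟨h.1, hσ.1.trans_le h.1, h.2⟩⟩
      rw [this, integral_Icc_eq_integral_Ioc, ← intervalIntegral.integral_of_le hσ.2,
        intervalIntegral.integral_deriv_eq_sub (fun x _ => hd.1 x)
          (hd.2.continuous.intervalIntegrable _ _)]
      have : β R = 0 := image_eq_zero_of_notMem_tsupport fun h => (hR h).2.false
      rw [this, zero_sub]
    rw [setIntegral_congr_fun measurableSet_Ioc hk2, integral_neg]
  · have hprod : Integrable (fun z : ℝ × ℝ => deriv β z.1 • f z.2) (μ.prod μ) :=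
      Integrable.smul_prod (hd.2.continuous.integrable_of_hasCompactSupport hc.deriv).restrict hfμ
    have hms : MeasurableSet {z : ℝ × ℝ | z.2 ≤ z.1} := measurableSet_le measurable_snd measurable_fst
    refine (hprod.indicator hms).congr (Filter.Eventually.of_forall fun z => ?_)
    simp only [Function.uncurry, Set.indicator, Set.mem_ofPred_eq, Set.mem_Ici]
    split_ifs <;> simp

/-- The primitive started to the left of the support is constant to the right of it, and that
constant is the total integral, which is zero. -/
lemma exists_primitive {δ : ℝ → ℝ} (hδ : ContDiff ℝ (⊤ : ℕ∞) δ) (hc : HasCompactSupport δ)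
    (h0 : ∫ τ, δ τ = 0) :
    ∃ γ : ℝ → ℝ, ContDiff ℝ (⊤ : ℕ∞) γ ∧ HasCompactSupport γ ∧ deriv γ = δ := by
  obtain ⟨R, hR0, hR⟩ := tsupport_subset_Icc hc
  have hder : ∀ x, HasDerivAt (fun u => ∫ t in (-R)..u, δ t) (δ x) x := fun x =>
    intervalIntegral.integral_hasDerivAt_right (hδ.continuous.intervalIntegrable _ _)
      (hδ.continuous.stronglyMeasurableAtFilter _ _) hδ.continuous.continuousAt
  have hdeq : deriv (fun u => ∫ t in (-R)..u, δ t) = δ := funext fun x => (hder x).deriv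
  have hz : ∀ x, x ∉ Set.Ioo (-R) R → δ x = 0 := fun x hx =>
    image_eq_zero_of_notMem_tsupport fun h => hx (hR h)
  refine ⟨fun u => ∫ t in (-R)..u, δ t, ?_, ?_, hdeq⟩
  · exact contDiff_infty_iff_deriv.2 ⟨fun x => (hder x).differentiableAt, by rwa [hdeq]⟩
  · refine HasCompactSupport.intro (isCompact_Icc (a := -R) (b := R)) fun x hx => ?_
    rcases lt_or_ge x (-R) with h | h
    · refine (intervalIntegral.integral_congr (g := fun _ => 0) fun t ht => hz t ?_).trans (by simp)
      rw [Set.uIcc_of_ge h.le] at ht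
      exact fun h' => (h'.1.trans_le ht.2).false
    · have hx2 : R < x := by
        by_contra hcon
        exact hx ⟨h, not_lt.1 hcon⟩
      rw [intervalIntegral.integral_eq_integral_of_support_subset, h0]
      intro t ht
      by_contra hcon
      refine ht (hz t fun h' => hcon ⟨h'.1, (h'.2.trans hx2).le⟩)

/-- The fundamental lemma of du Bois-Reymond. -/
lemma ae_const_of_integral_deriv_smul [CompleteSpace E] {K : ℝ → E}
    (hK : LocallyIntegrable K volume)
    (h : ∀ β : ℝ → ℝ, ContDiff ℝ (⊤ : ℕ∞) β → HasCompactSupport β →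
      ∫ τ, deriv β τ • K τ = 0) : ∃ c : E, K =ᵐ[volume] fun _ => c := by
  let b : ContDiffBump (0 : ℝ) := ⟨1, 2, one_pos, one_lt_two⟩
  let η : ℝ → ℝ := b.normed volume
  have hη : ContDiff ℝ (⊤ : ℕ∞) η := b.contDiff_normed
  have hηc : HasCompactSupport η := b.hasCompactSupport_normed
  have hη1 : ∫ τ, η τ = 1 := b.integral_normed
  refine ⟨∫ τ, η τ • K τ, ?_⟩
  have hKc := hK.sub (locallyIntegrable_const (∫ τ, η τ • K τ) (μ := volume (α := ℝ)))
  have := ae_eq_zero_of_integral_contDiff_smul_eq_zero hKc fun β hβ hβc => ?_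
  · filter_upwards [this] with x hx
    exact sub_eq_zero.1 hx
  · have i1 := hβ.continuous.integrable_of_hasCompactSupport (μ := volume) hβc
    have i2 := hη.continuous.integrable_of_hasCompactSupport (μ := volume) hηc
    have hbη : HasCompactSupport fun τ => (∫ t, β t) * η τ := hηc.mul_left
    -- Every test function is (∫ β) η plus the derivative of another one, since η has integral 1.
    -- This identifies the constant as ∫ η K.
    obtain ⟨γ, hγ, hγc, hγd⟩ := exists_primitive (δ := fun τ => β τ - (∫ t, β t) * η τ)
      (hβ.sub (contDiff_const.mul hη)) (hβc.sub hbη)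
      (by rw [integral_sub i1 (i2.const_mul _), integral_const_mul, hη1, mul_one, sub_self])
    have h1 := h γ hγ hγc
    rw [hγd] at h1
    have j1 := hK.integrable_smul_left_of_hasCompactSupport hβ.continuous hβc
    have j2 := hK.integrable_smul_left_of_hasCompactSupport hη.continuous hηc
    simp only [sub_smul, mul_smul] at h1
    have j2' : Integrable fun τ => (∫ t, β t) • η τ • K τ := j2.smul _
    rw [integral_sub j1 j2', integral_smul, sub_eq_zero] at h1
    simp only [Pi.sub_apply, smul_sub]
    rw [integral_sub j1 (i1.smul_const _), h1, integral_smul_const, sub_self]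

/-- A function with vanishing second weak derivative is affine. -/
lemma ae_affine_of_integral_deriv_deriv_smul [CompleteSpace E] {K : ℝ → E}
    (hK : LocallyIntegrable K volume)
    (h : ∀ β : ℝ → ℝ, ContDiff ℝ (⊤ : ℕ∞) β → HasCompactSupport β →
      ∫ τ, deriv (deriv β) τ • K τ = 0) : ∃ c c' : E, K =ᵐ[volume] fun τ => c + τ • c' := by
  let b : ContDiffBump (0 : ℝ) := ⟨1, 2, one_pos, one_lt_two⟩
  let η : ℝ → ℝ := b.normed volume
  have hη : ContDiff ℝ (⊤ : ℕ∞) η := b.contDiff_normed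
  have hηc : HasCompactSupport η := b.hasCompactSupport_normed
  have hη1 : ∫ τ, η τ = 1 := b.integral_normed
  have hηd := contDiff_infty_iff_deriv.1 hη
  set v : E := ∫ τ, deriv η τ • K τ with hv
  have hlin : LocallyIntegrable (fun τ : ℝ => τ • v) volume :=
    (by fun_prop : Continuous fun τ : ℝ => τ • v).locallyIntegrable
  -- If K has slope c' then v = ∫ η' K = -c', so adding τ v should remove the linear part. The same
  -- decomposition of β shows that the weak first derivative of K + τ v is zero.
  obtain ⟨c, hc⟩ := ae_const_of_integral_deriv_smul (hK.add hlin) fun β hβ hβc => by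
    have i1 := hβ.continuous.integrable_of_hasCompactSupport (μ := volume) hβc
    have i2 := hη.continuous.integrable_of_hasCompactSupport (μ := volume) hηc
    have hβd := contDiff_infty_iff_deriv.1 hβ
    have hbη : HasCompactSupport fun τ => (∫ t, β t) * η τ := hηc.mul_left
    obtain ⟨γ, hγ, hγc, hγd⟩ := exists_primitive (δ := fun τ => β τ - (∫ t, β t) * η τ)
      (hβ.sub (contDiff_const.mul hη)) (hβc.sub hbη)
      (by rw [integral_sub i1 (i2.const_mul _), integral_const_mul, hη1, mul_one, sub_self])
    have h1 := h γ hγ hγc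
    have hγ2 : deriv (deriv γ) = fun τ => deriv β τ - (∫ t, β t) * deriv η τ := by
      rw [hγd]
      funext τ
      rw [deriv_fun_sub (hβd.1 τ) ((hηd.1 τ).const_mul _), deriv_const_mul _ (hηd.1 τ)]
    rw [hγ2] at h1
    have j1 := hK.integrable_smul_left_of_hasCompactSupport hβd.2.continuous hβc.deriv
    have j2 := hK.integrable_smul_left_of_hasCompactSupport hηd.2.continuous hηc.deriv
    have j3 := hlin.integrable_smul_left_of_hasCompactSupport hβd.2.continuous hβc.deriv
    simp only [sub_smul, mul_smul] at h1
    have j2' : Integrable fun τ => (∫ t, β t) • deriv η τ • K τ := j2.smul _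
    rw [integral_sub j1 j2', integral_smul, sub_eq_zero, ← hv] at h1
    simp only [Pi.add_apply, smul_add]
    rw [integral_add j1 j3, h1]
    have h2 := integral_deriv_smul_primitive
      (locallyIntegrable_const v (μ := volume (α := ℝ))) hβ hβc
    simp only [intervalIntegral.integral_const, sub_zero] at h2
    rw [h2, integral_smul_const, add_neg_cancel]
  refine ⟨c, -v, ?_⟩
  filter_upwards [hc] with τ hτ
  rw [smul_neg, ← hτ]
  simp

/-- Weak solutions of `(ρ² + τ²) V'' + (4 - c) τ V' + (2 - c) V - B V' + N V = 0` are classical. -/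
lemma exists_classical_solution [CompleteSpace E] {V : ℝ → E} (hV : LocallyIntegrable V volume)
    {ρ : ℝ} (hρ : 0 < ρ) (c : ℝ) (B N : E →L[ℝ] E)
    (h : ∀ β : ℝ → ℝ, ContDiff ℝ (⊤ : ℕ∞) β → HasCompactSupport β →
      ∫ τ, (((ρ ^ 2 + τ ^ 2) * deriv (deriv β) τ + c * τ * deriv β τ) • V τ +
        deriv β τ • B (V τ) + β τ • N (V τ)) = 0) :
    ∃ V₀ V₁ V₂ : ℝ → E, V =ᵐ[volume] V₀ ∧ (∀ τ, HasDerivAt V₀ (V₁ τ) τ) ∧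
      (∀ τ, HasDerivAt V₁ (V₂ τ) τ) ∧ Continuous V₂ ∧
      ∀ τ, (ρ ^ 2 + τ ^ 2) • V₂ τ + ((4 - c) * τ) • V₁ τ + (2 - c) • V₀ τ - B (V₁ τ) +
        N (V₀ τ) = 0 := by
  have hr : ∀ τ : ℝ, ρ ^ 2 + τ ^ 2 ≠ 0 := fun τ => by positivity
  have hP : LocallyIntegrable (fun τ => (ρ ^ 2 + τ ^ 2) • V τ) volume :=
    hV.continuous_smul (by fun_prop)
  have hQ : LocallyIntegrable (fun τ => (c * τ) • V τ + B (V τ)) volume :=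
    (hV.continuous_smul (by fun_prop)).add (locallyIntegrable_clm B hV)
  have hR : LocallyIntegrable (fun τ => N (V τ)) volume := locallyIntegrable_clm N hV
  have hRp : Continuous fun τ => ∫ σ in (0 : ℝ)..τ, N (V σ) :=
    intervalIntegral.continuous_primitive (intervalIntegrable_of_locallyIntegrable hR) 0
  have hS := hQ.sub hRp.locallyIntegrable
  have hSp : Continuous fun τ => ∫ σ in (0 : ℝ)..τ,
      ((c * σ) • V σ + B (V σ) - ∫ t in (0 : ℝ)..σ, N (V t)) :=
    intervalIntegral.continuous_primitive (intervalIntegrable_of_locallyIntegrable hS) 0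
  -- With P = r² V, Q = c τ V + B V and R = N V the hypothesis is the weak form of P'' - Q' + R = 0.
  -- Moving all derivatives to β'' shows that P - ∫ (Q - ∫ R) has zero second derivative.
  obtain ⟨a, a', ha⟩ := ae_affine_of_integral_deriv_deriv_smul (hP.sub hSp.locallyIntegrable)
    fun β hβ hβc => by
      have hβd := contDiff_infty_iff_deriv.1 hβ
      have hβdd := contDiff_infty_iff_deriv.1 hβd.2
      have h1 := integral_deriv_smul_primitive hS hβd.2 hβc.deriv
      have h2 := integral_deriv_smul_primitive hR hβ hβc
      have k1 := hP.integrable_smul_left_of_hasCompactSupport hβdd.2.continuous hβc.deriv.deriv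
      have k2 := hSp.locallyIntegrable (μ := volume)
        |>.integrable_smul_left_of_hasCompactSupport hβdd.2.continuous hβc.deriv.deriv
      have k3 := hQ.integrable_smul_left_of_hasCompactSupport hβd.2.continuous hβc.deriv
      have k4 := hRp.locallyIntegrable (μ := volume)
        |>.integrable_smul_left_of_hasCompactSupport hβd.2.continuous hβc.deriv
      have k5 := hR.integrable_smul_left_of_hasCompactSupport hβ.continuous hβc
      have h3 := h β hβ hβc
      have e : ∀ τ, (((ρ ^ 2 + τ ^ 2) * deriv (deriv β) τ + c * τ * deriv β τ) • V τ +
        deriv β τ • B (V τ) + β τ • N (V τ)) = deriv (deriv β) τ • ((ρ ^ 2 + τ ^ 2) • V τ) +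
          deriv β τ • ((c * τ) • V τ + B (V τ)) + β τ • N (V τ) := by
        intro τ
        module
      simp only [e] at h3
      have h4 : ∫ τ, deriv β τ • ((c * τ) • V τ + B (V τ) - ∫ t in (0 : ℝ)..τ, N (V t)) =
          (∫ τ, deriv β τ • ((c * τ) • V τ + B (V τ))) -
            ∫ τ, deriv β τ • ∫ t in (0 : ℝ)..τ, N (V t) := by
        simp only [smul_sub]
        exact integral_sub k3 k4
      have h5 : ∫ τ, deriv (deriv β) τ • (∫ σ in (0 : ℝ)..τ,
          ((c * σ) • V σ + B (V σ) - ∫ t in (0 : ℝ)..σ, N (V t))) =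
          -∫ τ, deriv β τ • ((c * τ) • V τ + B (V τ) - ∫ t in (0 : ℝ)..τ, N (V t)) := h1
      have k13 : Integrable fun τ => deriv (deriv β) τ • ((ρ ^ 2 + τ ^ 2) • V τ) +
          deriv β τ • ((c * τ) • V τ + B (V τ)) := k1.add k3
      rw [integral_add k13 k5, integral_add k1 k3] at h3
      simp only [Pi.sub_apply, smul_sub]
      rw [integral_sub k1 k2, h5, h4, h2]
      rw [← h3]
      abel
  -- Division by r² > 0 gives a continuous representative. It may replace V inside its own
  -- integrals, and each use of the resulting formula gains a derivative.
  set V₀ : ℝ → E := fun τ => (ρ ^ 2 + τ ^ 2)⁻¹ • (a + τ • a' + ∫ σ in (0 : ℝ)..τ,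
      ((c * σ) • V σ + B (V σ) - ∫ t in (0 : ℝ)..σ, N (V t))) with hV₀
  have hae : V =ᵐ[volume] V₀ := by
    filter_upwards [ha] with τ hτ
    simp only [Pi.sub_apply, sub_eq_iff_eq_add] at hτ
    rw [hV₀, ← inv_smul_smul₀ (hr τ) (V τ), hτ]
  have hcont : Continuous V₀ := by
    have : Continuous fun τ : ℝ => (ρ ^ 2 + τ ^ 2)⁻¹ := by
      refine Continuous.inv₀ (by fun_prop) hr
    refine this.smul ?_
    fun_prop
  have hin : ∀ σ, ∫ t in (0 : ℝ)..σ, N (V t) = ∫ t in (0 : ℝ)..σ, N (V₀ t) := fun σ =>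
    intervalIntegral.integral_congr_ae (hae.mono fun t ht _ => by rw [ht])
  have hrep : ∀ τ, V₀ τ = (ρ ^ 2 + τ ^ 2)⁻¹ • (a + τ • a' + ∫ σ in (0 : ℝ)..τ,
      ((c * σ) • V₀ σ + B (V₀ σ) - ∫ t in (0 : ℝ)..σ, N (V₀ t))) := by
    intro τ
    refine (congrFun hV₀ τ).trans ?_
    congr 2
    refine intervalIntegral.integral_congr_ae (hae.mono fun t ht _ => ?_)
    simp only [hin t]
    rw [ht]
  clear_value V₀
  have hNc : Continuous fun t => N (V₀ t) := by fun_prop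
  have hNp : ∀ τ, HasDerivAt (fun σ => ∫ t in (0 : ℝ)..σ, N (V₀ t)) (N (V₀ τ)) τ := fun τ =>
    intervalIntegral.integral_hasDerivAt_right (hNc.intervalIntegrable _ _)
      (hNc.stronglyMeasurableAtFilter _ _) hNc.continuousAt
  have hNpc : Continuous fun σ => ∫ t in (0 : ℝ)..σ, N (V₀ t) :=
    continuous_iff_continuousAt.2 fun τ => (hNp τ).continuousAt
  have hGc : Continuous fun σ => (c * σ) • V₀ σ + B (V₀ σ) - ∫ t in (0 : ℝ)..σ, N (V₀ t) := by
    fun_prop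
  let W₁ : ℝ → E := fun τ => a' + ((c * τ) • V₀ τ + B (V₀ τ) - ∫ t in (0 : ℝ)..τ, N (V₀ t))
  have hW : ∀ τ, HasDerivAt (fun τ => a + τ • a' + ∫ σ in (0 : ℝ)..τ,
      ((c * σ) • V₀ σ + B (V₀ σ) - ∫ t in (0 : ℝ)..σ, N (V₀ t))) (W₁ τ) τ := by
    intro τ
    have h1 : HasDerivAt (fun τ : ℝ => a + τ • a') a' τ := by
      simpa using ((hasDerivAt_id τ).smul_const a').const_add a
    exact h1.add (intervalIntegral.integral_hasDerivAt_right (hGc.intervalIntegrable _ _)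
      (hGc.stronglyMeasurableAtFilter _ _) hGc.continuousAt)
  have hinv : ∀ τ : ℝ, HasDerivAt (fun τ : ℝ => (ρ ^ 2 + τ ^ 2)⁻¹)
      (-(2 * τ) / (ρ ^ 2 + τ ^ 2) ^ 2) τ := by
    intro τ
    have h1 : HasDerivAt (fun τ : ℝ => ρ ^ 2 + τ ^ 2) (2 * τ) τ := by
      simpa using (hasDerivAt_pow 2 τ).const_add (ρ ^ 2)
    exact h1.inv (hr τ)
  have hfun : V₀ = fun τ => (ρ ^ 2 + τ ^ 2)⁻¹ • (a + τ • a' + ∫ σ in (0 : ℝ)..τ,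
      ((c * σ) • V₀ σ + B (V₀ σ) - ∫ t in (0 : ℝ)..σ, N (V₀ t))) := funext hrep
  have hmul : ∀ τ, a + τ • a' + ∫ σ in (0 : ℝ)..τ,
      ((c * σ) • V₀ σ + B (V₀ σ) - ∫ t in (0 : ℝ)..σ, N (V₀ t)) = (ρ ^ 2 + τ ^ 2) • V₀ τ := by
    intro τ
    rw [hrep τ, smul_inv_smul₀ (hr τ)]
  let V₁ : ℝ → E := fun τ => (ρ ^ 2 + τ ^ 2)⁻¹ • (W₁ τ - (2 * τ) • V₀ τ)
  have hV1 : ∀ τ, HasDerivAt V₀ (V₁ τ) τ := by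
    intro τ
    have h1 := (hinv τ).smul (hW τ)
    rw [hfun]
    refine h1.congr_deriv ?_
    rw [hmul τ]
    simp only [V₁, smul_sub, smul_smul]
    rw [sub_eq_add_neg, ← neg_smul]
    congr 2
    have := hr τ
    field_simp
  have hW1 : ∀ τ, HasDerivAt W₁ (c • V₀ τ + (c * τ) • V₁ τ + B (V₁ τ) - N (V₀ τ)) τ := by
    intro τ
    have h1 : HasDerivAt (fun τ : ℝ => c * τ) c τ := by
      simpa using (hasDerivAt_id τ).const_mul c
    have h2 := ((((h1.smul (hV1 τ)).add (B.hasFDerivAt.comp_hasDerivAt τ (hV1 τ))).sub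
      (hNp τ)).const_add a')
    exact h2.congr_deriv (by abel)
  let Y : ℝ → E := fun τ => c • V₀ τ + (c * τ) • V₁ τ + B (V₁ τ) - N (V₀ τ) - (2 : ℝ) • V₀ τ -
    (2 * τ) • V₁ τ
  let V₂ : ℝ → E := fun τ => (ρ ^ 2 + τ ^ 2)⁻¹ • (Y τ - (2 * τ) • V₁ τ)
  have hV2 : ∀ τ, HasDerivAt V₁ (V₂ τ) τ := by
    intro τ
    have h1 : HasDerivAt (fun τ : ℝ => 2 * τ) 2 τ := by
      simpa using (hasDerivAt_id τ).const_mul (2 : ℝ)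
    have h3 := (hinv τ).smul ((hW1 τ).sub (h1.smul (hV1 τ)))
    refine HasDerivAt.congr_deriv (f := V₁) h3 ?_
    have e : W₁ τ - (2 * τ) • V₀ τ = (ρ ^ 2 + τ ^ 2) • V₁ τ := by
      simp only [V₁, smul_inv_smul₀ (hr τ)]
    simp only [Pi.sub_apply, Pi.smul_apply', e]
    simp only [V₂, Y, smul_smul]
    have e2 : -(2 * τ) / (ρ ^ 2 + τ ^ 2) ^ 2 * (ρ ^ 2 + τ ^ 2) =
        (ρ ^ 2 + τ ^ 2)⁻¹ * (-(2 * τ)) := by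
      have := hr τ
      field_simp
    rw [e2]
    module
  have c1 : Continuous V₁ := continuous_iff_continuousAt.2 fun τ => (hV2 τ).continuousAt
  refine ⟨V₀, V₁, V₂, hae, hV1, hV2, ?_, fun τ => ?_⟩
  · have : Continuous fun τ : ℝ => (ρ ^ 2 + τ ^ 2)⁻¹ := by
      refine Continuous.inv₀ (by fun_prop) hr
    refine this.smul ?_
    simp only [Y]
    fun_prop
  · simp only [V₂, smul_inv_smul₀ (hr τ), Y]
    module

end WeakODE

/-! ### Restricting weak identities to almost every line -/

section Fibers

variable {E : Type*} [NormedAddCommGroup E] [NormedSpace ℝ E]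

/-- Smooth functions supported in `(-N, N)`. -/
def bumps (N : ℕ) : Set (ℝ → ℝ) :=
  {β | ContDiff ℝ (⊤ : ℕ∞) β ∧ tsupport β ⊆ Set.Ioo (-(N : ℝ)) N}

lemma bumps_compactSupport {N : ℕ} {β : ℝ → ℝ} (hβ : β ∈ bumps N) : HasCompactSupport β :=
  HasCompactSupport.of_support_subset_isCompact (isCompact_Icc (a := -(N : ℝ)) (b := N))
    ((subset_tsupport β).trans (hβ.2.trans Set.Ioo_subset_Icc_self))

lemma norm_deriv_le_of_bump {N : ℕ} {γ : ℝ → ℝ} (hγ : ContDiff ℝ (⊤ : ℕ∞) γ)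
    (h0 : γ (-(N : ℝ)) = 0) {ε : ℝ}
    (hε : ∀ τ ∈ Set.Icc (-(N : ℝ)) N, |deriv γ τ| ≤ ε) :
    ∀ τ ∈ Set.Icc (-(N : ℝ)) N, |γ τ| ≤ 2 * N * ε := by
  intro τ hτ
  have hd := contDiff_infty_iff_deriv.1 hγ
  have hN : (0 : ℝ) ≤ N := Nat.cast_nonneg N
  have h := (convex_Icc (-(N : ℝ)) N).norm_image_sub_le_of_norm_deriv_le (f := γ) (C := ε)
    (fun x _ => hd.1 x) (fun x hx => hε x hx) (Set.left_mem_Icc.2 (by linarith)) hτ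
  rw [h0, sub_zero, Real.norm_eq_abs, Real.norm_eq_abs, sub_neg_eq_add,
    abs_of_nonneg (by linarith [hτ.1] : 0 ≤ τ + N)] at h
  have hε0 : 0 ≤ ε := (abs_nonneg _).trans (hε τ hτ)
  nlinarith [hτ.2]

/-- Only second derivatives have to be approximated, and C([-N, N]) is separable. Bumps and their
derivatives vanish at -N, so the mean value inequality controls β' and β, each time at the cost of
the length 2N. -/
lemma exists_countable_bumps (N : ℕ) : ∃ D : Set (ℝ → ℝ), D.Countable ∧ D ⊆ bumps N ∧
    ∀ β ∈ bumps N, ∀ ε > 0, ∃ γ ∈ D, ∀ τ ∈ Set.Icc (-(N : ℝ)) N,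
      |deriv (deriv β) τ - deriv (deriv γ) τ| ≤ ε ∧ |deriv β τ - deriv γ τ| ≤ 2 * N * ε ∧
      |β τ - γ τ| ≤ 2 * N * (2 * N * ε) := by
  have hcd : ∀ β ∈ bumps N, Continuous (deriv (deriv β)) := fun β hβ =>
    (contDiff_infty_iff_deriv.1 (contDiff_infty_iff_deriv.1 hβ.1).2).2.continuous
  let Φ : bumps N → C(Set.Icc (-(N : ℝ)) N, ℝ) := fun β =>
    ⟨fun τ => deriv (deriv β.1) τ, (hcd β.1 β.2).comp continuous_subtype_val⟩
  obtain ⟨c, hcs, hcc, hcd'⟩ :=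
    (TopologicalSpace.IsSeparable.of_separableSpace (Set.range Φ)).exists_countable_dense_subset
  choose g hg using fun (y : c) => hcs y.2
  have := hcc.to_subtype
  refine ⟨Set.range fun y : c => (g y : ℝ → ℝ), Set.countable_range _, ?_, ?_⟩
  · rintro _ ⟨y, rfl⟩; exact (g y).2
  intro β hβ ε hε
  have h1 := hcd' (Set.mem_range_self (⟨β, hβ⟩ : bumps N))
  obtain ⟨y, hyc, hy⟩ := Metric.mem_closure_iff.1 h1 ε hε
  refine ⟨g ⟨y, hyc⟩, ⟨⟨y, hyc⟩, rfl⟩, ?_⟩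
  set γ := g ⟨y, hyc⟩ with hγ
  have hΦ : Φ γ = y := hg ⟨y, hyc⟩
  rw [← hΦ, dist_eq_norm] at hy
  have e2 : ∀ τ ∈ Set.Icc (-(N : ℝ)) N, |deriv (deriv β) τ - deriv (deriv γ) τ| ≤ ε := by
    intro τ hτ
    exact (ContinuousMap.norm_coe_le_norm (Φ ⟨β, hβ⟩ - Φ γ) ⟨τ, hτ⟩).trans hy.le
  have hβd := contDiff_infty_iff_deriv.1 hβ.1
  have hγd := contDiff_infty_iff_deriv.1 γ.2.1
  have hβdd := contDiff_infty_iff_deriv.1 hβd.2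
  have hγdd := contDiff_infty_iff_deriv.1 hγd.2
  have hz : ∀ δ ∈ bumps N, δ (-(N : ℝ)) = 0 ∧ deriv δ (-(N : ℝ)) = 0 := by
    intro δ hδ
    have : -(N : ℝ) ∉ tsupport δ := fun h => (hδ.2 h).1.false
    exact ⟨image_eq_zero_of_notMem_tsupport this,
      image_eq_zero_of_notMem_tsupport fun h => this (tsupport_deriv_subset h)⟩
  have d1 : deriv (fun τ => β τ - (γ : ℝ → ℝ) τ) = fun τ => deriv β τ - deriv γ τ :=
    funext fun τ => deriv_fun_sub (hβd.1 τ) (hγd.1 τ)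
  have d2 : deriv (fun τ => deriv β τ - deriv γ τ) =
      fun τ => deriv (deriv β) τ - deriv (deriv γ) τ :=
    funext fun τ => deriv_fun_sub (hβdd.1 τ) (hγdd.1 τ)
  have e1 : ∀ τ ∈ Set.Icc (-(N : ℝ)) N, |deriv β τ - deriv γ τ| ≤ 2 * N * ε :=
    norm_deriv_le_of_bump (γ := fun τ => deriv β τ - deriv γ τ) (hβd.2.sub hγd.2)
      (by simp [(hz _ hβ).2, (hz _ γ.2).2]) (by rw [d2]; exact e2)
  have e0 : ∀ τ ∈ Set.Icc (-(N : ℝ)) N, |β τ - (γ : ℝ → ℝ) τ| ≤ 2 * N * (2 * N * ε) :=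
    norm_deriv_le_of_bump (γ := fun τ => β τ - (γ : ℝ → ℝ) τ) (hβ.1.sub γ.2.1)
      (by simp [(hz _ hβ).1, (hz _ γ.2).1]) (by rw [d1]; exact e1)
  exact fun τ hτ => ⟨e2 τ hτ, e1 τ hτ, e0 τ hτ⟩

/-- If `∫ β'' P + β' Q + β R` vanishes for a countable set of bumps approximating all bumps, then it
vanishes for all bumps. -/
lemma integral_eq_zero_of_countable {N : ℕ} {D : Set (ℝ → ℝ)} (hD : D ⊆ bumps N)
    (happ : ∀ β ∈ bumps N, ∀ ε > 0, ∃ γ ∈ D, ∀ τ ∈ Set.Icc (-(N : ℝ)) N,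
      |deriv (deriv β) τ - deriv (deriv γ) τ| ≤ ε ∧ |deriv β τ - deriv γ τ| ≤ 2 * N * ε ∧
      |β τ - γ τ| ≤ 2 * N * (2 * N * ε)) {P Q R : ℝ → E}
    (hP : LocallyIntegrable P volume) (hQ : LocallyIntegrable Q volume)
    (hR : LocallyIntegrable R volume)
    (h : ∀ β ∈ D, ∫ τ, (deriv (deriv β) τ • P τ + deriv β τ • Q τ + β τ • R τ) = 0)
    {β : ℝ → ℝ} (hβ : β ∈ bumps N) :
    ∫ τ, (deriv (deriv β) τ • P τ + deriv β τ • Q τ + β τ • R τ) = 0 := by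
  have hint : ∀ γ ∈ bumps N,
      Integrable fun τ => deriv (deriv γ) τ • P τ + deriv γ τ • Q τ + γ τ • R τ := by
    intro γ hγ
    have hc := bumps_compactSupport hγ
    have hd := contDiff_infty_iff_deriv.1 hγ.1
    have hdd := contDiff_infty_iff_deriv.1 hd.2
    exact ((hP.integrable_smul_left_of_hasCompactSupport hdd.2.continuous hc.deriv.deriv).add
      (hQ.integrable_smul_left_of_hasCompactSupport hd.2.continuous hc.deriv)).add
      (hR.integrable_smul_left_of_hasCompactSupport hγ.1.continuous hc)
  set I := Set.Icc (-(N : ℝ)) N with hI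
  have iP := (hP.integrableOn_isCompact (isCompact_Icc (a := -(N : ℝ)) (b := N))).norm
  have iQ := (hQ.integrableOn_isCompact (isCompact_Icc (a := -(N : ℝ)) (b := N))).norm
  have iR := (hR.integrableOn_isCompact (isCompact_Icc (a := -(N : ℝ)) (b := N))).norm
  set C : ℝ := ∫ τ in I, (‖P τ‖ + 2 * N * ‖Q τ‖ + 2 * N * (2 * N) * ‖R τ‖) with hC
  have hiC : IntegrableOn (fun τ => ‖P τ‖ + 2 * N * ‖Q τ‖ + 2 * N * (2 * N) * ‖R τ‖) I :=
    (iP.add (iQ.const_mul _)).add (iR.const_mul _)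
  have hC0 : 0 ≤ C := integral_nonneg fun τ => by positivity
  have key : ∀ ε > 0, ‖∫ τ, (deriv (deriv β) τ • P τ + deriv β τ • Q τ + β τ • R τ)‖ ≤ ε * C := by
    intro ε hε
    obtain ⟨γ, hγ, hb⟩ := happ β hβ ε hε
    have e1 : ∫ τ, (deriv (deriv β) τ • P τ + deriv β τ • Q τ + β τ • R τ) =
        ∫ τ, ((deriv (deriv β) τ - deriv (deriv γ) τ) • P τ + (deriv β τ - deriv γ τ) • Q τ +
          (β τ - γ τ) • R τ) := by
      rw [← sub_zero (∫ τ, (deriv (deriv β) τ • P τ + deriv β τ • Q τ + β τ • R τ)), ← h γ hγ,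
        ← integral_sub (hint β hβ) (hint γ (hD hγ))]
      refine integral_congr_ae (Filter.Eventually.of_forall fun τ => ?_)
      module
    have hz : ∀ δ ∈ bumps N, ∀ τ, τ ∉ I → δ τ = 0 ∧ deriv δ τ = 0 ∧ deriv (deriv δ) τ = 0 := by
      intro δ hδ τ hτ
      have h0 : τ ∉ tsupport δ := fun h => hτ (Set.Ioo_subset_Icc_self (hδ.2 h))
      have h1 : τ ∉ tsupport (deriv δ) := fun h => h0 (tsupport_deriv_subset h)
      have h2 : τ ∉ tsupport (deriv (deriv δ)) := fun h => h1 (tsupport_deriv_subset h)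
      exact ⟨image_eq_zero_of_notMem_tsupport h0, image_eq_zero_of_notMem_tsupport h1,
        image_eq_zero_of_notMem_tsupport h2⟩
    rw [e1, ← setIntegral_eq_integral_of_forall_compl_eq_zero (s := I)]
    · rw [hC, ← integral_const_mul]
      refine norm_integral_le_of_norm_le (hiC.const_mul ε) ?_
      filter_upwards [ae_restrict_mem measurableSet_Icc] with τ hτ
      obtain ⟨b2, b1, b0⟩ := hb τ hτ
      refine (norm_add₃_le).trans ?_
      rw [norm_smul, norm_smul, norm_smul]
      simp only [Real.norm_eq_abs]
      have := mul_le_mul_of_nonneg_right b2 (norm_nonneg (P τ))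
      have := mul_le_mul_of_nonneg_right b1 (norm_nonneg (Q τ))
      have := mul_le_mul_of_nonneg_right b0 (norm_nonneg (R τ))
      linarith
    · intro τ hτ
      simp [hz β hβ τ hτ, hz γ (hD hγ) τ hτ]
  have hn : ‖∫ τ, (deriv (deriv β) τ • P τ + deriv β τ • Q τ + β τ • R τ)‖ ≤ 0 := by
    refine le_of_forall_pos_le_add fun ε hε => ?_
    have := key (ε / (C + 1)) (by positivity)
    refine this.trans ?_
    rw [zero_add, div_mul_eq_mul_div, div_le_iff₀ (by linarith)]
    nlinarith
  exact norm_le_zero_iff.1 hn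

lemma exists_mem_bumps {β : ℝ → ℝ} (hβ : ContDiff ℝ (⊤ : ℕ∞) β) (hc : HasCompactSupport β) :
    ∃ N, β ∈ bumps N := by
  obtain ⟨R, hR0, hR⟩ := tsupport_subset_Icc hc
  obtain ⟨N, hN⟩ := exists_nat_ge R
  exact ⟨N, hβ, hR.trans (Set.Ioo_subset_Ioo (by linarith) hN)⟩

variable {X : Type*} [NormedAddCommGroup X] [InnerProductSpace ℝ X] [FiniteDimensional ℝ X]
  [MeasurableSpace X] [BorelSpace X]

lemma ae_locallyIntegrable_fiber {E : Type*} [NormedAddCommGroup E] {V : X × ℝ → E} (hV : LocallyIntegrable V (volume.prod volume)) :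
    ∀ᵐ x : X, LocallyIntegrable (fun τ => V (x, τ)) volume := by
  have h : ∀ k : ℕ, ∀ᵐ x : X, x ∈ Metric.closedBall (0 : X) k →
      IntegrableOn (fun τ => V (x, τ)) (Set.Icc (-(k : ℝ)) k) := by
    intro k
    have h1 := hV.integrableOn_isCompact
      ((isCompact_closedBall (0 : X) k).prod (isCompact_Icc (a := -(k : ℝ)) (b := k)))
    rw [IntegrableOn, ← Measure.prod_restrict] at h1
    exact (ae_restrict_iff' Metric.isClosed_closedBall.measurableSet).1 h1.prod_right_ae
  filter_upwards [ae_all_iff.2 h] with x hx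
  rw [locallyIntegrable_iff]
  intro K hK
  obtain ⟨R, hR0, hR⟩ := hK.isBounded.subset_closedBall_lt 0 (0 : ℝ)
  obtain ⟨k, hk⟩ := exists_nat_ge (max R ‖x‖)
  refine (hx k (by simpa using (le_max_right _ _).trans hk)).mono_set (hR.trans ?_)
  rw [Real.closedBall_eq_Icc]
  have := (le_max_left R ‖x‖).trans hk
  exact Set.Icc_subset_Icc (by linarith) (by linarith)

/-- Separation of variables: weak identities on a product hold on almost every fibre. -/
lemma ae_fiber_weak [CompleteSpace E] {P Q R : X × ℝ → E}
    (hP : LocallyIntegrable P (volume.prod volume)) (hQ : LocallyIntegrable Q (volume.prod volume))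
    (hR : LocallyIntegrable R (volume.prod volume))
    (h : ∀ α : X → ℝ, ContDiff ℝ (⊤ : ℕ∞) α → HasCompactSupport α →
      ∀ β : ℝ → ℝ, ContDiff ℝ (⊤ : ℕ∞) β → HasCompactSupport β →
      ∫ z : X × ℝ, α z.1 • (deriv (deriv β) z.2 • P z + deriv β z.2 • Q z + β z.2 • R z)
        ∂(volume.prod volume) = 0) :
    ∀ᵐ x : X, ∀ β : ℝ → ℝ, ContDiff ℝ (⊤ : ℕ∞) β → HasCompactSupport β →
      ∫ τ, (deriv (deriv β) τ • P (x, τ) + deriv β τ • Q (x, τ) + β τ • R (x, τ)) = 0 := by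
  -- For one β the line integral is a locally integrable function of x annihilated by all α. Its
  -- exceptional null set depends on β, which is why only countably many β are used afterwards and
  -- the rest are reached by approximation.
  have hone : ∀ β : ℝ → ℝ, ContDiff ℝ (⊤ : ℕ∞) β → HasCompactSupport β → ∀ᵐ x : X,
      ∫ τ, (deriv (deriv β) τ • P (x, τ) + deriv β τ • Q (x, τ) + β τ • R (x, τ)) = 0 := by
    intro β hβ hβc
    have hd := contDiff_infty_iff_deriv.1 hβ
    have hdd := contDiff_infty_iff_deriv.1 hd.2
    set G : X × ℝ → E := fun z =>
      deriv (deriv β) z.2 • P z + deriv β z.2 • Q z + β z.2 • R z with hG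
    have hGl : LocallyIntegrable G (volume.prod volume) :=
      ((hP.continuous_smul (hdd.2.continuous.comp continuous_snd)).add
        (hQ.continuous_smul (hd.2.continuous.comp continuous_snd))).add
        (hR.continuous_smul (hβ.continuous.comp continuous_snd))
    obtain ⟨N, hN⟩ := exists_mem_bumps hβ hβc
    have hzero : ∀ z : X × ℝ, z.2 ∉ Set.Icc (-(N : ℝ)) N → G z = 0 := by
      intro z hz
      have h0 : z.2 ∉ tsupport β := fun h => hz (Set.Ioo_subset_Icc_self (hN.2 h))
      have h1 : z.2 ∉ tsupport (deriv β) := fun h => h0 (tsupport_deriv_subset h)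
      have h2 : z.2 ∉ tsupport (deriv (deriv β)) := fun h => h1 (tsupport_deriv_subset h)
      simp [hG, image_eq_zero_of_notMem_tsupport h0, image_eq_zero_of_notMem_tsupport h1,
        image_eq_zero_of_notMem_tsupport h2]
    have hGK : ∀ K : Set X, IsCompact K → IntegrableOn G (K ×ˢ Set.univ) (volume.prod volume) := by
      intro K hK
      have h1 := hGl.integrableOn_isCompact (hK.prod (isCompact_Icc (a := -(N : ℝ)) (b := N)))
      refine h1.of_forall_sdiff_eq_zero (hK.measurableSet.prod MeasurableSet.univ) fun z hz => ?_
      refine hzero z fun h' => hz.2 ⟨hz.1.1, h'⟩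
    have hg : LocallyIntegrable (fun x : X => ∫ τ, G (x, τ)) volume := by
      rw [locallyIntegrable_iff]
      intro K hK
      have h1 := hGK K hK
      rw [IntegrableOn, ← Measure.prod_restrict, Measure.restrict_univ] at h1
      exact h1.integral_prod_left
    refine ae_eq_zero_of_integral_contDiff_smul_eq_zero hg fun α hα hαc => ?_
    have h1 := h α hα hαc β hβ hβc
    have hint : Integrable (fun z : X × ℝ => α z.1 • G z) (volume.prod volume) := by
      have h2 : Integrable (fun z : X × ℝ => α z.1 • G z)
          ((volume.prod volume).restrict (tsupport α ×ˢ Set.univ)) := by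
        have hb : ∃ C, ∀ x, ‖α x‖ ≤ C := hα.continuous.bounded_above_of_compact_support hαc
        obtain ⟨C, hC⟩ := hb
        refine Integrable.bdd_smul (φ := fun z : X × ℝ => α z.1) (hGK _ hαc) C ?_
          (Filter.Eventually.of_forall fun z => hC z.1)
        exact (hα.continuous.comp continuous_fst).aestronglyMeasurable
      refine (integrableOn_iff_integrable_of_support_subset ?_).1 h2
      intro z hz
      refine ⟨?_, trivial⟩
      by_contra hcon
      refine hz ?_
      have := image_eq_zero_of_notMem_tsupport hcon
      simp [this]
    rw [integral_prod _ hint] at h1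
    simpa only [integral_smul] using h1
  choose D hDc hDs hDa using exists_countable_bumps
  have hall : ∀ᵐ x : X, ∀ N : ℕ, ∀ β ∈ D N,
      ∫ τ, (deriv (deriv β) τ • P (x, τ) + deriv β τ • Q (x, τ) + β τ • R (x, τ)) = 0 := by
    refine ae_all_iff.2 fun N => (ae_ball_iff (hDc N)).2 fun β hβ => ?_
    exact hone β (hDs N hβ).1 (bumps_compactSupport (hDs N hβ))
  filter_upwards [hall, ae_locallyIntegrable_fiber hP, ae_locallyIntegrable_fiber hQ,
    ae_locallyIntegrable_fiber hR] with x hx h1 h2 h3 β hβ hβc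
  obtain ⟨N, hN⟩ := exists_mem_bumps hβ hβc
  exact integral_eq_zero_of_countable (hDs N) (hDa N) h1 h2 h3 (hx N) hN

end Fibers

/-! ### Monotone boundary terms and the energy estimate -/

section Energy

lemma not_integrable_of_inv_le {h : ℝ → ℝ} (hh : Integrable h) {T c : ℝ} (hc : 0 < c)
    (hb : ∀ τ, T < τ → c * τ⁻¹ ≤ h τ) (hT : 0 ≤ T) : False := by
  refine not_integrableOn_Ioi_inv (a := T) ?_
  refine ((hh.integrableOn (s := Set.Ioi T)).const_mul c⁻¹).mono' ?_ ?_
  · exact measurable_inv.aestronglyMeasurable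
  · filter_upwards [ae_restrict_mem measurableSet_Ioi] with τ hτ
    have hτ0 : 0 < τ := hT.trans_lt hτ
    rw [Real.norm_of_nonneg (by positivity)]
    rw [le_inv_mul_iff₀ hc]
    exact hb τ hτ

/-- A monotone function bounded by `(ρ + |τ|) h` with `h` integrable vanishes. -/
lemma monotone_eq_zero {Φ h : ℝ → ℝ} (hΦ : Monotone Φ) (hh : Integrable h) {ρ : ℝ} (hρ : 0 < ρ)
    (hb : ∀ τ, |Φ τ| ≤ (ρ + |τ|) * h τ) (τ : ℝ) : Φ τ = 0 := by
  -- If Φ(τ₀) > 0, then for τ > max(ρ, τ₀) monotonicity gives h(τ) ≥ Φ(τ₀)/(ρ + τ) ≥ Φ(τ₀)/(2τ),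
  -- which is not integrable. The opposite sign follows by reflecting τ.
  have key : ∀ {Φ h : ℝ → ℝ}, Monotone Φ → Integrable h → (∀ τ, |Φ τ| ≤ (ρ + |τ|) * h τ) →
      ∀ τ, Φ τ ≤ 0 := by
    intro Φ h hΦ hh hb τ₀
    by_contra hcon
    push Not at hcon
    refine not_integrable_of_inv_le hh (T := max ρ τ₀) (c := Φ τ₀ / 2) (by positivity) ?_
      (hρ.le.trans (le_max_left _ _))
    intro τ hτ
    have h1 : ρ < τ := (le_max_left _ _).trans_lt hτ
    have h2 : τ₀ ≤ τ := ((le_max_right _ _).trans_lt hτ).le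
    have hτ0 : 0 < τ := hρ.trans h1
    have h3 := (hΦ h2).trans ((le_abs_self _).trans (hb τ))
    rw [abs_of_pos hτ0] at h3
    have hpos : 0 < h τ := by
      by_contra hc
      push Not at hc
      have := mul_nonpos_of_nonneg_of_nonpos (by linarith : 0 ≤ ρ + τ) hc
      linarith
    rw [← div_eq_mul_inv, div_le_iff₀ hτ0]
    nlinarith
  refine le_antisymm (key hΦ hh hb τ) ?_
  have h2 := key (Φ := fun τ => -Φ (-τ)) (h := fun τ => h (-τ))
    (fun x y hxy => neg_le_neg (hΦ (neg_le_neg hxy))) hh.comp_neg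
    (fun τ => by simpa using hb (-τ)) (-τ)
  simpa using h2

/-- A Caccioppoli estimate. Integrating the derivative of χ² Φ with χ = 1 - τ²/R² leaves no boundary
terms. The term with (χ²)' is controlled by |Φ| ≤ (ρ + |τ|) √(p u), half of χ² p absorbs part of it,
and the remaining bound by ∫ u does not depend on R. -/
lemma integrable_of_energy {Φ Φ' p u : ℝ → ℝ} (hd : ∀ τ, HasDerivAt Φ (Φ' τ) τ)
    (hΦ' : Continuous Φ') (hp : Continuous p) (hp0 : ∀ τ, 0 ≤ p τ) (hu0 : ∀ τ, 0 ≤ u τ)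
    (hui : Integrable u) {C ρ : ℝ} (hC : 0 ≤ C) (hρ : 0 < ρ)
    (hle : ∀ τ, p τ - C * u τ ≤ Φ' τ) (hsq : ∀ τ, Φ τ ^ 2 ≤ (ρ + |τ|) ^ 2 * (p τ * u τ)) :
    Integrable p := by
  have hΦc : Continuous Φ := continuous_iff_continuousAt.2 fun τ => (hd τ).continuousAt
  have main : ∀ R : ℝ, ρ ≤ R → ∫ τ in (-R)..R, (1 - τ ^ 2 / R ^ 2) ^ 2 * p τ ≤
      2 * (C + 32) * ∫ τ, u τ := by
    intro R hR
    have hR0 : 0 < R := hρ.trans_le hR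
    have hχ : ∀ τ : ℝ, HasDerivAt (fun τ => (1 - τ ^ 2 / R ^ 2) ^ 2)
        (-(4 * τ / R ^ 2) * (1 - τ ^ 2 / R ^ 2)) τ := by
      intro τ
      have h1 : HasDerivAt (fun τ : ℝ => 1 - τ ^ 2 / R ^ 2) (-(2 * τ / R ^ 2)) τ := by
        simpa using ((hasDerivAt_pow 2 τ).div_const (R ^ 2)).const_sub 1
      refine (h1.pow 2).congr_deriv ?_
      simp only [Nat.cast_ofNat, Nat.add_one_sub_one, pow_one]
      ring
    have hderiv : ∀ τ ∈ Set.uIcc (-R) R, HasDerivAt (fun τ => (1 - τ ^ 2 / R ^ 2) ^ 2 * Φ τ)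
        (-(4 * τ / R ^ 2) * (1 - τ ^ 2 / R ^ 2) * Φ τ + (1 - τ ^ 2 / R ^ 2) ^ 2 * Φ' τ) τ :=
      fun τ _ => (hχ τ).mul (hd τ)
    have hint := intervalIntegral.integral_eq_sub_of_hasDerivAt hderiv
      (Continuous.intervalIntegrable (by fun_prop) _ _)
    have hend : (1 - R ^ 2 / R ^ 2) ^ 2 * Φ R - (1 - (-R) ^ 2 / R ^ 2) ^ 2 * Φ (-R) = 0 := by
      rw [neg_sq, div_self (by positivity)]; simp
    rw [hend] at hint
    have huI : IntervalIntegrable u volume (-R) R := hui.intervalIntegrable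
    have hlow : ∫ τ in (-R)..R, (2⁻¹ * ((1 - τ ^ 2 / R ^ 2) ^ 2 * p τ) - (C + 32) * u τ) ≤
        ∫ τ in (-R)..R, (-(4 * τ / R ^ 2) * (1 - τ ^ 2 / R ^ 2) * Φ τ +
          (1 - τ ^ 2 / R ^ 2) ^ 2 * Φ' τ) := by
      refine intervalIntegral.integral_mono_on (by linarith) ?_ ?_ fun τ hτ => ?_
      · exact (Continuous.intervalIntegrable (by fun_prop) _ _).sub (huI.const_mul _)
      · exact Continuous.intervalIntegrable (by fun_prop) _ _
      · set χ := 1 - τ ^ 2 / R ^ 2 with hχdef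
        have habs : |τ| ≤ R := abs_le.2 hτ
        have hτ2 : τ ^ 2 ≤ R ^ 2 := sq_le_sq' hτ.1 hτ.2
        have hχ0 : 0 ≤ χ := by
          rw [hχdef, sub_nonneg, div_le_one (by positivity)]; exact hτ2
        have hχ1 : χ ≤ 1 := by
          rw [hχdef]; linarith [div_nonneg (sq_nonneg τ) (sq_nonneg R)]
        -- The derivative of the cutoff is at most 4/R and ρ + |τ| ≤ 2R, because ρ ≤ R. The growth
        -- of Φ is exactly what the cutoff can pay for.
        have hk : (4 * τ / R ^ 2) ^ 2 * (ρ + |τ|) ^ 2 ≤ 64 := by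
          have h1 : |4 * τ / R ^ 2 * (ρ + |τ|)| ≤ 8 := by
            rw [abs_mul, abs_div, abs_mul, abs_of_pos (by positivity : (0 : ℝ) < R ^ 2),
              abs_of_pos (by norm_num : (0 : ℝ) < 4),
              abs_of_nonneg (by positivity : 0 ≤ ρ + |τ|), div_mul_eq_mul_div,
              div_le_iff₀ (by positivity)]
            nlinarith [abs_nonneg τ]
          calc _ = |4 * τ / R ^ 2 * (ρ + |τ|)| ^ 2 := by rw [sq_abs]; ring
            _ ≤ 8 ^ 2 := pow_le_pow_left₀ (abs_nonneg _) h1 2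
            _ = 64 := by norm_num
        have hpu : 0 ≤ p τ * u τ := mul_nonneg (hp0 τ) (hu0 τ)
        have hA : |4 * τ / R ^ 2 * χ * Φ τ| ≤ 2⁻¹ * (χ ^ 2 * p τ) + 32 * u τ := by
          refine abs_le_of_sq_le_sq ?_ (by have := hp0 τ; have := hu0 τ; positivity)
          calc (4 * τ / R ^ 2 * χ * Φ τ) ^ 2 = (4 * τ / R ^ 2) ^ 2 * χ ^ 2 * Φ τ ^ 2 := by ring
            _ ≤ (4 * τ / R ^ 2) ^ 2 * χ ^ 2 * ((ρ + |τ|) ^ 2 * (p τ * u τ)) :=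
              mul_le_mul_of_nonneg_left (hsq τ) (by positivity)
            _ = ((4 * τ / R ^ 2) ^ 2 * (ρ + |τ|) ^ 2) * (χ ^ 2 * (p τ * u τ)) := by ring
            _ ≤ 64 * (χ ^ 2 * (p τ * u τ)) :=
              mul_le_mul_of_nonneg_right hk (mul_nonneg (sq_nonneg _) hpu)
            _ ≤ (2⁻¹ * (χ ^ 2 * p τ) + 32 * u τ) ^ 2 := by
              nlinarith [sq_nonneg (2⁻¹ * (χ ^ 2 * p τ) - 32 * u τ)]
        have h1 := mul_le_mul_of_nonneg_left (hle τ) (sq_nonneg χ)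
        have h2 := (abs_le.1 hA).2
        have h3 : χ ^ 2 * (C * u τ) ≤ C * u τ :=
          mul_le_of_le_one_left (mul_nonneg hC (hu0 τ)) (pow_le_one₀ hχ0 hχ1)
        nlinarith
    rw [hint, intervalIntegral.integral_sub (Continuous.intervalIntegrable (by fun_prop) _ _)
      (huI.const_mul _), intervalIntegral.integral_const_mul,
      intervalIntegral.integral_const_mul] at hlow
    have hle2 : ∫ τ in (-R)..R, u τ ≤ ∫ τ, u τ := by
      rw [intervalIntegral.integral_of_le (by linarith)]
      exact setIntegral_le_integral hui (Filter.Eventually.of_forall hu0)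
    have := mul_le_mul_of_nonneg_left hle2 (by linarith : 0 ≤ C + 32)
    linarith
  refine integrable_of_intervalIntegral_norm_bounded (4 * (C + 32) * ∫ τ, u τ)
    (a := fun k : ℕ => -(k : ℝ)) (b := fun k : ℕ => (k : ℝ)) (l := Filter.atTop)
    (fun k => (hp.integrableOn_Icc).mono_set Set.Ioc_subset_Icc_self)
    (Filter.tendsto_neg_atTop_atBot.comp tendsto_natCast_atTop_atTop)
    tendsto_natCast_atTop_atTop ?_
  filter_upwards [Filter.eventually_ge_atTop (Nat.ceil ρ), Filter.eventually_gt_atTop 0]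
    with k hk hk0
  have hkρ : ρ ≤ k := Nat.ceil_le.1 hk
  have hk0' : (0 : ℝ) < k := Nat.cast_pos.2 hk0
  -- At radius 2k the squared cutoff is at least (3/4)² > 1/2 on [-k, k].
  have h1 := main (2 * k) (by linarith)
  have h2 : ∫ τ in (-(k : ℝ))..k, ‖p τ‖ ≤
      ∫ τ in (-(k : ℝ))..k, 2 * ((1 - τ ^ 2 / (2 * k) ^ 2) ^ 2 * p τ) := by
    refine intervalIntegral.integral_mono_on (by linarith) (hp.norm.intervalIntegrable _ _)
      (Continuous.intervalIntegrable (by fun_prop) _ _) fun τ hτ => ?_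
    rw [Real.norm_of_nonneg (hp0 τ), ← mul_assoc]
    refine le_mul_of_one_le_left (hp0 τ) ?_
    have h3 : τ ^ 2 / (2 * k) ^ 2 ≤ 1 / 4 := by
      rw [div_le_iff₀ (by positivity)]
      nlinarith [hτ.1, hτ.2]
    nlinarith
  have h3 : ∫ τ in (-(k : ℝ))..k, ((1 - τ ^ 2 / (2 * k) ^ 2) ^ 2 * p τ) ≤
      ∫ τ in (-(2 * (k : ℝ)))..(2 * k), ((1 - τ ^ 2 / (2 * k) ^ 2) ^ 2 * p τ) := by
    refine intervalIntegral.integral_mono_interval (by linarith) (by linarith) (by linarith)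
      (Filter.Eventually.of_forall fun τ => mul_nonneg (sq_nonneg _) (hp0 τ))
      (Continuous.intervalIntegrable (by fun_prop) _ _)
  rw [intervalIntegral.integral_const_mul] at h2
  linarith

variable {E : Type*} [NormedAddCommGroup E] [InnerProductSpace ℂ E]

lemma hasDerivAt_rpow_sq_add_sq {ρ : ℝ} (hρ : 0 < ρ) (q τ : ℝ) :
    HasDerivAt (fun τ : ℝ => (ρ ^ 2 + τ ^ 2) ^ q) (2 * q * τ * (ρ ^ 2 + τ ^ 2) ^ (q - 1)) τ := by
  have h1 : HasDerivAt (fun τ : ℝ => ρ ^ 2 + τ ^ 2) (2 * τ) τ := by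
    simpa using (hasDerivAt_pow 2 τ).const_add (ρ ^ 2)
  refine (h1.rpow_const (p := q) (Or.inl (by positivity))).congr_deriv ?_
  ring

lemma continuous_rpow_sq_add_sq {ρ : ℝ} (hρ : 0 < ρ) (q : ℝ) :
    Continuous fun τ : ℝ => (ρ ^ 2 + τ ^ 2) ^ q :=
  continuous_iff_continuousAt.2 fun τ => (hasDerivAt_rpow_sq_add_sq hρ q τ).continuousAt

lemma rpow_sq_add_sq_add_one {ρ : ℝ} (hρ : 0 < ρ) (q τ : ℝ) :
    (ρ ^ 2 + τ ^ 2) ^ (q + 1) = (ρ ^ 2 + τ ^ 2) ^ q * (ρ ^ 2 + τ ^ 2) :=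
  Real.rpow_add_one (by positivity) q

/-- Square integrable solutions of `(ρ² + τ²) V'' + (2 - 2σ) τ V' = G`, with `G` of lower order,
have square integrable derivative. -/
lemma integrable_energy {σ ρ C : ℝ} (hρ : 0 < ρ) (hC : 0 ≤ C) {V₀ V₁ V₂ : ℝ → E}
    (h₀ : ∀ τ, HasDerivAt V₀ (V₁ τ) τ) (h₁ : ∀ τ, HasDerivAt V₁ (V₂ τ) τ) (h₂ : Continuous V₂)
    (hode : ∀ τ, ‖(ρ ^ 2 + τ ^ 2) • V₂ τ + ((2 - 2 * σ) * τ) • V₁ τ‖ ≤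
      2 * ρ * ‖V₁ τ‖ + C * ‖V₀ τ‖)
    (hi : Integrable fun τ => (ρ ^ 2 + τ ^ 2) ^ (-σ) * ‖V₀ τ‖ ^ 2) :
    Integrable fun τ => (ρ ^ 2 + τ ^ 2) ^ (1 - σ) * ‖V₁ τ‖ ^ 2 := by
  letI : InnerProductSpace ℝ E := InnerProductSpace.rclikeToReal ℂ E
  have c0 : Continuous V₀ := continuous_iff_continuousAt.2 fun τ => (h₀ τ).continuousAt
  have c1 : Continuous V₁ := continuous_iff_continuousAt.2 fun τ => (h₁ τ).continuousAt
  have hrp : ∀ τ : ℝ, 0 < (ρ ^ 2 + τ ^ 2) ^ (-σ) := fun τ => by positivity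
  have hsplit : ∀ τ : ℝ, (ρ ^ 2 + τ ^ 2) ^ (1 - σ) = (ρ ^ 2 + τ ^ 2) ^ (-σ) * (ρ ^ 2 + τ ^ 2) := by
    intro τ; rw [← rpow_sq_add_sq_add_one hρ]; congr 1; ring
  have cw := continuous_rpow_sq_add_sq hρ (1 - σ)
  have cf := continuous_rpow_sq_add_sq hρ (-σ)
  have hd : ∀ τ, HasDerivAt (fun τ => (ρ ^ 2 + τ ^ 2) ^ (1 - σ) * inner ℝ (V₀ τ) (V₁ τ))
      ((ρ ^ 2 + τ ^ 2) ^ (-σ) * ((ρ ^ 2 + τ ^ 2) * ‖V₁ τ‖ ^ 2 +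
        inner ℝ (V₀ τ) ((ρ ^ 2 + τ ^ 2) • V₂ τ + ((2 - 2 * σ) * τ) • V₁ τ))) τ := by
    intro τ
    refine ((hasDerivAt_rpow_sq_add_sq hρ (1 - σ) τ).mul ((h₀ τ).inner ℝ (h₁ τ))).congr_deriv ?_
    rw [inner_add_right, inner_smul_right, inner_smul_right, real_inner_self_eq_norm_sq, hsplit,
      show 1 - σ - 1 = -σ by ring]
    ring
  -- Here Φ = (r²)^{1-σ} Re⟨V, V'⟩. Half of the square of V' is given up to absorb the first-order
  -- term, 2ρ |V| |V'| ≤ ρ² |V'|²/2 + 2 |V|². The factors 1/2 in p and 2 in u make p u the product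
  -- that Cauchy-Schwarz bounds Φ² by.
  have hpint := integrable_of_energy (p := fun τ => 2⁻¹ * ((ρ ^ 2 + τ ^ 2) ^ (1 - σ) * ‖V₁ τ‖ ^ 2))
    (u := fun τ => 2 * ((ρ ^ 2 + τ ^ 2) ^ (-σ) * ‖V₀ τ‖ ^ 2)) (C := (2 + C) / 2) hd
    (by fun_prop) (by fun_prop) (fun τ => by positivity) (fun τ => by positivity)
    (hi.const_mul 2) (by positivity) hρ (fun τ => ?_) (fun τ => ?_)
  · have := hpint.const_mul 2
    refine this.congr (Filter.Eventually.of_forall fun τ => ?_)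
    simp only; ring
  · set x := ‖V₀ τ‖ with hx
    set y := ‖V₁ τ‖ with hy
    have h1 := abs_le.1 ((abs_real_inner_le_norm (V₀ τ)
      ((ρ ^ 2 + τ ^ 2) • V₂ τ + ((2 - 2 * σ) * τ) • V₁ τ)).trans
      (mul_le_mul_of_nonneg_left (hode τ) (norm_nonneg _)))
    rw [hsplit]
    have h2 : 2⁻¹ * ((ρ ^ 2 + τ ^ 2) * y ^ 2) - (2 + C) * x ^ 2 ≤ (ρ ^ 2 + τ ^ 2) * y ^ 2 +
        inner ℝ (V₀ τ) ((ρ ^ 2 + τ ^ 2) • V₂ τ + ((2 - 2 * σ) * τ) • V₁ τ) := by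
      have h3 := h1.1
      nlinarith [sq_nonneg (ρ * y - 2 * x), mul_nonneg (sq_nonneg τ) (sq_nonneg y)]
    have h3 := mul_le_mul_of_nonneg_left h2 (hrp τ).le
    refine le_trans (le_of_eq ?_) h3
    ring
  · have h1 : (inner ℝ (V₀ τ) (V₁ τ)) ^ 2 ≤ ‖V₀ τ‖ ^ 2 * ‖V₁ τ‖ ^ 2 := by
      rw [← mul_pow]
      exact sq_le_sq' (abs_le.1 (abs_real_inner_le_norm _ _)).1
        (abs_le.1 (abs_real_inner_le_norm _ _)).2
    rw [mul_pow, hsplit]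
    set f := (ρ ^ 2 + τ ^ 2) ^ (-σ) with hf
    have hf0 : 0 < f := hrp τ
    have h2 : ρ ^ 2 + τ ^ 2 ≤ (ρ + |τ|) ^ 2 := by
      rw [← sq_abs τ]; nlinarith [abs_nonneg τ]
    calc (f * (ρ ^ 2 + τ ^ 2)) ^ 2 * inner ℝ (V₀ τ) (V₁ τ) ^ 2
        ≤ (f * (ρ ^ 2 + τ ^ 2)) ^ 2 * (‖V₀ τ‖ ^ 2 * ‖V₁ τ‖ ^ 2) :=
          mul_le_mul_of_nonneg_left h1 (sq_nonneg _)
      _ = (ρ ^ 2 + τ ^ 2) * (f * (ρ ^ 2 + τ ^ 2) * ‖V₁ τ‖ ^ 2 * (f * ‖V₀ τ‖ ^ 2)) := by ring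
      _ ≤ (ρ + |τ|) ^ 2 * (f * (ρ ^ 2 + τ ^ 2) * ‖V₁ τ‖ ^ 2 * (f * ‖V₀ τ‖ ^ 2)) :=
          mul_le_mul_of_nonneg_right h2 (by positivity)
      _ = _ := by ring

end Energy

/-! ### Green's formula on a line and the deficiency equations -/

section Green

open Complex ComplexConjugate

/-- The quadratic form `(ρ² + τ²) ⟨S_{-σ} (x, y), (p, q)⟩`, `S_{-σ} = (m/2 - σ) + 2σ Q`, with `Q` the
projection to the line through `(ρ, τ)`, as a bilinear form. -/
def pairForm (m σ ρ τ : ℝ) (x y p q : ℂ) : ℂ :=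
  (((m / 2 - σ) * τ ^ 2 + (m / 2 + σ) * ρ ^ 2 : ℝ) : ℂ) * (x * p) +
    ((2 * σ * ρ * τ : ℝ) : ℂ) * (y * p + x * q) +
    (((m / 2 - σ) * ρ ^ 2 + (m / 2 + σ) * τ ^ 2 : ℝ) : ℂ) * (y * q)

/-- The boundary form of the system on the pairs `(x, y)`, `(p, q)`. -/
def pairGreen (m σ ρ τ : ℝ) (x₀ x₁ y₀ y₁ p₀ p₁ q₀ q₁ : ℂ) : ℂ :=
  (((ρ ^ 2 + τ ^ 2) ^ (-σ) : ℝ) : ℂ) * (pairForm m σ ρ τ x₁ y₁ p₀ q₀ - pairForm m σ ρ τ x₀ y₀ p₁ q₁ -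
    ((m * ρ : ℝ) : ℂ) * (x₀ * q₀ - y₀ * p₀))

lemma hasDerivAt_ofReal_poly (a b τ : ℝ) :
    HasDerivAt (fun τ : ℝ => ((a * τ ^ 2 + b : ℝ) : ℂ)) ((2 * a * τ : ℝ) : ℂ) τ := by
  refine HasDerivAt.ofReal_comp ?_
  refine (((hasDerivAt_pow 2 τ).const_mul a).add_const b).congr_deriv ?_
  simp; ring

/-- Green's formula. -/
lemma hasDerivAt_pairGreen {m σ ρ : ℝ} (hρ : 0 < ρ) {x₀ x₁ x₂ y₀ y₁ y₂ p₀ p₁ p₂ q₀ q₁ q₂ : ℝ → ℂ}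
    {F G P Q : ℂ} {τ : ℝ}
    (hx₀ : HasDerivAt x₀ (x₁ τ) τ) (hx₁ : HasDerivAt x₁ (x₂ τ) τ)
    (hy₀ : HasDerivAt y₀ (y₁ τ) τ) (hy₁ : HasDerivAt y₁ (y₂ τ) τ)
    (hp₀ : HasDerivAt p₀ (p₁ τ) τ) (hp₁ : HasDerivAt p₁ (p₂ τ) τ)
    (hq₀ : HasDerivAt q₀ (q₁ τ) τ) (hq₁ : HasDerivAt q₁ (q₂ τ) τ)
    (hF : ((ρ ^ 2 + τ ^ 2 : ℝ) : ℂ) * x₂ τ + (((2 - 2 * σ) * τ : ℝ) : ℂ) * x₁ τ +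
      ((2 * ρ : ℝ) : ℂ) * y₁ τ = F)
    (hG : ((ρ ^ 2 + τ ^ 2 : ℝ) : ℂ) * y₂ τ + (((2 - 2 * σ) * τ : ℝ) : ℂ) * y₁ τ -
      ((2 * ρ : ℝ) : ℂ) * x₁ τ - (m : ℂ) * y₀ τ = G)
    (hP : ((ρ ^ 2 + τ ^ 2 : ℝ) : ℂ) * p₂ τ + (((2 - 2 * σ) * τ : ℝ) : ℂ) * p₁ τ +
      ((2 * ρ : ℝ) : ℂ) * q₁ τ = P)
    (hQ : ((ρ ^ 2 + τ ^ 2 : ℝ) : ℂ) * q₂ τ + (((2 - 2 * σ) * τ : ℝ) : ℂ) * q₁ τ -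
      ((2 * ρ : ℝ) : ℂ) * p₁ τ - (m : ℂ) * q₀ τ = Q) :
    HasDerivAt (fun τ => pairGreen m σ ρ τ (x₀ τ) (x₁ τ) (y₀ τ) (y₁ τ) (p₀ τ) (p₁ τ) (q₀ τ) (q₁ τ))
      ((((ρ ^ 2 + τ ^ 2) ^ (-σ - 1) : ℝ) : ℂ) * (pairForm m σ ρ τ F G (p₀ τ) (q₀ τ) -
        pairForm m σ ρ τ (x₀ τ) (y₀ τ) P Q)) τ := by
  have hf := (hasDerivAt_rpow_sq_add_sq hρ (-σ) τ).ofReal_comp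
  have hA := hasDerivAt_ofReal_poly (m / 2 - σ) ((m / 2 + σ) * ρ ^ 2) τ
  have hD := hasDerivAt_ofReal_poly (m / 2 + σ) ((m / 2 - σ) * ρ ^ 2) τ
  have hB : HasDerivAt (fun τ : ℝ => ((2 * σ * ρ * τ : ℝ) : ℂ)) ((2 * σ * ρ : ℝ) : ℂ) τ := by
    refine HasDerivAt.ofReal_comp ?_
    simpa using (hasDerivAt_id τ).const_mul (2 * σ * ρ)
  have h1 := ((hA.mul (hx₁.mul hp₀)).add (hB.mul ((hy₁.mul hp₀).add (hx₁.mul hq₀)))).add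
    (hD.mul (hy₁.mul hq₀))
  have h2 := ((hA.mul (hx₀.mul hp₁)).add (hB.mul ((hy₀.mul hp₁).add (hx₀.mul hq₁)))).add
    (hD.mul (hy₀.mul hq₁))
  have h3 := ((hx₀.mul hq₀).sub (hy₀.mul hp₀)).const_mul ((m * ρ : ℝ) : ℂ)
  have h4 := hf.mul ((h1.sub h2).sub h3)
  refine HasDerivAt.congr_deriv (f := fun τ => pairGreen m σ ρ τ (x₀ τ) (x₁ τ) (y₀ τ) (y₁ τ) (p₀ τ)
    (p₁ τ) (q₀ τ) (q₁ τ)) (h4.congr_of_eventuallyEq (Filter.Eventually.of_forall fun t => ?_)) ?_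
  · simp only [pairGreen, pairForm, Pi.add_apply, Pi.sub_apply, Pi.mul_apply]
    rw [add_comm ((m / 2 - σ) * ρ ^ 2)]
  -- After one power of r² is split off and F, G, P, Q are replaced by the left sides of the
  -- equations, the claim is a polynomial identity.
  have e : (ρ ^ 2 + τ ^ 2) ^ (-σ) = (ρ ^ 2 + τ ^ 2) ^ (-σ - 1) * (ρ ^ 2 + τ ^ 2) := by
    rw [← rpow_sq_add_sq_add_one hρ]; congr 1; ring
  simp only [Pi.add_apply, Pi.sub_apply, Pi.mul_apply, pairForm]
  rw [e, ← hF, ← hG, ← hP, ← hQ]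
  push_cast
  ring

/-- Green's formula for a single equation. -/
lemma hasDerivAt_scalarGreen {σ ρ : ℝ} (hρ : 0 < ρ) {w₀ w₁ w₂ q₀ q₁ q₂ : ℝ → ℂ} {F Q : ℂ} {τ : ℝ}
    (hw₀ : HasDerivAt w₀ (w₁ τ) τ) (hw₁ : HasDerivAt w₁ (w₂ τ) τ)
    (hq₀ : HasDerivAt q₀ (q₁ τ) τ) (hq₁ : HasDerivAt q₁ (q₂ τ) τ)
    (hF : ((ρ ^ 2 + τ ^ 2 : ℝ) : ℂ) * w₂ τ + (((2 - 2 * σ) * τ : ℝ) : ℂ) * w₁ τ = F)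
    (hQ : ((ρ ^ 2 + τ ^ 2 : ℝ) : ℂ) * q₂ τ + (((2 - 2 * σ) * τ : ℝ) : ℂ) * q₁ τ = Q) :
    HasDerivAt (fun τ => (((ρ ^ 2 + τ ^ 2) ^ (1 - σ) : ℝ) : ℂ) * (w₁ τ * q₀ τ - w₀ τ * q₁ τ))
      ((((ρ ^ 2 + τ ^ 2) ^ (-σ) : ℝ) : ℂ) * (F * q₀ τ - w₀ τ * Q)) τ := by
  have hf := (hasDerivAt_rpow_sq_add_sq hρ (1 - σ) τ).ofReal_comp
  have h4 := hf.mul ((hw₁.mul hq₀).sub (hw₀.mul hq₁))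
  refine HasDerivAt.congr_deriv h4 ?_
  have e : (ρ ^ 2 + τ ^ 2) ^ (1 - σ) = (ρ ^ 2 + τ ^ 2) ^ (-σ) * (ρ ^ 2 + τ ^ 2) := by
    rw [← rpow_sq_add_sq_add_one hρ]; congr 1; ring
  simp only [Pi.sub_apply, Pi.mul_apply]
  rw [e, show 1 - σ - 1 = -σ by ring, ← hF, ← hQ]
  push_cast
  ring

lemma norm_pairForm_le {m σ ρ τ : ℝ} (x y p q : ℂ) :
    ‖pairForm m σ ρ τ x y p q‖ ≤ (|m / 2 - σ| + |m / 2 + σ| + |σ|) * (ρ ^ 2 + τ ^ 2) *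
      ((‖x‖ + ‖y‖) * (‖p‖ + ‖q‖)) := by
  have h1 : |(m / 2 - σ) * τ ^ 2 + (m / 2 + σ) * ρ ^ 2| ≤
      (|m / 2 - σ| + |m / 2 + σ| + |σ|) * (ρ ^ 2 + τ ^ 2) := by
    refine (abs_add_le _ _).trans ?_
    rw [abs_mul, abs_mul, abs_of_nonneg (sq_nonneg τ), abs_of_nonneg (sq_nonneg ρ)]
    nlinarith [abs_nonneg (m / 2 - σ), abs_nonneg (m / 2 + σ), abs_nonneg σ, sq_nonneg τ,
      sq_nonneg ρ, mul_nonneg (abs_nonneg (m / 2 - σ)) (sq_nonneg ρ),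
      mul_nonneg (abs_nonneg (m / 2 + σ)) (sq_nonneg τ), mul_nonneg (abs_nonneg σ) (sq_nonneg τ),
      mul_nonneg (abs_nonneg σ) (sq_nonneg ρ)]
  have h3 : |(m / 2 - σ) * ρ ^ 2 + (m / 2 + σ) * τ ^ 2| ≤
      (|m / 2 - σ| + |m / 2 + σ| + |σ|) * (ρ ^ 2 + τ ^ 2) := by
    refine (abs_add_le _ _).trans ?_
    rw [abs_mul, abs_mul, abs_of_nonneg (sq_nonneg τ), abs_of_nonneg (sq_nonneg ρ)]
    nlinarith [abs_nonneg (m / 2 - σ), abs_nonneg (m / 2 + σ), abs_nonneg σ, sq_nonneg τ,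
      sq_nonneg ρ, mul_nonneg (abs_nonneg (m / 2 - σ)) (sq_nonneg τ),
      mul_nonneg (abs_nonneg (m / 2 + σ)) (sq_nonneg ρ), mul_nonneg (abs_nonneg σ) (sq_nonneg τ),
      mul_nonneg (abs_nonneg σ) (sq_nonneg ρ)]
  have h2 : |2 * σ * ρ * τ| ≤ (|m / 2 - σ| + |m / 2 + σ| + |σ|) * (ρ ^ 2 + τ ^ 2) := by
    have : |2 * σ * ρ * τ| = |σ| * (2 * (|ρ| * |τ|)) := by
      rw [abs_mul, abs_mul, abs_mul, abs_two]; ring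
    rw [this]
    have h4 : 2 * (|ρ| * |τ|) ≤ ρ ^ 2 + τ ^ 2 := by
      rw [← sq_abs ρ, ← sq_abs τ]; nlinarith [sq_nonneg (|ρ| - |τ|)]
    refine mul_le_mul ?_ h4 (by positivity) (by positivity)
    linarith [abs_nonneg (m / 2 - σ), abs_nonneg (m / 2 + σ)]
  set M := (|m / 2 - σ| + |m / 2 + σ| + |σ|) * (ρ ^ 2 + τ ^ 2) with hM
  unfold pairForm
  refine norm_add₃_le.trans ?_
  rw [norm_mul (Complex.ofReal _), norm_mul (Complex.ofReal _), norm_mul (Complex.ofReal _),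
    Complex.norm_real, Complex.norm_real, Complex.norm_real, Real.norm_eq_abs, Real.norm_eq_abs,
    Real.norm_eq_abs]
  have k1 := mul_le_mul_of_nonneg_right h1 (norm_nonneg (x * p))
  have k2 : |2 * σ * ρ * τ| * ‖y * p + x * q‖ ≤ M * (‖y * p‖ + ‖x * q‖) :=
    mul_le_mul h2 (norm_add_le _ _) (norm_nonneg _) ((abs_nonneg _).trans h2)
  have k3 := mul_le_mul_of_nonneg_right h3 (norm_nonneg (y * q))
  simp only [norm_mul] at k1 k2 k3 ⊢
  linarith

/-- Only the shape matters: r² times a value times a derivative, plus ρ times a product of values.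
For finite energy these are at most ρ + |τ| times an integrable function. -/
lemma norm_pairGreen_le {m σ ρ τ : ℝ} (hρ : 0 < ρ) (x₀ x₁ y₀ y₁ p₀ p₁ q₀ q₁ : ℂ) :
    ‖pairGreen m σ ρ τ x₀ x₁ y₀ y₁ p₀ p₁ q₀ q₁‖ ≤ (|m / 2 - σ| + |m / 2 + σ| + |σ| + |m|) *
      ((ρ ^ 2 + τ ^ 2) ^ (-σ) * ((ρ ^ 2 + τ ^ 2) * ((‖x₁‖ + ‖y₁‖) * (‖p₀‖ + ‖q₀‖) +
        (‖x₀‖ + ‖y₀‖) * (‖p₁‖ + ‖q₁‖)) + ρ * ((‖x₀‖ + ‖y₀‖) * (‖p₀‖ + ‖q₀‖)))) := by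
  unfold pairGreen
  have hf0 : 0 ≤ (ρ ^ 2 + τ ^ 2) ^ (-σ) := by positivity
  rw [norm_mul, Complex.norm_real, Real.norm_of_nonneg hf0, mul_left_comm]
  refine mul_le_mul_of_nonneg_left ?_ hf0
  refine (norm_sub_le _ _).trans ((add_le_add_left (norm_sub_le _ _) _).trans ?_)
  have k1 := norm_pairForm_le (m := m) (σ := σ) (ρ := ρ) (τ := τ) x₁ y₁ p₀ q₀
  have k2 := norm_pairForm_le (m := m) (σ := σ) (ρ := ρ) (τ := τ) x₀ y₀ p₁ q₁
  have k3 : ‖((m * ρ : ℝ) : ℂ) * (x₀ * q₀ - y₀ * p₀)‖ ≤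
      |m| * (ρ * ((‖x₀‖ + ‖y₀‖) * (‖p₀‖ + ‖q₀‖))) := by
    rw [norm_mul, Complex.norm_real, Real.norm_eq_abs, abs_mul, abs_of_pos hρ, mul_assoc]
    refine mul_le_mul_of_nonneg_left (mul_le_mul_of_nonneg_left ?_ hρ.le) (abs_nonneg _)
    refine (norm_sub_le _ _).trans ?_
    rw [norm_mul, norm_mul]
    nlinarith [norm_nonneg x₀, norm_nonneg y₀, norm_nonneg p₀, norm_nonneg q₀,
      mul_nonneg (norm_nonneg x₀) (norm_nonneg p₀), mul_nonneg (norm_nonneg y₀) (norm_nonneg q₀)]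
  set M := |m / 2 - σ| + |m / 2 + σ| + |σ| with hM
  have hM0 : 0 ≤ M := by positivity
  have hX1 : 0 ≤ (ρ ^ 2 + τ ^ 2) * ((‖x₁‖ + ‖y₁‖) * (‖p₀‖ + ‖q₀‖)) := by positivity
  have hX2 : 0 ≤ (ρ ^ 2 + τ ^ 2) * ((‖x₀‖ + ‖y₀‖) * (‖p₁‖ + ‖q₁‖)) := by positivity
  have hX3 : 0 ≤ ρ * ((‖x₀‖ + ‖y₀‖) * (‖p₀‖ + ‖q₀‖)) := by positivity
  have := mul_nonneg hM0 hX3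
  have := mul_nonneg (abs_nonneg m) hX1
  have := mul_nonneg (abs_nonneg m) hX2
  nlinarith

/-- `(ρ² + τ²) |a| |b| ≤ (ρ + |τ|) ((ρ² + τ²) a² + b²)`. -/
lemma sq_mul_le {ρ τ a b : ℝ} (hρ : 0 < ρ) (ha : 0 ≤ a) (hb : 0 ≤ b) :
    (ρ ^ 2 + τ ^ 2) * (a * b) ≤ (ρ + |τ|) * ((ρ ^ 2 + τ ^ 2) * a ^ 2 + b ^ 2) := by
  set r := Real.sqrt (ρ ^ 2 + τ ^ 2) with hr
  have hr2 : r ^ 2 = ρ ^ 2 + τ ^ 2 := Real.sq_sqrt (by positivity)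
  have hr0 : 0 ≤ r := Real.sqrt_nonneg _
  have hle : r ≤ ρ + |τ| := by
    refine Real.sqrt_le_iff.2 ⟨by positivity, ?_⟩
    rw [← sq_abs τ]; nlinarith [abs_nonneg τ]
  rw [← hr2]
  have h1 : r ^ 2 * (a * b) ≤ r * (r ^ 2 * a ^ 2 + b ^ 2) := by
    nlinarith [mul_nonneg hr0 (sq_nonneg (r * a - b)), mul_nonneg hr0 (sq_nonneg (r * a)),
      mul_nonneg hr0 (sq_nonneg b), mul_nonneg (mul_nonneg hr0 hr0) (mul_nonneg ha hb)]
  exact h1.trans (mul_le_mul_of_nonneg_right hle (by positivity))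

/-- The data of a square integrable function with square integrable derivative. -/
structure EnergyFinite {E : Type*} [NormedAddCommGroup E] (σ ρ : ℝ) (x₀ x₁ : ℝ → E) : Prop where
  fn : Integrable fun τ => (ρ ^ 2 + τ ^ 2) ^ (-σ) * ‖x₀ τ‖ ^ 2
  der : Integrable fun τ => (ρ ^ 2 + τ ^ 2) ^ (1 - σ) * ‖x₁ τ‖ ^ 2

/-- The density `f ((ρ² + τ²) |x'|² + |x|²)`. -/
def energyDensity {E : Type*} [NormedAddCommGroup E] (σ ρ : ℝ) (x₀ x₁ : ℝ → E) (τ : ℝ) : ℝ :=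
  (ρ ^ 2 + τ ^ 2) ^ (-σ) * ((ρ ^ 2 + τ ^ 2) * ‖x₁ τ‖ ^ 2 + ‖x₀ τ‖ ^ 2)

lemma EnergyFinite.integrable {σ ρ : ℝ} (hρ : 0 < ρ) {x₀ x₁ : ℝ → ℂ}
    (h : EnergyFinite σ ρ x₀ x₁) : Integrable (energyDensity σ ρ x₀ x₁) := by
  refine (h.der.add h.fn).congr (Filter.Eventually.of_forall fun τ => ?_)
  have e : (ρ ^ 2 + τ ^ 2) ^ (1 - σ) = (ρ ^ 2 + τ ^ 2) ^ (-σ) * (ρ ^ 2 + τ ^ 2) := by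
    rw [← rpow_sq_add_sq_add_one hρ]; congr 1; ring
  simp only [Pi.add_apply, energyDensity, e]
  ring

lemma hasDerivAt_conj {x : ℝ → ℂ} {x' : ℂ} {τ : ℝ} (h : HasDerivAt x x' τ) :
    HasDerivAt (fun τ => conj (x τ)) (conj x') τ := h.star

/-- A nonnegative multiple of the boundary term being monotone and small, it vanishes. -/
lemma eq_zero_of_green {ρ c : ℝ} (hρ : 0 < ρ) (hc : c ≠ 0) {Φ q h : ℝ → ℝ}
    (hd : ∀ τ, HasDerivAt Φ (c * q τ) τ) (hq : ∀ τ, 0 ≤ q τ) (hh : Integrable h)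
    (hb : ∀ τ, |Φ τ| ≤ (ρ + |τ|) * h τ) (τ : ℝ) : q τ = 0 := by
  -- Multiplying by c once more makes the derivative c² q, so the sign of c plays no role.
  have hd' : ∀ τ, HasDerivAt (fun τ => c * Φ τ) (c * (c * q τ)) τ := fun τ => (hd τ).const_mul c
  have hmono : Monotone fun τ => c * Φ τ := by
    refine monotone_of_deriv_nonneg (fun τ => (hd' τ).differentiableAt) fun τ => ?_
    rw [(hd' τ).deriv, ← mul_assoc]
    exact mul_nonneg (mul_self_nonneg c) (hq τ)
  have hz := monotone_eq_zero hmono (hh.const_mul |c|) hρ (fun τ => by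
    rw [abs_mul, mul_left_comm]
    exact mul_le_mul_of_nonneg_left (hb τ) (abs_nonneg c))
  have h0 : HasDerivAt (fun τ => c * Φ τ) 0 τ := by
    have : (fun τ => c * Φ τ) = fun _ => 0 := funext hz
    rw [this]; exact hasDerivAt_const τ 0
  have := (hd' τ).unique h0
  simpa [hc] using this

lemma add_norm_sq_le (a b : ℝ) : (a + b) ^ 2 ≤ 2 * (a ^ 2 + b ^ 2) := by
  nlinarith [sq_nonneg (a - b)]

/-- The deficiency equations for the pairs have no nonzero solutions. -/
lemma pair_eq_zero_of_deficiency {m σ ρ : ℝ} (hρ : 0 < ρ) (hα : 0 < m / 2 + σ) (hβ : 0 < m / 2 - σ)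
    {z : ℂ} (hz : z.im ≠ 0) {x₀ x₁ x₂ y₀ y₁ y₂ : ℝ → ℂ}
    (hx₀ : ∀ τ, HasDerivAt x₀ (x₁ τ) τ) (hx₁ : ∀ τ, HasDerivAt x₁ (x₂ τ) τ)
    (hy₀ : ∀ τ, HasDerivAt y₀ (y₁ τ) τ) (hy₁ : ∀ τ, HasDerivAt y₁ (y₂ τ) τ)
    (hF : ∀ τ, ((ρ ^ 2 + τ ^ 2 : ℝ) : ℂ) * x₂ τ + (((2 - 2 * σ) * τ : ℝ) : ℂ) * x₁ τ +
      ((2 * ρ : ℝ) : ℂ) * y₁ τ = z * x₀ τ)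
    (hG : ∀ τ, ((ρ ^ 2 + τ ^ 2 : ℝ) : ℂ) * y₂ τ + (((2 - 2 * σ) * τ : ℝ) : ℂ) * y₁ τ -
      ((2 * ρ : ℝ) : ℂ) * x₁ τ - (m : ℂ) * y₀ τ = z * y₀ τ)
    (ex : EnergyFinite σ ρ x₀ x₁) (ey : EnergyFinite σ ρ y₀ y₁) (τ : ℝ) :
    x₀ τ = 0 ∧ y₀ τ = 0 := by
  set J : ℝ → ℂ := fun τ => pairGreen m σ ρ τ (x₀ τ) (x₁ τ) (y₀ τ) (y₁ τ) (conj (x₀ τ))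
    (conj (x₁ τ)) (conj (y₀ τ)) (conj (y₁ τ)) with hJ
  -- Green's formula is applied to the solution and its conjugate, giving the derivative (z - z̄) q.
  -- Here q is the quadratic form diagonalised along (ρ, τ) and (τ, -ρ), with eigenvalues m/2 + σ
  -- and m/2 - σ.
  set q : ℝ → ℝ := fun τ => (ρ ^ 2 + τ ^ 2) ^ (-σ - 1) *
    ((m / 2 + σ) * normSq (ρ * x₀ τ + τ * y₀ τ) + (m / 2 - σ) * normSq (τ * x₀ τ - ρ * y₀ τ))
    with hq
  have hJd : ∀ τ, HasDerivAt J (((2 * z.im * q τ : ℝ) : ℂ) * I) τ := by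
    intro τ
    have hP := congrArg conj (hF τ)
    have hQ := congrArg conj (hG τ)
    simp only [map_add, map_sub, map_mul, conj_ofReal] at hP hQ
    refine (hasDerivAt_pairGreen hρ (hx₀ τ) (hx₁ τ) (hy₀ τ) (hy₁ τ) (hasDerivAt_conj (hx₀ τ))
      (p₂ := fun τ => conj (x₂ τ)) (hasDerivAt_conj (hx₁ τ)) (hasDerivAt_conj (hy₀ τ))
      (q₂ := fun τ => conj (y₂ τ)) (hasDerivAt_conj (hy₁ τ)) (hF τ) (hG τ) hP hQ).congr_deriv ?_
    have hzz : ((2 * z.im : ℝ) : ℂ) * I = z - conj z := (sub_conj z).symm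
    have e1 : ((2 * z.im * q τ : ℝ) : ℂ) * I = (((2 * z.im : ℝ) : ℂ) * I) * (q τ : ℂ) := by
      push_cast; ring
    rw [e1, hzz, hq]
    simp only [ofReal_mul, ofReal_add (_ * _), ← mul_conj, map_add, map_sub, map_mul, conj_ofReal,
      pairForm]
    push_cast
    ring
  have hΦ : ∀ τ, HasDerivAt (fun τ => (J τ).im) (2 * z.im * q τ) τ := by
    intro τ
    have := imCLM.hasFDerivAt.comp_hasDerivAt τ (hJd τ)
    refine HasDerivAt.congr_deriv this ?_
    simp [-ofReal_mul]
  set K := |m / 2 - σ| + |m / 2 + σ| + |σ| + |m| with hK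
  have hK0 : 0 ≤ K := by positivity
  have hq0 := eq_zero_of_green hρ (by simpa using hz : 2 * z.im ≠ 0) hΦ
    (h := fun τ => 10 * K * (energyDensity σ ρ x₀ x₁ τ + energyDensity σ ρ y₀ y₁ τ))
    (fun τ => by
      have := normSq_nonneg (ρ * x₀ τ + τ * y₀ τ)
      have := normSq_nonneg (τ * x₀ τ - ρ * y₀ τ)
      simp only [hq]; positivity)
    (((ex.integrable hρ).add (ey.integrable hρ)).const_mul _)
    (fun τ => by
      refine (abs_im_le_norm _).trans ((norm_pairGreen_le hρ _ _ _ _ _ _ _ _).trans ?_)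
      rw [← hK]
      simp only [norm_conj, energyDensity]
      set f := (ρ ^ 2 + τ ^ 2) ^ (-σ) with hf
      have hf0 : 0 ≤ f := by positivity
      set X := ‖x₀ τ‖ + ‖y₀ τ‖ with hX
      set Y := ‖x₁ τ‖ + ‖y₁ τ‖ with hY
      have h1 := sq_mul_le (τ := τ) hρ (by positivity : 0 ≤ Y) (by positivity : 0 ≤ X)
      have h2 : ρ * (X * X) ≤ (ρ + |τ|) * X ^ 2 := by
        nlinarith [abs_nonneg τ, sq_nonneg X, mul_nonneg (abs_nonneg τ) (sq_nonneg X)]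
      have h3 : X ^ 2 ≤ 2 * (‖x₀ τ‖ ^ 2 + ‖y₀ τ‖ ^ 2) := add_norm_sq_le _ _
      have h4 : Y ^ 2 ≤ 2 * (‖x₁ τ‖ ^ 2 + ‖y₁ τ‖ ^ 2) := add_norm_sq_le _ _
      have h5 : (ρ ^ 2 + τ ^ 2) * (Y * X + X * Y) + ρ * (X * X) ≤
          (ρ + |τ|) * (10 * ((ρ ^ 2 + τ ^ 2) * ‖x₁ τ‖ ^ 2 + ‖x₀ τ‖ ^ 2 +
            ((ρ ^ 2 + τ ^ 2) * ‖y₁ τ‖ ^ 2 + ‖y₀ τ‖ ^ 2))) := by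
        have h6 : 2 * ((ρ ^ 2 + τ ^ 2) * Y ^ 2 + X ^ 2) + X ^ 2 ≤
            10 * ((ρ ^ 2 + τ ^ 2) * ‖x₁ τ‖ ^ 2 + ‖x₀ τ‖ ^ 2 +
            ((ρ ^ 2 + τ ^ 2) * ‖y₁ τ‖ ^ 2 + ‖y₀ τ‖ ^ 2)) := by
          have := mul_le_mul_of_nonneg_left h4 (by positivity : 0 ≤ ρ ^ 2 + τ ^ 2)
          have : 0 ≤ (ρ ^ 2 + τ ^ 2) * (‖x₁ τ‖ ^ 2 + ‖y₁ τ‖ ^ 2) := by positivity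
          have : 0 ≤ ‖x₀ τ‖ ^ 2 + ‖y₀ τ‖ ^ 2 := by positivity
          linarith
        have h7 := mul_le_mul_of_nonneg_left h6 (by positivity : 0 ≤ ρ + |τ|)
        refine le_trans ?_ h7
        linarith
      have h8 := mul_le_mul_of_nonneg_left (mul_le_mul_of_nonneg_left h5 hf0) hK0
      refine h8.trans (le_of_eq ?_)
      ring) τ
  have hg0 : (ρ ^ 2 + τ ^ 2) ^ (-σ - 1) ≠ 0 := by positivity
  simp only [hq, mul_eq_zero, hg0, false_or] at hq0
  have n1 := normSq_nonneg (ρ * x₀ τ + τ * y₀ τ)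
  have n2 := normSq_nonneg (τ * x₀ τ - ρ * y₀ τ)
  have z1 : normSq (ρ * x₀ τ + τ * y₀ τ) = 0 := by nlinarith [mul_nonneg hα.le n1, mul_nonneg hβ.le n2]
  have z2 : normSq (τ * x₀ τ - ρ * y₀ τ) = 0 := by nlinarith [mul_nonneg hα.le n1, mul_nonneg hβ.le n2]
  rw [normSq_eq_zero] at z1 z2
  have hr : ((ρ ^ 2 + τ ^ 2 : ℝ) : ℂ) ≠ 0 := ofReal_ne_zero.2 (by positivity)
  constructor
  · refine (mul_eq_zero.1 (?_ : ((ρ ^ 2 + τ ^ 2 : ℝ) : ℂ) * x₀ τ = 0)).resolve_left hr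
    push_cast
    linear_combination (ρ : ℂ) * z1 + (τ : ℂ) * z2
  · refine (mul_eq_zero.1 (?_ : ((ρ ^ 2 + τ ^ 2 : ℝ) : ℂ) * y₀ τ = 0)).resolve_left hr
    push_cast
    linear_combination (τ : ℂ) * z1 - (ρ : ℂ) * z2

end Green

/-! ### Finite-energy solutions of the homogeneous equations -/

section Kernel

open Complex ComplexConjugate

/-- The scalar deficiency equations have no nonzero solutions. -/
lemma scalar_eq_zero_of_deficiency {σ ρ μ : ℝ} (hρ : 0 < ρ) {z : ℂ} (hz : z.im ≠ 0)
    {w₀ w₁ w₂ : ℝ → ℂ} (hw₀ : ∀ τ, HasDerivAt w₀ (w₁ τ) τ) (hw₁ : ∀ τ, HasDerivAt w₁ (w₂ τ) τ)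
    (hF : ∀ τ, ((ρ ^ 2 + τ ^ 2 : ℝ) : ℂ) * w₂ τ + (((2 - 2 * σ) * τ : ℝ) : ℂ) * w₁ τ -
      (μ : ℂ) * w₀ τ = z * w₀ τ)
    (ew : EnergyFinite σ ρ w₀ w₁) (τ : ℝ) : w₀ τ = 0 := by
  set J : ℝ → ℂ := fun τ => (((ρ ^ 2 + τ ^ 2) ^ (1 - σ) : ℝ) : ℂ) *
    (w₁ τ * conj (w₀ τ) - w₀ τ * conj (w₁ τ)) with hJ
  have hJd : ∀ τ, HasDerivAt J
      (((2 * z.im * ((ρ ^ 2 + τ ^ 2) ^ (-σ) * normSq (w₀ τ)) : ℝ) : ℂ) * I) τ := by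
    intro τ
    have h1 : ((ρ ^ 2 + τ ^ 2 : ℝ) : ℂ) * w₂ τ + (((2 - 2 * σ) * τ : ℝ) : ℂ) * w₁ τ =
        (μ + z) * w₀ τ := by linear_combination hF τ
    have h2 := congrArg conj h1
    simp only [map_add, map_mul, conj_ofReal] at h2
    refine (hasDerivAt_scalarGreen hρ (hw₀ τ) (hw₁ τ) (hasDerivAt_conj (hw₀ τ))
      (q₂ := fun τ => conj (w₂ τ)) (hasDerivAt_conj (hw₁ τ)) h1 h2).congr_deriv ?_
    have hzz : ((2 * z.im : ℝ) : ℂ) * I = z - conj z := (sub_conj z).symm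
    have e1 : ((2 * z.im * ((ρ ^ 2 + τ ^ 2) ^ (-σ) * normSq (w₀ τ)) : ℝ) : ℂ) * I =
        (((2 * z.im : ℝ) : ℂ) * I) * (((ρ ^ 2 + τ ^ 2) ^ (-σ) : ℝ) * (normSq (w₀ τ) : ℂ)) := by
      push_cast; ring
    rw [e1, hzz, ← mul_conj]
    ring
  have hΦ : ∀ τ, HasDerivAt (fun τ => (J τ).im)
      (2 * z.im * ((ρ ^ 2 + τ ^ 2) ^ (-σ) * normSq (w₀ τ))) τ := by
    intro τ
    have := imCLM.hasFDerivAt.comp_hasDerivAt τ (hJd τ)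
    refine HasDerivAt.congr_deriv this ?_
    simp [-ofReal_mul]
  have hq0 := eq_zero_of_green hρ (by simpa using hz : 2 * z.im ≠ 0) hΦ
    (h := fun τ => 2 * energyDensity σ ρ w₀ w₁ τ)
    (fun τ => mul_nonneg (by positivity) (normSq_nonneg _)) ((ew.integrable hρ).const_mul _)
    (fun τ => by
      refine (abs_im_le_norm _).trans ?_
      have e : (ρ ^ 2 + τ ^ 2) ^ (1 - σ) = (ρ ^ 2 + τ ^ 2) ^ (-σ) * (ρ ^ 2 + τ ^ 2) := by
        rw [← rpow_sq_add_sq_add_one hρ]; congr 1; ring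
      simp only [hJ, energyDensity, norm_mul, norm_real]
      rw [Real.norm_of_nonneg (by positivity), e]
      have h1 : ‖w₁ τ * conj (w₀ τ) - w₀ τ * conj (w₁ τ)‖ ≤ 2 * (‖w₁ τ‖ * ‖w₀ τ‖) := by
        refine (norm_sub_le _ _).trans (le_of_eq ?_)
        simp only [norm_mul, norm_conj]; ring
      have h2 := sq_mul_le (τ := τ) (a := ‖w₁ τ‖) (b := ‖w₀ τ‖) hρ (norm_nonneg _) (norm_nonneg _)
      have hf0 : 0 ≤ (ρ ^ 2 + τ ^ 2) ^ (-σ) := by positivity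
      have hr0 : 0 ≤ (ρ ^ 2 + τ ^ 2) ^ (-σ) * (ρ ^ 2 + τ ^ 2) := by positivity
      refine (mul_le_mul_of_nonneg_left h1 hr0).trans ?_
      have h3 := mul_le_mul_of_nonneg_left h2 hf0
      linarith) τ
  have hg0 : (ρ ^ 2 + τ ^ 2) ^ (-σ) ≠ 0 := by positivity
  simpa [hg0] using hq0

/-- Solutions of finite energy of the scalar equation are constant. -/
lemma scalar_kernel {σ ρ μ : ℝ} (hρ : 0 < ρ) (hμ : 0 ≤ μ)
    {w₀ w₁ w₂ : ℝ → ℂ} (hw₀ : ∀ τ, HasDerivAt w₀ (w₁ τ) τ) (hw₁ : ∀ τ, HasDerivAt w₁ (w₂ τ) τ)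
    (hF : ∀ τ, ((ρ ^ 2 + τ ^ 2 : ℝ) : ℂ) * w₂ τ + (((2 - 2 * σ) * τ : ℝ) : ℂ) * w₁ τ -
      (μ : ℂ) * w₀ τ = 0)
    (ew : EnergyFinite σ ρ w₀ w₁) (τ : ℝ) : w₁ τ = 0 ∧ μ * w₀ τ = 0 := by
  -- The equation in divergence form gives J' = (r²)^{-σ} (μ |w|² + r² |w'|²) ≥ 0, so Re J is
  -- monotone and must vanish.
  set J : ℝ → ℂ := fun τ => (((ρ ^ 2 + τ ^ 2) ^ (1 - σ) : ℝ) : ℂ) * (w₁ τ * conj (w₀ τ)) with hJ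
  have e : ∀ τ : ℝ, (ρ ^ 2 + τ ^ 2) ^ (1 - σ) = (ρ ^ 2 + τ ^ 2) ^ (-σ) * (ρ ^ 2 + τ ^ 2) := by
    intro τ; rw [← rpow_sq_add_sq_add_one hρ]; congr 1; ring
  have hJd : ∀ τ, HasDerivAt J ((((ρ ^ 2 + τ ^ 2) ^ (-σ) *
      (μ * normSq (w₀ τ) + (ρ ^ 2 + τ ^ 2) * normSq (w₁ τ)) : ℝ) : ℂ)) τ := by
    intro τ
    have hf := (hasDerivAt_rpow_sq_add_sq hρ (1 - σ) τ).ofReal_comp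
    refine HasDerivAt.congr_deriv (f := J) (hf.mul ((hw₁ τ).mul (hasDerivAt_conj (hw₀ τ)))) ?_
    rw [e, show 1 - σ - 1 = -σ by ring]
    push_cast
    rw [← mul_conj, ← mul_conj]
    have h1 := hF τ
    push_cast at h1
    linear_combination (((ρ ^ 2 + τ ^ 2) ^ (-σ) : ℝ) : ℂ) * conj (w₀ τ) * h1
  have hΦ : ∀ τ, HasDerivAt (fun τ => (J τ).re) (1 * ((ρ ^ 2 + τ ^ 2) ^ (-σ) *
      (μ * normSq (w₀ τ) + (ρ ^ 2 + τ ^ 2) * normSq (w₁ τ)))) τ := by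
    intro τ
    have := reCLM.hasFDerivAt.comp_hasDerivAt τ (hJd τ)
    refine HasDerivAt.congr_deriv this ?_
    rw [one_mul, reCLM_apply, ofReal_re]
  have hq0 := eq_zero_of_green hρ one_ne_zero hΦ (h := energyDensity σ ρ w₀ w₁)
    (fun τ => by
      have := normSq_nonneg (w₀ τ)
      have := normSq_nonneg (w₁ τ)
      positivity) (ew.integrable hρ)
    (fun τ => by
      refine (abs_re_le_norm _).trans ?_
      simp only [hJ, energyDensity, norm_mul, norm_real, norm_conj]
      rw [Real.norm_of_nonneg (by positivity), e]
      have h2 := sq_mul_le (τ := τ) (a := ‖w₁ τ‖) (b := ‖w₀ τ‖) hρ (norm_nonneg _) (norm_nonneg _)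
      have hf0 : 0 ≤ (ρ ^ 2 + τ ^ 2) ^ (-σ) := by positivity
      have h3 := mul_le_mul_of_nonneg_left h2 hf0
      linarith) τ
  have hg0 : (ρ ^ 2 + τ ^ 2) ^ (-σ) ≠ 0 := by positivity
  have hr : 0 < ρ ^ 2 + τ ^ 2 := by positivity
  have h1 := (mul_eq_zero.1 hq0).resolve_left hg0
  have n0 := mul_nonneg hμ (normSq_nonneg (w₀ τ))
  have n1 := mul_nonneg hr.le (normSq_nonneg (w₁ τ))
  constructor
  · have : (ρ ^ 2 + τ ^ 2) * normSq (w₁ τ) = 0 := by linarith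
    exact normSq_eq_zero.1 ((mul_eq_zero.1 this).resolve_left hr.ne')
  · have : μ * normSq (w₀ τ) = 0 := by linarith
    rcases mul_eq_zero.1 this with h | h
    · simp [h]
    · simp [normSq_eq_zero.1 h]

lemma sqrt_sq_add_sq_le {ρ : ℝ} (hρ : 0 < ρ) (τ : ℝ) : √(ρ ^ 2 + τ ^ 2) ≤ ρ + |τ| := by
  refine Real.sqrt_le_iff.2 ⟨by positivity, ?_⟩
  rw [← sq_abs τ]; nlinarith [abs_nonneg τ]

/-- The assumption σ > 1/2 enters through r^{2-2σ} = r · r^{1-2σ}, where the second factor is at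
most ρ^{1-2σ} because its exponent is negative. -/
lemma rpow_one_sub_le {σ ρ : ℝ} (hρ : 0 < ρ) (hσ : 1 / 2 < σ) (τ : ℝ) :
    (ρ ^ 2 + τ ^ 2) ^ (1 - σ) ≤ (ρ + |τ|) * (ρ ^ 2) ^ (1 / 2 - σ) := by
  have hr : 0 < ρ ^ 2 + τ ^ 2 := by positivity
  rw [show 1 - σ = 1 / 2 + (1 / 2 - σ) by ring, Real.rpow_add hr, ← Real.sqrt_eq_rpow]
  refine mul_le_mul (sqrt_sq_add_sq_le hρ τ) ?_ (by positivity) (by positivity)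
  exact Real.rpow_le_rpow_of_nonpos (by positivity) (by nlinarith [sq_nonneg τ]) (by linarith)

/-- The first integral of the homogeneous system for the pairs vanishes on solutions of finite
energy. -/
lemma pair_first_integral {m σ ρ : ℝ} (hρ : 0 < ρ) (hσ : 1 / 2 < σ) {x₀ x₁ x₂ y₀ y₁ y₂ : ℝ → ℂ}
    (hx₀ : ∀ τ, HasDerivAt x₀ (x₁ τ) τ) (hx₁ : ∀ τ, HasDerivAt x₁ (x₂ τ) τ)
    (hy₀ : ∀ τ, HasDerivAt y₀ (y₁ τ) τ) (hy₁ : ∀ τ, HasDerivAt y₁ (y₂ τ) τ)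
    (hF : ∀ τ, ((ρ ^ 2 + τ ^ 2 : ℝ) : ℂ) * x₂ τ + (((2 - 2 * σ) * τ : ℝ) : ℂ) * x₁ τ +
      ((2 * ρ : ℝ) : ℂ) * y₁ τ = 0)
    (hG : ∀ τ, ((ρ ^ 2 + τ ^ 2 : ℝ) : ℂ) * y₂ τ + (((2 - 2 * σ) * τ : ℝ) : ℂ) * y₁ τ -
      ((2 * ρ : ℝ) : ℂ) * x₁ τ - (m : ℂ) * y₀ τ = 0)
    (ex : EnergyFinite σ ρ x₀ x₁) (ey : EnergyFinite σ ρ y₀ y₁) (τ : ℝ) :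
    (((m / 2 - σ) * τ ^ 2 + (m / 2 + σ) * ρ ^ 2 : ℝ) : ℂ) * x₁ τ =
      -(ρ : ℂ) * (((2 * σ * τ : ℝ) : ℂ) * y₁ τ + m * y₀ τ) := by
  have hrp : ∀ τ : ℝ, 0 < ρ ^ 2 + τ ^ 2 := fun τ => by positivity
  have e1 : ∀ τ : ℝ, (ρ ^ 2 + τ ^ 2) ^ (1 - σ) = (ρ ^ 2 + τ ^ 2) ^ (-σ) * (ρ ^ 2 + τ ^ 2) := by
    intro τ; rw [← rpow_sq_add_sq_add_one hρ]; congr 1; ring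
  -- The constant pair (1, 0) solves the homogeneous system, since x enters it only through its
  -- derivatives. The boundary form with this pair is therefore a first integral.
  set J : ℝ → ℂ := fun τ => pairGreen m σ ρ τ (x₀ τ) (x₁ τ) (y₀ τ) (y₁ τ) 1 0 0 0 with hJ
  have hJd : ∀ τ, HasDerivAt J 0 τ := by
    intro τ
    refine (hasDerivAt_pairGreen hρ (hx₀ τ) (hx₁ τ) (hy₀ τ) (hy₁ τ) (p₀ := fun _ => 1)
      (p₁ := fun _ => 0) (p₂ := fun _ => 0) (q₀ := fun _ => 0) (q₁ := fun _ => 0) (q₂ := fun _ => 0)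
      (P := 0) (Q := 0)
      (hasDerivAt_const τ _) (hasDerivAt_const τ _) (hasDerivAt_const τ _) (hasDerivAt_const τ _)
      (hF τ) (hG τ) (by simp) (by simp)).congr_deriv ?_
    simp [pairForm]
  have hJc : ∀ τ, J τ = J 0 := fun τ =>
    is_const_of_deriv_eq_zero (fun τ => (hJd τ).differentiableAt) (fun τ => (hJd τ).deriv) τ 0
  set K := |m / 2 - σ| + |m / 2 + σ| + |σ| + |m| with hK
  have hK0 : 0 ≤ K := by positivity
  -- By Cauchy-Schwarz |J|² is at most (r²)^{1-σ} times the energy density, hence at most ρ + |τ|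
  -- times an integrable function. A constant function with this bound is zero.
  have hsq : ‖J 0‖ ^ 2 = 0 := by
    refine monotone_eq_zero (Φ := fun _ => ‖J 0‖ ^ 2) monotone_const (h := fun τ =>
      4 * K ^ 2 * (ρ ^ 2) ^ (1 / 2 - σ) * (energyDensity σ ρ x₀ x₁ τ + energyDensity σ ρ y₀ y₁ τ))
      (((ex.integrable hρ).add (ey.integrable hρ)).const_mul _) hρ (fun τ => ?_) 0
    rw [abs_of_nonneg (by positivity), ← hJc τ]
    have h1 : ‖J τ‖ ≤ _ := norm_pairGreen_le hρ _ _ _ _ _ _ _ _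
    rw [← hK] at h1
    simp only [norm_one, norm_zero, add_zero, mul_one, mul_zero] at h1
    set f := (ρ ^ 2 + τ ^ 2) ^ (-σ) with hf
    have hf0 : 0 ≤ f := by positivity
    set X := ‖x₀ τ‖ + ‖y₀ τ‖ with hX
    set Y := ‖x₁ τ‖ + ‖y₁ τ‖ with hY
    have h3 : X ^ 2 ≤ 2 * (‖x₀ τ‖ ^ 2 + ‖y₀ τ‖ ^ 2) := add_norm_sq_le _ _
    have h4 : Y ^ 2 ≤ 2 * (‖x₁ τ‖ ^ 2 + ‖y₁ τ‖ ^ 2) := add_norm_sq_le _ _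
    have h5 : ‖J τ‖ ^ 2 ≤ (K * (f * ((ρ ^ 2 + τ ^ 2) * Y + ρ * X))) ^ 2 :=
      pow_le_pow_left₀ (norm_nonneg _) h1 2
    have h6 : ((ρ ^ 2 + τ ^ 2) * Y + ρ * X) ^ 2 ≤
        (ρ ^ 2 + τ ^ 2) * (4 * ((ρ ^ 2 + τ ^ 2) * (‖x₁ τ‖ ^ 2 + ‖y₁ τ‖ ^ 2) +
          (‖x₀ τ‖ ^ 2 + ‖y₀ τ‖ ^ 2))) := by
      refine (add_norm_sq_le _ _).trans ?_
      have k1 := mul_le_mul_of_nonneg_left h4 (sq_nonneg (ρ ^ 2 + τ ^ 2))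
      have k2 := mul_le_mul_of_nonneg_left h3 (sq_nonneg ρ)
      have k3 : ρ ^ 2 * (‖x₀ τ‖ ^ 2 + ‖y₀ τ‖ ^ 2) ≤
          (ρ ^ 2 + τ ^ 2) * (‖x₀ τ‖ ^ 2 + ‖y₀ τ‖ ^ 2) :=
        mul_le_mul_of_nonneg_right (by linarith [sq_nonneg τ]) (by positivity)
      rw [mul_pow, mul_pow]
      linarith
    have h7 := rpow_one_sub_le hρ hσ τ
    rw [e1, ← hf] at h7
    simp only [energyDensity, ← hf]
    set E := (ρ ^ 2 + τ ^ 2) * (‖x₁ τ‖ ^ 2 + ‖y₁ τ‖ ^ 2) + (‖x₀ τ‖ ^ 2 + ‖y₀ τ‖ ^ 2) with hE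
    have hE0 : 0 ≤ E := by positivity
    have h8 : (K * (f * ((ρ ^ 2 + τ ^ 2) * Y + ρ * X))) ^ 2 ≤
        K ^ 2 * f ^ 2 * ((ρ ^ 2 + τ ^ 2) * (4 * E)) := by
      rw [mul_pow, mul_pow, ← mul_assoc]
      exact mul_le_mul_of_nonneg_left h6 (by positivity)
    have h9 := mul_le_mul_of_nonneg_left h7 (by positivity : 0 ≤ 4 * K ^ 2 * f * E)
    have h10 : f * ((ρ ^ 2 + τ ^ 2) * ‖x₁ τ‖ ^ 2 + ‖x₀ τ‖ ^ 2) +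
        f * ((ρ ^ 2 + τ ^ 2) * ‖y₁ τ‖ ^ 2 + ‖y₀ τ‖ ^ 2) = f * E := by rw [hE]; ring
    rw [h10]
    refine h5.trans (h8.trans ?_)
    refine le_trans (le_of_eq ?_) (h9.trans (le_of_eq ?_)) <;> ring
  have hJ0 : ∀ τ, J τ = 0 := fun τ => by
    rw [hJc τ]; simpa using hsq
  have h1 := hJ0 τ
  have hg0 : (((ρ ^ 2 + τ ^ 2) ^ (-σ) : ℝ) : ℂ) ≠ 0 :=
    ofReal_ne_zero.2 (Real.rpow_pos_of_pos (hrp τ) _).ne'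
  have h2 := (mul_eq_zero.1 h1).resolve_left hg0
  simp only [pairForm] at h2
  push_cast at h2 ⊢
  linear_combination h2

/-- Solutions of finite energy of the homogeneous system for the pairs have constant first
component and zero second component. -/
lemma pair_kernel {m σ ρ : ℝ} (hρ : 0 < ρ) (hσ : 1 / 2 < σ) (hα : 1 < m / 2 + σ)
    (hβ : 0 < m / 2 - σ) {x₀ x₁ x₂ y₀ y₁ y₂ : ℝ → ℂ}
    (hx₀ : ∀ τ, HasDerivAt x₀ (x₁ τ) τ) (hx₁ : ∀ τ, HasDerivAt x₁ (x₂ τ) τ)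
    (hy₀ : ∀ τ, HasDerivAt y₀ (y₁ τ) τ) (hy₁ : ∀ τ, HasDerivAt y₁ (y₂ τ) τ)
    (hF : ∀ τ, ((ρ ^ 2 + τ ^ 2 : ℝ) : ℂ) * x₂ τ + (((2 - 2 * σ) * τ : ℝ) : ℂ) * x₁ τ +
      ((2 * ρ : ℝ) : ℂ) * y₁ τ = 0)
    (hG : ∀ τ, ((ρ ^ 2 + τ ^ 2 : ℝ) : ℂ) * y₂ τ + (((2 - 2 * σ) * τ : ℝ) : ℂ) * y₁ τ -
      ((2 * ρ : ℝ) : ℂ) * x₁ τ - (m : ℂ) * y₀ τ = 0)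
    (ex : EnergyFinite σ ρ x₀ x₁) (ey : EnergyFinite σ ρ y₀ y₁) (τ : ℝ) :
    x₁ τ = 0 ∧ y₀ τ = 0 := by
  have hm : 0 < m := by linarith
  have hrp : ∀ τ : ℝ, 0 < ρ ^ 2 + τ ^ 2 := fun τ => by positivity
  have e1 : ∀ τ : ℝ, (ρ ^ 2 + τ ^ 2) ^ (1 - σ) = (ρ ^ 2 + τ ^ 2) ^ (-σ) * (ρ ^ 2 + τ ^ 2) := by
    intro τ; rw [← rpow_sq_add_sq_add_one hρ]; congr 1; ring
  have e2 : ∀ τ : ℝ, (ρ ^ 2 + τ ^ 2) ^ (2 - σ) = (ρ ^ 2 + τ ^ 2) ^ (1 - σ) * (ρ ^ 2 + τ ^ 2) := by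
    intro τ; rw [← rpow_sq_add_sq_add_one hρ]; congr 1; ring
  have hrρ : ∀ τ : ℝ, ρ ≤ √(ρ ^ 2 + τ ^ 2) := fun τ =>
    Real.le_sqrt_of_sq_le (by nlinarith [sq_nonneg τ])
  have hrτ : ∀ τ : ℝ, |τ| ≤ √(ρ ^ 2 + τ ^ 2) := fun τ =>
    Real.le_sqrt_of_sq_le (by rw [sq_abs]; nlinarith [sq_nonneg ρ])
  have hr2 : ∀ τ : ℝ, √(ρ ^ 2 + τ ^ 2) ^ 2 = ρ ^ 2 + τ ^ 2 := fun τ => Real.sq_sqrt (hrp τ).le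
  have hc := fun τ => pair_first_integral hρ hσ hx₀ hx₁ hy₀ hy₁ hF hG ex ey τ
  set δ := min (m / 2 - σ) (m / 2 + σ) with hδ
  have hδ0 : 0 < δ := lt_min hβ (by linarith)
  set L := δ⁻¹ * (ρ * (2 * σ + m)) with hL
  have hL0 : 0 ≤ L := by positivity
  -- The coefficient of x' in the first integral is at least δ r². This gives x' one power of r more
  -- decay than finite energy alone, which the boundary term below needs.
  have hxy : ∀ τ : ℝ, (ρ ^ 2 + τ ^ 2) * ‖x₁ τ‖ ≤ L * (√(ρ ^ 2 + τ ^ 2) * ‖y₁ τ‖ + ‖y₀ τ‖) := by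
    intro τ
    have h1 := congrArg norm (hc τ)
    rw [norm_mul, norm_mul, norm_neg, norm_real, norm_real, Real.norm_of_nonneg (by positivity),
      Real.norm_of_nonneg hρ.le] at h1
    have h2 : ‖((2 * σ * τ : ℝ) : ℂ) * y₁ τ + m * y₀ τ‖ ≤
        (2 * σ + m) * (√(ρ ^ 2 + τ ^ 2) * ‖y₁ τ‖ + ‖y₀ τ‖) := by
      refine (norm_add_le _ _).trans ?_
      rw [norm_mul, norm_mul, norm_real, norm_real, Real.norm_of_nonneg hm.le, Real.norm_eq_abs,
        abs_mul, abs_of_pos (by linarith : 0 < 2 * σ)]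
      have k1 := mul_le_mul_of_nonneg_right (hrτ τ) (norm_nonneg (y₁ τ))
      have k2 := mul_le_mul_of_nonneg_left k1 (by linarith : 0 ≤ 2 * σ)
      have k3 : 0 ≤ m * (√(ρ ^ 2 + τ ^ 2) * ‖y₁ τ‖) := by positivity
      have k4 : 0 ≤ σ * ‖y₀ τ‖ := mul_nonneg (by linarith) (norm_nonneg _)
      nlinarith
    have h3 : δ * (ρ ^ 2 + τ ^ 2) ≤ (m / 2 - σ) * τ ^ 2 + (m / 2 + σ) * ρ ^ 2 := by
      have k1 := mul_le_mul_of_nonneg_right (min_le_left (m / 2 - σ) (m / 2 + σ)) (sq_nonneg τ)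
      have k2 := mul_le_mul_of_nonneg_right (min_le_right (m / 2 - σ) (m / 2 + σ)) (sq_nonneg ρ)
      rw [← hδ] at k1 k2
      linarith
    have h4 := mul_le_mul_of_nonneg_right h3 (norm_nonneg (x₁ τ))
    rw [hL, mul_assoc, inv_mul_eq_div, le_div_iff₀ hδ0]
    have h5 := mul_le_mul_of_nonneg_left h2 hρ.le
    linarith
  -- The first equation reads ((r²)^{2-σ} x')' = (r²)^{1-σ} Y, and the first integral turns the
  -- second into Y' = 2 (m/2 + σ - 1) x'. Hence (r²)^{2-σ} Re(Y x̄') has a derivative that is a sum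
  -- of squares, because m/2 + σ > 1.
  set Y : ℝ → ℂ := fun τ => 2 * ((τ : ℂ) * x₁ τ - (ρ : ℂ) * y₁ τ) with hY
  have hYd : ∀ τ, HasDerivAt Y (((2 * (m / 2 + σ - 1) : ℝ) : ℂ) * x₁ τ) τ := by
    intro τ
    have h1 : HasDerivAt (fun τ : ℝ => (τ : ℂ)) 1 τ := (hasDerivAt_id τ).ofReal_comp
    refine HasDerivAt.congr_deriv (f := Y)
      (((h1.mul (hx₁ τ)).sub ((hy₁ τ).const_mul (ρ : ℂ))).const_mul 2) ?_
    have hr : ((ρ ^ 2 + τ ^ 2 : ℝ) : ℂ) ≠ 0 := ofReal_ne_zero.2 (hrp τ).ne'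
    refine mul_left_cancel₀ hr ?_
    have h2 := hF τ
    have h3 := hG τ
    have h4 := hc τ
    push_cast at h2 h3 h4 ⊢
    linear_combination 2 * (τ : ℂ) * h2 - 2 * (ρ : ℂ) * h3 - 2 * h4
  set Ψ : ℝ → ℂ := fun τ => (((ρ ^ 2 + τ ^ 2) ^ (2 - σ) : ℝ) : ℂ) * (Y τ * conj (x₁ τ)) with hΨ
  set q : ℝ → ℝ := fun τ => (ρ ^ 2 + τ ^ 2) ^ (1 - σ) * (normSq (Y τ) +
    2 * (m / 2 + σ - 1) * (ρ ^ 2 + τ ^ 2) * normSq (x₁ τ)) with hq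
  have hΨd : ∀ τ, HasDerivAt Ψ (q τ : ℂ) τ := by
    intro τ
    have hf := (hasDerivAt_rpow_sq_add_sq hρ (2 - σ) τ).ofReal_comp
    refine HasDerivAt.congr_deriv (f := Ψ) (hf.mul ((hYd τ).mul (hasDerivAt_conj (hx₁ τ)))) ?_
    simp only [hq]
    rw [e2, show 2 - σ - 1 = 1 - σ by ring]
    push_cast
    rw [← mul_conj, ← mul_conj]
    have h2 := congrArg conj (hF τ)
    simp only [map_add, map_mul, conj_ofReal, map_zero] at h2
    push_cast at h2
    simp only [hY, map_sub, map_mul, conj_ofReal, map_ofNat]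
    linear_combination (((ρ ^ 2 + τ ^ 2) ^ (1 - σ) : ℝ) : ℂ) *
      (2 * ((τ : ℂ) * x₁ τ - (ρ : ℂ) * y₁ τ)) * h2
  have hΦ : ∀ τ, HasDerivAt (fun τ => (Ψ τ).re) (1 * q τ) τ := by
    intro τ
    have := reCLM.hasFDerivAt.comp_hasDerivAt τ (hΨd τ)
    refine HasDerivAt.congr_deriv this ?_
    rw [one_mul, reCLM_apply, ofReal_re]
  have hq0 := eq_zero_of_green hρ one_ne_zero hΦ
    (h := fun τ => 4 * (L + ρ) * L * energyDensity σ ρ y₀ y₁ τ)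
    (fun τ => by
      have := normSq_nonneg (Y τ)
      have := normSq_nonneg (x₁ τ)
      have : 0 < m / 2 + σ - 1 := by linarith
      simp only [hq]; positivity) ((ey.integrable hρ).const_mul _)
    (fun τ => by
      refine (abs_re_le_norm _).trans ?_
      simp only [hΨ, energyDensity, norm_mul, norm_real, norm_conj]
      rw [Real.norm_of_nonneg (by positivity), e2, e1]
      set f := (ρ ^ 2 + τ ^ 2) ^ (-σ) with hf
      have hf0 : 0 ≤ f := by positivity
      have h1 := hxy τ
      have h2 := sqrt_sq_add_sq_le hρ τ
      have h3 := hr2 τ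
      have h4 := hrτ τ
      have h5 := hrρ τ
      set r := √(ρ ^ 2 + τ ^ 2) with hr
      have hr0 : 0 ≤ r := Real.sqrt_nonneg _
      rw [← h3] at h1 ⊢
      set E := r * ‖y₁ τ‖ + ‖y₀ τ‖ with hE
      have hE0 : 0 ≤ E := by positivity
      have h6 : r * ‖Y τ‖ ≤ 2 * (L + ρ) * E := by
        have k1 : ‖Y τ‖ ≤ 2 * (r * ‖x₁ τ‖ + ρ * ‖y₁ τ‖) := by
          simp only [hY]
          rw [norm_mul, norm_ofNat]
          refine mul_le_mul_of_nonneg_left ((norm_sub_le _ _).trans ?_) zero_le_two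
          rw [norm_mul, norm_mul, norm_real, norm_real, Real.norm_of_nonneg hρ.le,
            Real.norm_eq_abs]
          gcongr
        have k2 := mul_le_mul_of_nonneg_left k1 hr0
        have k3 : ρ * (r * ‖y₁ τ‖) ≤ ρ * E :=
          mul_le_mul_of_nonneg_left (by rw [hE]; linarith [norm_nonneg (y₀ τ)]) hρ.le
        nlinarith
      have h7 : (r * ‖Y τ‖) * (r ^ 2 * ‖x₁ τ‖) ≤ (2 * (L + ρ) * E) * (L * E) :=
        mul_le_mul h6 h1 (by positivity) (by positivity)
      have h8 : E ^ 2 ≤ 2 * (r ^ 2 * ‖y₁ τ‖ ^ 2 + ‖y₀ τ‖ ^ 2) := by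
        have := add_norm_sq_le (r * ‖y₁ τ‖) ‖y₀ τ‖
        rwa [mul_pow] at this
      have h9 : (r * ‖Y τ‖) * (r ^ 2 * ‖x₁ τ‖) ≤
          4 * (L + ρ) * L * (r ^ 2 * ‖y₁ τ‖ ^ 2 + ‖y₀ τ‖ ^ 2) := by
        have := mul_le_mul_of_nonneg_left h8 (by positivity : 0 ≤ 2 * (L + ρ) * L)
        nlinarith
      have h10 := mul_le_mul_of_nonneg_left h9 (by positivity : 0 ≤ f * r)
      have h11 : f * r * (4 * (L + ρ) * L * (r ^ 2 * ‖y₁ τ‖ ^ 2 + ‖y₀ τ‖ ^ 2)) ≤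
          f * (ρ + |τ|) * (4 * (L + ρ) * L * (r ^ 2 * ‖y₁ τ‖ ^ 2 + ‖y₀ τ‖ ^ 2)) :=
        mul_le_mul_of_nonneg_right (mul_le_mul_of_nonneg_left h2 hf0) (by positivity)
      refine le_trans (le_of_eq ?_) ((h10.trans h11).trans (le_of_eq ?_)) <;> ring)
  have hg0 : ∀ τ : ℝ, (ρ ^ 2 + τ ^ 2) ^ (1 - σ) ≠ 0 := fun τ =>
    (Real.rpow_pos_of_pos (hrp τ) _).ne'
  have h1 := (mul_eq_zero.1 (hq0 τ)).resolve_left (hg0 τ)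
  have n1 := normSq_nonneg (Y τ)
  have hα1 : 0 < 2 * (m / 2 + σ - 1) * (ρ ^ 2 + τ ^ 2) :=
    mul_pos (by linarith) (hrp τ)
  have n2 := mul_nonneg hα1.le (normSq_nonneg (x₁ τ))
  have z1 : Y τ = 0 := normSq_eq_zero.1 (by linarith)
  have z2 : x₁ τ = 0 := normSq_eq_zero.1
    ((mul_eq_zero.1 (by linarith : 2 * (m / 2 + σ - 1) * (ρ ^ 2 + τ ^ 2) * normSq (x₁ τ) = 0)).resolve_left
      hα1.ne')
  have hρc : (ρ : ℂ) ≠ 0 := ofReal_ne_zero.2 hρ.ne'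
  have z3 : y₁ τ = 0 := by
    simp only [hY, z2, mul_zero, zero_sub] at z1
    simpa [hρc] using z1
  refine ⟨z2, ?_⟩
  have h4 := hc τ
  rw [z2, z3, mul_zero, mul_zero, zero_add] at h4
  have hmc : (m : ℂ) ≠ 0 := ofReal_ne_zero.2 hm.ne'
  simpa [hρc, hmc] using h4.symm

end Kernel

/-! ### Symmetry of the line equations for square integrable data -/

section Symmetry

open Complex ComplexConjugate

lemma rpow_one_sub_eq {ρ : ℝ} (hρ : 0 < ρ) (q τ : ℝ) :
    (ρ ^ 2 + τ ^ 2) ^ (1 + q) = (ρ ^ 2 + τ ^ 2) ^ q * (ρ ^ 2 + τ ^ 2) := by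
  rw [← rpow_sq_add_sq_add_one hρ, add_comm q]

/-- Symmetry of the system for the pairs. -/
lemma integral_pairForm_sub_eq_zero {m σ ρ : ℝ} (hρ : 0 < ρ)
    {x₀ x₁ x₂ y₀ y₁ y₂ p₀ p₁ p₂ q₀ q₁ q₂ F G P Q : ℝ → ℂ}
    (hx₀ : ∀ τ, HasDerivAt x₀ (x₁ τ) τ) (hx₁ : ∀ τ, HasDerivAt x₁ (x₂ τ) τ)
    (hy₀ : ∀ τ, HasDerivAt y₀ (y₁ τ) τ) (hy₁ : ∀ τ, HasDerivAt y₁ (y₂ τ) τ)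
    (hp₀ : ∀ τ, HasDerivAt p₀ (p₁ τ) τ) (hp₁ : ∀ τ, HasDerivAt p₁ (p₂ τ) τ)
    (hq₀ : ∀ τ, HasDerivAt q₀ (q₁ τ) τ) (hq₁ : ∀ τ, HasDerivAt q₁ (q₂ τ) τ)
    (hF : ∀ τ, ((ρ ^ 2 + τ ^ 2 : ℝ) : ℂ) * x₂ τ + (((2 - 2 * σ) * τ : ℝ) : ℂ) * x₁ τ +
      ((2 * ρ : ℝ) : ℂ) * y₁ τ = F τ)
    (hG : ∀ τ, ((ρ ^ 2 + τ ^ 2 : ℝ) : ℂ) * y₂ τ + (((2 - 2 * σ) * τ : ℝ) : ℂ) * y₁ τ -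
      ((2 * ρ : ℝ) : ℂ) * x₁ τ - (m : ℂ) * y₀ τ = G τ)
    (hP : ∀ τ, ((ρ ^ 2 + τ ^ 2 : ℝ) : ℂ) * p₂ τ + (((2 - 2 * σ) * τ : ℝ) : ℂ) * p₁ τ +
      ((2 * ρ : ℝ) : ℂ) * q₁ τ = P τ)
    (hQ : ∀ τ, ((ρ ^ 2 + τ ^ 2 : ℝ) : ℂ) * q₂ τ + (((2 - 2 * σ) * τ : ℝ) : ℂ) * q₁ τ -
      ((2 * ρ : ℝ) : ℂ) * p₁ τ - (m : ℂ) * q₀ τ = Q τ)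
    (ex : EnergyFinite σ ρ x₀ x₁) (ey : EnergyFinite σ ρ y₀ y₁)
    (ep : EnergyFinite (σ - 1) ρ p₀ p₁) (eq : EnergyFinite (σ - 1) ρ q₀ q₁)
    (iF : Integrable fun τ => (ρ ^ 2 + τ ^ 2) ^ (-σ) * ‖F τ‖ ^ 2)
    (iG : Integrable fun τ => (ρ ^ 2 + τ ^ 2) ^ (-σ) * ‖G τ‖ ^ 2)
    (iP : Integrable fun τ => (ρ ^ 2 + τ ^ 2) ^ (-σ) * ‖P τ‖ ^ 2)
    (iQ : Integrable fun τ => (ρ ^ 2 + τ ^ 2) ^ (-σ) * ‖Q τ‖ ^ 2)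
    (ep' : EnergyFinite σ ρ p₀ p₁) (eq' : EnergyFinite σ ρ q₀ q₁) :
    Integrable (fun τ => (((ρ ^ 2 + τ ^ 2) ^ (-σ - 1) : ℝ) : ℂ) *
      (pairForm m σ ρ τ (F τ) (G τ) (p₀ τ) (q₀ τ) -
        pairForm m σ ρ τ (x₀ τ) (y₀ τ) (P τ) (Q τ))) ∧
    ∫ τ, (((ρ ^ 2 + τ ^ 2) ^ (-σ - 1) : ℝ) : ℂ) *
      (pairForm m σ ρ τ (F τ) (G τ) (p₀ τ) (q₀ τ) -
        pairForm m σ ρ τ (x₀ τ) (y₀ τ) (P τ) (Q τ)) = 0 := by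
  set J : ℝ → ℂ := fun τ => pairGreen m σ ρ τ (x₀ τ) (x₁ τ) (y₀ τ) (y₁ τ) (p₀ τ) (p₁ τ) (q₀ τ)
    (q₁ τ) with hJ
  set J' : ℝ → ℂ := fun τ => (((ρ ^ 2 + τ ^ 2) ^ (-σ - 1) : ℝ) : ℂ) *
      (pairForm m σ ρ τ (F τ) (G τ) (p₀ τ) (q₀ τ) -
        pairForm m σ ρ τ (x₀ τ) (y₀ τ) (P τ) (Q τ)) with hJ'
  have hd : ∀ τ, HasDerivAt J (J' τ) τ := fun τ =>
    hasDerivAt_pairGreen hρ (hx₀ τ) (hx₁ τ) (hy₀ τ) (hy₁ τ) (hp₀ τ) (hp₁ τ) (hq₀ τ) (hq₁ τ)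
      (hF τ) (hG τ) (hP τ) (hQ τ)
  have hJc : Continuous J := continuous_iff_continuousAt.2 fun τ => (hd τ).continuousAt
  have hJm : AEStronglyMeasurable J' volume := by
    have : J' = deriv J := funext fun τ => (hd τ).deriv.symm
    rw [this]
    exact aestronglyMeasurable_deriv J _
  have key : ∀ a b c d : ℝ, (a + b) * (c + d) ≤ a ^ 2 + b ^ 2 + (c ^ 2 + d ^ 2) := by
    intro a b c d
    nlinarith [sq_nonneg (a - c), sq_nonneg (a - d), sq_nonneg (b - c), sq_nonneg (b - d)]
  -- The pair (p, q) has finite energy also for σ - 1, that is with one more power of r². This makes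
  -- the boundary form itself integrable, so the integral of its derivative is zero.
  have iJ : Integrable J := by
    set K := |m / 2 - σ| + |m / 2 + σ| + |σ| + |m| with hK
    have hK0 : 0 ≤ K := by positivity
    refine ((((((ex.integrable hρ).add (ey.integrable hρ)).add
      ((ep.integrable hρ).add (eq.integrable hρ))).add
      ((ep'.fn.add eq'.fn).const_mul (ρ ^ 2))).add (ex.fn.add ey.fn)).const_mul K).mono'
      hJc.aestronglyMeasurable (Filter.Eventually.of_forall fun τ => ?_)
    refine (norm_pairGreen_le hρ _ _ _ _ _ _ _ _).trans ?_
    rw [← hK]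
    refine mul_le_mul_of_nonneg_left ?_ hK0
    have e1 : (ρ ^ 2 + τ ^ 2) ^ (-(σ - 1)) = (ρ ^ 2 + τ ^ 2) ^ (-σ) * (ρ ^ 2 + τ ^ 2) := by
      rw [← rpow_one_sub_eq hρ]; congr 1; ring
    simp only [Pi.add_apply, energyDensity, e1]
    set f := (ρ ^ 2 + τ ^ 2) ^ (-σ) with hf
    have hf0 : 0 ≤ f := by positivity
    have k1 := mul_le_mul_of_nonneg_left (key ‖x₁ τ‖ ‖y₁ τ‖ ‖p₀ τ‖ ‖q₀ τ‖)
      (by positivity : 0 ≤ f * (ρ ^ 2 + τ ^ 2))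
    have k2 := mul_le_mul_of_nonneg_left (key ‖x₀ τ‖ ‖y₀ τ‖ ((ρ ^ 2 + τ ^ 2) * ‖p₁ τ‖)
      ((ρ ^ 2 + τ ^ 2) * ‖q₁ τ‖)) hf0
    have k3 := mul_le_mul_of_nonneg_left (key ‖x₀ τ‖ ‖y₀ τ‖ (ρ * ‖p₀ τ‖) (ρ * ‖q₀ τ‖)) hf0
    simp only [mul_pow] at k1 k2 k3
    linarith
  have iJ' : Integrable J' := by
    set K := |m / 2 - σ| + |m / 2 + σ| + |σ| with hK
    have hK0 : 0 ≤ K := by positivity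
    refine ((((iF.add iG).add (ep'.fn.add eq'.fn)).add
      ((ex.fn.add ey.fn).add (iP.add iQ))).const_mul K).mono' hJm
      (Filter.Eventually.of_forall fun τ => ?_)
    have e : (ρ ^ 2 + τ ^ 2) ^ (-σ) = (ρ ^ 2 + τ ^ 2) ^ (-σ - 1) * (ρ ^ 2 + τ ^ 2) := by
      rw [← rpow_sq_add_sq_add_one hρ]; congr 1; ring
    simp only [hJ', Pi.add_apply, e, norm_mul, norm_real]
    rw [Real.norm_of_nonneg (by positivity)]
    have k1 := norm_pairForm_le (m := m) (σ := σ) (ρ := ρ) (τ := τ) (F τ) (G τ) (p₀ τ) (q₀ τ)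
    have k2 := norm_pairForm_le (m := m) (σ := σ) (ρ := ρ) (τ := τ) (x₀ τ) (y₀ τ) (P τ) (Q τ)
    rw [← hK] at k1 k2
    set g := (ρ ^ 2 + τ ^ 2) ^ (-σ - 1) with hg
    have hg0 : 0 ≤ g := by positivity
    have hc : 0 ≤ K * (ρ ^ 2 + τ ^ 2) := by positivity
    have k3 := (norm_sub_le _ _).trans (add_le_add
      (k1.trans (mul_le_mul_of_nonneg_left (key ‖F τ‖ ‖G τ‖ ‖p₀ τ‖ ‖q₀ τ‖) hc))
      (k2.trans (mul_le_mul_of_nonneg_left (key ‖x₀ τ‖ ‖y₀ τ‖ ‖P τ‖ ‖Q τ‖) hc)))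
    refine (mul_le_mul_of_nonneg_left k3 hg0).trans (le_of_eq ?_)
    ring
  exact ⟨iJ', integral_eq_zero_of_hasDerivAt_of_integrable hd iJ' iJ⟩

/-- Symmetry of the scalar equations. -/
lemma integral_scalar_sub_eq_zero {σ ρ : ℝ} (hρ : 0 < ρ)
    {w₀ w₁ w₂ q₀ q₁ q₂ F Q : ℝ → ℂ}
    (hw₀ : ∀ τ, HasDerivAt w₀ (w₁ τ) τ) (hw₁ : ∀ τ, HasDerivAt w₁ (w₂ τ) τ)
    (hq₀ : ∀ τ, HasDerivAt q₀ (q₁ τ) τ) (hq₁ : ∀ τ, HasDerivAt q₁ (q₂ τ) τ)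
    (μ : ℝ)
    (hF : ∀ τ, ((ρ ^ 2 + τ ^ 2 : ℝ) : ℂ) * w₂ τ + (((2 - 2 * σ) * τ : ℝ) : ℂ) * w₁ τ -
      (μ : ℂ) * w₀ τ = F τ)
    (hQ : ∀ τ, ((ρ ^ 2 + τ ^ 2 : ℝ) : ℂ) * q₂ τ + (((2 - 2 * σ) * τ : ℝ) : ℂ) * q₁ τ -
      (μ : ℂ) * q₀ τ = Q τ)
    (ew : EnergyFinite σ ρ w₀ w₁) (eq : EnergyFinite (σ - 1) ρ q₀ q₁)
    (iF : Integrable fun τ => (ρ ^ 2 + τ ^ 2) ^ (-σ) * ‖F τ‖ ^ 2)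
    (iQ : Integrable fun τ => (ρ ^ 2 + τ ^ 2) ^ (-σ) * ‖Q τ‖ ^ 2)
    (eq' : EnergyFinite σ ρ q₀ q₁) :
    Integrable (fun τ => (((ρ ^ 2 + τ ^ 2) ^ (-σ) : ℝ) : ℂ) * (F τ * q₀ τ - w₀ τ * Q τ)) ∧
    ∫ τ, (((ρ ^ 2 + τ ^ 2) ^ (-σ) : ℝ) : ℂ) * (F τ * q₀ τ - w₀ τ * Q τ) = 0 := by
  set J : ℝ → ℂ := fun τ => (((ρ ^ 2 + τ ^ 2) ^ (1 - σ) : ℝ) : ℂ) *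
    (w₁ τ * q₀ τ - w₀ τ * q₁ τ) with hJ
  set J' : ℝ → ℂ := fun τ => (((ρ ^ 2 + τ ^ 2) ^ (-σ) : ℝ) : ℂ) * (F τ * q₀ τ - w₀ τ * Q τ) with hJ'
  have hd : ∀ τ, HasDerivAt J (J' τ) τ := fun τ => by
    refine (hasDerivAt_scalarGreen hρ (hw₀ τ) (hw₁ τ) (hq₀ τ) (hq₁ τ) (F := F τ + μ * w₀ τ)
      (Q := Q τ + μ * q₀ τ) (by rw [← hF τ]; ring) (by rw [← hQ τ]; ring)).congr_deriv ?_
    simp only [hJ']; ring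
  have hJc : Continuous J := continuous_iff_continuousAt.2 fun τ => (hd τ).continuousAt
  have hJm : AEStronglyMeasurable J' volume := by
    have : J' = deriv J := funext fun τ => (hd τ).deriv.symm
    rw [this]
    exact aestronglyMeasurable_deriv J _
  have key : ∀ a b : ℝ, a * b ≤ a ^ 2 + b ^ 2 := by
    intro a b
    nlinarith [sq_nonneg (a - b), sq_nonneg a, sq_nonneg b]
  have iJ : Integrable J := by
    refine ((ew.integrable hρ).add (eq.integrable hρ)).mono'
      hJc.aestronglyMeasurable (Filter.Eventually.of_forall fun τ => ?_)
    have e1 : (ρ ^ 2 + τ ^ 2) ^ (-(σ - 1)) = (ρ ^ 2 + τ ^ 2) ^ (-σ) * (ρ ^ 2 + τ ^ 2) := by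
      rw [← rpow_one_sub_eq hρ]; congr 1; ring
    have e2 : (ρ ^ 2 + τ ^ 2) ^ (1 - σ) = (ρ ^ 2 + τ ^ 2) ^ (-σ) * (ρ ^ 2 + τ ^ 2) := by
      rw [← rpow_one_sub_eq hρ]; congr 1
    simp only [hJ, Pi.add_apply, energyDensity, e1, e2]
    rw [norm_mul, norm_real, Real.norm_of_nonneg (by positivity)]
    set f := (ρ ^ 2 + τ ^ 2) ^ (-σ) with hf
    have hf0 : 0 ≤ f := by positivity
    have k0 := norm_sub_le (w₁ τ * q₀ τ) (w₀ τ * q₁ τ)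
    rw [norm_mul, norm_mul] at k0
    have k1 := mul_le_mul_of_nonneg_left (key ‖w₁ τ‖ ‖q₀ τ‖)
      (by positivity : 0 ≤ f * (ρ ^ 2 + τ ^ 2))
    have k2 := mul_le_mul_of_nonneg_left (key ‖w₀ τ‖ ((ρ ^ 2 + τ ^ 2) * ‖q₁ τ‖)) hf0
    have k3 := mul_le_mul_of_nonneg_left k0 (by positivity : 0 ≤ f * (ρ ^ 2 + τ ^ 2))
    rw [mul_pow] at k2
    linarith
  have iJ' : Integrable J' := by
    refine ((iF.add eq'.fn).add (ew.fn.add iQ)).mono' hJm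
      (Filter.Eventually.of_forall fun τ => ?_)
    simp only [hJ', Pi.add_apply, norm_mul, norm_real]
    rw [Real.norm_of_nonneg (by positivity)]
    set g := (ρ ^ 2 + τ ^ 2) ^ (-σ) with hg
    have hg0 : 0 ≤ g := by positivity
    have k0 := norm_sub_le (F τ * q₀ τ) (w₀ τ * Q τ)
    rw [norm_mul, norm_mul] at k0
    have k3 := k0.trans (add_le_add (key ‖F τ‖ ‖q₀ τ‖) (key ‖w₀ τ‖ ‖Q τ‖))
    refine (mul_le_mul_of_nonneg_left k3 hg0).trans (le_of_eq ?_)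
    ring
  exact ⟨iJ', integral_eq_zero_of_hasDerivAt_of_integrable hd iJ' iJ⟩

end Symmetry

/-! ### Exterior algebra split by two orthonormal vectors -/

section Exterior

variable {n : ℕ}

lemma inner_intMul (j : Fin n) (v w : Ext n) :
    inner ℂ (intMul j v) w = inner ℂ v (extMul j w) := by
  rw [← inner_conj_symm, ← inner_extMul, inner_conj_symm]

lemma inner_intVec (x : Space n) (v w : Ext n) :
    inner ℂ (intVec x v) w = inner ℂ v (extVec x w) := by
  rw [← inner_conj_symm, ← inner_extVec, inner_conj_symm]

lemma extMul_extMul (j k : Fin n) (v : Ext n) :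
    extMul j (extMul k v) = -extMul k (extMul j v) := by
  ext J
  simp only [extMul_apply, PiLp.neg_apply]
  by_cases hjk : j = k
  · subst hjk; simp
  have hkj : k ≠ j := fun h => hjk h.symm
  by_cases hj : j ∈ J
  · by_cases hk : k ∈ J
    · obtain ⟨I, hkI, rfl⟩ : ∃ I, k ∉ I ∧ J = insert k I :=
        ⟨J.erase k, by simp, by simp [hk]⟩
      obtain ⟨I', hjI, rfl⟩ : ∃ I', j ∉ I' ∧ I = insert j I' :=
        ⟨I.erase j, by simp, (Finset.insert_erase (by simpa [hjk] using hj)).symm⟩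
      have hkI' : k ∉ I' := fun h => hkI (by simp [h])
      have e1 : (insert k (insert j I')).erase j = insert k I' := by
        rw [Finset.insert_comm, Finset.erase_insert (by simp [hjI, hjk])]
      have e2 : (insert k (insert j I')).erase k = insert j I' := Finset.erase_insert hkI
      have s1 : sgn j (insert k (insert j I')) = (if k < j then -1 else 1) * sgn j I' := by
        rw [sgn_insert j k hkI, sgn_insert j j hjI]; simp
      have s2 : sgn k (insert k (insert j I')) = (if j < k then -1 else 1) * sgn k I' := by
        rw [sgn_insert k k hkI, sgn_insert k j hjI]; simp
      have s3 : sgn k (insert k I') = sgn k I' := by rw [sgn_insert k k hkI']; simp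
      have s4 : sgn j (insert j I') = sgn j I' := by rw [sgn_insert j j hjI]; simp
      rw [e1, e2, s1, s2, s3, s4]
      rcases lt_or_gt_of_ne hjk with h | h
      · simp [h, h.not_gt, hjI, hkI', hjk, hkj]; ring
      · simp [h, h.not_gt, hjI, hkI', hjk, hkj]; ring
    · simp [hk]
  · simp [hj]

lemma intMul_intMul (j k : Fin n) (v : Ext n) :
    intMul j (intMul k v) = -intMul k (intMul j v) := by
  refine ext_inner_right ℂ fun w => ?_
  rw [inner_neg_left, inner_intMul, inner_intMul, inner_intMul, inner_intMul, extMul_extMul,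
    inner_neg_right]

lemma extVec_eq_sum (x : Space n) (v : Ext n) : extVec x v = ∑ k, (x k : ℂ) • extMul k v := by
  simp [extVec]

lemma eq_zero_of_eq_neg_self {v : Ext n} (h : v = -v) : v = 0 := by
  have h2 : v + v = 0 := by
    nth_rw 1 [h]
    exact neg_add_cancel v
  rw [← two_smul ℂ] at h2
  simpa using h2

lemma extVec_extMul (x : Space n) (j : Fin n) (v : Ext n) :
    extVec x (extMul j v) = -extMul j (extVec x v) := by
  simp only [extVec, _root_.sum_apply, _root_.smul_apply, map_sum, map_smul]
  rw [← Finset.sum_neg_distrib]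
  exact Finset.sum_congr rfl fun k _ => by rw [extMul_extMul, smul_neg]

lemma intVec_intMul (x : Space n) (j : Fin n) (v : Ext n) :
    intVec x (intMul j v) = -intMul j (intVec x v) := by
  simp only [intVec, _root_.sum_apply, _root_.smul_apply, map_sum, map_smul]
  rw [← Finset.sum_neg_distrib]
  exact Finset.sum_congr rfl fun k _ => by rw [intMul_intMul, smul_neg]

lemma extVec_extVec (x : Space n) (v : Ext n) : extVec x (extVec x v) = 0 := by
  have h : extVec x (extVec x v) = -extVec x (extVec x v) := by
    conv_lhs => rw [extVec_eq_sum x (extVec x v)]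
    conv_rhs => rw [extVec_eq_sum x v]
    simp only [map_sum, map_smul]
    rw [← Finset.sum_neg_distrib]
    refine Finset.sum_congr rfl fun k _ => ?_
    rw [extVec_extMul, smul_neg, neg_neg]
  exact eq_zero_of_eq_neg_self h

lemma intVec_intVec (x : Space n) (v : Ext n) : intVec x (intVec x v) = 0 := by
  refine ext_inner_right ℂ fun w => ?_
  rw [inner_intVec, inner_intVec, extVec_extVec, inner_zero_right, inner_zero_left]

lemma intMul_extVec (x : Space n) (j : Fin n) (v : Ext n) :
    intMul j (extVec x v) + extVec x (intMul j v) = (x j : ℂ) • v := by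
  simp only [extVec, _root_.sum_apply, _root_.smul_apply, map_sum, map_smul]
  rw [← Finset.sum_add_distrib]
  simp only [← smul_add, clifford, smul_ite, smul_zero, Finset.sum_ite_eq, Finset.mem_univ, if_true]

lemma intVec_extMul (x : Space n) (j : Fin n) (v : Ext n) :
    intVec x (extMul j v) + extMul j (intVec x v) = (x j : ℂ) • v := by
  simp only [intVec, _root_.sum_apply, _root_.smul_apply, map_sum, map_smul]
  rw [← Finset.sum_add_distrib]
  simp only [← smul_add, clifford, smul_ite, smul_zero, Finset.sum_ite_eq', Finset.mem_univ, if_true]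

/-- The four components of a form with respect to the unit vectors `e` and `e_j`, `e ⊥ e_j`. -/
def comp00 (e : Space n) (j : Fin n) : Ext n →L[ℂ] Ext n :=
  intVec e ∘L extVec e ∘L intMul j ∘L extMul j

/-- The component along `e`. -/
def comp10 (e : Space n) (j : Fin n) : Ext n →L[ℂ] Ext n :=
  intVec e ∘L intMul j ∘L extMul j

/-- The component along `e_j`. -/
def comp01 (e : Space n) (j : Fin n) : Ext n →L[ℂ] Ext n :=
  intVec e ∘L extVec e ∘L intMul j

/-- The component along `e ∧ e_j`. -/
def comp11 (e : Space n) (j : Fin n) : Ext n →L[ℂ] Ext n :=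
  intMul j ∘L intVec e

variable {e : Space n} {j : Fin n} (he : ‖e‖ = 1) (hj : e j = 0)

include he in
lemma int_ext_unit (v : Ext n) : intVec e (extVec e v) = v - extVec e (intVec e v) := by
  have := intVec_extVec e v
  rw [he] at this
  rw [eq_sub_iff_add_eq, this]; simp

lemma int_ext_mul (j : Fin n) (v : Ext n) :
    intMul j (extMul j v) = v - extMul j (intMul j v) := by
  have := clifford j j v
  rw [if_pos rfl] at this
  rw [eq_sub_iff_add_eq, this]

lemma extMul_extMul_self (j : Fin n) (v : Ext n) : extMul j (extMul j v) = 0 :=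
  eq_zero_of_eq_neg_self (extMul_extMul j j v)

lemma intMul_intMul_self (j : Fin n) (v : Ext n) : intMul j (intMul j v) = 0 :=
  eq_zero_of_eq_neg_self (intMul_intMul j j v)

include hj in
lemma int_extVec_comm (v : Ext n) : intMul j (extVec e v) = -extVec e (intMul j v) := by
  have := intMul_extVec e j v
  rw [hj] at this
  exact eq_neg_of_add_eq_zero_left (by simpa using this)

include hj in
lemma intVec_extMul_comm (v : Ext n) : intVec e (extMul j v) = -extMul j (intVec e v) := by
  have := intVec_extMul e j v
  rw [hj] at this
  exact eq_neg_of_add_eq_zero_left (by simpa using this)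

-- Because e is orthogonal to e_j, operators belonging to different vectors anticommute, and
-- `comp_extVec`, `comp_extMul`, `comp_intVec` and `comp_intMul` form a table of constant matrices
-- on the four components. The signs in the rows for e_j come from moving it past e.
include he hj in
lemma comp_extVec (v : Ext n) : comp00 e j (extVec e v) = 0 ∧
    comp10 e j (extVec e v) = comp00 e j v ∧ comp01 e j (extVec e v) = 0 ∧
    comp11 e j (extVec e v) = comp01 e j v := by
  simp only [comp00, comp10, comp01, comp11, ContinuousLinearMap.comp_apply]
  simp only [int_extVec_comm hj, intVec_extMul_comm hj, extVec_extMul, intVec_intMul,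
    extVec_extVec, intVec_intVec, extMul_extMul_self, intMul_intMul_self, int_ext_unit he,
    int_ext_mul, map_neg, map_sub, map_zero, neg_neg, neg_zero, sub_zero, and_true, true_and]

include he hj in
lemma comp_extMul (v : Ext n) : comp00 e j (extMul j v) = 0 ∧
    comp10 e j (extMul j v) = 0 ∧ comp01 e j (extMul j v) = comp00 e j v ∧
    comp11 e j (extMul j v) = -comp10 e j v := by
  simp only [comp00, comp10, comp01, comp11, ContinuousLinearMap.comp_apply]
  simp [int_extVec_comm hj, intVec_extMul_comm hj, extVec_extMul, intVec_intMul,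
    extVec_extVec, intVec_intVec, extMul_extMul_self, intMul_intMul_self]

include he hj in
lemma comp_intVec (v : Ext n) : comp00 e j (intVec e v) = comp10 e j v ∧
    comp10 e j (intVec e v) = 0 ∧ comp01 e j (intVec e v) = comp11 e j v ∧
    comp11 e j (intVec e v) = 0 := by
  simp only [comp00, comp10, comp01, comp11, ContinuousLinearMap.comp_apply]
  simp [int_extVec_comm hj, intVec_extMul_comm hj, extVec_extMul, intVec_intMul,
    extVec_extVec, intVec_intVec, extMul_extMul_self, intMul_intMul_self, int_ext_unit he,
    int_ext_mul]
  exact (sub_eq_add_neg _ _).symm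

include he hj in
lemma comp_intMul (v : Ext n) : comp00 e j (intMul j v) = comp01 e j v ∧
    comp10 e j (intMul j v) = -comp11 e j v ∧ comp01 e j (intMul j v) = 0 ∧
    comp11 e j (intMul j v) = 0 := by
  simp only [comp00, comp10, comp01, comp11, ContinuousLinearMap.comp_apply]
  simp [int_extVec_comm hj, intVec_extMul_comm hj, extVec_extMul, intVec_intMul,
    extVec_extVec, intVec_intVec, extMul_extMul_self, intMul_intMul_self, int_ext_unit he,
    int_ext_mul]

include he hj in
/-- The decomposition into the four components is orthogonal. -/
lemma inner_comp (v w : Ext n) : inner ℂ v w =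
    inner ℂ (comp00 e j v) (comp00 e j w) + inner ℂ (comp10 e j v) (comp10 e j w) +
      inner ℂ (comp01 e j v) (comp01 e j w) + inner ℂ (comp11 e j v) (comp11 e j w) := by
  have h1 : ∀ v w : Ext n, inner ℂ v w = inner ℂ (intVec e (extVec e v)) (intVec e (extVec e w)) +
      inner ℂ (intVec e v) (intVec e w) := by
    intro v w
    rw [inner_intVec, inner_extVec, int_ext_unit he (intVec e (extVec e w)), intVec_intVec,
      map_zero, sub_zero, inner_intVec e v, int_ext_unit he w, inner_sub_right, sub_add_cancel]
  have h2 : ∀ v w : Ext n, inner ℂ v w = inner ℂ (intMul j (extMul j v)) (intMul j (extMul j w)) +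
      inner ℂ (intMul j v) (intMul j w) := by
    intro v w
    rw [inner_intMul, inner_extMul, int_ext_mul j (intMul j (extMul j w)), intMul_intMul_self,
      map_zero, sub_zero, inner_intMul j v, int_ext_mul j w, inner_sub_right, sub_add_cancel]
  rw [h1 v w, h2 (intVec e (extVec e v)), h2 (intVec e v)]
  have h3 : ∀ v : Ext n, extVec e (intMul j v) = -intMul j (extVec e v) := fun v => by
    rw [int_extVec_comm hj, neg_neg]
  simp only [comp00, comp10, comp01, comp11, ContinuousLinearMap.comp_apply]
  simp only [h3, intVec_extMul_comm hj, extVec_extMul, intVec_intMul, map_neg, neg_neg,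
    inner_neg_neg]
  ring

end Exterior

/-! ### The operators B and N and the symbol in components -/

section Fiber

open Complex ComplexConjugate

variable {d p : ℕ}

/-- The point `(x', t)` of `ℝ^{d+1}`. -/
def lift (x : Space d) (t : ℝ) : Space (d + 1) := WithLp.toLp 2 (Fin.snoc (α := fun _ => ℝ) x t)

@[simp] lemma lift_castSucc (x : Space d) (t : ℝ) (i : Fin d) : lift x t i.castSucc = x i := by
  simp [lift]

@[simp] lemma lift_last (x : Space d) (t : ℝ) : lift x t (Fin.last d) = t := by
  simp [lift]

lemma norm_lift_sq (x : Space d) (t : ℝ) : ‖lift x t‖ ^ 2 = ‖x‖ ^ 2 + t ^ 2 := by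
  rw [EuclideanSpace.real_norm_sq_eq, EuclideanSpace.real_norm_sq_eq, Fin.sum_univ_castSucc]
  simp

lemma extVec_lift (x : Space d) (t : ℝ) :
    extVec (lift x t) = extVec (lift x 0) + (t : ℂ) • extMul (Fin.last d) := by
  refine ContinuousLinearMap.ext fun v => ?_
  simp only [extVec, Fin.sum_univ_castSucc, lift_castSucc, lift_last, ofReal_zero,
    _root_.add_apply, _root_.sum_apply, _root_.smul_apply, zero_smul, add_zero]

lemma intVec_lift (x : Space d) (t : ℝ) :
    intVec (lift x t) = intVec (lift x 0) + (t : ℂ) • intMul (Fin.last d) := by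
  refine ContinuousLinearMap.ext fun v => ?_
  simp only [intVec, Fin.sum_univ_castSucc, lift_castSucc, lift_last, ofReal_zero,
    _root_.add_apply, _root_.sum_apply, _root_.smul_apply, zero_smul, add_zero]

lemma extVec_smul {n : ℕ} (c : ℝ) (x : Space n) : extVec (c • x) = (c : ℂ) • extVec x := by
  simp [extVec, Finset.smul_sum, smul_smul]

lemma intVec_smul {n : ℕ} (c : ℝ) (x : Space n) : intVec (c • x) = (c : ℂ) • intVec x := by
  simp [intVec, Finset.smul_sum, smul_smul]

lemma proj_incl {n : ℕ} (v : Form n p) : proj n p (incl n p v) = v := by ext I; simp [I.2]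

lemma inner_eq_inner_incl {n : ℕ} (v w : Form n p) :
    inner ℂ v w = inner ℂ (incl n p v) (incl n p w) := by
  rw [inner_incl, proj_incl]

/-- A contraction after an exterior multiplication preserves the degree, so nothing is lost by
projecting. This allows all identities for p-forms to be checked in the full exterior algebra. -/
lemma incl_proj_intMul_extMul {n : ℕ} (j k : Fin n) (v : Form n p) :
    incl n p (proj n p (intMul j (extMul k (incl n p v)))) = intMul j (extMul k (incl n p v)) := by
  ext J
  rw [incl_apply]
  split_ifs with h
  · rfl
  · rw [intMul_apply, extMul_apply, incl_apply]
    split_ifs with h1 h2 h3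
    · rfl
    · exfalso
      rw [Finset.card_erase_of_mem h2, Finset.card_insert_of_notMem h1] at h3
      exact h h3
    · simp
    · simp

lemma incl_proj_extMul_intMul {n : ℕ} (j k : Fin n) (v : Form n p) :
    incl n p (proj n p (extMul j (intMul k (incl n p v)))) = extMul j (intMul k (incl n p v)) := by
  ext J
  rw [incl_apply]
  split_ifs with h
  · rfl
  · rw [extMul_apply, intMul_apply, incl_apply]
    split_ifs with h1 h2 h3
    · simp
    · exfalso
      rw [Finset.card_insert_of_notMem h2, Finset.card_erase_add_one h1] at h3
      exact h h3
    · simp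
    · rfl

/-- The operator `i_{e_n} ε_{x'} + ε_{e_n} i_{x'}` on `p`-forms. -/
def bOp (p : ℕ) (x : Space d) : Form (d + 1) p →L[ℂ] Form (d + 1) p :=
  proj (d + 1) p ∘L (intMul (Fin.last d) ∘L extVec (lift x 0) +
    extMul (Fin.last d) ∘L intVec (lift x 0)) ∘L incl (d + 1) p

/-- The operator `ε_{e_n} i_{e_n}` on `p`-forms. -/
def nOp (d p : ℕ) : Form (d + 1) p →L[ℂ] Form (d + 1) p :=
  proj (d + 1) p ∘L (extMul (Fin.last d) ∘L intMul (Fin.last d)) ∘L incl (d + 1) p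

lemma incl_nOp (v : Form (d + 1) p) : incl (d + 1) p (nOp d p v) =
    extMul (Fin.last d) (intMul (Fin.last d) (incl (d + 1) p v)) := by
  simp only [nOp, ContinuousLinearMap.comp_apply, incl_proj_extMul_intMul]

lemma incl_bOp (x : Space d) (v : Form (d + 1) p) : incl (d + 1) p (bOp p x v) =
    intMul (Fin.last d) (extVec (lift x 0) (incl (d + 1) p v)) +
      extMul (Fin.last d) (intVec (lift x 0) (incl (d + 1) p v)) := by
  simp only [bOp, extVec, intVec, ContinuousLinearMap.comp_apply, _root_.add_apply,
    _root_.sum_apply, _root_.smul_apply, map_add, map_sum, map_smul, incl_proj_extMul_intMul,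
    incl_proj_intMul_extMul]

/-- The unit vector in the direction of `(x', 0)`. -/
def dir (x : Space d) : Space (d + 1) := ‖x‖⁻¹ • lift x 0

lemma norm_dir {x : Space d} (hx : x ≠ 0) : ‖dir x‖ = 1 := by
  have h : ‖lift x 0‖ = ‖x‖ := by
    have := norm_lift_sq x 0
    rw [zero_pow two_ne_zero, add_zero] at this
    exact (sq_eq_sq₀ (norm_nonneg _) (norm_nonneg _)).1 this
  rw [dir, norm_smul, norm_inv, norm_norm, h, inv_mul_cancel₀ (norm_ne_zero_iff.2 hx)]

lemma dir_last (x : Space d) : dir x (Fin.last d) = 0 := by simp [dir]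

lemma lift_zero_eq {x : Space d} (hx : x ≠ 0) : lift x 0 = ‖x‖ • dir x := by
  rw [dir, smul_smul, mul_inv_cancel₀ (norm_ne_zero_iff.2 hx), one_smul]

variable {x : Space d} (hx : x ≠ 0)

/-- The components of a `p`-form with respect to `x' / |x'|` and `e_n`. -/
def c00 (p : ℕ) (x : Space d) : Form (d + 1) p →L[ℂ] Ext (d + 1) :=
  comp00 (dir x) (Fin.last d) ∘L incl (d + 1) p

/-- The component along `x'`. -/
def c10 (p : ℕ) (x : Space d) : Form (d + 1) p →L[ℂ] Ext (d + 1) :=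
  comp10 (dir x) (Fin.last d) ∘L incl (d + 1) p

/-- The component along `e_n`. -/
def c01 (p : ℕ) (x : Space d) : Form (d + 1) p →L[ℂ] Ext (d + 1) :=
  comp01 (dir x) (Fin.last d) ∘L incl (d + 1) p

/-- The component along `x' ∧ e_n`. -/
def c11 (p : ℕ) (x : Space d) : Form (d + 1) p →L[ℂ] Ext (d + 1) :=
  comp11 (dir x) (Fin.last d) ∘L incl (d + 1) p

include hx in
lemma inner_components (v w : Form (d + 1) p) : inner ℂ v w =
    inner ℂ (c00 p x v) (c00 p x w) + inner ℂ (c10 p x v) (c10 p x w) +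
      inner ℂ (c01 p x v) (c01 p x w) + inner ℂ (c11 p x v) (c11 p x w) := by
  rw [inner_eq_inner_incl, inner_comp (norm_dir hx) (dir_last x)]
  rfl

include hx in
lemma norm_sq_components (v : Form (d + 1) p) : ‖v‖ ^ 2 =
    ‖c00 p x v‖ ^ 2 + ‖c10 p x v‖ ^ 2 + ‖c01 p x v‖ ^ 2 + ‖c11 p x v‖ ^ 2 := by
  have := inner_components hx v v
  simp only [inner_self_eq_norm_sq_to_K] at this
  exact_mod_cast this

-- On the pair of components along x/|x| and along e_n, B is |x| times a quarter turn, and it kills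
-- the other two. This is the source of the 2 × 2 system in the line equation.
include hx in
lemma components_bOp (v : Form (d + 1) p) : c00 p x (bOp p x v) = 0 ∧
    c10 p x (bOp p x v) = -(‖x‖ : ℂ) • c01 p x v ∧ c01 p x (bOp p x v) = (‖x‖ : ℂ) • c10 p x v ∧
    c11 p x (bOp p x v) = 0 := by
  have he := norm_dir hx
  have hj := dir_last x
  simp only [c00, c10, c01, c11, ContinuousLinearMap.comp_apply, incl_bOp, lift_zero_eq hx,
    extVec_smul, intVec_smul, _root_.smul_apply, map_smul, map_add, (comp_intMul he hj _).1,
    (comp_intMul he hj _).2.1, (comp_intMul he hj _).2.2.1, (comp_intMul he hj _).2.2.2,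
    (comp_extMul he hj _).1, (comp_extMul he hj _).2.1, (comp_extMul he hj _).2.2.1,
    (comp_extMul he hj _).2.2.2, (comp_extVec he hj _).1, (comp_extVec he hj _).2.1,
    (comp_extVec he hj _).2.2.1, (comp_extVec he hj _).2.2.2, (comp_intVec he hj _).1,
    (comp_intVec he hj _).2.1, (comp_intVec he hj _).2.2.1, (comp_intVec he hj _).2.2.2]
  simp

include hx in
lemma components_nOp (v : Form (d + 1) p) : c00 p x (nOp d p v) = 0 ∧
    c10 p x (nOp d p v) = 0 ∧ c01 p x (nOp d p v) = c01 p x v ∧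
    c11 p x (nOp d p v) = c11 p x v := by
  have he := norm_dir hx
  have hj := dir_last x
  simp only [c00, c10, c01, c11, ContinuousLinearMap.comp_apply, incl_nOp, (comp_intMul he hj _).1,
    (comp_intMul he hj _).2.1,
    (comp_extMul he hj _).1, (comp_extMul he hj _).2.1, (comp_extMul he hj _).2.2.1,
    (comp_extMul he hj _).2.2.2]
  simp

include hx in
lemma norm_bOp_le (v : Form (d + 1) p) : ‖bOp p x v‖ ≤ ‖x‖ * ‖v‖ := by
  refine (sq_le_sq₀ (norm_nonneg _) (by positivity)).1 ?_
  rw [mul_pow, norm_sq_components hx v, norm_sq_components hx (bOp p x v)]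
  obtain ⟨h1, h2, h3, h4⟩ := components_bOp hx v
  rw [h1, h2, h3, h4, norm_smul, norm_smul, norm_neg, norm_real, norm_norm, norm_zero]
  nlinarith [mul_nonneg (sq_nonneg ‖x‖) (sq_nonneg ‖c00 p x v‖),
    mul_nonneg (sq_nonneg ‖x‖) (sq_nonneg ‖c11 p x v‖)]

include hx in
lemma eq_zero_of_components {v : Form (d + 1) p} (h0 : c00 p x v = 0) (h1 : c10 p x v = 0)
    (h2 : c01 p x v = 0) (h3 : c11 p x v = 0) : v = 0 := by
  have := norm_sq_components hx v
  rw [h0, h1, h2, h3] at this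
  simpa using this

lemma norm_coord_le {n : ℕ} (v : Ext n) (I : Finset (Fin n)) : ‖v I‖ ≤ ‖v‖ := PiLp.norm_apply_le v I

include hx in
lemma norm_components_le (v : Form (d + 1) p) (I : Finset (Fin (d + 1))) :
    ‖c00 p x v I‖ ≤ ‖v‖ ∧ ‖c10 p x v I‖ ≤ ‖v‖ ∧ ‖c01 p x v I‖ ≤ ‖v‖ ∧ ‖c11 p x v I‖ ≤ ‖v‖ := by
  have h := norm_sq_components hx v
  have n0 := sq_nonneg ‖c00 p x v‖
  have n1 := sq_nonneg ‖c10 p x v‖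
  have n2 := sq_nonneg ‖c01 p x v‖
  have n3 := sq_nonneg ‖c11 p x v‖
  refine ⟨(norm_coord_le _ I).trans ?_, (norm_coord_le _ I).trans ?_, (norm_coord_le _ I).trans ?_,
    (norm_coord_le _ I).trans ?_⟩ <;>
  · refine (sq_le_sq₀ (norm_nonneg _) (norm_nonneg _)).1 ?_
    linarith

include hx in
/-- The symbol in terms of the components. -/
lemma inner_symbol_components {m σ : ℝ} (hm : m = ((d + 1 : ℕ) : ℝ) - 2 * p) (t : ℝ)
    (v w : Form (d + 1) p) :
    ((‖x‖ ^ 2 + t ^ 2 : ℝ) : ℂ) * inner ℂ (symbol (d + 1) p (-σ) (lift x t) v) w =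
      ∑ I, (((m / 2 - σ : ℝ) : ℂ) * (((‖x‖ ^ 2 + t ^ 2 : ℝ) : ℂ) *
          (conj (c00 p x v I) * c00 p x w I)) +
        ((m / 2 + σ : ℝ) : ℂ) * (((‖x‖ ^ 2 + t ^ 2 : ℝ) : ℂ) *
          (conj (c11 p x v I) * c11 p x w I)) +
        pairForm m σ ‖x‖ t (conj (c10 p x v I)) (conj (c01 p x v I)) (c10 p x w I)
          (c01 p x w I)) := by
  have he := norm_dir hx
  have hj := dir_last x
  have hr : 0 < ‖x‖ ^ 2 + t ^ 2 := by have := norm_pos_iff.2 hx; positivity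
  have hrc : ((‖x‖ ^ 2 + t ^ 2 : ℝ) : ℂ) ≠ 0 := ofReal_ne_zero.2 hr.ne'
  -- The factor r² cancels the normalisation of ξ/|ξ|, so the form becomes polynomial in |x| and t.
  have e1 : ∀ v w : Form (d + 1) p, ((‖x‖ ^ 2 + t ^ 2 : ℝ) : ℂ) *
      inner ℂ (extVec (‖lift x t‖⁻¹ • lift x t) (incl (d + 1) p v))
        (extVec (‖lift x t‖⁻¹ • lift x t) (incl (d + 1) p w)) =
      inner ℂ (extVec (lift x t) (incl (d + 1) p v)) (extVec (lift x t) (incl (d + 1) p w)) := by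
    intro v w
    rw [extVec_smul, _root_.smul_apply, _root_.smul_apply, inner_smul_left, inner_smul_right,
      conj_ofReal, ← mul_assoc, ← mul_assoc, ← norm_lift_sq, ofReal_pow, ofReal_inv]
    have : (‖lift x t‖ : ℂ) ≠ 0 := by
      rw [ofReal_ne_zero]; intro h
      have h2 := norm_lift_sq x t
      rw [h] at h2; simp at h2; linarith
    field_simp
  have e2 : ∀ v w : Form (d + 1) p, ((‖x‖ ^ 2 + t ^ 2 : ℝ) : ℂ) *
      inner ℂ (intVec (‖lift x t‖⁻¹ • lift x t) (incl (d + 1) p v))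
        (intVec (‖lift x t‖⁻¹ • lift x t) (incl (d + 1) p w)) =
      inner ℂ (intVec (lift x t) (incl (d + 1) p v)) (intVec (lift x t) (incl (d + 1) p w)) := by
    intro v w
    rw [intVec_smul, _root_.smul_apply, _root_.smul_apply, inner_smul_left, inner_smul_right,
      conj_ofReal, ← mul_assoc, ← mul_assoc, ← norm_lift_sq, ofReal_pow, ofReal_inv]
    have : (‖lift x t‖ : ℂ) ≠ 0 := by
      rw [ofReal_ne_zero]; intro h
      have h2 := norm_lift_sq x t
      rw [h] at h2; simp at h2; linarith
    field_simp
  rw [inner_symbol, mul_add, mul_left_comm, e1, mul_left_comm, e2, extVec_lift, intVec_lift,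
    lift_zero_eq hx, extVec_smul, intVec_smul]
  simp only [_root_.add_apply, _root_.smul_apply]
  rw [inner_comp he hj, inner_comp he hj (_ • intVec _ _ + _)]
  simp only [map_add, map_smul, (comp_intMul he hj _).1,
    (comp_intMul he hj _).2.1, (comp_intMul he hj _).2.2.1, (comp_intMul he hj _).2.2.2,
    (comp_extMul he hj _).1, (comp_extMul he hj _).2.1, (comp_extMul he hj _).2.2.1,
    (comp_extMul he hj _).2.2.2, (comp_extVec he hj _).1, (comp_extVec he hj _).2.1,
    (comp_extVec he hj _).2.2.1, (comp_extVec he hj _).2.2.2, (comp_intVec he hj _).1,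
    (comp_intVec he hj _).2.1, (comp_intVec he hj _).2.2.1, (comp_intVec he hj _).2.2.2]
  have f00 : ∀ v, comp00 (dir x) (Fin.last d) (incl (d + 1) p v) = c00 p x v := fun _ => rfl
  have f10 : ∀ v, comp10 (dir x) (Fin.last d) (incl (d + 1) p v) = c10 p x v := fun _ => rfl
  have f01 : ∀ v, comp01 (dir x) (Fin.last d) (incl (d + 1) p v) = c01 p x v := fun _ => rfl
  have f11 : ∀ v, comp11 (dir x) (Fin.last d) (incl (d + 1) p v) = c11 p x v := fun _ => rfl
  simp only [f00, f10, f01, f11, smul_zero, add_zero, zero_add, inner_zero_left, PiLp.inner_apply,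
    PiLp.add_apply, PiLp.smul_apply, PiLp.neg_apply, smul_eq_mul, RCLike.inner_apply]
  rw [← Finset.sum_add_distrib, ← Finset.sum_add_distrib, ← Finset.sum_add_distrib,
    ← Finset.sum_add_distrib, Finset.mul_sum, Finset.mul_sum, ← Finset.sum_add_distrib]
  refine Finset.sum_congr rfl fun I _ => ?_
  simp only [map_add, map_mul, map_neg, conj_ofReal, pairForm, hm]
  push_cast
  ring

end Fiber

/-! ### The equation on one line -/

section FiberEquation

open Complex ComplexConjugate

variable {d p : ℕ} {x : Space d} {m σ : ℝ} {V₀ V₁ V₂ W : ℝ → Form (d + 1) p}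

/-- The equation `r² V'' + (2 - 2σ) τ V' - 2 B V' - m N V = W` on the line over `x'`. -/
structure FiberEq (m σ : ℝ) (x : Space d) (V₀ V₁ V₂ W : ℝ → Form (d + 1) p) : Prop where
  d₀ : ∀ τ, HasDerivAt V₀ (V₁ τ) τ
  d₁ : ∀ τ, HasDerivAt V₁ (V₂ τ) τ
  eqn : ∀ τ, ((‖x‖ ^ 2 + τ ^ 2 : ℝ) : ℂ) • V₂ τ + (((2 - 2 * σ) * τ : ℝ) : ℂ) • V₁ τ -
    (2 : ℂ) • bOp p x (V₁ τ) - (m : ℂ) • nOp d p (V₀ τ) = W τ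

lemma hasDerivAt_clm_coord (L : Form (d + 1) p →L[ℂ] Ext (d + 1)) (I : Finset (Fin (d + 1)))
    {V : ℝ → Form (d + 1) p} {V' : Form (d + 1) p} {τ : ℝ} (h : HasDerivAt V V' τ) :
    HasDerivAt (fun τ => L (V τ) I) (L V' I) τ := by
  have := (((EuclideanSpace.proj I : Ext (d + 1) →L[ℂ] ℂ) ∘L L).restrictScalars
    ℝ).hasFDerivAt.comp_hasDerivAt τ h
  exact this

/-- B mixes only `c10` and `c01`, and N keeps exactly the components containing e_n. Hence there is
a coupled pair and two scalar equations, with μ = 0 for `c00` and μ = m for `c11`. The zero term is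
kept so that one scalar lemma serves both. -/
lemma FiberEq.equations (h : FiberEq m σ x V₀ V₁ V₂ W) (hx : x ≠ 0) (I : Finset (Fin (d + 1)))
    (τ : ℝ) :
    (((‖x‖ ^ 2 + τ ^ 2 : ℝ) : ℂ) * c10 p x (V₂ τ) I +
      (((2 - 2 * σ) * τ : ℝ) : ℂ) * c10 p x (V₁ τ) I +
      ((2 * ‖x‖ : ℝ) : ℂ) * c01 p x (V₁ τ) I = c10 p x (W τ) I) ∧
    (((‖x‖ ^ 2 + τ ^ 2 : ℝ) : ℂ) * c01 p x (V₂ τ) I +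
      (((2 - 2 * σ) * τ : ℝ) : ℂ) * c01 p x (V₁ τ) I -
      ((2 * ‖x‖ : ℝ) : ℂ) * c10 p x (V₁ τ) I - (m : ℂ) * c01 p x (V₀ τ) I = c01 p x (W τ) I) ∧
    (((‖x‖ ^ 2 + τ ^ 2 : ℝ) : ℂ) * c00 p x (V₂ τ) I +
      (((2 - 2 * σ) * τ : ℝ) : ℂ) * c00 p x (V₁ τ) I - ((0 : ℝ) : ℂ) * c00 p x (V₀ τ) I =
      c00 p x (W τ) I) ∧
    (((‖x‖ ^ 2 + τ ^ 2 : ℝ) : ℂ) * c11 p x (V₂ τ) I +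
      (((2 - 2 * σ) * τ : ℝ) : ℂ) * c11 p x (V₁ τ) I - (m : ℂ) * c11 p x (V₀ τ) I =
      c11 p x (W τ) I) := by
  obtain ⟨b0, b1, b2, b3⟩ := components_bOp hx (V₁ τ)
  obtain ⟨n0, n1, n2, n3⟩ := components_nOp (p := p) hx (V₀ τ)
  have h1 := h.eqn τ
  refine ⟨?_, ?_, ?_, ?_⟩
  · have := congrArg (fun v => c10 p x v I) h1
    simp only [map_add, map_sub, map_smul, b1, n1, PiLp.add_apply, PiLp.sub_apply,
      PiLp.smul_apply, smul_eq_mul, smul_zero, PiLp.zero_apply] at this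
    rw [← this]; push_cast; ring
  · have := congrArg (fun v => c01 p x v I) h1
    simp only [map_add, map_sub, map_smul, b2, n2, PiLp.add_apply, PiLp.sub_apply,
      PiLp.smul_apply, smul_eq_mul, smul_zero, PiLp.zero_apply] at this
    rw [← this]; push_cast; ring
  · have := congrArg (fun v => c00 p x v I) h1
    simp only [map_add, map_sub, map_smul, b0, n0, PiLp.add_apply, PiLp.sub_apply,
      PiLp.smul_apply, smul_eq_mul, smul_zero, PiLp.zero_apply] at this
    rw [← this]; push_cast; ring
  · have := congrArg (fun v => c11 p x v I) h1
    simp only [map_add, map_sub, map_smul, b3, n3, PiLp.add_apply, PiLp.sub_apply,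
      PiLp.smul_apply, smul_eq_mul, smul_zero, PiLp.zero_apply] at this
    rw [← this]; push_cast; ring

lemma integrable_coord {q : ℝ} (hx : x ≠ 0) (L : Form (d + 1) p →L[ℂ] Ext (d + 1))
    (I : Finset (Fin (d + 1))) (hL : ∀ v, ‖L v I‖ ≤ ‖v‖) {V : ℝ → Form (d + 1) p}
    (hV : AEStronglyMeasurable V volume)
    (h : Integrable fun τ => (‖x‖ ^ 2 + τ ^ 2) ^ q * ‖V τ‖ ^ 2) :
    Integrable fun τ => (‖x‖ ^ 2 + τ ^ 2) ^ q * ‖L (V τ) I‖ ^ 2 := by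
  have hρ := norm_pos_iff.2 hx
  refine h.mono' ?_ (Filter.Eventually.of_forall fun τ => ?_)
  · refine (continuous_rpow_sq_add_sq hρ q).aestronglyMeasurable.mul ?_
    have h1 : AEStronglyMeasurable (fun τ => L (V τ) I) volume :=
      ((EuclideanSpace.proj I : Ext (d + 1) →L[ℂ] ℂ) ∘L L).continuous.comp_aestronglyMeasurable hV
    exact h1.norm.pow 2
  · rw [Real.norm_of_nonneg (by positivity)]
    exact mul_le_mul_of_nonneg_left (pow_le_pow_left₀ (norm_nonneg _) (hL _) 2) (by positivity)

lemma EnergyFinite.coord (hx : x ≠ 0) (L : Form (d + 1) p →L[ℂ] Ext (d + 1))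
    (I : Finset (Fin (d + 1))) (hL : ∀ v, ‖L v I‖ ≤ ‖v‖) (h : EnergyFinite σ ‖x‖ V₀ V₁)
    (h₀ : AEStronglyMeasurable V₀ volume) (h₁ : AEStronglyMeasurable V₁ volume) :
    EnergyFinite σ ‖x‖ (fun τ => L (V₀ τ) I) (fun τ => L (V₁ τ) I) :=
  ⟨integrable_coord hx L I hL h₀ h.fn, integrable_coord hx L I hL h₁ h.der⟩

lemma FiberEq.continuous₀ (h : FiberEq m σ x V₀ V₁ V₂ W) : Continuous V₀ :=
  continuous_iff_continuousAt.2 fun τ => (h.d₀ τ).continuousAt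

lemma FiberEq.continuous₁ (h : FiberEq m σ x V₀ V₁ V₂ W) : Continuous V₁ :=
  continuous_iff_continuousAt.2 fun τ => (h.d₁ τ).continuousAt

/-- Square integrable solutions of `L V = z V` have finite energy. -/
lemma FiberEq.energyFinite {z : ℂ} (hx : x ≠ 0)
    (h : FiberEq m σ x V₀ V₁ V₂ (fun τ => z • V₀ τ)) (hc : Continuous V₂)
    (hi : Integrable fun τ => (‖x‖ ^ 2 + τ ^ 2) ^ (-σ) * ‖V₀ τ‖ ^ 2) :
    EnergyFinite σ ‖x‖ V₀ V₁ := by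
  have hρ := norm_pos_iff.2 hx
  refine ⟨hi, ?_⟩
  refine integrable_energy (C := ‖(m : ℂ)‖ * ‖nOp d p‖ + ‖z‖) hρ (by positivity) h.d₀ h.d₁ hc
    (fun τ => ?_) hi
  have h1 := h.eqn τ
  have h2 : (‖x‖ ^ 2 + τ ^ 2) • V₂ τ + ((2 - 2 * σ) * τ) • V₁ τ =
      (2 : ℂ) • bOp p x (V₁ τ) + ((m : ℂ) • nOp d p (V₀ τ) + z • V₀ τ) := by
    rw [Complex.coe_smul, Complex.coe_smul] at h1
    rw [← h1]; abel
  rw [h2]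
  refine (norm_add_le _ _).trans (add_le_add ?_ ((norm_add_le _ _).trans ?_))
  · rw [norm_smul, norm_ofNat, mul_assoc]
    exact mul_le_mul_of_nonneg_left (norm_bOp_le hx _) zero_le_two
  · rw [norm_smul, norm_smul, add_mul, mul_assoc]
    gcongr
    exact (nOp d p).le_opNorm _

/-- There are no nonzero square integrable solutions of `L V = z V` for nonreal `z`. -/
lemma FiberEq.eq_zero {z : ℂ} (hx : x ≠ 0) (hz : z.im ≠ 0) (hα : 0 < m / 2 + σ)
    (hβ : 0 < m / 2 - σ) (h : FiberEq m σ x V₀ V₁ V₂ (fun τ => z • V₀ τ)) (hc : Continuous V₂)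
    (hi : Integrable fun τ => (‖x‖ ^ 2 + τ ^ 2) ^ (-σ) * ‖V₀ τ‖ ^ 2) (τ : ℝ) : V₀ τ = 0 := by
  have hρ := norm_pos_iff.2 hx
  have he := h.energyFinite hx hc hi
  have m0 := h.continuous₀.aestronglyMeasurable (μ := volume)
  have m1 := h.continuous₁.aestronglyMeasurable (μ := volume)
  have hcoord := fun (L : Form (d + 1) p →L[ℂ] Ext (d + 1)) I hL =>
    he.coord hx L I hL m0 m1
  have hpair := fun I => pair_eq_zero_of_deficiency (m := m) (σ := σ) hρ hα hβ hz
    (fun τ => hasDerivAt_clm_coord (c10 p x) I (h.d₀ τ))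
    (fun τ => hasDerivAt_clm_coord (c10 p x) I (h.d₁ τ))
    (fun τ => hasDerivAt_clm_coord (c01 p x) I (h.d₀ τ))
    (fun τ => hasDerivAt_clm_coord (c01 p x) I (h.d₁ τ))
    (fun τ => by rw [(h.equations hx I τ).1]; simp)
    (fun τ => by rw [(h.equations hx I τ).2.1]; simp)
    (hcoord (c10 p x) I fun v => (norm_components_le hx v I).2.1)
    (hcoord (c01 p x) I fun v => (norm_components_le hx v I).2.2.1) τ
  refine eq_zero_of_components hx ?_ ?_ ?_ ?_
  · ext I
    exact scalar_eq_zero_of_deficiency hρ hz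
      (fun τ => hasDerivAt_clm_coord (c00 p x) I (h.d₀ τ))
      (fun τ => hasDerivAt_clm_coord (c00 p x) I (h.d₁ τ))
      (fun τ => by rw [(h.equations hx I τ).2.2.1]; simp)
      (hcoord (c00 p x) I fun v => (norm_components_le hx v I).1) τ
  · ext I; exact (hpair I).1
  · ext I; exact (hpair I).2
  · ext I
    exact scalar_eq_zero_of_deficiency hρ hz
      (fun τ => hasDerivAt_clm_coord (c11 p x) I (h.d₀ τ))
      (fun τ => hasDerivAt_clm_coord (c11 p x) I (h.d₁ τ))
      (fun τ => by rw [(h.equations hx I τ).2.2.2]; simp)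
      (hcoord (c11 p x) I fun v => (norm_components_le hx v I).2.2.2) τ

/-- Square integrable solutions of `L V = 0` are constant with values in the kernel of `N`. -/
lemma FiberEq.kernel (hx : x ≠ 0) (hσ : 1 / 2 < σ) (hα : 1 < m / 2 + σ)
    (hβ : 0 < m / 2 - σ) (h : FiberEq m σ x V₀ V₁ V₂ (fun _ => 0)) (hc : Continuous V₂)
    (hi : Integrable fun τ => (‖x‖ ^ 2 + τ ^ 2) ^ (-σ) * ‖V₀ τ‖ ^ 2) (τ : ℝ) :
    V₁ τ = 0 ∧ nOp d p (V₀ τ) = 0 := by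
  have hρ := norm_pos_iff.2 hx
  have h' : FiberEq m σ x V₀ V₁ V₂ (fun τ => (0 : ℂ) • V₀ τ) := ⟨h.d₀, h.d₁, by simpa using h.eqn⟩
  have he := h'.energyFinite hx hc hi
  have m0 := h.continuous₀.aestronglyMeasurable (μ := volume)
  have m1 := h.continuous₁.aestronglyMeasurable (μ := volume)
  have hm : 0 < m := by linarith
  have hmc : (m : ℂ) ≠ 0 := ofReal_ne_zero.2 hm.ne'
  have hcoord := fun (L : Form (d + 1) p →L[ℂ] Ext (d + 1)) I hL =>
    he.coord hx L I hL m0 m1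
  have hpair := fun I => pair_kernel (m := m) (σ := σ) hρ hσ hα hβ
    (fun τ => hasDerivAt_clm_coord (c10 p x) I (h.d₀ τ))
    (fun τ => hasDerivAt_clm_coord (c10 p x) I (h.d₁ τ))
    (fun τ => hasDerivAt_clm_coord (c01 p x) I (h.d₀ τ))
    (fun τ => hasDerivAt_clm_coord (c01 p x) I (h.d₁ τ))
    (fun τ => by rw [(h.equations hx I τ).1]; simp)
    (fun τ => by rw [(h.equations hx I τ).2.1]; simp)
    (hcoord (c10 p x) I fun v => (norm_components_le hx v I).2.1)
    (hcoord (c01 p x) I fun v => (norm_components_le hx v I).2.2.1)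
  have h00 := fun I => (scalar_kernel hρ le_rfl
    (fun τ => hasDerivAt_clm_coord (c00 p x) I (h.d₀ τ))
    (fun τ => hasDerivAt_clm_coord (c00 p x) I (h.d₁ τ))
    (fun τ => by rw [(h.equations hx I τ).2.2.1]; simp)
    (hcoord (c00 p x) I fun v => (norm_components_le hx v I).1) τ).1
  have h11 := fun I => scalar_kernel hρ hm.le
    (fun τ => hasDerivAt_clm_coord (c11 p x) I (h.d₀ τ))
    (fun τ => hasDerivAt_clm_coord (c11 p x) I (h.d₁ τ))
    (fun τ => by rw [(h.equations hx I τ).2.2.2]; simp)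
    (hcoord (c11 p x) I fun v => (norm_components_le hx v I).2.2.2) τ
  have hy : ∀ τ, c01 p x (V₀ τ) = 0 := fun τ => by ext I; exact (hpair I τ).2
  have hy1 : c01 p x (V₁ τ) = 0 := by
    ext I
    have h1 := hasDerivAt_clm_coord (c01 p x) I (h.d₀ τ)
    have h2 : (fun τ => c01 p x (V₀ τ) I) = fun _ => 0 := by funext t; rw [hy t]; rfl
    rw [h2] at h1
    exact h1.unique (hasDerivAt_const τ 0)
  have hw : c11 p x (V₀ τ) = 0 := by
    ext I
    simpa [hmc] using (h11 I).2
  constructor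
  · refine eq_zero_of_components hx ?_ ?_ hy1 ?_
    · ext I; exact h00 I
    · ext I; exact (hpair I τ).1
    · ext I; exact (h11 I).1
  · obtain ⟨n0, n1, n2, n3⟩ := components_nOp (p := p) hx (V₀ τ)
    exact eq_zero_of_components hx n0 n1 (n2.trans (hy τ)) (n3.trans hw)

lemma integral_add_add_eq_zero {f g h : ℝ → ℂ} (hf : Integrable f ∧ ∫ τ, f τ = 0)
    (hg : Integrable g ∧ ∫ τ, g τ = 0) (hh : Integrable h ∧ ∫ τ, h τ = 0) (a b : ℂ) :
    Integrable (fun τ => a * f τ + b * g τ + h τ) ∧ ∫ τ, (a * f τ + b * g τ + h τ) = 0 := by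
  have i1 : Integrable fun τ => a * f τ := hf.1.const_mul a
  have i2 : Integrable fun τ => b * g τ := hg.1.const_mul b
  have i3 : Integrable fun τ => a * f τ + b * g τ := i1.add i2
  refine ⟨i3.add hh.1, ?_⟩
  rw [integral_add i3 hh.1, integral_add i1 i2, integral_const_mul, integral_const_mul, hf.2, hg.2,
    hh.2]
  simp

/-- Symmetry of `L` with respect to the form given by the symbol. -/
lemma FiberEq.integral_symbol_sub_eq_zero {Φ₀ Φ₁ Φ₂ Ψ : ℝ → Form (d + 1) p} (hx : x ≠ 0)
    (hm : m = ((d + 1 : ℕ) : ℝ) - 2 * p)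
    (h : FiberEq m σ x V₀ V₁ V₂ W) (h' : FiberEq m σ x Φ₀ Φ₁ Φ₂ Ψ)
    (eV : EnergyFinite σ ‖x‖ V₀ V₁) (eΦ : EnergyFinite σ ‖x‖ Φ₀ Φ₁)
    (eΦ' : EnergyFinite (σ - 1) ‖x‖ Φ₀ Φ₁)
    (mW : AEStronglyMeasurable W volume) (mΨ : AEStronglyMeasurable Ψ volume)
    (iW : Integrable fun τ => (‖x‖ ^ 2 + τ ^ 2) ^ (-σ) * ‖W τ‖ ^ 2)
    (iΨ : Integrable fun τ => (‖x‖ ^ 2 + τ ^ 2) ^ (-σ) * ‖Ψ τ‖ ^ 2) :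
    ∫ τ, (((‖x‖ ^ 2 + τ ^ 2) ^ (-σ) : ℝ) : ℂ) *
      (inner ℂ (symbol (d + 1) p (-σ) (lift x τ) (W τ)) (Φ₀ τ) -
        inner ℂ (symbol (d + 1) p (-σ) (lift x τ) (V₀ τ)) (Ψ τ)) = 0 := by
  have hρ := norm_pos_iff.2 hx
  have m0 := h.continuous₀.aestronglyMeasurable (μ := volume)
  have m1 := h.continuous₁.aestronglyMeasurable (μ := volume)
  have k0 := h'.continuous₀.aestronglyMeasurable (μ := volume)
  have k1 := h'.continuous₁.aestronglyMeasurable (μ := volume)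
  have hconj : ∀ (L : Form (d + 1) p →L[ℂ] Ext (d + 1)) I, (∀ v, ‖L v I‖ ≤ ‖v‖) →
      EnergyFinite σ ‖x‖ (fun τ => conj (L (V₀ τ) I)) (fun τ => conj (L (V₁ τ) I)) := by
    intro L I hL
    have := eV.coord hx L I hL m0 m1
    exact ⟨by simpa only [norm_conj] using this.fn, by simpa only [norm_conj] using this.der⟩
  have hconjW : ∀ (L : Form (d + 1) p →L[ℂ] Ext (d + 1)) I, (∀ v, ‖L v I‖ ≤ ‖v‖) →
      Integrable fun τ => (‖x‖ ^ 2 + τ ^ 2) ^ (-σ) * ‖conj (L (W τ) I)‖ ^ 2 := by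
    intro L I hL
    simpa only [norm_conj] using integrable_coord hx L I hL mW iW
  have b00 := fun I (v : Form (d + 1) p) => (norm_components_le hx v I).1
  have b10 := fun I (v : Form (d + 1) p) => (norm_components_le hx v I).2.1
  have b01 := fun I (v : Form (d + 1) p) => (norm_components_le hx v I).2.2.1
  have b11 := fun I (v : Form (d + 1) p) => (norm_components_le hx v I).2.2.2
  have s00 := fun I => integral_scalar_sub_eq_zero hρ
    (fun τ => hasDerivAt_conj (hasDerivAt_clm_coord (c00 p x) I (h.d₀ τ)))
    (w₂ := fun τ => conj (c00 p x (V₂ τ) I))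
    (fun τ => hasDerivAt_conj (hasDerivAt_clm_coord (c00 p x) I (h.d₁ τ)))
    (fun τ => hasDerivAt_clm_coord (c00 p x) I (h'.d₀ τ))
    (fun τ => hasDerivAt_clm_coord (c00 p x) I (h'.d₁ τ)) 0 (F := fun τ => conj (c00 p x (W τ) I))
    (fun τ => by
      have := congrArg conj (h.equations hx I τ).2.2.1
      simpa only [map_add, map_sub, map_mul, conj_ofReal] using this)
    (fun τ => (h'.equations hx I τ).2.2.1)
    (hconj _ I (b00 I)) (eΦ'.coord hx _ I (b00 I) k0 k1) (hconjW _ I (b00 I))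
    (integrable_coord hx _ I (b00 I) mΨ iΨ) (eΦ.coord hx _ I (b00 I) k0 k1)
  have s11 := fun I => integral_scalar_sub_eq_zero hρ
    (fun τ => hasDerivAt_conj (hasDerivAt_clm_coord (c11 p x) I (h.d₀ τ)))
    (w₂ := fun τ => conj (c11 p x (V₂ τ) I))
    (fun τ => hasDerivAt_conj (hasDerivAt_clm_coord (c11 p x) I (h.d₁ τ)))
    (fun τ => hasDerivAt_clm_coord (c11 p x) I (h'.d₀ τ))
    (fun τ => hasDerivAt_clm_coord (c11 p x) I (h'.d₁ τ)) m (F := fun τ => conj (c11 p x (W τ) I))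
    (fun τ => by
      have := congrArg conj (h.equations hx I τ).2.2.2
      simpa only [map_add, map_sub, map_mul, conj_ofReal] using this)
    (fun τ => (h'.equations hx I τ).2.2.2)
    (hconj _ I (b11 I)) (eΦ'.coord hx _ I (b11 I) k0 k1) (hconjW _ I (b11 I))
    (integrable_coord hx _ I (b11 I) mΨ iΨ) (eΦ.coord hx _ I (b11 I) k0 k1)
  have sp := fun I => integral_pairForm_sub_eq_zero (m := m) (σ := σ) hρ
    (fun τ => hasDerivAt_conj (hasDerivAt_clm_coord (c10 p x) I (h.d₀ τ)))
    (x₂ := fun τ => conj (c10 p x (V₂ τ) I))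
    (fun τ => hasDerivAt_conj (hasDerivAt_clm_coord (c10 p x) I (h.d₁ τ)))
    (fun τ => hasDerivAt_conj (hasDerivAt_clm_coord (c01 p x) I (h.d₀ τ)))
    (y₂ := fun τ => conj (c01 p x (V₂ τ) I))
    (fun τ => hasDerivAt_conj (hasDerivAt_clm_coord (c01 p x) I (h.d₁ τ)))
    (fun τ => hasDerivAt_clm_coord (c10 p x) I (h'.d₀ τ))
    (fun τ => hasDerivAt_clm_coord (c10 p x) I (h'.d₁ τ))
    (fun τ => hasDerivAt_clm_coord (c01 p x) I (h'.d₀ τ))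
    (fun τ => hasDerivAt_clm_coord (c01 p x) I (h'.d₁ τ))
    (F := fun τ => conj (c10 p x (W τ) I)) (G := fun τ => conj (c01 p x (W τ) I))
    (fun τ => by
      have := congrArg conj (h.equations hx I τ).1
      simpa only [map_add, map_sub, map_mul, conj_ofReal] using this)
    (fun τ => by
      have := congrArg conj (h.equations hx I τ).2.1
      simpa only [map_add, map_sub, map_mul, conj_ofReal] using this)
    (fun τ => (h'.equations hx I τ).1) (fun τ => (h'.equations hx I τ).2.1)
    (hconj _ I (b10 I)) (hconj _ I (b01 I))
    (eΦ'.coord hx _ I (b10 I) k0 k1) (eΦ'.coord hx _ I (b01 I) k0 k1)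
    (hconjW _ I (b10 I)) (hconjW _ I (b01 I))
    (integrable_coord hx _ I (b10 I) mΨ iΨ) (integrable_coord hx _ I (b01 I) mΨ iΨ)
    (eΦ.coord hx _ I (b10 I) k0 k1) (eΦ.coord hx _ I (b01 I) k0 k1)
  -- The component formula for the symbol carries a factor r². It is borrowed from the weight, which
  -- leaves exponent -σ - 1 for the pair, whereas the scalar terms return it.
  have hsum : ∀ τ : ℝ, (((‖x‖ ^ 2 + τ ^ 2) ^ (-σ) : ℝ) : ℂ) *
      (inner ℂ (symbol (d + 1) p (-σ) (lift x τ) (W τ)) (Φ₀ τ) -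
        inner ℂ (symbol (d + 1) p (-σ) (lift x τ) (V₀ τ)) (Ψ τ)) =
      ∑ I, (((m / 2 - σ : ℝ) : ℂ) * ((((‖x‖ ^ 2 + τ ^ 2) ^ (-σ) : ℝ) : ℂ) *
          (conj (c00 p x (W τ) I) * c00 p x (Φ₀ τ) I - conj (c00 p x (V₀ τ) I) *
            c00 p x (Ψ τ) I)) +
        ((m / 2 + σ : ℝ) : ℂ) * ((((‖x‖ ^ 2 + τ ^ 2) ^ (-σ) : ℝ) : ℂ) *
          (conj (c11 p x (W τ) I) * c11 p x (Φ₀ τ) I - conj (c11 p x (V₀ τ) I) *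
            c11 p x (Ψ τ) I)) +
        (((‖x‖ ^ 2 + τ ^ 2) ^ (-σ - 1) : ℝ) : ℂ) *
          (pairForm m σ ‖x‖ τ (conj (c10 p x (W τ) I)) (conj (c01 p x (W τ) I))
            (c10 p x (Φ₀ τ) I) (c01 p x (Φ₀ τ) I) -
          pairForm m σ ‖x‖ τ (conj (c10 p x (V₀ τ) I)) (conj (c01 p x (V₀ τ) I))
            (c10 p x (Ψ τ) I) (c01 p x (Ψ τ) I))) := by
    intro τ
    have e : (ρ : ℝ) → (ρ = ‖x‖ ^ 2 + τ ^ 2) → (‖x‖ ^ 2 + τ ^ 2) ^ (-σ) =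
        (‖x‖ ^ 2 + τ ^ 2) ^ (-σ - 1) * (‖x‖ ^ 2 + τ ^ 2) := by
      intro _ _
      rw [← rpow_sq_add_sq_add_one hρ]; congr 1; ring
    rw [e _ rfl, ofReal_mul, mul_assoc, mul_sub, inner_symbol_components hx hm,
      inner_symbol_components hx hm, ← Finset.sum_sub_distrib, Finset.mul_sum]
    refine Finset.sum_congr rfl fun I _ => ?_
    ring
  simp only [hsum]
  have h3 := fun I => integral_add_add_eq_zero (s00 I) (s11 I) (sp I) ((m / 2 - σ : ℝ) : ℂ)
    ((m / 2 + σ : ℝ) : ℂ)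
  rw [integral_finsetSum _ fun I _ => (h3 I).1]
  exact Finset.sum_eq_zero fun I _ => (h3 I).2

end FiberEquation

/-! ### The operator on the Fourier side -/

section FourierSide

open LineDeriv

variable {n d p : ℕ} {F : Type*} [NormedAddCommGroup F] [NormedSpace ℂ F]

lemma hasTemperateGrowth_coord (j : Fin n) : (fun x : Space n => (x j : ℂ)).HasTemperateGrowth :=
  (Complex.ofRealCLM ∘L (EuclideanSpace.proj j : Space n →L[ℝ] ℝ)).hasTemperateGrowth

/-- Multiplication of Schwartz functions by the coordinate `x_j`. -/
def coordS (j : Fin n) : 𝓢(Space n, F) →L[ℂ] 𝓢(Space n, F) :=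
  SchwartzMap.smulLeftCLM F (fun x : Space n => (x j : ℂ))

/-- The partial derivative `∂/∂x_j` of Schwartz functions. -/
def pdS (j : Fin n) : 𝓢(Space n, F) →L[ℂ] 𝓢(Space n, F) :=
  lineDerivOpCLM ℂ 𝓢(Space n, F) (EuclideanSpace.single j (1 : ℝ))

lemma coordS_apply (j : Fin n) (η : 𝓢(Space n, F)) (x : Space n) :
    coordS j η x = (x j : ℂ) • η x :=
  SchwartzMap.smulLeftCLM_apply_apply (hasTemperateGrowth_coord j) η x

lemma pdS_apply (j : Fin n) (η : 𝓢(Space n, F)) (x : Space n) :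
    pdS j η x = fderiv ℝ η x (EuclideanSpace.single j (1 : ℝ)) :=
  SchwartzMap.lineDerivOp_apply_eq_fderiv _ _ _

lemma pd_apply (j : Fin n) (u : 𝓢'(Space n, Ext n)) (ψ : 𝓢(Space n, ℂ)) :
    pd j u ψ = -u (pdS j ψ) :=
  map_neg u (pdS j ψ)

lemma mapVal_apply {G : Type*} [NormedAddCommGroup G] [NormedSpace ℂ G] (A : F →L[ℂ] G)
    (u : 𝓢'(Space n, F)) (ψ : 𝓢(Space n, ℂ)) : mapVal A u ψ = A (u ψ) := rfl

lemma coordS_eq_inner (j : Fin n) (η : 𝓢(Space n, F)) :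
    SchwartzMap.smulLeftCLM F (inner ℝ · (EuclideanSpace.single j (1 : ℝ))) η = coordS j η := by
  have : (inner ℝ · (EuclideanSpace.single j (1 : ℝ)) : Space n → ℝ).HasTemperateGrowth :=
    ((innerSL ℝ).flip (EuclideanSpace.single j (1 : ℝ))).hasTemperateGrowth
  ext x
  rw [SchwartzMap.smulLeftCLM_apply_apply this, coordS_apply, Complex.coe_smul,
    EuclideanSpace.inner_single_right]
  simp

lemma pdS_fourier (j : Fin n) (ψ : 𝓢(Space n, ℂ)) :
    pdS j (𝓕 ψ) = 𝓕 (-(2 * Real.pi * Complex.I) • coordS j ψ) := by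
  rw [← coordS_eq_inner]
  exact SchwartzMap.lineDerivOp_fourier_eq ψ _

lemma coordS_fourier (j : Fin n) (ψ : 𝓢(Space n, ℂ)) :
    coordS j (𝓕 ψ) = 𝓕 ((2 * Real.pi * Complex.I)⁻¹ • pdS j ψ) := by
  have h : 𝓕 (pdS j ψ) = (2 * Real.pi * Complex.I) • coordS j (𝓕 ψ) := by
    rw [← coordS_eq_inner]
    exact SchwartzMap.fourier_lineDerivOp_eq ψ _
  rw [FourierTransform.fourier_smul, h, smul_smul, inv_mul_cancel₀ Complex.two_pi_I_ne_zero,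
    one_smul]

/-- The operator `i_{e_n} ε_{e_j} + ε_{e_n} i_{e_j}` on `p`-forms. -/
def bJ (p : ℕ) (j : Fin d) : Form (d + 1) p →L[ℂ] Form (d + 1) p :=
  proj (d + 1) p ∘L (intMul (Fin.last d) ∘L extMul j.castSucc +
    extMul (Fin.last d) ∘L intMul j.castSucc) ∘L incl (d + 1) p

lemma bOp_eq_sum (x : Space d) (v : Form (d + 1) p) : bOp p x v = ∑ j, (x j : ℂ) • bJ p j v := by
  simp only [bOp, bJ, extVec, intVec, ContinuousLinearMap.comp_apply, _root_.add_apply,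
    _root_.sum_apply, _root_.smul_apply, map_add, map_sum, map_smul, Fin.sum_univ_castSucc,
    lift_castSucc, lift_last, Complex.ofReal_zero, zero_smul, add_zero, smul_add,
    Finset.sum_add_distrib]

/-- The Fourier transform of `Δ_{a,p} u`. -/
lemma fourier_deltaOp (a : ℝ) (u : 𝓢'(Space (d + 1), Form (d + 1) p)) (ψ : 𝓢(Space (d + 1), ℂ)) :
    𝓕 (deltaOp d p a u) ψ =
      ∑ j, 𝓕 u (coordS j (coordS j (pdS (Fin.last d) (pdS (Fin.last d) ψ)))) +
      (a : ℂ) • 𝓕 u (coordS (Fin.last d) (pdS (Fin.last d) ψ)) +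
      (2 : ℂ) • ∑ j : Fin d, bJ p j (𝓕 u (coordS j.castSucc (pdS (Fin.last d) ψ))) -
      (((d + 1 : ℕ) : ℂ) - 2 * (p : ℂ)) • nOp d p (𝓕 u ψ) := by
  simp only [TemperedDistribution.fourier_apply]
  set c : ℂ := 2 * Real.pi * Complex.I with hc
  have hc0 : c ≠ 0 := Complex.two_pi_I_ne_zero
  -- Each factor x_n comes with exactly one derivative, so the constants 2πi cancel and the
  -- normalisation of the Fourier transform leaves no trace in the formula.
  have h1 : ∀ (j : Fin (d + 1)) (η : 𝓢(Space (d + 1), ℂ)),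
      pdS j (coordS (Fin.last d) (𝓕 η)) = -𝓕 (coordS j (pdS (Fin.last d) η)) := by
    intro j η
    rw [coordS_fourier, pdS_fourier, map_smul, smul_smul, FourierTransform.fourier_smul, ← hc,
      neg_mul, mul_inv_cancel₀ hc0, neg_one_smul]
  have h2 : ∀ j : Fin (d + 1), pdS j (pdS j (coordS (Fin.last d) (coordS (Fin.last d) (𝓕 ψ)))) =
      𝓕 (coordS j (coordS j (pdS (Fin.last d) (pdS (Fin.last d) ψ)))) := by
    intro j
    rw [coordS_fourier, coordS_fourier, pdS_fourier, pdS_fourier, ← hc]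
    simp only [map_smul, smul_smul, FourierTransform.fourier_smul]
    rw [show -c * (-c * (c⁻¹ * c⁻¹)) = 1 by field_simp, one_smul]
  have h3 : ∀ v : 𝓢'(Space (d + 1), Ext (d + 1)), deltaExt d p a v (𝓕 ψ) =
      ∑ j, v (𝓕 (coordS j (coordS j (pdS (Fin.last d) (pdS (Fin.last d) ψ))))) +
      (a : ℂ) • v (𝓕 (coordS (Fin.last d) (pdS (Fin.last d) ψ))) +
      (2 : ℂ) • ∑ j : Fin d,
        (intMul (Fin.last d) (extMul j.castSucc (v (𝓕 (coordS j.castSucc (pdS (Fin.last d) ψ))))) +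
        extMul (Fin.last d) (intMul j.castSucc
          (v (𝓕 (coordS j.castSucc (pdS (Fin.last d) ψ)))))) -
      (((d + 1 : ℕ) : ℂ) - 2 * (p : ℂ)) • extMul (Fin.last d) (intMul (Fin.last d) (v (𝓕 ψ))) := by
    intro v
    have e1 : ((mulCoord (Fin.last d) ∘L mulCoord (Fin.last d) ∘L (∑ j, pd j ∘L pd j)) v) (𝓕 ψ) =
        ∑ j, v (𝓕 (coordS j (coordS j (pdS (Fin.last d) (pdS (Fin.last d) ψ))))) := by
      have : ((mulCoord (Fin.last d) ∘L mulCoord (Fin.last d) ∘L (∑ j, pd j ∘L pd j)) v) (𝓕 ψ) =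
        ((∑ j, pd j ∘L pd j) v) (coordS (Fin.last d) (coordS (Fin.last d) (𝓕 ψ))) := rfl
      rw [this, _root_.sum_apply, UniformConvergenceCLM.sum_apply]
      refine Finset.sum_congr rfl fun j _ => ?_
      rw [← h2 j]
      exact (pd_apply j (pd j v) _).trans ((congrArg Neg.neg (pd_apply j v _)).trans (neg_neg _))
    have e2 : ((mulCoord (Fin.last d) ∘L pd (Fin.last d)) v) (𝓕 ψ) =
        v (𝓕 (coordS (Fin.last d) (pdS (Fin.last d) ψ))) := by
      refine (pd_apply (Fin.last d) v (coordS (Fin.last d) (𝓕 ψ))).trans ?_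
      rw [h1, map_neg, neg_neg]
    have e3 : ((mulCoord (Fin.last d) ∘L (mapVal (intMul (Fin.last d)) ∘L dPrime d -
        mapVal (extMul (Fin.last d)) ∘L deltaPrime d)) v) (𝓕 ψ) = ∑ j : Fin d,
        (intMul (Fin.last d) (extMul j.castSucc (v (𝓕 (coordS j.castSucc (pdS (Fin.last d) ψ))))) +
        extMul (Fin.last d) (intMul j.castSucc
          (v (𝓕 (coordS j.castSucc (pdS (Fin.last d) ψ)))))) := by
      have : ((mulCoord (Fin.last d) ∘L (mapVal (intMul (Fin.last d)) ∘L dPrime d -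
        mapVal (extMul (Fin.last d)) ∘L deltaPrime d)) v) (𝓕 ψ) =
        intMul (Fin.last d) (dPrime d v (coordS (Fin.last d) (𝓕 ψ))) -
        extMul (Fin.last d) (deltaPrime d v (coordS (Fin.last d) (𝓕 ψ))) := rfl
      have f1 : dPrime d v (coordS (Fin.last d) (𝓕 ψ)) = ∑ j : Fin d,
          extMul j.castSucc (v (𝓕 (coordS j.castSucc (pdS (Fin.last d) ψ)))) := by
        rw [dPrime, _root_.sum_apply, UniformConvergenceCLM.sum_apply]
        refine Finset.sum_congr rfl fun j _ => ?_
        refine congrArg (extMul j.castSucc) ((pd_apply j.castSucc v _).trans ?_)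
        rw [h1, map_neg, neg_neg]
      have f2 : deltaPrime d v (coordS (Fin.last d) (𝓕 ψ)) = -∑ j : Fin d,
          intMul j.castSucc (v (𝓕 (coordS j.castSucc (pdS (Fin.last d) ψ)))) := by
        rw [deltaPrime, _root_.neg_apply, UniformConvergenceCLM.neg_apply, _root_.sum_apply,
          UniformConvergenceCLM.sum_apply]
        refine congrArg Neg.neg (Finset.sum_congr rfl fun j _ => ?_)
        refine congrArg (intMul j.castSucc) ((pd_apply j.castSucc v _).trans ?_)
        rw [h1, map_neg, neg_neg]
      rw [this, f1, f2, map_neg, sub_neg_eq_add, map_sum, map_sum, ← Finset.sum_add_distrib]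
    rw [← e1, ← e2, ← e3]
    rfl
  have h4 : deltaOp d p a u (𝓕 ψ) =
      proj (d + 1) p (deltaExt d p a (mapVal (incl (d + 1) p) u) (𝓕 ψ)) := rfl
  rw [h4, h3]
  simp only [mapVal_apply, map_sub, map_add, map_smul, map_sum, proj_incl]
  simp only [bJ, nOp, ContinuousLinearMap.comp_apply, _root_.add_apply, map_add]

/-- The derivative of a Schwartz function along the last coordinate. -/
lemma hasDerivAt_lift (η : 𝓢(Space (d + 1), F)) (x : Space d) (τ : ℝ) :
    HasDerivAt (fun τ => η (lift x τ)) (pdS (Fin.last d) η (lift x τ)) τ := by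
  have h1 : HasDerivAt (fun τ => lift x τ) (EuclideanSpace.single (Fin.last d) (1 : ℝ)) τ := by
    have h2 : (fun τ => lift x τ) =
        fun τ => lift x 0 + τ • EuclideanSpace.single (Fin.last d) (1 : ℝ) := by
      funext t
      ext i
      refine Fin.lastCases ?_ (fun j => ?_) i
      · simp
      · simp [EuclideanSpace.single_apply, Fin.castSucc_ne_last]
    rw [h2]
    simpa using ((hasDerivAt_id τ).smul_const
      (EuclideanSpace.single (Fin.last d) (1 : ℝ))).const_add (lift x 0)
  rw [pdS_apply]
  exact (η.differentiableAt.hasFDerivAt).comp_hasDerivAt τ h1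

lemma lift_init (ξ : Space (d + 1)) : ∃ x : Space d, ∃ τ : ℝ, ξ = lift x τ := by
  refine ⟨WithLp.toLp 2 fun i => ξ i.castSucc, ξ (Fin.last d), ?_⟩
  ext i
  refine Fin.lastCases ?_ (fun j => ?_) i <;> simp

lemma pdS_coordS_castSucc (j : Fin d) (η : 𝓢(Space (d + 1), F)) :
    pdS (Fin.last d) (coordS j.castSucc η) = coordS j.castSucc (pdS (Fin.last d) η) := by
  ext ξ
  obtain ⟨x, τ, rfl⟩ := lift_init ξ
  refine (hasDerivAt_lift _ x τ).unique ?_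
  simp only [coordS_apply, lift_castSucc]
  exact (hasDerivAt_lift η x τ).const_smul _

lemma pdS_coordS_last (η : 𝓢(Space (d + 1), F)) :
    pdS (Fin.last d) (coordS (Fin.last d) η) = η + coordS (Fin.last d) (pdS (Fin.last d) η) := by
  ext ξ
  obtain ⟨x, τ, rfl⟩ := lift_init ξ
  refine (hasDerivAt_lift _ x τ).unique ?_
  simp only [coordS_apply, lift_last, _root_.add_apply, SchwartzMap.add_apply]
  have h := ((hasDerivAt_id τ).ofReal_comp).smul (hasDerivAt_lift η x τ)
  refine HasDerivAt.congr_deriv h ?_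
  simp [add_comm]

/-- The Fourier transform of `Δ_{a,p} φ` for a Schwartz form `φ` with Fourier transform `η`. -/
def deltaHat (a : ℝ) (η : 𝓢(Space (d + 1), Form (d + 1) p)) :
    𝓢(Space (d + 1), Form (d + 1) p) :=
  ∑ j, pdS (Fin.last d) (pdS (Fin.last d) (coordS j (coordS j η))) -
    (a : ℂ) • pdS (Fin.last d) (coordS (Fin.last d) η) -
    (2 : ℂ) • ∑ j : Fin d, SchwartzMap.postcompCLM (bJ p j) (pdS (Fin.last d) (coordS j.castSucc η)) -
    (((d + 1 : ℕ) : ℂ) - 2 * (p : ℂ)) • SchwartzMap.postcompCLM (nOp d p) η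

lemma integral_pdS_smul (j : Fin n) (ψ : 𝓢(Space n, ℂ)) (η : 𝓢(Space n, F)) :
    ∫ x, pdS j ψ x • η x = -∫ x, ψ x • pdS j η x := by
  rw [← neg_eq_iff_eq_neg]
  exact (SchwartzMap.integral_smul_lineDerivOp_right_eq_neg_left ψ η _).symm

lemma integral_coordS_smul (j : Fin n) (ψ : 𝓢(Space n, ℂ)) (η : 𝓢(Space n, F)) :
    ∫ x, coordS j ψ x • η x = ∫ x, ψ x • coordS j η x := by
  refine integral_congr_ae (Filter.Eventually.of_forall fun x => ?_)
  simp only [coordS_apply]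
  rw [smul_smul, smul_eq_mul, mul_comm]

lemma schwartz_apply [CompleteSpace F] (η : 𝓢(Space n, F)) (ψ : 𝓢(Space n, ℂ)) :
    (η : 𝓢'(Space n, F)) ψ = ∫ x, ψ x • η x := SchwartzMap.coe_apply η ψ

lemma coe_pdS_apply [CompleteSpace F] (j : Fin n) (ψ : 𝓢(Space n, ℂ)) (η : 𝓢(Space n, F)) :
    (η : 𝓢'(Space n, F)) (pdS j ψ) = -(pdS j η : 𝓢'(Space n, F)) ψ := by
  rw [schwartz_apply, schwartz_apply, integral_pdS_smul]

lemma coe_coordS_apply [CompleteSpace F] (j : Fin n) (ψ : 𝓢(Space n, ℂ)) (η : 𝓢(Space n, F)) :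
    (η : 𝓢'(Space n, F)) (coordS j ψ) = (coordS j η : 𝓢'(Space n, F)) ψ := by
  rw [schwartz_apply, schwartz_apply, integral_coordS_smul]

lemma coe_postcomp_apply {G : Type*} [NormedAddCommGroup G] [NormedSpace ℂ G] [CompleteSpace F]
    [CompleteSpace G] (A : F →L[ℂ] G) (ψ : 𝓢(Space n, ℂ)) (η : 𝓢(Space n, F)) :
    A ((η : 𝓢'(Space n, F)) ψ) = (SchwartzMap.postcompCLM A η : 𝓢'(Space n, G)) ψ := by
  rw [schwartz_apply, schwartz_apply, ← A.integral_comp_comm ((IsRep.schwartz η).2 ψ).1]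
  simp

/-- Integration by parts moves the operators from the test function to the Fourier transform of φ.
The terms with one τ-derivative change sign. -/
lemma fourier_deltaOp_schwartz (a : ℝ) (φ : 𝓢(Space (d + 1), Form (d + 1) p)) :
    𝓕 (deltaOp d p a (φ : 𝓢'(Space (d + 1), Form (d + 1) p))) =
      (deltaHat a (𝓕 φ : 𝓢(Space (d + 1), Form (d + 1) p)) :
        𝓢'(Space (d + 1), Form (d + 1) p)) := by
  ext1 ψ
  rw [fourier_deltaOp, TemperedDistribution.fourier_toTemperedDistributionCLM_eq]
  simp only [deltaHat, map_sub, map_sum, map_smul, coe_coordS_apply, coe_pdS_apply, neg_neg,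
    map_neg, coe_postcomp_apply]
  simp [UniformConvergenceCLM.sum_apply, sub_eq_add_neg]

end FourierSide

/-! ### Coordinates (x, τ) and restriction of equations to lines -/

section FullSpace

variable {d p : ℕ}

/-- The homeomorphism `(x', t) ↦ (x', t)` of `ℝᵈ × ℝ` with `ℝ^{d+1}`. -/
def liftHomeo (d : ℕ) : Space d × ℝ ≃ₜ Space (d + 1) where
  toFun z := lift z.1 z.2
  invFun ξ := (WithLp.toLp 2 fun i => ξ i.castSucc, ξ (Fin.last d))
  left_inv z := by ext <;> simp
  right_inv ξ := by
    ext i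
    refine Fin.lastCases ?_ (fun j => ?_) i <;> simp
  continuous_toFun := by
    refine (PiLp.continuous_toLp 2 _).comp (continuous_pi fun i => ?_)
    refine Fin.lastCases ?_ (fun j => ?_) i
    · simpa using continuous_snd
    · simp only [Fin.snoc_castSucc]
      exact (EuclideanSpace.proj j : Space d →L[ℝ] ℝ).continuous.comp continuous_fst
  continuous_invFun := by
    refine Continuous.prodMk ((PiLp.continuous_toLp 2 _).comp (continuous_pi fun i => ?_)) ?_
    · exact (EuclideanSpace.proj i.castSucc : Space (d + 1) →L[ℝ] ℝ).continuous
    · exact (EuclideanSpace.proj (Fin.last d) : Space (d + 1) →L[ℝ] ℝ).continuous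

lemma measurePreserving_lift (d : ℕ) :
    MeasurePreserving (fun z : Space d × ℝ => lift z.1 z.2) (volume.prod volume) volume := by
  have h1 := (MeasurePreserving.id (volume : Measure ℝ)).prod (PiLp.volume_preserving_ofLp (Fin d))
  have h2 := h1.comp (Measure.measurePreserving_swap (μ := (volume : Measure (Space d)))
    (ν := (volume : Measure ℝ)))
  have h3 := (volume_preserving_piFinSuccAbove (fun _ : Fin (d + 1) => ℝ) (Fin.last d)).symm
  have h4 := (PiLp.volume_preserving_toLp (Fin (d + 1))).comp (h3.comp h2)
  refine h4.congr (liftHomeo d).continuous.measurable (Filter.Eventually.of_forall fun z => ?_)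
  ext i
  refine Fin.lastCases ?_ (fun j => ?_) i
  · simp [MeasurableEquiv.piFinSuccAbove, lift]
  · simp [MeasurableEquiv.piFinSuccAbove, lift]

lemma measurableEmbedding_lift (d : ℕ) :
    MeasurableEmbedding (fun z : Space d × ℝ => lift z.1 z.2) :=
  (liftHomeo d).measurableEmbedding

lemma integral_lift {F : Type*} [NormedAddCommGroup F] [NormedSpace ℝ F] (g : Space (d + 1) → F) :
    ∫ ξ, g ξ = ∫ z : Space d × ℝ, g (lift z.1 z.2) ∂(volume.prod volume) :=
  ((measurePreserving_lift d).integral_comp (measurableEmbedding_lift d) g).symm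

lemma integrable_lift {F : Type*} [NormedAddCommGroup F] {g : Space (d + 1) → F} :
    Integrable (fun z : Space d × ℝ => g (lift z.1 z.2)) (volume.prod volume) ↔ Integrable g :=
  (measurePreserving_lift d).integrable_comp_emb (measurableEmbedding_lift d)

lemma ae_lift {P : Space (d + 1) → Prop} (h : ∀ᵐ ξ, P ξ) :
    ∀ᵐ x : Space d, ∀ᵐ τ : ℝ, P (lift x τ) :=
  Measure.ae_ae_of_ae_prod ((measurePreserving_lift d).quasiMeasurePreserving.ae h)

lemma locallyIntegrable_lift {F : Type*} [NormedAddCommGroup F] {g : Space (d + 1) → F}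
    (hg : LocallyIntegrable g volume) :
    LocallyIntegrable (fun z : Space d × ℝ => g (lift z.1 z.2)) (volume.prod volume) := by
  rw [locallyIntegrable_iff] at hg ⊢
  intro K hK
  have h1 := hg _ (hK.image (liftHomeo d).continuous)
  have h2 := ((measurePreserving_lift d).integrableOn_image (measurableEmbedding_lift d)).1 h1
  exact h2

/-- The form of `deltaHat` on the lines over the points of `ℝᵈ`. -/
lemma deltaHat_lift (a : ℝ) (η : 𝓢(Space (d + 1), Form (d + 1) p)) (x : Space d) (τ : ℝ) :
    deltaHat a η (lift x τ) =
      ((‖x‖ ^ 2 + τ ^ 2 : ℝ) : ℂ) • pdS (Fin.last d) (pdS (Fin.last d) η) (lift x τ) +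
      (((4 - a) * τ : ℝ) : ℂ) • pdS (Fin.last d) η (lift x τ) +
      ((2 - a : ℝ) : ℂ) • η (lift x τ) - (2 : ℂ) • bOp p x (pdS (Fin.last d) η (lift x τ)) -
      (((d + 1 : ℕ) : ℂ) - 2 * (p : ℂ)) • nOp d p (η (lift x τ)) := by
  have h : ∑ j, pdS (Fin.last d) (pdS (Fin.last d) (coordS j (coordS j η))) (lift x τ) =
      ((‖x‖ ^ 2 + τ ^ 2 : ℝ) : ℂ) • pdS (Fin.last d) (pdS (Fin.last d) η) (lift x τ) +
      ((4 * τ : ℝ) : ℂ) • pdS (Fin.last d) η (lift x τ) + (2 : ℂ) • η (lift x τ) := by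
    rw [Fin.sum_univ_castSucc]
    simp only [pdS_coordS_castSucc, pdS_coordS_last, map_add, SchwartzMap.add_apply, coordS_apply,
      lift_castSucc, lift_last, smul_smul, smul_add]
    rw [← Finset.sum_smul, EuclideanSpace.real_norm_sq_eq]
    push_cast
    simp only [sq]
    module
  rw [deltaHat]
  simp only [SchwartzMap.sub_apply, SchwartzMap.smul_apply, SchwartzMap.sum_apply,
    SchwartzMap.postcompCLM_apply, pdS_coordS_castSucc, pdS_coordS_last, SchwartzMap.add_apply,
    coordS_apply, lift_castSucc, lift_last, map_smul, h, bOp_eq_sum]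
  push_cast
  module

lemma locallyIntegrable_bOp {G : Space d × ℝ → Form (d + 1) p}
    (hG : LocallyIntegrable G (volume.prod volume)) :
    LocallyIntegrable (fun z => bOp p z.1 (G z)) (volume.prod volume) := by
  -- B depends linearly on x, so it is a sum of continuous coordinate functions times fixed
  -- operators, each preserving local integrability.
  have h : (fun z : Space d × ℝ => bOp p z.1 (G z)) =
      ∑ j, fun z => (z.1 j) • bJ p j (G z) := by
    funext z
    rw [Finset.sum_apply, bOp_eq_sum]
    rfl
  rw [h]
  refine locallyIntegrable_finset_sum' _ fun j _ => ?_
  exact (locallyIntegrable_clm ((bJ p j).restrictScalars ℝ) hG).continuous_smul (by fun_prop)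

/-- Weak solutions on the full space restrict to classical solutions on almost every line. -/
lemma ae_fiber_classical {g : Space (d + 1) → Form (d + 1) p} (hg : LocallyIntegrable g volume)
    (c : ℝ) (M : Form (d + 1) p →L[ℂ] Form (d + 1) p)
    (h : ∀ α : Space d → ℝ, ContDiff ℝ (⊤ : ℕ∞) α → HasCompactSupport α →
      ∀ β : ℝ → ℝ, ContDiff ℝ (⊤ : ℕ∞) β → HasCompactSupport β →
      ∫ z : Space d × ℝ, α z.1 • (deriv (deriv β) z.2 • (‖z.1‖ ^ 2 + z.2 ^ 2) • g (lift z.1 z.2) +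
        deriv β z.2 • ((c * z.2) • g (lift z.1 z.2) + (2 : ℂ) • bOp p z.1 (g (lift z.1 z.2))) +
        β z.2 • -M (g (lift z.1 z.2))) ∂(volume.prod volume) = 0) :
    ∀ᵐ x : Space d, x ≠ 0 → ∃ V₀ V₁ V₂ : ℝ → Form (d + 1) p,
      (fun τ => g (lift x τ)) =ᵐ[volume] V₀ ∧ (∀ τ, HasDerivAt V₀ (V₁ τ) τ) ∧
      (∀ τ, HasDerivAt V₁ (V₂ τ) τ) ∧ Continuous V₂ ∧
      ∀ τ, ((‖x‖ ^ 2 + τ ^ 2 : ℝ) : ℂ) • V₂ τ + (((4 - c) * τ : ℝ) : ℂ) • V₁ τ +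
        ((2 - c : ℝ) : ℂ) • V₀ τ - (2 : ℂ) • bOp p x (V₁ τ) - M (V₀ τ) = 0 := by
  have hG := locallyIntegrable_lift hg
  have hB := locallyIntegrable_bOp hG
  have hP : LocallyIntegrable (fun z : Space d × ℝ => (‖z.1‖ ^ 2 + z.2 ^ 2) • g (lift z.1 z.2))
      (volume.prod volume) := hG.continuous_smul (by fun_prop)
  have hQ1 : LocallyIntegrable (fun z : Space d × ℝ => (c * z.2) • g (lift z.1 z.2))
      (volume.prod volume) := hG.continuous_smul (by fun_prop)
  have hQ : LocallyIntegrable (fun z : Space d × ℝ => (c * z.2) • g (lift z.1 z.2) +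
      (2 : ℂ) • bOp p z.1 (g (lift z.1 z.2))) (volume.prod volume) := hQ1.add (hB.smul (2 : ℂ))
  have hR : LocallyIntegrable (fun z : Space d × ℝ => -M (g (lift z.1 z.2)))
      (volume.prod volume) := (locallyIntegrable_clm (M.restrictScalars ℝ) hG).neg
  have h1 := ae_fiber_weak (X := Space d) hP hQ hR h
  filter_upwards [h1, ae_locallyIntegrable_fiber hG] with x hx hloc hx0
  have hode : ∀ β : ℝ → ℝ, ContDiff ℝ (⊤ : ℕ∞) β → HasCompactSupport β →
      ∫ τ, (((‖x‖ ^ 2 + τ ^ 2) * deriv (deriv β) τ + c * τ * deriv β τ) • g (lift x τ) +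
        deriv β τ • (((2 : ℂ) • bOp p x).restrictScalars ℝ) (g (lift x τ)) +
        β τ • (-(M.restrictScalars ℝ)) (g (lift x τ))) = 0 := by
    intro β hβ hβc
    refine Eq.trans (integral_congr_ae (Filter.Eventually.of_forall fun τ => ?_)) (hx β hβ hβc)
    have e1 : (((2 : ℂ) • bOp p x).restrictScalars ℝ) (g (lift x τ)) =
      (2 : ℂ) • bOp p x (g (lift x τ)) := rfl
    have e2 : (-(M.restrictScalars ℝ)) (g (lift x τ)) = -M (g (lift x τ)) := rfl
    change _ = deriv (deriv β) τ • ((‖x‖ ^ 2 + τ ^ 2) • g (lift x τ)) +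
      deriv β τ • ((c * τ) • g (lift x τ) + (2 : ℂ) • bOp p x (g (lift x τ))) +
      β τ • -M (g (lift x τ))
    beta_reduce
    rw [e1, e2]
    module
  obtain ⟨V₀, V₁, V₂, e, d0, d1, c2, eq⟩ := exists_classical_solution hloc (norm_pos_iff.2 hx0) c
    _ _ hode
  refine ⟨V₀, V₁, V₂, e, d0, d1, c2, fun τ => ?_⟩
  have h2 := eq τ
  rw [← h2, Complex.coe_smul, Complex.coe_smul, Complex.coe_smul]
  exact sub_eq_add_neg _ _

/-- The function `α(x') β(x_n)` as a Schwartz function. -/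
lemma exists_tensor {α : Space d → ℝ} (hα : ContDiff ℝ (⊤ : ℕ∞) α) (hαc : HasCompactSupport α)
    {β : ℝ → ℝ} (hβ : ContDiff ℝ (⊤ : ℕ∞) β) (hβc : HasCompactSupport β) :
    ∃ ψ : 𝓢(Space (d + 1), ℂ), ∀ x τ, ψ (lift x τ) = ((α x * β τ : ℝ) : ℂ) ∧
      pdS (Fin.last d) ψ (lift x τ) = ((α x * deriv β τ : ℝ) : ℂ) ∧
      pdS (Fin.last d) (pdS (Fin.last d) ψ) (lift x τ) = ((α x * deriv (deriv β) τ : ℝ) : ℂ) := by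
  let f : Space (d + 1) → ℂ := fun ξ =>
    ((α (WithLp.toLp 2 fun i => ξ i.castSucc) * β (ξ (Fin.last d)) : ℝ) : ℂ)
  have hf : ContDiff ℝ (⊤ : ℕ∞) f := by
    refine Complex.ofRealCLM.contDiff.comp (ContDiff.mul (hα.comp ?_) (hβ.comp ?_))
    · refine (PiLp.contDiff_toLp).comp (contDiff_pi.2 fun i => ?_)
      exact (EuclideanSpace.proj i.castSucc : Space (d + 1) →L[ℝ] ℝ).contDiff
    · exact (EuclideanSpace.proj (Fin.last d) : Space (d + 1) →L[ℝ] ℝ).contDiff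
  have hfl : ∀ x τ, f (lift x τ) = ((α x * β τ : ℝ) : ℂ) := by
    intro x τ
    simp only [f, lift_castSucc, lift_last]
  have hfc : HasCompactSupport f := by
    refine HasCompactSupport.intro ((hαc.isCompact.prod hβc.isCompact).image
      (liftHomeo d).continuous) fun ξ hξ => ?_
    obtain ⟨x, τ, rfl⟩ := lift_init ξ
    rw [hfl]
    by_contra hne
    refine hξ ⟨(x, τ), ⟨subset_tsupport _ ?_, subset_tsupport _ ?_⟩, rfl⟩
    · intro h0; apply hne; simp [h0]
    · intro h0; apply hne; simp [h0]
  have hd : ∀ {γ : ℝ → ℝ}, ContDiff ℝ (⊤ : ℕ∞) γ → ∀ x τ,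
      HasDerivAt (fun τ => ((α x * γ τ : ℝ) : ℂ)) ((α x * deriv γ τ : ℝ) : ℂ) τ := by
    intro γ hγ x τ
    exact (((hγ.differentiable (by simp)).differentiableAt.hasDerivAt).const_mul
      (α x)).ofReal_comp
  have h1 : ∀ x τ, pdS (Fin.last d) (hfc.toSchwartzMap hf) (lift x τ) =
      ((α x * deriv β τ : ℝ) : ℂ) := by
    intro x τ
    refine (hasDerivAt_lift (hfc.toSchwartzMap hf) x τ).unique ?_
    have : (fun τ => (hfc.toSchwartzMap hf) (lift x τ)) = fun τ => ((α x * β τ : ℝ) : ℂ) :=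
      funext fun t => hfl x t
    rw [this]
    exact hd hβ x τ
  refine ⟨hfc.toSchwartzMap hf, fun x τ => ⟨hfl x τ, h1 x τ, ?_⟩⟩
  refine (hasDerivAt_lift (pdS (Fin.last d) (hfc.toSchwartzMap hf)) x τ).unique ?_
  rw [funext fun t => h1 x t]
  exact hd (contDiff_infty_iff_deriv.1 hβ).2 x τ

end FullSpace

/-! ### Distributional equations as line equations -/

section DistributionFibers

variable {d p : ℕ}

/-- The function `f` is integrable with integral `a`. -/
structure HasInt {X F : Type*} [MeasureSpace X] [NormedAddCommGroup F] [NormedSpace ℂ F]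
    (f : X → F) (a : F) : Prop where
  integrable : Integrable f
  eq : ∫ x, f x = a

namespace HasInt

variable {X F G : Type*} [MeasureSpace X] [NormedAddCommGroup F] [NormedSpace ℂ F]
  [NormedAddCommGroup G] [NormedSpace ℂ G] {f g : X → F} {a b : F}

lemma add (hf : HasInt f a) (hg : HasInt g b) : HasInt (fun x => f x + g x) (a + b) :=
  ⟨hf.1.add hg.1, by rw [integral_add hf.1 hg.1, hf.2, hg.2]⟩

lemma sub (hf : HasInt f a) (hg : HasInt g b) : HasInt (fun x => f x - g x) (a - b) :=
  ⟨hf.1.sub hg.1, by rw [integral_sub hf.1 hg.1, hf.2, hg.2]⟩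

lemma smul (c : ℂ) (hf : HasInt f a) : HasInt (fun x => c • f x) (c • a) :=
  ⟨hf.1.smul c, by rw [integral_smul, hf.2]⟩

lemma sum {ι : Type*} [Fintype ι] {f : ι → X → F} {a : ι → F} (h : ∀ i, HasInt (f i) (a i)) :
    HasInt (fun x => ∑ i, f i x) (∑ i, a i) :=
  ⟨integrable_finset_sum _ fun i _ => (h i).1, by
    rw [integral_finset_sum _ fun i _ => (h i).1]
    exact Finset.sum_congr rfl fun i _ => (h i).2⟩

lemma clm [CompleteSpace F] [CompleteSpace G] (A : F →L[ℂ] G) (hf : HasInt f a) :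
    HasInt (fun x => A (f x)) (A a) :=
  ⟨A.integrable_comp hf.1, by rw [A.integral_comp_comm hf.1, hf.2]⟩

end HasInt

lemma IsRep.hasInt {n : ℕ} {F : Type*} [NormedAddCommGroup F] [NormedSpace ℂ F]
    {T : 𝓢'(Space n, F)} {g : Space n → F} (h : IsRep T g) (ψ : 𝓢(Space n, ℂ)) :
    HasInt (fun x => ψ x • g x) (T ψ) :=
  ⟨(h.2 ψ).1, (h.2 ψ).2.symm⟩

/-- The Fourier transform of `Δ_{c,p} w`, in terms of the function `𝓕 w`. -/
lemma IsRep.exists_hasInt_deltaOp {w : 𝓢'(Space (d + 1), Form (d + 1) p)}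
    {g : Space (d + 1) → Form (d + 1) p} (hg : IsRep (𝓕 w) g) (c : ℝ)
    (ψ : 𝓢(Space (d + 1), ℂ)) :
    ∃ f : Space (d + 1) → Form (d + 1) p, HasInt f (𝓕 (deltaOp d p c w) ψ) ∧ ∀ x τ,
      f (lift x τ) =
        (((‖x‖ ^ 2 + τ ^ 2 : ℝ) : ℂ) * pdS (Fin.last d) (pdS (Fin.last d) ψ) (lift x τ)) •
          g (lift x τ) +
        (((c * τ : ℝ) : ℂ) * pdS (Fin.last d) ψ (lift x τ)) • g (lift x τ) +
        (2 * pdS (Fin.last d) ψ (lift x τ)) • bOp p x (g (lift x τ)) -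
        ((((d + 1 : ℕ) : ℂ) - 2 * (p : ℂ)) * ψ (lift x τ)) • nOp d p (g (lift x τ)) := by
  set ψ₁ := pdS (Fin.last d) ψ with hψ₁
  set ψ₂ := pdS (Fin.last d) ψ₁ with hψ₂
  let m : ℂ := ((d + 1 : ℕ) : ℂ) - 2 * (p : ℂ)
  have hI1 : HasInt (fun ξ => ∑ j, coordS j (coordS j ψ₂) ξ • g ξ)
      (∑ j, 𝓕 w (coordS j (coordS j ψ₂))) :=
    HasInt.sum (f := fun j ξ => coordS j (coordS j ψ₂) ξ • g ξ) fun j => hg.hasInt _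
  have hI2 : HasInt (fun ξ => (c : ℂ) • coordS (Fin.last d) ψ₁ ξ • g ξ)
      ((c : ℂ) • 𝓕 w (coordS (Fin.last d) ψ₁)) := (hg.hasInt _).smul _
  have hI3 : HasInt (fun ξ => ∑ j : Fin d, bJ p j (coordS j.castSucc ψ₁ ξ • g ξ))
      (∑ j : Fin d, bJ p j (𝓕 w (coordS j.castSucc ψ₁))) :=
    HasInt.sum (f := fun (j : Fin d) ξ => bJ p j (coordS j.castSucc ψ₁ ξ • g ξ))
      fun j => HasInt.clm (bJ p j) (hg.hasInt _)
  have hI4 : HasInt (fun ξ => nOp d p (ψ ξ • g ξ)) (nOp d p (𝓕 w ψ)) :=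
    HasInt.clm (nOp d p) (hg.hasInt _)
  refine ⟨_, (fourier_deltaOp c w ψ).symm ▸ ((hI1.add hI2).add (hI3.smul (2 : ℂ))).sub
    (hI4.smul m), fun x τ => ?_⟩
  beta_reduce
  generalize g (lift x τ) = v
  simp only [coordS_apply, lift_castSucc, lift_last, bOp_eq_sum, map_smul]
  generalize ψ₂ (lift x τ) = e₂, ψ₁ (lift x τ) = e₁, ψ (lift x τ) = e₀
  have hs : ∑ j : Fin (d + 1), ((lift x τ j : ℂ) * ((lift x τ j : ℂ) * e₂)) • v =
      (((‖x‖ ^ 2 + τ ^ 2 : ℝ) : ℂ) * e₂) • v := by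
    rw [← Finset.sum_smul, Fin.sum_univ_castSucc, EuclideanSpace.real_norm_sq_eq]
    congr 1
    simp only [lift_castSucc, lift_last]
    push_cast
    rw [add_mul, Finset.sum_mul]
    congr 1
    · exact Finset.sum_congr rfl fun j _ => by ring
    · ring
  have hb : ∑ j : Fin d, ((x j : ℂ) * e₁) • bJ p j v =
      e₁ • ∑ j : Fin d, (x j : ℂ) • bJ p j v := by
    rw [Finset.smul_sum]
    exact Finset.sum_congr rfl fun j _ => by rw [smul_smul, mul_comm]
  simp only [smul_eq_mul] at hs ⊢
  rw [hs, hb]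
  simp only [m]
  push_cast
  module

/-- The distributional equation `Δ_{c,p} w = κ w` becomes an ordinary differential equation on
almost every line, when `𝓕 w` is a function. -/
lemma ae_fiber_of_deltaOp_eq {w : 𝓢'(Space (d + 1), Form (d + 1) p)}
    {g : Space (d + 1) → Form (d + 1) p} (hg : IsRep (𝓕 w) g) {c : ℝ} {κ : ℂ}
    (h : deltaOp d p c w = κ • w) :
    ∀ᵐ x : Space d, x ≠ 0 → ∃ V₀ V₁ V₂ : ℝ → Form (d + 1) p,
      (fun τ => g (lift x τ)) =ᵐ[volume] V₀ ∧ Continuous V₂ ∧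
      FiberEq (((d + 1 : ℕ) : ℝ) - 2 * p) ((c - 2) / 2) x V₀ V₁ V₂
        (fun τ => (κ - ((2 - c : ℝ) : ℂ)) • V₀ τ) := by
  let m : ℂ := ((d + 1 : ℕ) : ℂ) - 2 * (p : ℂ)
  -- The eigenvalue is absorbed in the zero-order term. Afterwards 4 - c = 2 - 2σ fixes σ = (c -
  -- 2)/2, and the leftover (2 - c) V goes to the right-hand side.
  have key := ae_fiber_classical hg.locallyIntegrable c
    (m • nOp d p + κ • ContinuousLinearMap.id ℂ _) (fun α hα hαc β hβ hβc => ?_)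
  · filter_upwards [key] with x hx hx0
    obtain ⟨V₀, V₁, V₂, e, d0, d1, c2, eq⟩ := hx hx0
    refine ⟨V₀, V₁, V₂, e, c2, d0, d1, fun τ => ?_⟩
    have h1 := eq τ
    have hm : (((((d + 1 : ℕ) : ℝ) - 2 * p : ℝ)) : ℂ) = m := by simp [m]
    have hc : (2 - 2 * ((c - 2) / 2)) = 4 - c := by ring
    rw [hm, hc]
    simp only [_root_.add_apply, _root_.smul_apply, ContinuousLinearMap.id_apply] at h1
    refine sub_eq_zero.1 (Eq.trans ?_ h1)
    generalize m = M
    module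
  · obtain ⟨ψ, hψ⟩ := exists_tensor hα hαc hβ hβc
    obtain ⟨f, hf, hfl⟩ := hg.exists_hasInt_deltaOp c ψ
    rw [h, FourierTransform.fourier_smul] at hf
    have hI5 : HasInt (fun ξ => κ • ψ ξ • g ξ) ((κ • 𝓕 w) ψ) := (hg.hasInt ψ).smul κ
    have h2 := (hf.sub hI5).eq
    rw [sub_self, integral_lift] at h2
    rw [← h2]
    refine integral_congr_ae (Filter.Eventually.of_forall fun z => ?_)
    obtain ⟨x, τ⟩ := z
    obtain ⟨e0, e1, e2⟩ := hψ x τ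
    beta_reduce
    rw [hfl, e0, e1, e2]
    generalize g (lift x τ) = v
    simp only [_root_.add_apply, _root_.smul_apply, ContinuousLinearMap.id_apply]
    generalize bOp p x v = b
    simp only [← Complex.coe_smul, m]
    push_cast
    module

end DistributionFibers

/-! ### The dual function of an element of the Hilbert space -/

section Duality

open ComplexConjugate

variable {n d p : ℕ} {s : ℝ} {hs : |s| < (n : ℝ) / 2 - p}

lemma inner_symbol_right (ξ : Space n) (v w : Form n p) :
    inner ℂ (symbol n p s ξ v) w = inner ℂ v (symbol n p s ξ w) := by
  rw [← inner_symbol_symm, inner_conj_symm]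

/-- The function `|2πξ|^{2s} S(ξ) û(ξ)`, which represents `⟨·, u⟩` in the `L²` pairing. -/
def HSob.dualHat (u : HSob n p s hs) (ξ : Space n) : Form n p :=
  (wt (2 * s) ξ : ℂ) • symbol n p s ξ (u.hat ξ)

/-- The function S û is square integrable for the measure |2πξ|^{2s} dξ, which has temperate growth
since |2s| < n. Integration against this measure is a tempered distribution, and the weight becomes
part of the representing function. -/
lemma HSob.exists_dual (u : HSob n p s hs) :
    ∃ w : 𝓢'(Space n, Form n p), IsRep (𝓕 w) u.dualHat := by
  have hn := dim_pos hs
  have hr := range_two hs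
  have hT : (wtMeasure n (2 * s)).HasTemperateGrowth := temperate_wtMeasure hn hr.1 hr.2
  have hac : wtMeasure n (2 * s) ≪ volume := withDensity_absolutelyContinuous _ _
  have hm : AEStronglyMeasurable (fun ξ => symbol n p s ξ (u.hat ξ)) volume :=
    (ContinuousLinearMap.apply ℂ (Form n p)).flip.aestronglyMeasurable_comp₂
      (measurable_symbol n p s).aestronglyMeasurable u.isRep_hat.1
  have hw : AEStronglyMeasurable (fun ξ : Space n => (wt (2 * s) ξ : ℂ)) volume :=
    (Complex.measurable_ofReal.comp (measurable_wt _)).aestronglyMeasurable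
  have hk : MemLp (fun ξ => symbol n p s ξ (u.hat ξ)) 2 (wtMeasure n (2 * s)) := by
    rw [memLp_two_iff_integrable_sq_norm (hm.mono_ac hac), integrable_wtMeasure_real]
    refine ((memLp_two_iff_integrable_sq_norm u.memLp_symbol.1).1 u.memLp_symbol).congr ?_
    refine Filter.Eventually.of_forall fun ξ => ?_
    simp only [map_smul, norm_smul, Complex.norm_real, Real.norm_of_nonneg (wt_nonneg _ _),
      mul_pow, wt_sq]
  refine ⟨𝓕⁻ (Lp.toTemperedDistribution hk.toLp), ?_⟩
  rw [FourierTransform.fourier_fourierInv_eq]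
  refine ⟨hw.smul hm, fun ψ => ?_⟩
  have hcongr : (fun ξ => (wt (2 * s) ξ : ℂ) • (ψ ξ • symbol n p s ξ (u.hat ξ))) =
      fun ξ => ψ ξ • u.dualHat ξ := funext fun ξ => smul_comm _ _ _
  constructor
  · rw [← hcongr, ← integrable_wtMeasure]
    exact integrable_schwartz_smul hk ψ
  · rw [Lp.toTemperedDistribution_apply, ← hcongr, ← integral_wtMeasure]
    refine integral_congr_ae ?_
    filter_upwards [hk.coeFn_toLp] with ξ hξ
    rw [hξ]

/-- The conformally invariant inner product as an `L²` pairing. -/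
lemma HSob.hasInt_inner {v : HSob n p s hs} {η : Space n → Form n p} (hv : v.hat =ᵐ[volume] η)
    (u : HSob n p s hs) : HasInt (fun ξ => inner ℂ (η ξ) (u.dualHat ξ)) (inner ℂ v u) := by
  have h : (fun ξ => (((2 * Real.pi * ‖ξ‖) ^ (2 * s) : ℝ) : ℂ) *
      inner ℂ (symbol n p s ξ (v.hat ξ)) (u.hat ξ)) =ᵐ[volume]
      fun ξ => inner ℂ (η ξ) (u.dualHat ξ) := by
    filter_upwards [hv] with ξ hξ
    rw [hξ, HSob.dualHat, inner_smul_right, inner_symbol_right]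
    rfl
  exact ⟨(HSob.integrable_inner v u).congr h, by rw [HSob.inner_def, integral_congr_ae h]⟩

lemma HSob.hat_schwartz {v : HSob n p s hs} {φ : 𝓢(Space n, Form n p)}
    (hv : v.toDist = (φ : 𝓢'(Space n, Form n p))) :
    v.hat =ᵐ[volume] (𝓕 φ : 𝓢(Space n, Form n p)) := by
  refine v.isRep_hat.ae_eq ?_
  rw [hv, TemperedDistribution.fourier_toTemperedDistributionCLM_eq]
  exact IsRep.schwartz _

lemma HSob.hat_deltaMin {a : ℝ} {hs : |(2 - a) / 2| < ((d + 1 : ℕ) : ℝ) / 2 - p}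
    (v : (deltaMin d p a hs).domain) {φ : 𝓢(Space (d + 1), Form (d + 1) p)}
    (hv : (v : HSob (d + 1) p ((2 - a) / 2) hs).toDist = (φ : 𝓢'(Space (d + 1), Form (d + 1) p))) :
    (deltaMin d p a hs v).hat =ᵐ[volume] deltaHat a (𝓕 φ : 𝓢(Space (d + 1), Form (d + 1) p)) := by
  refine (deltaMin d p a hs v).isRep_hat.ae_eq ?_
  have h : (deltaMin d p a hs v).toDist =
      deltaOp d p a (v : HSob (d + 1) p ((2 - a) / 2) hs).toDist := rfl
  rw [h, hv, fourier_deltaOp_schwartz]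
  exact IsRep.schwartz _

/-- The Schwartz function `x ↦ ψ(x) v`. -/
def smulConst {F : Type*} [NormedAddCommGroup F] [NormedSpace ℂ F] (v : F) (ψ : 𝓢(Space n, ℂ)) :
    𝓢(Space n, F) :=
  SchwartzMap.postcompCLM (ContinuousLinearMap.toSpanSingleton ℂ v) ψ

lemma smulConst_apply {F : Type*} [NormedAddCommGroup F] [NormedSpace ℂ F] (v : F)
    (ψ : 𝓢(Space n, ℂ)) (x : Space n) : smulConst v ψ x = ψ x • v := by
  simp [smulConst]

lemma fourier_smulConst (v : Form n p) (ψ : 𝓢(Space n, ℂ)) :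
    𝓕 (smulConst v ψ) = smulConst v (𝓕 ψ) := by
  ext1 ξ
  rw [smulConst_apply, SchwartzMap.fourier_coe, SchwartzMap.fourier_coe]
  rw [Real.fourier_eq, Real.fourier_eq]
  simp only [smulConst_apply, smul_assoc, integral_smul_const, ← smul_assoc]

lemma pdS_lift_conj {ψ ψ' : 𝓢(Space (d + 1), ℂ)} (h : ∀ ξ, ψ' ξ = conj (ψ ξ)) (x : Space d)
    (τ : ℝ) : pdS (Fin.last d) ψ' (lift x τ) = conj (pdS (Fin.last d) ψ (lift x τ)) := by
  refine (hasDerivAt_lift ψ' x τ).unique ?_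
  have h1 := Complex.conjCLE.toContinuousLinearMap.hasFDerivAt.comp_hasDerivAt τ
    (hasDerivAt_lift ψ x τ)
  refine h1.congr_of_eventuallyEq (Filter.Eventually.of_forall fun t => ?_)
  simp [h]

lemma pdS_lift_smulConst (v : Form (d + 1) p) (ψ : 𝓢(Space (d + 1), ℂ)) :
    pdS (Fin.last d) (smulConst v ψ) = smulConst v (pdS (Fin.last d) ψ) := by
  ext1 ξ
  obtain ⟨x, τ, rfl⟩ := lift_init ξ
  refine (hasDerivAt_lift _ x τ).unique ?_
  simp only [smulConst_apply]
  exact (hasDerivAt_lift ψ x τ).smul_const v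

/-- Take χ'(x) to be the conjugate of χ(-x). The inner product is conjugate linear in the test form
while distributions pair linearly, and this exchange reconciles the two without leaving compact
support. -/
lemma exists_fourier_conj (χ : 𝓢(Space n, ℂ)) (hχ : HasCompactSupport χ) :
    ∃ χ' : 𝓢(Space n, ℂ), HasCompactSupport χ' ∧ ∀ ξ, 𝓕 χ' ξ = conj (𝓕 χ ξ) := by
  let c : 𝓢(Space n, ℂ) := SchwartzMap.postcompCLM (𝕜 := ℝ)
    (Complex.conjCLE.toContinuousLinearMap) χ
  let χ' : 𝓢(Space n, ℂ) := SchwartzMap.compCLMOfContinuousLinearEquiv ℂ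
    (LinearIsometryEquiv.neg ℝ (E := Space n)).toContinuousLinearEquiv c
  have hc : ∀ x, χ' x = conj (χ (-x)) := fun x => rfl
  refine ⟨χ', ?_, fun ξ => ?_⟩
  · have h1 : HasCompactSupport fun x => χ (-x) :=
      hχ.comp_homeomorph (Homeomorph.neg (Space n))
    exact h1.comp_left (g := conj) (map_zero _)
  · rw [SchwartzMap.fourier_coe, SchwartzMap.fourier_coe, Real.fourier_eq', Real.fourier_eq',
      ← integral_conj, ← integral_neg_eq_self]
    refine integral_congr_ae (Filter.Eventually.of_forall fun x => ?_)
    simp only [hc, smul_eq_mul, map_mul, ← Complex.exp_conj, Complex.conj_ofReal, Complex.conj_I,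
      neg_neg, inner_neg_left]
    congr 2
    push_cast
    ring

end Duality

/-! ### The adjoint equation and density of test forms -/

section DualEquation

open ComplexConjugate

variable {n d p : ℕ} {s : ℝ}

/-- The adjoint of i_{e_n} ε_x + ε_{e_n} i_x is i_x ε_{e_n} + ε_x i_{e_n}, and anticommutation,
valid as x ⊥ e_n, makes this -B. -/
lemma inner_bOp (x : Space d) (v w : Form (d + 1) p) :
    inner ℂ (bOp p x v) w = -inner ℂ v (bOp p x w) := by
  rw [inner_eq_inner_incl, inner_eq_inner_incl v, incl_bOp, incl_bOp, inner_add_left,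
    inner_add_right, inner_intMul, inner_extVec, inner_extMul, inner_intVec,
    eq_sub_of_add_eq (intVec_extMul _ _ _), eq_sub_of_add_eq (intMul_extVec _ _ _), lift_last]
  simp only [inner_sub_right, Complex.ofReal_zero, zero_smul, inner_zero_right]
  ring

lemma inner_nOp (v w : Form (d + 1) p) : inner ℂ (nOp d p v) w = inner ℂ v (nOp d p w) := by
  rw [inner_eq_inner_incl, inner_eq_inner_incl v, incl_nOp, incl_nOp, inner_extMul, inner_intMul]

lemma eq_zero_of_pairing {w : 𝓢'(Space n, Form n p)}
    (h : ∀ χ : 𝓢(Space n, ℂ), HasCompactSupport χ → ∀ v : Form n p,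
      inner ℂ v (w (𝓕 χ)) = 0) : w = 0 := by
  have h1 : (w : 𝓢(Space n, ℂ) →L[ℂ] Form n p) = 0 :=
    eq_zero_of_fourier_compactSupport fun χ hχ => ext_inner_left ℂ fun v => by
      rw [inner_zero_right]; exact h χ hχ v
  exact h1

/-- The element of `Ḣ^{s,p}(ℝⁿ)` given by a Schwartz form. -/
def HSob.ofSchwartz (hs : |s| < (n : ℝ) / 2 - p) (φ : 𝓢(Space n, Form n p)) : HSob n p s hs :=
  ⟨(φ : 𝓢'(Space n, Form n p)), schwartz_mem hs φ⟩

lemma HSob.ofSchwartz_mem (hs : |s| < (n : ℝ) / 2 - p) {χ : 𝓢(Space n, ℂ)}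
    (hχ : HasCompactSupport χ) (v : Form n p) :
    HSob.ofSchwartz hs (smulConst v χ) ∈ testForms n p hs := by
  refine ⟨_, ?_, rfl⟩
  have h : (smulConst v χ : Space n → Form n p) = fun x => χ x • v :=
    funext fun x => smulConst_apply v χ x
  rw [h]
  exact hχ.smul_right

/-- A form orthogonal to all smooth compactly supported forms vanishes. -/
lemma HSob.eq_zero_of_orthogonal {hs : |s| < (n : ℝ) / 2 - p} {u : HSob n p s hs}
    (h : ∀ φ ∈ testForms n p hs, inner ℂ φ u = 0) : u = 0 := by
  obtain ⟨w, hw⟩ := u.exists_dual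
  have hw0 : 𝓕 w = 0 := by
    refine eq_zero_of_pairing fun χ hχ v => ?_
    obtain ⟨χ', hχ', hc⟩ := exists_fourier_conj χ hχ
    have h1 := HSob.hasInt_inner (HSob.hat_schwartz
      (v := HSob.ofSchwartz hs (smulConst v χ')) rfl) u
    rw [h _ (HSob.ofSchwartz_mem hs hχ' v)] at h1
    have h2 := HasInt.clm (innerSL ℂ v) (hw.hasInt (𝓕 χ))
    refine h2.eq.symm.trans (Eq.trans ?_ h1.eq)
    refine integral_congr_ae (Filter.Eventually.of_forall fun ξ => ?_)
    simp only [fourier_smulConst, smulConst_apply, hc, inner_smul_left, Complex.conj_conj,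
      innerSL_apply_apply, inner_smul_right]
  have h3 : u.dualHat =ᵐ[volume] 0 := by
    rw [hw0] at hw
    exact hw.ae_eq_zero
  have h4 := (HSob.hasInt_inner (v := u) (Filter.EventuallyEq.refl _ _) u).eq
  rw [integral_congr_ae (g := fun _ => (0 : ℂ)) (h3.mono fun ξ hξ => by simp [hξ]),
    integral_zero] at h4
  exact inner_self_eq_zero.1 h4.symm

lemma dense_testForms (hs : |s| < (n : ℝ) / 2 - p) :
    Dense (testForms n p hs : Set (HSob n p s hs)) := by
  rw [Submodule.dense_iff_topologicalClosure_eq_top, Submodule.topologicalClosure_eq_top_iff,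
    Submodule.eq_bot_iff]
  intro u hu
  exact HSob.eq_zero_of_orthogonal fun φ hφ => (Submodule.mem_orthogonal _ _).1 hu φ hφ

variable {a : ℝ} {hs : |(2 - a) / 2| < ((d + 1 : ℕ) : ℝ) / 2 - p}

/-- The equation `T* u = z u` for the dual distribution. -/
lemma deltaOp_dual_eq {z : ℂ} {u : HSob (d + 1) p ((2 - a) / 2) hs}
    (h : ∀ φ : (deltaMin d p a hs).domain,
      inner ℂ (deltaMin d p a hs φ) u = z * inner ℂ (φ : HSob (d + 1) p ((2 - a) / 2) hs) u)
    {w : 𝓢'(Space (d + 1), Form (d + 1) p)} (hw : IsRep (𝓕 w) u.dualHat) :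
    deltaOp d p (4 - a) w = (z - ((2 - a : ℝ) : ℂ)) • w := by
  -- In the flat pairing the transpose of the Fourier-side operator with parameter a is the one with
  -- parameter 4 - a, up to the constant 2 - a. The sign from moving B across is the sign that
  -- integration by parts would give, so the integrands agree pointwise.
  have key : 𝓕 (deltaOp d p (4 - a) w) - (z - ((2 - a : ℝ) : ℂ)) • 𝓕 w = 0 := by
    refine eq_zero_of_pairing fun χ hχ v => ?_
    obtain ⟨χ', hχ', hc⟩ := exists_fourier_conj χ hχ
    obtain ⟨f, hf, hfl⟩ := hw.exists_hasInt_deltaOp (4 - a) (𝓕 χ)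
    let φ : (deltaMin d p a hs).domain := ⟨_, HSob.ofSchwartz_mem hs hχ' v⟩
    have h1 := HSob.hasInt_inner (HSob.hat_schwartz
      (v := HSob.ofSchwartz hs (smulConst v χ')) rfl) u
    have h2 := HSob.hasInt_inner (HSob.hat_deltaMin φ rfl) u
    have h3 := HasInt.clm (innerSL ℂ v) (hf.sub ((hw.hasInt (𝓕 χ)).smul (z - ((2 - a : ℝ) : ℂ))))
    have h4 := (h2.sub (h1.smul z)).eq
    rw [h φ, smul_eq_mul, sub_self] at h4
    refine h3.eq.symm.trans (Eq.trans ?_ h4)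
    refine integral_congr_ae (Filter.Eventually.of_forall fun ξ => ?_)
    obtain ⟨x, τ, rfl⟩ := lift_init ξ
    have e1 := pdS_lift_conj hc x τ
    have e2 := pdS_lift_conj (ψ := pdS (Fin.last d) (𝓕 χ)) (ψ' := pdS (Fin.last d) (𝓕 χ'))
      (fun ξ => by obtain ⟨x, τ, rfl⟩ := lift_init ξ; exact pdS_lift_conj hc x τ) x τ
    beta_reduce
    rw [hfl, fourier_smulConst, deltaHat_lift, pdS_lift_smulConst, pdS_lift_smulConst]
    simp only [smulConst_apply, e1, e2, hc, map_smul, innerSL_apply_apply, inner_sub_left,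
      inner_add_left, inner_smul_left, inner_sub_right, inner_add_right, inner_smul_right,
      Complex.conj_conj, Complex.conj_ofReal, inner_bOp, inner_nOp, map_sub, map_mul, map_natCast,
      Complex.conj_ofNat, smul_eq_mul]
    push_cast
    ring
  have h2 := congrArg (fun T : 𝓢'(Space (d + 1), Form (d + 1) p) => 𝓕⁻ T) (sub_eq_zero.1 key)
  rw [← FourierTransform.fourier_smul] at h2
  simpa using h2

end DualEquation

/-! ### Inner products as integrals over lines -/

section FiberIntegrals

variable {n d p : ℕ} {s : ℝ}

lemma abs_le_norm_lift (x : Space d) (τ : ℝ) : |τ| ≤ ‖lift x τ‖ := by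
  refine abs_le_of_sq_le_sq ?_ (norm_nonneg _)
  rw [norm_lift_sq]; nlinarith [sq_nonneg ‖x‖]

lemma schwartz_lift_bound {F : Type*} [NormedAddCommGroup F] [NormedSpace ℝ F]
    (η : 𝓢(Space (d + 1), F)) (N : ℕ) :
    ∃ C, 0 ≤ C ∧ ∀ x τ, (1 + |τ|) ^ N * ‖η (lift x τ)‖ ≤ C := by
  refine ⟨2 ^ N * (Finset.Iic (N, 0)).sup (fun m => SchwartzMap.seminorm ℝ m.1 m.2) η,
    by positivity, fun x τ => ?_⟩
  have h := SchwartzMap.one_add_le_sup_seminorm_apply (𝕜 := ℝ) (m := (N, 0)) (k := N) (n := 0)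
    le_rfl le_rfl η (lift x τ)
  rw [norm_iteratedFDeriv_zero] at h
  refine le_trans ?_ h
  gcongr
  exact abs_le_norm_lift x τ

lemma integrable_of_line_bound {F : Type*} [NormedAddCommGroup F] {f : ℝ → F}
    (hf : AEStronglyMeasurable f volume) {C : ℝ} (h : ∀ τ, (1 + |τ|) ^ 2 * ‖f τ‖ ≤ C) :
    Integrable f := by
  have h1 : Integrable fun τ : ℝ => (1 + ‖τ‖) ^ (-(2 : ℝ)) :=
    integrable_one_add_norm (by simp)
  refine (h1.const_mul C).mono' hf (Filter.Eventually.of_forall fun τ => ?_)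
  rw [Real.rpow_neg (by positivity), Real.rpow_two, Real.norm_eq_abs, ← div_eq_mul_inv,
    le_div_iff₀ (by positivity), mul_comm]
  exact h τ

lemma rpow_sq_add_sq_le {ρ : ℝ} (hρ : 0 < ρ) (q : ℝ) :
    ∃ K : ℝ, ∃ N : ℕ, 0 ≤ K ∧ ∀ τ : ℝ, (ρ ^ 2 + τ ^ 2) ^ q ≤ K * (1 + |τ|) ^ (2 * N) := by
  rcases le_or_gt q 0 with hq | hq
  · refine ⟨(ρ ^ 2) ^ q, 0, by positivity, fun τ => ?_⟩
    rw [mul_zero, pow_zero, mul_one]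
    exact Real.rpow_le_rpow_of_nonpos (by positivity) (by nlinarith [sq_nonneg τ]) hq
  · obtain ⟨N, hN⟩ := exists_nat_ge q
    refine ⟨((ρ + 1) ^ 2) ^ q, N, by positivity, fun τ => ?_⟩
    have h0 := abs_nonneg τ
    have h1 : ρ ^ 2 + τ ^ 2 ≤ (ρ + 1) ^ 2 * (1 + |τ|) ^ 2 := by
      rw [← sq_abs τ, ← mul_pow]
      have h2 : 0 ≤ ρ * |τ| := by positivity
      nlinarith [sq_nonneg (ρ + 1 + |τ|), mul_nonneg h2 h2, mul_nonneg h2 h0, mul_nonneg h2 hρ.le]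
    refine (Real.rpow_le_rpow (by positivity) h1 hq.le).trans ?_
    rw [Real.mul_rpow (by positivity) (by positivity), pow_mul, ← Real.rpow_natCast _ N]
    refine mul_le_mul_of_nonneg_left ?_ (by positivity)
    exact Real.rpow_le_rpow_of_exponent_le (by nlinarith) hN

lemma integrable_schwartz_lift (η : 𝓢(Space (d + 1), Form (d + 1) p)) {x : Space d} (hx : x ≠ 0)
    (q : ℝ) : Integrable fun τ : ℝ => (‖x‖ ^ 2 + τ ^ 2) ^ q * ‖η (lift x τ)‖ ^ 2 := by
  have hρ := norm_pos_iff.2 hx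
  obtain ⟨K, N, hK, h1⟩ := rpow_sq_add_sq_le hρ q
  obtain ⟨C, hC, h2⟩ := schwartz_lift_bound η (N + 1)
  have hc : Continuous fun τ : ℝ => η (lift x τ) :=
    η.continuous.comp ((liftHomeo d).continuous.comp (by fun_prop : Continuous fun τ => (x, τ)))
  refine integrable_of_line_bound (C := K * C ^ 2)
    ((continuous_rpow_sq_add_sq hρ q).mul (hc.norm.pow 2)).aestronglyMeasurable fun τ => ?_
  rw [Real.norm_of_nonneg (by positivity)]
  have h3 := pow_le_pow_left₀ (by positivity) (h2 x τ) 2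
  calc (1 + |τ|) ^ 2 * ((‖x‖ ^ 2 + τ ^ 2) ^ q * ‖η (lift x τ)‖ ^ 2)
      ≤ (1 + |τ|) ^ 2 * ((K * (1 + |τ|) ^ (2 * N)) * ‖η (lift x τ)‖ ^ 2) := by
        gcongr; exact h1 τ
    _ = K * ((1 + |τ|) ^ (N + 1) * ‖η (lift x τ)‖) ^ 2 := by ring
    _ ≤ K * C ^ 2 := mul_le_mul_of_nonneg_left h3 hK

lemma energyFinite_schwartz (η : 𝓢(Space (d + 1), Form (d + 1) p)) {x : Space d} (hx : x ≠ 0)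
    (σ : ℝ) : EnergyFinite σ ‖x‖ (fun τ => η (lift x τ))
      (fun τ => pdS (Fin.last d) η (lift x τ)) :=
  ⟨integrable_schwartz_lift η hx _, integrable_schwartz_lift _ hx _⟩

/-- The Fourier transform itself satisfies the line equation with σ = -(2 - a)/2, since 2 - 2σ = 4 -
a. The zero-order term (2 - a) η is moved to the right. The dual function has the opposite σ. -/
lemma fiberEq_schwartz (a : ℝ) (η : 𝓢(Space (d + 1), Form (d + 1) p)) (x : Space d) :
    FiberEq (((d + 1 : ℕ) : ℝ) - 2 * p) (-((2 - a) / 2)) x (fun τ => η (lift x τ))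
      (fun τ => pdS (Fin.last d) η (lift x τ))
      (fun τ => pdS (Fin.last d) (pdS (Fin.last d) η) (lift x τ))
      (fun τ => (deltaHat a η - ((2 - a : ℝ) : ℂ) • η) (lift x τ)) := by
  refine ⟨fun τ => hasDerivAt_lift η x τ, fun τ => hasDerivAt_lift _ x τ, fun τ => ?_⟩
  rw [SchwartzMap.sub_apply, SchwartzMap.smul_apply, deltaHat_lift,
    show 2 - 2 * -((2 - a) / 2) = 4 - a by ring]
  push_cast
  module

lemma wt_lift (t : ℝ) (x : Space d) (τ : ℝ) :
    wt t (lift x τ) = (2 * Real.pi) ^ t * (‖x‖ ^ 2 + τ ^ 2) ^ (t / 2) := by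
  rw [wt, Real.mul_rpow (by positivity) (norm_nonneg _), ← norm_lift_sq, ← Real.rpow_natCast,
    ← Real.rpow_mul (norm_nonneg _)]
  congr 2
  push_cast
  ring

lemma integral_fibers {F : Type*} [NormedAddCommGroup F] [NormedSpace ℂ F]
    {f : Space (d + 1) → F} {a : F} (h : HasInt f a) : ∫ x, ∫ τ, f (lift x τ) = a := by
  rw [← h.eq, integral_lift, integral_prod _ (integrable_lift.2 h.integrable)]

lemma ae_integrable_fiber {F : Type*} [NormedAddCommGroup F] {f : Space (d + 1) → F}
    (h : Integrable f) : ∀ᵐ x : Space d, Integrable fun τ => f (lift x τ) :=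
  (integrable_lift.2 h).prod_right_ae

variable {hs : |s| < ((d + 1 : ℕ) : ℝ) / 2 - p}

lemma HSob.ae_integrable_hat (u : HSob (d + 1) p s hs) : ∀ᵐ x : Space d,
    Integrable fun τ => (‖x‖ ^ 2 + τ ^ 2) ^ s * ‖u.hat (lift x τ)‖ ^ 2 := by
  have h := (memLp_iff u.isRep_hat.1).2 u.memLp_hat
  filter_upwards [ae_integrable_fiber h] with x hx
  refine (hx.const_mul (((2 * Real.pi) ^ (2 * s))⁻¹)).congr
    (Filter.Eventually.of_forall fun τ => ?_)
  have h0 : (2 * Real.pi) ^ (2 * s) ≠ 0 := (Real.rpow_pos_of_pos (by positivity) _).ne'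
  beta_reduce
  rw [wt_lift, mul_div_cancel_left₀ s two_ne_zero, mul_assoc, inv_mul_cancel_left₀ h0]

/-- The symbol is bounded, and the weight r^{-2s} times the square of r^{2s} is again r^{2s}. Finite
norm thus becomes square integrability of the dual function for the inverse weight. -/
lemma HSob.ae_integrable_dualHat (u : HSob (d + 1) p s hs) : ∀ᵐ x : Space d, x ≠ 0 →
    Integrable fun τ => (‖x‖ ^ 2 + τ ^ 2) ^ (-s) * ‖u.dualHat (lift x τ)‖ ^ 2 := by
  obtain ⟨w, hw⟩ := u.exists_dual
  obtain ⟨C, hC⟩ := symbol_bounded (d + 1) p s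
  have hC0 : 0 ≤ C := (norm_nonneg _).trans (hC 0)
  have h := (memLp_iff u.isRep_hat.1).2 u.memLp_hat
  have hm : AEStronglyMeasurable (fun z : Space d × ℝ => u.dualHat (lift z.1 z.2))
      (volume.prod volume) :=
    hw.1.comp_quasiMeasurePreserving (measurePreserving_lift d).quasiMeasurePreserving
  filter_upwards [ae_integrable_fiber h, hm.prodMk_left] with x hx hmx hx0
  have hρ := norm_pos_iff.2 hx0
  refine (hx.const_mul (((2 * Real.pi) ^ (2 * s)) * C ^ 2)).mono' ?_
    (Filter.Eventually.of_forall fun τ => ?_)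
  · exact (continuous_rpow_sq_add_sq hρ _).aestronglyMeasurable.mul (hmx.norm.pow 2)
  · have hr : 0 < ‖x‖ ^ 2 + τ ^ 2 := by positivity
    have h1 : ‖symbol (d + 1) p s (lift x τ) (u.hat (lift x τ))‖ ≤ C * ‖u.hat (lift x τ)‖ :=
      (symbol (d + 1) p s _).le_of_opNorm_le (hC _) _
    have h2 : (‖x‖ ^ 2 + τ ^ 2) ^ (-s) * (‖x‖ ^ 2 + τ ^ 2) ^ s = 1 := by
      rw [← Real.rpow_add hr]; simp
    rw [Real.norm_of_nonneg (by positivity), HSob.dualHat, norm_smul, Complex.norm_real,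
      Real.norm_of_nonneg (wt_nonneg _ _), wt_lift, mul_div_cancel_left₀ s two_ne_zero]
    calc _ = ((‖x‖ ^ 2 + τ ^ 2) ^ (-s) * (‖x‖ ^ 2 + τ ^ 2) ^ s) * ((2 * Real.pi) ^ (2 * s)) ^ 2 *
          (‖x‖ ^ 2 + τ ^ 2) ^ s * ‖symbol (d + 1) p s (lift x τ) (u.hat (lift x τ))‖ ^ 2 := by ring
      _ ≤ ((‖x‖ ^ 2 + τ ^ 2) ^ (-s) * (‖x‖ ^ 2 + τ ^ 2) ^ s) * ((2 * Real.pi) ^ (2 * s)) ^ 2 *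
          (‖x‖ ^ 2 + τ ^ 2) ^ s * (C * ‖u.hat (lift x τ)‖) ^ 2 := by gcongr
      _ = _ := by rw [h2]; ring

/-- `⟨v₁, v₂⟩ = ⟨u₁, u₂⟩` when the two sides agree on almost every line. -/
lemma HSob.inner_eq_of_fibers {v₁ v₂ u₁ u₂ : HSob (d + 1) p s hs}
    (h : ∀ᵐ x : Space d, ∫ τ, (((‖x‖ ^ 2 + τ ^ 2) ^ s : ℝ) : ℂ) *
      (inner ℂ (symbol (d + 1) p s (lift x τ) (v₁.hat (lift x τ))) (v₂.hat (lift x τ)) -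
        inner ℂ (symbol (d + 1) p s (lift x τ) (u₁.hat (lift x τ))) (u₂.hat (lift x τ))) = 0) :
    inner ℂ v₁ v₂ = inner ℂ u₁ u₂ := by
  have h1 : ∀ v w : HSob (d + 1) p s hs, HasInt (fun ξ => (wt (2 * s) ξ : ℂ) *
      inner ℂ (symbol (d + 1) p s ξ (v.hat ξ)) (w.hat ξ)) (inner ℂ v w) :=
    fun v w => ⟨HSob.integrable_inner v w, rfl⟩
  have h2 := integral_fibers ((h1 v₁ v₂).sub (h1 u₁ u₂))
  rw [← sub_eq_zero, ← h2]
  refine integral_eq_zero_of_ae ?_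
  filter_upwards [h] with x hx
  have h3 : ∀ τ, (wt (2 * s) (lift x τ) : ℂ) *
      inner ℂ (symbol (d + 1) p s (lift x τ) (v₁.hat (lift x τ))) (v₂.hat (lift x τ)) -
      (wt (2 * s) (lift x τ) : ℂ) *
      inner ℂ (symbol (d + 1) p s (lift x τ) (u₁.hat (lift x τ))) (u₂.hat (lift x τ)) =
      (((2 * Real.pi) ^ (2 * s) : ℝ) : ℂ) * ((((‖x‖ ^ 2 + τ ^ 2) ^ s : ℝ) : ℂ) *
      (inner ℂ (symbol (d + 1) p s (lift x τ) (v₁.hat (lift x τ))) (v₂.hat (lift x τ)) -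
        inner ℂ (symbol (d + 1) p s (lift x τ) (u₁.hat (lift x τ))) (u₂.hat (lift x τ)))) := by
    intro τ
    rw [wt_lift, mul_div_cancel_left₀ s two_ne_zero]
    push_cast
    ring
  simp only [h3]
  rw [integral_const_mul, hx, mul_zero]
  rfl

/-- The symmetry of `Δ_{a,p}` against solutions on a line. -/
lemma FiberEq.integral_symbol_deltaHat {a : ℝ} {x : Space d} {V₀ V₁ V₂ W : ℝ → Form (d + 1) p}
    (hx : x ≠ 0)
    (h : FiberEq (((d + 1 : ℕ) : ℝ) - 2 * p) (-((2 - a) / 2)) x V₀ V₁ V₂ W)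
    (eV : EnergyFinite (-((2 - a) / 2)) ‖x‖ V₀ V₁) (mW : AEStronglyMeasurable W volume)
    (iW : Integrable fun τ => (‖x‖ ^ 2 + τ ^ 2) ^ ((2 - a) / 2) * ‖W τ‖ ^ 2)
    (η : 𝓢(Space (d + 1), Form (d + 1) p)) :
    ∫ τ, (((‖x‖ ^ 2 + τ ^ 2) ^ ((2 - a) / 2) : ℝ) : ℂ) *
      (inner ℂ (symbol (d + 1) p ((2 - a) / 2) (lift x τ) (W τ + ((2 - a : ℝ) : ℂ) • V₀ τ))
          (η (lift x τ)) -
        inner ℂ (symbol (d + 1) p ((2 - a) / 2) (lift x τ) (V₀ τ))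
          (deltaHat a η (lift x τ))) = 0 := by
  have key := h.integral_symbol_sub_eq_zero hx rfl (fiberEq_schwartz a η x) eV
    (energyFinite_schwartz η hx _) (energyFinite_schwartz η hx _) mW ?_ ?_ ?_
  · rw [neg_neg] at key
    rw [← key]
    refine integral_congr_ae (Filter.Eventually.of_forall fun τ => ?_)
    beta_reduce
    rw [SchwartzMap.sub_apply, SchwartzMap.smul_apply, map_add, map_smul, inner_add_left,
      inner_smul_left, inner_sub_right, inner_smul_right, Complex.conj_ofReal]
    ring
  · exact ((deltaHat a η - ((2 - a : ℝ) : ℂ) • η).continuous.comp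
      ((liftHomeo d).continuous.comp
        (by fun_prop : Continuous fun τ => (x, τ)))).aestronglyMeasurable
  · rwa [neg_neg]
  · exact integrable_schwartz_lift _ hx _

end FiberIntegrals

/-! ### Essential self-adjointness and solutions of the homogeneous equation -/

section SelfAdjoint

variable {d p : ℕ} {a : ℝ} {hs : |(2 - a) / 2| < ((d + 1 : ℕ) : ℝ) / 2 - p}

lemma exists_schwartz_domain (φ : (deltaMin d p a hs).domain) :
    ∃ η : 𝓢(Space (d + 1), Form (d + 1) p),
      (φ : HSob (d + 1) p ((2 - a) / 2) hs).hat =ᵐ[volume] η ∧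
      (deltaMin d p a hs φ).hat =ᵐ[volume] deltaHat a η := by
  obtain ⟨χ, -, hχ⟩ := φ.2
  exact ⟨𝓕 χ, HSob.hat_schwartz hχ, HSob.hat_deltaMin φ hχ⟩

/-- On every line with x ≠ 0 the weight and symbol of the inner product are those of Green's formula
with σ = -(2 - a)/2. The Fourier transforms are Schwartz functions, so no boundary terms appear, and
the real constant 2 - a cancels. -/
lemma deltaMin_symmetric (hd : 0 < d) (φ ψ : (deltaMin d p a hs).domain) :
    inner ℂ (deltaMin d p a hs φ) (ψ : HSob (d + 1) p ((2 - a) / 2) hs) =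
      inner ℂ (φ : HSob (d + 1) p ((2 - a) / 2) hs) (deltaMin d p a hs ψ) := by
  obtain ⟨η, h1, h2⟩ := exists_schwartz_domain φ
  obtain ⟨θ, h3, h4⟩ := exists_schwartz_domain ψ
  refine HSob.inner_eq_of_fibers ?_
  filter_upwards [ae_lift h1, ae_lift h2, ae_lift h3, ae_lift h4, ae_ne_zero hd]
    with x e1 e2 e3 e4 hx
  have hc : Continuous fun τ => (deltaHat a η - ((2 - a : ℝ) : ℂ) • η) (lift x τ) :=
    (deltaHat a η - ((2 - a : ℝ) : ℂ) • η).continuous.comp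
      ((liftHomeo d).continuous.comp (by fun_prop : Continuous fun τ => (x, τ)))
  refine Eq.trans (integral_congr_ae ?_) ((fiberEq_schwartz a η x).integral_symbol_deltaHat hx
    (energyFinite_schwartz η hx _) hc.aestronglyMeasurable (integrable_schwartz_lift _ hx _) θ)
  filter_upwards [e1, e2, e3, e4] with τ f1 f2 f3 f4
  rw [f1, f2, f3, f4, SchwartzMap.sub_apply, SchwartzMap.smul_apply, sub_add_cancel]

/-- The dual function of a solution of `T* u = z u` is a classical solution on almost every
line. -/
lemma ae_dualHat_fiber {z : ℂ} {u : HSob (d + 1) p ((2 - a) / 2) hs}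
    (h : ∀ φ : (deltaMin d p a hs).domain,
      inner ℂ (deltaMin d p a hs φ) u = z * inner ℂ (φ : HSob (d + 1) p ((2 - a) / 2) hs) u) :
    ∀ᵐ x : Space d, x ≠ 0 → ∃ V₀ V₁ V₂ : ℝ → Form (d + 1) p,
      (fun τ => u.dualHat (lift x τ)) =ᵐ[volume] V₀ ∧ Continuous V₂ ∧
      FiberEq (((d + 1 : ℕ) : ℝ) - 2 * p) ((2 - a) / 2) x V₀ V₁ V₂ (fun τ => z • V₀ τ) ∧
      Integrable fun τ => (‖x‖ ^ 2 + τ ^ 2) ^ (-((2 - a) / 2)) * ‖V₀ τ‖ ^ 2 := by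
  obtain ⟨w, hw⟩ := u.exists_dual
  filter_upwards [ae_fiber_of_deltaOp_eq hw (deltaOp_dual_eq h hw), u.ae_integrable_dualHat]
    with x hx hi hx0
  obtain ⟨V₀, V₁, V₂, e, hc, hV⟩ := hx hx0
  refine ⟨V₀, V₁, V₂, e, hc, ⟨hV.d₀, hV.d₁, fun τ => ?_⟩, (hi hx0).congr ?_⟩
  · have h1 := hV.eqn τ
    have h2 : z - ((2 - a : ℝ) : ℂ) - ((2 - (4 - a) : ℝ) : ℂ) = z := by push_cast; ring
    rw [h2, show (4 - a - 2) / 2 = (2 - a) / 2 by ring] at h1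
    exact h1
  · filter_upwards [e] with τ hτ
    rw [hτ]

lemma HSob.eq_zero_of_dualHat_fibers {s : ℝ} {hs : |s| < ((d + 1 : ℕ) : ℝ) / 2 - p} (hd : 0 < d)
    {u : HSob (d + 1) p s hs}
    (h : ∀ᵐ x : Space d, x ≠ 0 → ∀ᵐ τ : ℝ, u.dualHat (lift x τ) = 0) : u = 0 := by
  have h1 := integral_fibers (HSob.hasInt_inner (v := u) (Filter.EventuallyEq.refl _ _) u)
  refine inner_self_eq_zero.1 (h1.symm.trans (integral_eq_zero_of_ae ?_) : inner ℂ u u = 0)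
  filter_upwards [h, ae_ne_zero hd] with x hx hx0
  refine integral_eq_zero_of_ae ?_
  filter_upwards [hx hx0] with τ hτ
  simp [hτ]

/-- On almost every line the dual function is a square integrable solution with nonreal eigenvalue.
The bound |(2 - a)/2| < m/2 is precisely the definiteness that Green's formula needs. -/
lemma deltaMin_deficiency (hd : 0 < d) {z : ℂ} (hz : z.im ≠ 0)
    {u : HSob (d + 1) p ((2 - a) / 2) hs}
    (h : ∀ φ : (deltaMin d p a hs).domain,
      inner ℂ (deltaMin d p a hs φ) u = z * inner ℂ (φ : HSob (d + 1) p ((2 - a) / 2) hs) u) :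
    u = 0 := by
  have hr := abs_lt.1 hs
  refine HSob.eq_zero_of_dualHat_fibers hd ?_
  filter_upwards [ae_dualHat_fiber h] with x hx hx0
  obtain ⟨V₀, V₁, V₂, e, hc, hV, hi⟩ := hx hx0
  filter_upwards [e] with τ hτ
  rw [hτ]
  exact hV.eq_zero hx0 hz (by linarith) (by linarith) hc hi τ

lemma deltaMin_essentiallySelfAdjoint (hd : 0 < d) :
    IsEssentiallySelfAdjoint (deltaMin d p a hs) := by
  refine isEssentiallySelfAdjoint_of_deficiency (dense_testForms hs) (deltaMin_symmetric hd) ?_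
  rintro z (rfl | rfl) u hu
  · exact deltaMin_deficiency hd (by simp) hu
  · exact deltaMin_deficiency hd (by simp) hu

/-- The pairs `(u, g)` with `T* u = g` lie in the closure of `Δ_{a,p}`. -/
lemma mem_closure_graph_deltaMin (hd : 0 < d) {u g : HSob (d + 1) p ((2 - a) / 2) hs}
    (h : ∀ φ : (deltaMin d p a hs).domain, inner ℂ (deltaMin d p a hs φ) u =
      inner ℂ (φ : HSob (d + 1) p ((2 - a) / 2) hs) g) :
    (u, g) ∈ (deltaMin d p a hs).closure.graph := by
  refine mem_closure_graph_of_deficiency (deltaMin_essentiallySelfAdjoint hd).2.1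
    (deltaMin_symmetric hd) ?_ h
  rintro z (rfl | rfl) u hu
  · exact deltaMin_deficiency hd (by simp) hu
  · exact deltaMin_deficiency hd (by simp) hu

lemma integral_mul_sq_le {X : Type*} [MeasureSpace X] {f g : X → ℝ} (hf0 : 0 ≤ f) (hg0 : 0 ≤ g)
    (hf : MemLp f 2 (volume : Measure X)) (hg : MemLp g 2 (volume : Measure X)) :
    (∫ x, f x * g x) ^ 2 ≤ (∫ x, f x ^ 2) * ∫ x, g x ^ 2 := by
  have h := integral_mul_le_Lp_mul_Lq_of_nonneg (p := 2) (q := 2)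
    (Real.HolderConjugate.two_two) (Filter.Eventually.of_forall hf0)
    (Filter.Eventually.of_forall hg0) (by simpa using hf) (by simpa using hg)
  simp only [Real.rpow_two, ← Real.sqrt_eq_rpow] at h
  have h1 : 0 ≤ ∫ x, f x * g x := integral_nonneg fun x => mul_nonneg (hf0 x) (hg0 x)
  have h2 := pow_le_pow_left₀ h1 h 2
  rwa [mul_pow, Real.sq_sqrt (integral_nonneg fun x => sq_nonneg _),
    Real.sq_sqrt (integral_nonneg fun x => sq_nonneg _)] at h2

/-- Cauchy-Schwarz for |2πξ|^{-s} ψ against |2πξ|^{s} û, where the first factor is square integrable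
because 2|s| < n. With this, norm limits in the graph become limits of distributions. -/
lemma continuous_hat_apply {n : ℕ} {s : ℝ} {hs : |s| < (n : ℝ) / 2 - p} (ψ : 𝓢(Space n, ℂ)) :
    Continuous fun u : HSob n p s hs => 𝓕 u.toDist ψ := by
  have hn := dim_pos hs
  have hr := range_two hs
  have hT : (wtMeasure n (-(2 * s))).HasTemperateGrowth :=
    temperate_wtMeasure hn (by linarith) (by linarith)
  have hc : 0 < (n : ℝ) / 2 - p - |s| := by linarith
  let L : HSob n p s hs →ₗ[ℂ] Form n p :=
    { toFun := fun u => 𝓕 u.toDist ψ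
      map_add' := fun u v => by rw [map_add, FourierTransform.fourier_add]; rfl
      map_smul' := fun c u => by rw [map_smul, FourierTransform.fourier_smul]; rfl }
  have hm : AEStronglyMeasurable (fun ξ : Space n => wt (-s) ξ * ‖ψ ξ‖) volume :=
    (measurable_wt _).aestronglyMeasurable.mul ψ.continuous.norm.aestronglyMeasurable
  have hψ : MemLp (fun ξ : Space n => wt (-s) ξ * ‖ψ ξ‖) 2 volume := by
    have h := (memLp_two_iff_integrable_sq_norm (ψ.continuous.aestronglyMeasurable
      (μ := wtMeasure n (-(2 * s))))).1 (ψ.memLp 2 _)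
    rw [integrable_wtMeasure_real] at h
    refine (memLp_two_iff_integrable_sq hm).2 (h.congr (Filter.Eventually.of_forall fun ξ => ?_))
    beta_reduce
    rw [mul_pow, ← wt_sq, mul_neg]
  have hbd : ∀ u, ‖L u‖ ≤ Real.sqrt ((∫ ξ : Space n, (wt (-s) ξ * ‖ψ ξ‖) ^ 2) /
      ((n : ℝ) / 2 - p - |s|)) * ‖u‖ := by
    intro u
    have h1 : ‖L u‖ ≤ ∫ ξ, (wt (-s) ξ * ‖ψ ξ‖) * ‖(wt s ξ : ℂ) • u.hat ξ‖ := by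
      have e : L u = ∫ ξ, ψ ξ • u.hat ξ := (u.isRep_hat.2 ψ).2
      rw [e]
      refine (norm_integral_le_integral_norm _).trans_eq (integral_congr_ae ?_)
      filter_upwards [ae_ne_zero hn] with ξ hξ
      have h2 : wt (-s) ξ * wt s ξ = 1 := by
        unfold wt
        rw [← Real.rpow_add (by have := norm_pos_iff.2 hξ; positivity)]
        simp
      rw [norm_smul, norm_smul, Complex.norm_real, Real.norm_of_nonneg (wt_nonneg _ _)]
      linear_combination -(‖ψ ξ‖ * ‖u.hat ξ‖) * h2
    have h2 := integral_mul_sq_le (fun ξ => mul_nonneg (wt_nonneg _ _) (norm_nonneg _))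
      (fun ξ => norm_nonneg _) hψ u.memLp_hat.norm
    have h3 := HSob.lower u
    rw [← HSob.norm_sq] at h3
    refine (sq_le_sq₀ (norm_nonneg _) (by positivity)).1 ?_
    rw [mul_pow, Real.sq_sqrt (div_nonneg (integral_nonneg fun ξ => sq_nonneg _) hc.le)]
    refine (pow_le_pow_left₀ (norm_nonneg _) h1 2).trans (h2.trans ?_)
    rw [div_mul_eq_mul_div, mul_div_assoc]
    refine mul_le_mul_of_nonneg_left ?_ (integral_nonneg fun ξ => sq_nonneg _)
    rw [le_div_iff₀ hc]
    linarith
  exact (L.mkContinuous _ hbd).continuous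

lemma closure_graph_induction {H : Type*} [NormedAddCommGroup H] [InnerProductSpace ℂ H]
    {T : H →ₗ.[ℂ] H} (hc : T.IsClosable) {P : H → H → Prop} (hP : IsClosed {q : H × H | P q.1 q.2})
    (h : ∀ φ : T.domain, P φ (T φ)) {u g : H} (hu : (u, g) ∈ T.closure.graph) : P u g := by
  rw [← hc.graph_closure_eq_closure_graph] at hu
  refine (closure_minimal (fun q hq => ?_) hP) hu
  obtain ⟨φ, h1, h2⟩ := (LinearPMap.mem_graph_iff _).1 hq
  have := h φ
  rw [h1, h2] at this
  exact this

/-- The closure of `Δ_{a,p}` acts as a differential operator. -/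
lemma deltaOp_eq_of_mem_closure (hd : 0 < d) {u g : HSob (d + 1) p ((2 - a) / 2) hs}
    (h : (u, g) ∈ (deltaMin d p a hs).closure.graph) : deltaOp d p a u.toDist = g.toDist := by
  have key : ∀ ψ, 𝓕 (deltaOp d p a u.toDist) ψ = 𝓕 g.toDist ψ := by
    intro ψ
    refine closure_graph_induction (deltaMin_essentiallySelfAdjoint (hs := hs) hd).2.1
      (P := fun u g => 𝓕 (deltaOp d p a u.toDist) ψ = 𝓕 g.toDist ψ) ?_ (fun φ => rfl) h
    refine isClosed_eq ?_ ((continuous_hat_apply ψ).comp continuous_snd)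
    simp only [fourier_deltaOp]
    have h1 : ∀ ψ, Continuous fun q : HSob (d + 1) p ((2 - a) / 2) hs ×
        HSob (d + 1) p ((2 - a) / 2) hs => 𝓕 q.1.toDist ψ :=
      fun ψ => (continuous_hat_apply ψ).comp continuous_fst
    refine Continuous.sub (Continuous.add (Continuous.add ?_ ?_) ?_) ?_
    · exact continuous_finset_sum _ fun j _ => h1 _
    · exact (continuous_const_smul (a : ℂ)).comp (h1 _)
    · exact (continuous_const_smul (2 : ℂ)).comp
        (continuous_finset_sum _ fun j _ => (bJ p j).continuous.comp (h1 _))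
    · exact (continuous_const_smul (((d + 1 : ℕ) : ℂ) - 2 * (p : ℂ))).comp
        ((nOp d p).continuous.comp (h1 _))
  have h2 : 𝓕 (deltaOp d p a u.toDist) = 𝓕 g.toDist := by ext1 ψ; exact key ψ
  have h3 := congrArg (fun T : 𝓢'(Space (d + 1), Form (d + 1) p) => 𝓕⁻ T) h2
  simpa using h3

/-- A solution of `Δ_{a,p} u = 0` is annihilated by the adjoint of `Δ_{a,p}`. -/
lemma inner_deltaMin_eq_zero (hd : 0 < d) {u : HSob (d + 1) p ((2 - a) / 2) hs}
    (hu : deltaOp d p a u.toDist = 0) (φ : (deltaMin d p a hs).domain) :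
    inner ℂ (deltaMin d p a hs φ) u = 0 := by
  obtain ⟨η, h1, h2⟩ := exists_schwartz_domain φ
  have h0 : (0 : HSob (d + 1) p ((2 - a) / 2) hs).hat =ᵐ[volume] fun _ => 0 := by
    refine (0 : HSob (d + 1) p ((2 - a) / 2) hs).isRep_hat.ae_eq ?_
    rw [map_zero, FourierTransform.fourier_zero]
    exact IsRep.zero
  -- This is the symmetry relation ⟨Δu, φ⟩ = ⟨u, Δφ⟩ with Δu = 0 written as the zero element, so
  -- that the comparison of line integrals applies.
  have key : inner ℂ (0 : HSob (d + 1) p ((2 - a) / 2) hs)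
      (φ : HSob (d + 1) p ((2 - a) / 2) hs) = inner ℂ u (deltaMin d p a hs φ) := by
    refine HSob.inner_eq_of_fibers ?_
    have hu' : deltaOp d p a u.toDist = (0 : ℂ) • u.toDist := by
      rw [hu]; ext1 ψ; exact (zero_smul ℂ (u.toDist ψ)).symm
    filter_upwards [ae_lift h1, ae_lift h2, ae_lift h0, ae_ne_zero hd,
      ae_fiber_of_deltaOp_eq u.isRep_hat hu', u.ae_integrable_hat] with x e1 e2 e0 hx hV hi
    obtain ⟨V₀, V₁, V₂, e, hc, hV⟩ := hV hx
    rw [show (a - 2) / 2 = -((2 - a) / 2) by ring] at hV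
    have hi' : Integrable fun τ => (‖x‖ ^ 2 + τ ^ 2) ^ ((2 - a) / 2) * ‖V₀ τ‖ ^ 2 := by
      refine hi.congr ?_
      filter_upwards [e] with τ hτ
      rw [hτ]
    -- It is not yet known that u lies in the domain of the closure. Finite energy, obtained from
    -- the line equation for û, is what removes the boundary terms.
    have hE := hV.energyFinite hx hc (by rwa [neg_neg])
    refine Eq.trans (integral_congr_ae ?_) (hV.integral_symbol_deltaHat hx hE
      ((continuous_const_smul _).comp hV.continuous₀).aestronglyMeasurable ?_ η)
    · filter_upwards [e1, e2, e0, e] with τ f1 f2 f0 f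
      rw [f1, f2, f0, f, zero_sub, neg_smul, neg_add_cancel]
    · simp only [norm_smul, mul_pow]
      refine (hi'.const_mul (‖(0 : ℂ) - ((2 - a : ℝ) : ℂ)‖ ^ 2)).congr
        (Filter.Eventually.of_forall fun τ => ?_)
      beta_reduce
      ring
  rw [inner_zero_left] at key
  rw [← inner_conj_symm, ← key, map_zero]

/-- The dual function of a solution of `Δ_{a,p} u = 0` is constant on almost every line. -/
lemma ae_dualHat_const (hd : 0 < d) (ha : a < 1) {u : HSob (d + 1) p ((2 - a) / 2) hs}
    (hu : deltaOp d p a u.toDist = 0) :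
    ∀ᵐ x : Space d, x ≠ 0 → ∃ V : Form (d + 1) p,
      (fun τ => u.dualHat (lift x τ)) =ᵐ[volume] (fun _ => V) ∧ nOp d p V = 0 := by
  have hr := abs_lt.1 hs
  have h1 : ∀ φ : (deltaMin d p a hs).domain, inner ℂ (deltaMin d p a hs φ) u =
      (0 : ℂ) * inner ℂ (φ : HSob (d + 1) p ((2 - a) / 2) hs) u := fun φ => by
    rw [zero_mul]; exact inner_deltaMin_eq_zero hd hu φ
  filter_upwards [ae_dualHat_fiber h1] with x hx hx0
  obtain ⟨V₀, V₁, V₂, e, hc, hV, hi⟩ := hx hx0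
  have hV' : FiberEq (((d + 1 : ℕ) : ℝ) - 2 * p) ((2 - a) / 2) x V₀ V₁ V₂ (fun _ => 0) :=
    ⟨hV.d₀, hV.d₁, fun τ => by rw [hV.eqn τ, zero_smul]⟩
  -- With σ = (2 - a)/2, a < 1 gives σ > 1/2. Since m/2 > σ, also m/2 + σ > 1.
  have hk := fun τ => hV'.kernel hx0 (by linarith) (by linarith) (by linarith) hc hi τ
  have hconst : ∀ τ, V₀ τ = V₀ 0 := fun τ =>
    is_const_of_deriv_eq_zero (fun τ => (hV.d₀ τ).differentiableAt)
      (fun τ => (hV.d₀ τ).deriv.trans (hk τ).1) τ 0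
  refine ⟨V₀ 0, ?_, (hk 0).2⟩
  filter_upwards [e] with τ hτ
  rw [hτ, hconst]

end SelfAdjoint

/-! ### Building solutions of the adjoint equation from line solutions -/

section AdjointSolutions

variable {n d p : ℕ} {s : ℝ}

lemma incl_symbol (s : ℝ) (ξ : Space n) (v : Form n p) : incl n p (symbol n p s ξ v) =
    (((n : ℝ) / 2 - p + s : ℝ) : ℂ) •
      intVec (‖ξ‖⁻¹ • ξ) (extVec (‖ξ‖⁻¹ • ξ) (incl n p v)) +
    (((n : ℝ) / 2 - p - s : ℝ) : ℂ) •
      extVec (‖ξ‖⁻¹ • ξ) (intVec (‖ξ‖⁻¹ • ξ) (incl n p v)) := by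
  simp only [symbol, extVec, intVec, ContinuousLinearMap.comp_apply, _root_.add_apply,
    _root_.sum_apply, _root_.smul_apply, map_add, map_sum, map_smul, incl_proj_extMul_intMul,
    incl_proj_intMul_extMul]

/-- `S_s(ξ) S_{-s}(ξ) = (n/2 - p + s) (n/2 - p - s)`. -/
lemma symbol_symbol_neg {ξ : Space n} (hξ : ξ ≠ 0) (s : ℝ) (v : Form n p) :
    symbol n p s ξ (symbol n p (-s) ξ v) =
      ((((n : ℝ) / 2 - p + s) * ((n : ℝ) / 2 - p - s) : ℝ) : ℂ) • v := by
  have hi : Function.Injective (incl n p) := fun v w h => by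
    rw [← proj_incl v, h, proj_incl]
  apply hi
  set e := ‖ξ‖⁻¹ • ξ with he
  have hn : ‖e‖ = 1 := by
    rw [he, norm_smul, norm_inv, norm_norm, inv_mul_cancel₀ (norm_ne_zero_iff.2 hξ)]
  set w := incl n p v with hw
  have h1 : ∀ w : Ext n, extVec e (intVec e w) = w - intVec e (extVec e w) := fun w => by
    have := intVec_extVec e w
    rw [hn, one_pow, Complex.ofReal_one, one_smul] at this
    exact eq_sub_of_add_eq' this
  rw [incl_symbol, incl_symbol, ← he, map_smul, ← hw]
  simp only [map_add, map_smul, extVec_extVec, intVec_intVec, map_zero, smul_zero, add_zero,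
    zero_add, h1, map_sub, sub_zero]
  push_cast
  module

/-- As S_s S_{-s} is a nonzero scalar c, the choice û = c⁻¹ |2πξ|^{-2s} S_{-s} U inverts the passage
to the dual function, and boundedness of S_{-s} keeps the norm finite. Solutions can thus be
prescribed through their dual functions. -/
lemma HSob.exists_of_dualHat (hs : |s| < (n : ℝ) / 2 - p) {U : Space n → Form n p}
    (hU : AEStronglyMeasurable U volume)
    (hi : Integrable fun ξ => wt (-(2 * s)) ξ * ‖U ξ‖ ^ 2) :
    ∃ u : HSob n p s hs, u.dualHat =ᵐ[volume] U := by
  have hr := abs_lt.1 hs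
  obtain ⟨C, hC⟩ := symbol_bounded n p (-s)
  set c : ℝ := ((n : ℝ) / 2 - p + s) * ((n : ℝ) / 2 - p - s) with hcdef
  have hc : c ≠ 0 := (mul_pos (by linarith) (by linarith)).ne'
  have hm : AEStronglyMeasurable (fun ξ => (wt (-s) ξ : ℂ) • U ξ) volume :=
    (Complex.measurable_ofReal.comp (measurable_wt _)).aestronglyMeasurable.smul hU
  have h2 : MemLp (fun ξ => (wt (-s) ξ : ℂ) • U ξ) 2 volume := by
    refine (memLp_iff (s := -s) hU).1 ?_
    simpa only [mul_neg] using hi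
  have h3 : MemLp (fun ξ => symbol n p (-s) ξ ((wt (-s) ξ : ℂ) • U ξ)) 2 volume := by
    refine MemLp.of_le_mul (c := C) h2 ?_ (Filter.Eventually.of_forall fun ξ => ?_)
    · exact (ContinuousLinearMap.apply ℂ (Form n p)).flip.aestronglyMeasurable_comp₂
        (measurable_symbol n p (-s)).aestronglyMeasurable hm
    · exact (symbol n p (-s) ξ).le_of_opNorm_le (hC ξ) _
  obtain ⟨u, hu⟩ := HSob.exists_hat hs (h3.const_smul ((c : ℂ)⁻¹))
  refine ⟨u, ?_⟩
  filter_upwards [hu, ae_ne_zero (dim_pos hs)] with ξ hξ hξ0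
  have h4 : wt s ξ * wt (-s) ξ = 1 := by
    unfold wt
    rw [← Real.rpow_add (by have := norm_pos_iff.2 hξ0; positivity)]
    simp
  have h5 : u.dualHat ξ = (wt s ξ : ℂ) • symbol n p s ξ ((wt s ξ : ℂ) • u.hat ξ) := by
    rw [HSob.dualHat, wt_sq, map_smul, smul_smul, sq, Complex.ofReal_mul]
  rw [h5, hξ]
  change (wt s ξ : ℂ) • symbol n p s ξ ((c : ℂ)⁻¹ •
    symbol n p (-s) ξ ((wt (-s) ξ : ℂ) • U ξ)) = U ξ
  rw [map_smul, map_smul, map_smul, symbol_symbol_neg hξ0, ← hcdef, smul_smul, smul_smul,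
    smul_smul]
  have h6 : (wt s ξ : ℂ) * (c : ℂ)⁻¹ * (wt (-s) ξ : ℂ) * (c : ℂ) = 1 := by
    have h7 : (c : ℂ) ≠ 0 := Complex.ofReal_ne_zero.2 hc
    have h8 : (wt s ξ : ℂ) * (wt (-s) ξ : ℂ) = 1 := by exact_mod_cast h4
    field_simp
    exact h8
  rw [h6, one_smul]

lemma integrable_inner_schwartz_lift (θ : 𝓢(Space (d + 1), Form (d + 1) p)) (x : Space d)
    {V : ℝ → Form (d + 1) p} (hV : Continuous V) {C : ℝ} {k : ℕ}
    (h : ∀ τ, ‖V τ‖ ≤ C * (1 + |τ|) ^ k) : Integrable fun τ => inner ℂ (θ (lift x τ)) (V τ) := by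
  obtain ⟨K, hK, h2⟩ := schwartz_lift_bound θ (k + 2)
  have hC : 0 ≤ C := by
    have := (norm_nonneg _).trans (h 0)
    simpa using this
  have hc : Continuous fun τ : ℝ => θ (lift x τ) :=
    θ.continuous.comp ((liftHomeo d).continuous.comp (by fun_prop : Continuous fun τ => (x, τ)))
  refine integrable_of_line_bound (C := K * C) (hc.inner hV).aestronglyMeasurable fun τ => ?_
  calc (1 + |τ|) ^ 2 * ‖inner ℂ (θ (lift x τ)) (V τ)‖
      ≤ (1 + |τ|) ^ 2 * (‖θ (lift x τ)‖ * (C * (1 + |τ|) ^ k)) := by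
        gcongr
        exact (norm_inner_le_norm _ _).trans (mul_le_mul_of_nonneg_left (h τ) (norm_nonneg _))
    _ = ((1 + |τ|) ^ (k + 2) * ‖θ (lift x τ)‖) * C := by ring
    _ ≤ K * C := mul_le_mul_of_nonneg_right (h2 x τ) hC

/-- Integration by parts on a line against a solution of polynomial growth. -/
lemma FiberEq.integral_inner_deltaHat {a : ℝ} {κ : ℂ} {x : Space d}
    {V₀ V₁ V₂ : ℝ → Form (d + 1) p}
    (h : FiberEq (((d + 1 : ℕ) : ℝ) - 2 * p) ((2 - a) / 2) x V₀ V₁ V₂ (fun τ => κ • V₀ τ))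
    {C₀ C₁ : ℝ} {k₀ k₁ : ℕ} (h0 : ∀ τ, ‖V₀ τ‖ ≤ C₀ * (1 + |τ|) ^ k₀)
    (h1 : ∀ τ, ‖V₁ τ‖ ≤ C₁ * (1 + |τ|) ^ k₁) (η : 𝓢(Space (d + 1), Form (d + 1) p)) :
    ∫ τ, (inner ℂ (deltaHat a η (lift x τ)) (V₀ τ) - κ * inner ℂ (η (lift x τ)) (V₀ τ)) = 0 := by
  set η₁ := pdS (Fin.last d) η with hη₁
  set η₂ := pdS (Fin.last d) η₁ with hη₂
  -- On the line θ₂ = r² η and θ₁ = r² η' + (2 - a) τ η - 2 B η, so ⟨θ₁, V⟩ - ⟨θ₂, V'⟩ is the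
  -- Lagrange bracket. Both are Schwartz forms and outweigh polynomial growth of V and V'.
  let θ₂ : 𝓢(Space (d + 1), Form (d + 1) p) := ∑ j, coordS j (coordS j η)
  let θ₁ : 𝓢(Space (d + 1), Form (d + 1) p) := ∑ j, coordS j (coordS j η₁) +
    ((2 - a : ℝ) : ℂ) • coordS (Fin.last d) η -
    (2 : ℂ) • ∑ j : Fin d, SchwartzMap.postcompCLM (bJ p j) (coordS j.castSucc η)
  have hr : ∀ (η : 𝓢(Space (d + 1), Form (d + 1) p)) τ,
      (∑ j, coordS j (coordS j η)) (lift x τ) = ((‖x‖ ^ 2 + τ ^ 2 : ℝ) : ℂ) • η (lift x τ) := by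
    intro η τ
    rw [SchwartzMap.sum_apply, Fin.sum_univ_castSucc, EuclideanSpace.real_norm_sq_eq]
    simp only [coordS_apply, lift_castSucc, lift_last, smul_smul]
    rw [← Finset.sum_smul, ← add_smul]
    push_cast
    simp only [sq]
  have e2 : ∀ τ, θ₂ (lift x τ) = ((‖x‖ ^ 2 + τ ^ 2 : ℝ) : ℂ) • η (lift x τ) := hr η
  have e1 : ∀ τ, θ₁ (lift x τ) = ((‖x‖ ^ 2 + τ ^ 2 : ℝ) : ℂ) • η₁ (lift x τ) +
      (((2 - a) * τ : ℝ) : ℂ) • η (lift x τ) - (2 : ℂ) • bOp p x (η (lift x τ)) := by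
    intro τ
    simp only [θ₁, SchwartzMap.sub_apply, SchwartzMap.add_apply, SchwartzMap.smul_apply, hr,
      coordS_apply, lift_last, bOp_eq_sum]
    rw [SchwartzMap.sum_apply]
    simp only [SchwartzMap.postcompCLM_apply, coordS_apply, lift_castSucc, map_smul]
    push_cast
    module
  have d0 : ∀ τ, HasDerivAt (fun τ => η (lift x τ)) (η₁ (lift x τ)) τ := hasDerivAt_lift η x
  have d1 : ∀ τ, HasDerivAt (fun τ => η₁ (lift x τ)) (η₂ (lift x τ)) τ := hasDerivAt_lift η₁ x
  have dr : ∀ τ : ℝ, HasDerivAt (fun τ : ℝ => ((‖x‖ ^ 2 + τ ^ 2 : ℝ) : ℂ)) ((2 * τ : ℝ) : ℂ) τ := by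
    intro τ
    have := ((hasDerivAt_id τ).pow 2).const_add (‖x‖ ^ 2)
    exact (this.congr_deriv (by simp)).ofReal_comp
  have dl : ∀ τ : ℝ, HasDerivAt (fun τ : ℝ => (((2 - a) * τ : ℝ) : ℂ)) ((2 - a : ℝ) : ℂ) τ := by
    intro τ
    have := (hasDerivAt_id τ).const_mul (2 - a)
    exact (this.congr_deriv (by simp)).ofReal_comp
  have dB : ∀ τ, HasDerivAt (fun τ => bOp p x (η (lift x τ))) (bOp p x (η₁ (lift x τ))) τ :=
    fun τ => ((bOp p x).restrictScalars ℝ).hasFDerivAt.comp_hasDerivAt τ (d0 τ)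
  have D2 : ∀ τ, HasDerivAt (fun τ => θ₂ (lift x τ)) (((‖x‖ ^ 2 + τ ^ 2 : ℝ) : ℂ) • η₁ (lift x τ) +
      ((2 * τ : ℝ) : ℂ) • η (lift x τ)) τ := by
    intro τ
    simp only [e2]
    exact (dr τ).smul (d0 τ)
  have D1 : ∀ τ, HasDerivAt (fun τ => θ₁ (lift x τ))
      ((((‖x‖ ^ 2 + τ ^ 2 : ℝ) : ℂ) • η₂ (lift x τ) + ((2 * τ : ℝ) : ℂ) • η₁ (lift x τ)) +
      ((((2 - a) * τ : ℝ) : ℂ) • η₁ (lift x τ) + ((2 - a : ℝ) : ℂ) • η (lift x τ)) -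
      (2 : ℂ) • bOp p x (η₁ (lift x τ))) τ := by
    intro τ
    simp only [e1]
    exact (((dr τ).smul (d1 τ)).add ((dl τ).smul (d0 τ))).sub ((dB τ).const_smul (2 : ℂ))
  have key : ∀ τ, HasDerivAt
      (fun τ => inner ℂ (θ₁ (lift x τ)) (V₀ τ) - inner ℂ (θ₂ (lift x τ)) (V₁ τ))
      (inner ℂ (deltaHat a η (lift x τ)) (V₀ τ) - κ * inner ℂ (η (lift x τ)) (V₀ τ)) τ := by
    intro τ
    refine (((D1 τ).inner ℂ (h.d₀ τ)).sub ((D2 τ).inner ℂ (h.d₁ τ))).congr_deriv ?_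
    have h3 := congrArg (fun v => inner ℂ (η (lift x τ)) v) (h.eqn τ)
    rw [deltaHat_lift, e1, e2, ← hη₁, ← hη₂]
    simp only [inner_sub_left, inner_add_left, inner_smul_left, inner_sub_right, inner_add_right,
      inner_smul_right, Complex.conj_ofReal, inner_bOp, inner_nOp, map_sub, map_mul, map_natCast,
      Complex.conj_ofNat] at h3 ⊢
    push_cast at h3 ⊢
    linear_combination -h3
  have c0 := h.continuous₀
  have c1 := h.continuous₁
  exact integral_eq_zero_of_hasDerivAt_of_integrable key
    ((integrable_inner_schwartz_lift _ x c0 h0).sub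
      ((integrable_inner_schwartz_lift _ x c0 h0).const_mul κ))
    ((integrable_inner_schwartz_lift _ x c0 h0).sub (integrable_inner_schwartz_lift _ x c1 h1))

/-- The converse of the passage from the adjoint equation to the lines. Polynomial growth on each
line may depend on x, because integrability in all variables already comes from u being in the
Hilbert space. -/
lemma deltaMin_adjoint_of_fibers {a : ℝ} {hs : |(2 - a) / 2| < ((d + 1 : ℕ) : ℝ) / 2 - p}
    (hd : 0 < d) {κ : ℂ} {u : HSob (d + 1) p ((2 - a) / 2) hs}
    (h : ∀ᵐ x : Space d, x ≠ 0 → ∃ V₀ V₁ V₂ : ℝ → Form (d + 1) p,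
      (fun τ => u.dualHat (lift x τ)) =ᵐ[volume] V₀ ∧
      FiberEq (((d + 1 : ℕ) : ℝ) - 2 * p) ((2 - a) / 2) x V₀ V₁ V₂ (fun τ => κ • V₀ τ) ∧
      ∃ (C₀ C₁ : ℝ) (k₀ k₁ : ℕ), (∀ τ, ‖V₀ τ‖ ≤ C₀ * (1 + |τ|) ^ k₀) ∧
        ∀ τ, ‖V₁ τ‖ ≤ C₁ * (1 + |τ|) ^ k₁) (φ : (deltaMin d p a hs).domain) :
    inner ℂ (deltaMin d p a hs φ) u = κ * inner ℂ (φ : HSob (d + 1) p ((2 - a) / 2) hs) u := by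
  obtain ⟨η, h1, h2⟩ := exists_schwartz_domain φ
  have h3 := integral_fibers ((HSob.hasInt_inner h2 u).sub ((HSob.hasInt_inner h1 u).smul κ))
  rw [← sub_eq_zero, ← smul_eq_mul, ← h3]
  refine integral_eq_zero_of_ae ?_
  filter_upwards [h, ae_ne_zero hd] with x hx hx0
  obtain ⟨V₀, V₁, V₂, e, hV, C₀, C₁, k₀, k₁, b0, b1⟩ := hx hx0
  refine (integral_congr_ae ?_).trans (hV.integral_inner_deltaHat b0 b1 η)
  filter_upwards [e] with τ hτ
  rw [hτ, smul_eq_mul]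

end AdjointSolutions

/-! ### Eigenvectors with polynomial dual functions -/

section Eigenvectors

open Polynomial in
/-- The coefficients of the polynomial solutions of `(1 + t²) q'' + a t q' = κ q`. -/
def eigenCoeff (a κ c₀ c₁ : ℝ) : ℕ → ℝ
  | 0 => c₀
  | 1 => c₁
  | n + 2 => (κ - n * (n - 1 + a)) * eigenCoeff a κ c₀ c₁ n / ((n + 1) * (n + 2))

-- The recursion for the coefficients has step two, and its factor κ - n(n - 1 + a) vanishes at n =
-- k when κ = k(k + a - 1). Starting with the parity of k makes the series stop at degree k.
open Polynomial in
lemma exists_eigenpolynomial (k : ℕ) (a : ℝ) : ∃ q : ℝ[X], q ≠ 0 ∧ q.natDegree ≤ k ∧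
    ∀ t : ℝ, (1 + t ^ 2) * q.derivative.derivative.eval t + a * t * q.derivative.eval t =
      k * (k + a - 1) * q.eval t := by
  set κ : ℝ := k * (k + a - 1) with hκ
  let c := eigenCoeff a κ (if Even k then 1 else 0) (if Even k then 0 else 1)
  have hrec : ∀ n, c (n + 2) = (κ - n * (n - 1 + a)) * c n / ((n + 1) * (n + 2)) := fun n => rfl
  have hpar : ∀ n, Even (n + k + 1) → c n = 0 := by
    intro n
    induction n using Nat.strong_induction_on with
    | _ n ih =>
      intro hn
      match n with
      | 0 =>
        have : ¬Even k := by
          rw [zero_add] at hn; exact fun h => by simp [Nat.even_add_one, h] at hn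
        exact if_neg this
      | 1 =>
        have : Even k := by
          rw [add_comm 1 k, add_assoc] at hn
          exact (Nat.even_add.1 hn).2 (by decide)
        exact if_pos this
      | n + 2 =>
        have : Even (n + k + 1) := by
          have h2 : n + 2 + k + 1 = (n + k + 1) + 2 := by ring
          rw [h2] at hn
          exact (Nat.even_add.1 hn).2 (by decide)
        rw [hrec, ih n (by omega) this]
        simp
  have hdeg : ∀ n, k < n → c n = 0 := by
    intro n
    induction n using Nat.strong_induction_on with
    | _ n ih =>
      intro hn
      match n with
      | 0 => omega
      | 1 =>
        obtain rfl : k = 0 := by omega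
        exact hpar 1 (by decide)
      | n + 2 =>
        rcases lt_trichotomy k n with h | rfl | h
        · rw [hrec, ih n (by omega) h]; simp
        · rw [hrec, hκ]
          have : (k : ℝ) * (k + a - 1) - k * (k - 1 + a) = 0 := by ring
          rw [this]; simp
        · obtain rfl : k = n + 1 := by omega
          exact hpar _ ⟨n + 2, by ring⟩
  let q : ℝ[X] := ∑ j ∈ Finset.range (k + 1), monomial j (c j)
  have hq : ∀ n, q.coeff n = c n := by
    intro n
    simp only [q, finset_sum_coeff, coeff_monomial, Finset.sum_ite_eq', Finset.mem_range]
    split_ifs with h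
    · rfl
    · exact (hdeg n (by omega)).symm
  have hode : (1 + X ^ 2) * derivative (derivative q) + C a * (X * derivative q) = C κ * q := by
    ext n
    rw [add_mul, one_mul, coeff_add, coeff_add, coeff_C_mul, coeff_C_mul, coeff_derivative,
      coeff_derivative, coeff_X_pow_mul', hq, hq]
    match n with
    | 0 =>
      have := hrec 0
      simp at this ⊢
      rw [this]
      ring
    | 1 =>
      have := hrec 1
      rw [coeff_X_mul]
      simp [coeff_derivative, hq] at this ⊢
      rw [this]
      ring
    | n + 2 =>
      have := hrec (n + 2)
      rw [coeff_X_mul, if_pos (by omega), Nat.add_sub_cancel]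
      simp only [coeff_derivative, hq]
      rw [this]
      push_cast
      have h1 : (n : ℝ) + 2 + 1 ≠ 0 := by positivity
      have h2 : (n : ℝ) + 2 + 2 ≠ 0 := by positivity
      field_simp
      ring
  refine ⟨q, fun h0 => ?_, ?_, fun t => ?_⟩
  · have h1 : ∀ n, c n = 0 := fun n => by rw [← hq, h0, coeff_zero]
    by_cases hk : Even k
    · have : c 0 = 1 := if_pos hk
      simp [h1] at this
    · have : c 1 = 1 := if_neg hk
      simp [h1] at this
  · refine natDegree_le_iff_coeff_eq_zero.2 fun n hn => by rw [hq, hdeg n hn]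
  · have := congrArg (Polynomial.eval t) hode
    simp only [eval_add, eval_mul, eval_one, eval_pow, eval_X, eval_C] at this
    rw [← this]; ring

lemma polynomial_bound {q : Polynomial ℝ} {k : ℕ} (hq : q.natDegree ≤ k) :
    ∃ C, 0 ≤ C ∧ ∀ t, |q.eval t| ≤ C * (1 + |t|) ^ k := by
  refine ⟨∑ j ∈ Finset.range (k + 1), |q.coeff j|, Finset.sum_nonneg fun _ _ => abs_nonneg _,
    fun t => ?_⟩
  rw [Polynomial.eval_eq_sum_range' (Nat.lt_succ_of_le hq), Finset.sum_mul]
  refine (Finset.abs_sum_le_sum_abs _ _).trans (Finset.sum_le_sum fun j hj => ?_)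
  rw [abs_mul, abs_pow]
  have h0 := abs_nonneg t
  refine mul_le_mul_of_nonneg_left ?_ (abs_nonneg _)
  calc |t| ^ j ≤ (1 + |t|) ^ j := by gcongr; linarith
    _ ≤ (1 + |t|) ^ k := pow_le_pow_right₀ (by linarith) (by simp at hj; omega)

variable {d p : ℕ} {a : ℝ} {hs : |(2 - a) / 2| < ((d + 1 : ℕ) : ℝ) / 2 - p}

/-- The form `i_{x'} ε_{x'} w`. -/
def transverse (w : Form (d + 1) p) (x : Space d) : Form (d + 1) p :=
  proj (d + 1) p (intVec (lift x 0) (extVec (lift x 0) (incl (d + 1) p w)))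

lemma incl_transverse (w : Form (d + 1) p) (x : Space d) : incl (d + 1) p (transverse w x) =
    intVec (lift x 0) (extVec (lift x 0) (incl (d + 1) p w)) := by
  simp only [transverse, extVec, intVec, _root_.sum_apply, _root_.smul_apply, map_sum, map_smul,
    incl_proj_intMul_extMul]

lemma continuous_transverse (w : Form (d + 1) p) : Continuous (transverse w) := by
  have h1 : Continuous (fun x : Space (d + 1) => extVec x) := by unfold extVec; fun_prop
  have h2 : Continuous (fun x : Space (d + 1) => intVec x) := by unfold intVec; fun_prop
  have h3 : Continuous (fun x : Space (d + 1) =>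
      proj (d + 1) p (intVec x (extVec x (incl (d + 1) p w)))) := by fun_prop
  exact h3.comp ((liftHomeo d).continuous.comp (by fun_prop : Continuous fun x => (x, (0 : ℝ))))

lemma incl_injective {n : ℕ} : Function.Injective (incl n p) := fun v w h => by
  rw [← proj_incl v, h, proj_incl]

/-- If w has no e_n, then i_x ε_x w contains neither x nor e_n. Together with `bOp_transverse` this
leaves only the scalar equation with μ = 0 on such forms. -/
lemma nOp_transverse {w : Form (d + 1) p} (hw : intMul (Fin.last d) (incl (d + 1) p w) = 0)
    (x : Space d) : nOp d p (transverse w x) = 0 := by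
  apply incl_injective
  have h1 := intMul_extVec (lift x 0) (Fin.last d) (incl (d + 1) p w)
  rw [hw, map_zero, add_zero, lift_last, Complex.ofReal_zero, zero_smul] at h1
  rw [incl_nOp, incl_transverse, map_zero]
  have h2 := intVec_intMul (lift x 0) (Fin.last d) (extVec (lift x 0) (incl (d + 1) p w))
  rw [h1, map_zero] at h2
  rw [zero_eq_neg.1 h2, map_zero]

lemma bOp_transverse {w : Form (d + 1) p} (hw : intMul (Fin.last d) (incl (d + 1) p w) = 0)
    (x : Space d) : bOp p x (transverse w x) = 0 := by
  apply incl_injective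
  have h1 := intMul_extVec (lift x 0) (Fin.last d) (incl (d + 1) p w)
  rw [hw, map_zero, add_zero, lift_last, Complex.ofReal_zero, zero_smul] at h1
  have h2 := intVec_extVec (lift x 0) (extVec (lift x 0) (incl (d + 1) p w))
  rw [extVec_extVec, map_zero, zero_add] at h2
  rw [incl_bOp, incl_transverse, map_zero, intVec_intVec, map_zero, add_zero, h2, map_smul, h1,
    smul_zero]

/-- Take w = e_I with I avoiding n and some j < n, which is possible because p < d. At x = (3/2) e_j
the operator i_x ε_x multiplies w by 9/4, and this point lies in the annulus 1 < |x| < 2 that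
supports the eigenvector. -/
lemma exists_transverse_ne_zero (hp : p < d) : ∃ w : Form (d + 1) p,
    intMul (Fin.last d) (incl (d + 1) p w) = 0 ∧
    ∃ j : Fin d, transverse w (EuclideanSpace.single j (3 / 2 : ℝ)) ≠ 0 := by
  obtain ⟨J, -, hJ⟩ := Finset.exists_subset_card_eq (s := (Finset.univ : Finset (Fin d))) (n := p)
    (by simpa using hp.le)
  obtain ⟨j, hj⟩ : ∃ j, j ∉ J := by
    by_contra! h
    have : J = Finset.univ := Finset.eq_univ_iff_forall.2 h
    rw [this, Finset.card_univ, Fintype.card_fin] at hJ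
    omega
  let I : Finset (Fin (d + 1)) := J.map Fin.castSuccEmb
  have hI : I.card = p := by rw [Finset.card_map, hJ]
  let w : Form (d + 1) p := EuclideanSpace.single ⟨I, hI⟩ 1
  have hint : ∀ i, i ∉ I → intMul i (incl (d + 1) p w) = 0 := by
    intro i hi
    ext K
    rw [intMul_apply, incl_apply]
    split_ifs with h1 h2
    · rfl
    · have : (⟨insert i K, h2⟩ : {I : Finset (Fin (d + 1)) // I.card = p}) ≠ ⟨I, hI⟩ := by
        intro h
        have h' : insert i K = I := congrArg Subtype.val h
        exact hi (h' ▸ Finset.mem_insert_self i K)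
      simp [w, this]
    · simp
  have hj' : j.castSucc ∉ I := by simpa [I] using hj
  refine ⟨w, hint _ (by simp [I]), j, fun h0 => ?_⟩
  have h1 := incl_transverse w (EuclideanSpace.single j (3 / 2 : ℝ))
  have hx : ∀ i, (lift (EuclideanSpace.single j (3 / 2 : ℝ)) 0) i =
      if i = j.castSucc then (3 / 2 : ℝ) else 0 := by
    intro i
    refine Fin.lastCases ?_ (fun i => ?_) i
    · rw [lift_last, if_neg (Fin.castSucc_lt_last j).ne']
    · rw [lift_castSucc]; simp [Pi.single_apply]
  have he : ∀ v, extVec (lift (EuclideanSpace.single j (3 / 2 : ℝ)) 0) v =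
      (3 / 2 : ℂ) • extMul j.castSucc v := by
    intro v
    simp only [extVec, _root_.sum_apply, _root_.smul_apply, hx]
    rw [Finset.sum_eq_single j.castSucc (fun b _ hb => by simp [hb]) (by simp)]
    simp
  have hi : ∀ v, intVec (lift (EuclideanSpace.single j (3 / 2 : ℝ)) 0) v =
      (3 / 2 : ℂ) • intMul j.castSucc v := by
    intro v
    simp only [intVec, _root_.sum_apply, _root_.smul_apply, hx]
    rw [Finset.sum_eq_single j.castSucc (fun b _ hb => by simp [hb]) (by simp)]
    simp
  rw [h0, map_zero, he, hi, map_smul, int_ext_mul, hint _ hj', map_zero, sub_zero, smul_smul] at h1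
  have h2 : incl (d + 1) p w = 0 := by
    rcases smul_eq_zero.1 h1.symm with h | h
    · norm_num at h
    · exact h
  have h3 := norm_incl w
  rw [h2] at h3
  simp [w] at h3

lemma one_add_sq_rpow_le {s : ℝ} (hs : 0 ≤ s) {ρ : ℝ} (hρ : 1 ≤ ρ) (τ : ℝ) :
    (ρ ^ 2 + τ ^ 2) ^ (-s) ≤ 2 ^ s * (1 + |τ|) ^ (-(2 * s)) := by
  have h0 := abs_nonneg τ
  have h1 : (1 + |τ|) ^ 2 / 2 ≤ ρ ^ 2 + τ ^ 2 := by
    rw [← sq_abs τ]; nlinarith [sq_nonneg (1 - |τ|)]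
  refine (Real.rpow_le_rpow_of_nonpos (by positivity) h1 (neg_nonpos.2 hs)).trans_eq ?_
  rw [Real.div_rpow (by positivity) zero_le_two, Real.rpow_neg zero_le_two, div_inv_eq_mul,
    mul_comm, ← Real.rpow_natCast, ← Real.rpow_mul (by positivity)]
  congr 2
  push_cast
  ring

lemma mem_pointSpectrum_closure {H : Type*} [NormedAddCommGroup H] [InnerProductSpace ℂ H]
    {T : H →ₗ.[ℂ] H} {u : H} {κ : ℂ} (hu : u ≠ 0) (h : (u, κ • u) ∈ T.closure.graph) :
    κ ∈ pointSpectrum T.closure := by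
  obtain ⟨v, h1, h2⟩ := (LinearPMap.mem_graph_iff _).1 h
  exact ⟨v, by rwa [h1], by rw [h2, h1]⟩

/-- The substitution τ = |x| t reduces the line equation to the polynomial equation. Under the
weight r^{-(2-a)} a polynomial of degree k is square integrable as soon as 2 - a - 2k > 1, which is
the hypothesis on k. -/
lemma eigenvalue_mem_pointSpectrum (hd : 0 < d) (ha : 2 - ((d + 1 : ℕ) : ℝ) + 2 * p < a) (k : ℕ)
    (hk : (k : ℝ) < (1 - a) / 2) :
    (((k : ℝ) * (k + a - 1) : ℝ) : ℂ) ∈ pointSpectrum (deltaMin d p a hs).closure := by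
  have hk0 : (0 : ℝ) ≤ k := k.cast_nonneg
  have hpd : p < d := by
    push_cast at ha
    have h1 : (2 : ℝ) * p < d := by linarith
    have h2 : 2 * p < d := by exact_mod_cast h1
    omega
  obtain ⟨q, hq0, hqk, hode⟩ := exists_eigenpolynomial k a
  obtain ⟨w, hw, j, hj⟩ := exists_transverse_ne_zero hpd
  -- An annulus makes the bounds uniform in x: |τ/|x|| ≤ |τ|, r² is comparable with (1 + |τ|)² from
  -- below, and `transverse w` is bounded.
  let A : Set (Space d) := {x | 1 < ‖x‖ ∧ ‖x‖ < 2}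
  have hA : IsOpen A := (isOpen_lt continuous_const continuous_norm).inter
    (isOpen_lt continuous_norm continuous_const)
  let c : Space d → ℝ := A.indicator fun _ => 1
  have hcm : Measurable c := measurable_const.indicator hA.measurableSet
  let G : Space d × ℝ → Form (d + 1) p := fun z =>
    ((c z.1 * q.eval (z.2 / ‖z.1‖) : ℝ) : ℂ) • transverse w z.1
  let U : Space (d + 1) → Form (d + 1) p := fun ξ => G ((liftHomeo d).symm ξ)
  have hUl : ∀ x τ, U (lift x τ) = G (x, τ) := fun x τ =>
    congrArg G ((liftHomeo d).symm_apply_apply (x, τ))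
  have hGm : Measurable G := by
    have h1 : Measurable fun z : Space d × ℝ => ((c z.1 * q.eval (z.2 / ‖z.1‖) : ℝ) : ℂ) :=
      Complex.measurable_ofReal.comp ((hcm.comp measurable_fst).mul
        (q.continuous.measurable.comp (measurable_snd.div measurable_fst.norm)))
    have h2 : Measurable fun z : Space d × ℝ => transverse w z.1 :=
      (continuous_transverse w).measurable.comp measurable_fst
    exact h1.smul h2
  have hUm : AEStronglyMeasurable U volume :=
    (hGm.comp (liftHomeo d).symm.continuous.measurable).aestronglyMeasurable
  obtain ⟨C, hC, hqb⟩ := polynomial_bound hqk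
  obtain ⟨K, hK⟩ := (isCompact_closedBall (0 : Space d) 2).exists_bound_of_continuousOn
    (continuous_transverse w).continuousOn
  have hs0 : 0 ≤ (2 - a) / 2 := by linarith
  have hUi : Integrable fun ξ => wt (-(2 * ((2 - a) / 2))) ξ * ‖U ξ‖ ^ 2 := by
    rw [← integrable_lift]
    have hcint : Integrable c := by
      refine (integrable_indicator_iff hA.measurableSet).2 (integrableOn_const ?_)
      refine ((measure_mono fun x hx => ?_).trans_lt (measure_ball_lt_top (x := (0 : Space d))
        (r := 2))).ne
      simpa using hx.2
    have hτint : Integrable fun τ : ℝ => (1 + ‖τ‖) ^ (-((2 - a) - 2 * k)) :=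
      integrable_one_add_norm (by simp; linarith)
    refine ((hcint.mul_prod hτint).const_mul ((2 * Real.pi) ^ (-(2 * ((2 - a) / 2))) *
      (2 ^ ((2 - a) / 2) * (C * K) ^ 2))).mono' ?_ (Filter.Eventually.of_forall fun z => ?_)
    · refine (Measurable.mul ?_ (Measurable.pow_const (Measurable.norm ?_) 2)).aestronglyMeasurable
      · exact (measurable_wt _).comp (liftHomeo d).continuous.measurable
      · simp only [hUl]; exact hGm
    · obtain ⟨x, τ⟩ := z
      beta_reduce
      rw [hUl, Real.norm_of_nonneg (mul_nonneg (wt_nonneg _ _) (sq_nonneg _))]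
      by_cases hx : x ∈ A
      · have hc1 : c x = 1 := Set.indicator_of_mem hx _
        have hτ0 := abs_nonneg τ
        have hx1 : |τ / ‖x‖| ≤ |τ| := by
          rw [abs_div, abs_norm]
          exact div_le_self hτ0 hx.1.le
        have h1 : ‖G (x, τ)‖ ≤ C * (1 + |τ|) ^ k * K := by
          change ‖((c x * q.eval (τ / ‖x‖) : ℝ) : ℂ) • transverse w x‖ ≤ _
          rw [norm_smul, Complex.norm_real, hc1, one_mul, Real.norm_eq_abs]
          refine mul_le_mul ((hqb _).trans ?_) (hK x ?_) (norm_nonneg _) (by positivity)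
          · gcongr
          · simpa using hx.2.le
        have h2 := one_add_sq_rpow_le hs0 hx.1.le τ
        rw [wt_lift, hc1, one_mul, show -(2 * ((2 - a) / 2)) / 2 = -((2 - a) / 2) by ring,
          Real.norm_eq_abs]
        have h3 : (1 + |τ|) ^ (-((2 - a) - 2 * (k : ℝ))) =
            (1 + |τ|) ^ (-(2 * ((2 - a) / 2))) * ((1 + |τ|) ^ k) ^ 2 := by
          rw [← pow_mul, ← Real.rpow_natCast, ← Real.rpow_add (by positivity)]
          congr 1
          push_cast
          ring
        rw [h3]
        calc (2 * Real.pi) ^ (-(2 * ((2 - a) / 2))) * (‖x‖ ^ 2 + τ ^ 2) ^ (-((2 - a) / 2)) *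
              ‖G (x, τ)‖ ^ 2
            ≤ (2 * Real.pi) ^ (-(2 * ((2 - a) / 2))) *
              (2 ^ ((2 - a) / 2) * (1 + |τ|) ^ (-(2 * ((2 - a) / 2)))) *
              (C * (1 + |τ|) ^ k * K) ^ 2 := by gcongr
          _ = _ := by ring
      · have hc0 : c x = 0 := Set.indicator_of_notMem hx _
        have h1 : G (x, τ) = 0 := by
          change ((c x * q.eval (τ / ‖x‖) : ℝ) : ℂ) • transverse w x = 0
          rw [hc0, zero_mul, Complex.ofReal_zero, zero_smul]
        rw [h1, hc0]
        simp
  obtain ⟨u, hu⟩ := HSob.exists_of_dualHat hs hUm hUi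
  have hadj := deltaMin_adjoint_of_fibers hd (κ := (((k : ℝ) * (k + a - 1) : ℝ) : ℂ)) (u := u) ?_
  · refine mem_pointSpectrum_closure (u := u) (fun hu0 => ?_)
      (mem_closure_graph_deltaMin hd fun φ => by rw [hadj φ, inner_smul_right])
    have h0 : U =ᵐ[volume] 0 := by
      refine hu.symm.trans ?_
      have h1 : u.hat =ᵐ[volume] fun _ => 0 := by
        refine u.isRep_hat.ae_eq ?_
        rw [hu0, map_zero, FourierTransform.fourier_zero]
        exact IsRep.zero
      filter_upwards [h1] with ξ hξ
      rw [HSob.dualHat, hξ, map_zero, smul_zero]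
      rfl
    have h1 : ∀ᵐ x : Space d, x ∈ A → transverse w x = 0 := by
      filter_upwards [ae_lift h0] with x hx hxA
      by_contra hne
      apply hq0
      have hc1 : c x = 1 := Set.indicator_of_mem hxA _
      have hx0 : ‖x‖ ≠ 0 := (zero_lt_one.trans hxA.1).ne'
      have h2 : ∀ τ, G (x, τ) = 0 := by
        have hcont : Continuous fun τ : ℝ => G (x, τ) := by
          have h2 : Continuous fun τ : ℝ => ((c x * q.eval (τ / ‖x‖) : ℝ) : ℂ) :=
            Complex.continuous_ofReal.comp (continuous_const.mul
              (q.continuous.comp (continuous_id.div_const _)))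
          exact h2.smul (continuous_const (y := transverse w x))
        have := (hcont.ae_eq_iff_eq volume continuous_const (g := fun _ => 0)).1 ?_
        · exact fun τ => congrFun this τ
        · filter_upwards [hx] with τ hτ
          rw [← hUl, hτ]; rfl
      refine Polynomial.funext fun t => ?_
      have h3 : ((c x * q.eval (t * ‖x‖ / ‖x‖) : ℝ) : ℂ) • transverse w x = 0 := h2 (t * ‖x‖)
      rw [hc1, one_mul, mul_div_cancel_right₀ _ hx0] at h3
      rcases smul_eq_zero.1 h3 with h | h
      · simpa using h
      · exact absurd h hne
    -- If u were zero, this open set would be null, hence empty, but it contains (3/2) e_j.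
    have h2 : IsOpen (A ∩ {x | transverse w x ≠ 0}) :=
      hA.inter (isOpen_ne_fun (continuous_transverse w) continuous_const)
    have h3 : volume (A ∩ {x | transverse w x ≠ 0}) = 0 := by
      rw [← compl_mem_ae_iff]
      filter_upwards [h1] with x hx hx'
      exact hx'.2 (hx hx'.1)
    have h4 := h2.eq_empty_of_measure_zero h3
    have h5 : EuclideanSpace.single j (3 / 2 : ℝ) ∈ A ∩ {x : Space d | transverse w x ≠ 0} := by
      refine ⟨?_, hj⟩
      change 1 < ‖EuclideanSpace.single j (3 / 2 : ℝ)‖ ∧ ‖EuclideanSpace.single j (3 / 2 : ℝ)‖ < 2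
      rw [EuclideanSpace.norm_single, Real.norm_of_nonneg (by norm_num)]
      constructor <;> norm_num
    rw [h4] at h5
    exact h5
  · filter_upwards [ae_lift hu] with x hx hx0
    have hρ := norm_pos_iff.2 hx0
    have hd1 : ∀ (q : Polynomial ℝ) τ, HasDerivAt
        (fun τ => ((c x * q.eval (τ / ‖x‖) : ℝ) : ℂ) • transverse w x)
        (((c x * q.derivative.eval (τ / ‖x‖) / ‖x‖ : ℝ) : ℂ) • transverse w x) τ := by
      intro q τ
      have h1 := (q.hasDerivAt (τ / ‖x‖)).comp τ ((hasDerivAt_id τ).div_const ‖x‖)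
      refine ((h1.const_mul (c x)).congr_deriv ?_).ofReal_comp.smul_const _
      ring
    have hd2 : ∀ τ, HasDerivAt
        (fun τ => ((c x * q.derivative.eval (τ / ‖x‖) / ‖x‖ : ℝ) : ℂ) • transverse w x)
        (((c x * q.derivative.derivative.eval (τ / ‖x‖) / ‖x‖ / ‖x‖ : ℝ) : ℂ) •
          transverse w x) τ := by
      intro τ
      have h1 := (q.derivative.hasDerivAt (τ / ‖x‖)).comp τ ((hasDerivAt_id τ).div_const ‖x‖)
      refine (((h1.const_mul (c x)).div_const ‖x‖).congr_deriv ?_).ofReal_comp.smul_const _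
      ring
    have hbound : ∀ (q : Polynomial ℝ) (b : ℝ), ∃ (C : ℝ) (k : ℕ), ∀ τ,
        ‖((c x * q.eval (τ / ‖x‖) / b : ℝ) : ℂ) • transverse w x‖ ≤ C * (1 + |τ|) ^ k := by
      intro q b
      obtain ⟨C, hC, hb⟩ := polynomial_bound (q := q.comp (Polynomial.C ‖x‖⁻¹ * Polynomial.X)) le_rfl
      refine ⟨|c x / b| * C * ‖transverse w x‖,
        (q.comp (Polynomial.C ‖x‖⁻¹ * Polynomial.X)).natDegree, fun τ => ?_⟩
      have h1 := hb τ
      rw [Polynomial.eval_comp, Polynomial.eval_mul, Polynomial.eval_C, Polynomial.eval_X,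
        inv_mul_eq_div] at h1
      rw [norm_smul, Complex.norm_real, Real.norm_eq_abs, mul_div_right_comm, abs_mul]
      calc |c x / b| * |q.eval (τ / ‖x‖)| * ‖transverse w x‖ ≤ |c x / b| *
            (C * (1 + |τ|) ^ (q.comp (Polynomial.C ‖x‖⁻¹ * Polynomial.X)).natDegree) *
            ‖transverse w x‖ := by gcongr
        _ = _ := by ring
    obtain ⟨C₀, k₀, b0⟩ := hbound q 1
    obtain ⟨C₁, k₁, b1⟩ := hbound q.derivative ‖x‖
    refine ⟨fun τ => ((c x * q.eval (τ / ‖x‖) : ℝ) : ℂ) • transverse w x, _, _,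
      hx.mono fun τ hτ => hτ.trans (hUl x τ),
      ⟨hd1 q, hd2, fun τ => ?_⟩, C₀, C₁, k₀, k₁, fun τ => ?_, b1⟩
    · change _ = (((k : ℝ) * (k + a - 1) : ℝ) : ℂ) •
        (((c x * q.eval (τ / ‖x‖) : ℝ) : ℂ) • transverse w x)
      beta_reduce
      rw [map_smul, map_smul, bOp_transverse hw, nOp_transverse hw, smul_zero, smul_zero, smul_zero,
        smul_zero, sub_zero, sub_zero, smul_smul, smul_smul, smul_smul, ← add_smul]
      congr 1
      norm_cast
      have := hode (τ / ‖x‖)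
      rw [mul_left_comm, ← this]
      field_simp
      ring
    · have := b0 τ
      rwa [div_one] at this

end Eigenvectors

/-! ### Pullback to the hyperplane and the symbol -/

section Pullback

variable {d p : ℕ}

/-- The pullback `⋀ ℂ^{d+1} → ⋀ ℂᵈ` along the inclusion `x' ↦ (x', 0)`. -/
def pullExt (d : ℕ) : Ext (d + 1) →L[ℂ] Ext d :=
  LinearMap.toContinuousLinearMap
    { toFun := fun v => WithLp.toLp 2 fun J => v (J.map Fin.castSuccEmb)
      map_add' := by intro v w; ext J; simp
      map_smul' := by intro c v; ext J; simp }

lemma pullExt_apply (v : Ext (d + 1)) (J : Finset (Fin d)) :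
    pullExt d v J = v (J.map Fin.castSuccEmb) := rfl

lemma pullForm_apply (v : Form (d + 1) p) (J : {J : Finset (Fin d) // J.card = p}) :
    pullForm d p v J = v ⟨J.1.map Fin.castSuccEmb, by rw [Finset.card_map, J.2]⟩ := rfl

lemma incl_pullForm (v : Form (d + 1) p) :
    incl d p (pullForm d p v) = pullExt d (incl (d + 1) p v) := by
  ext J
  rw [pullExt_apply, incl_apply, incl_apply]
  by_cases h : J.card = p
  · rw [dif_pos h, dif_pos (by rw [Finset.card_map, h])]
    rfl
  · rw [dif_neg h, dif_neg (by rwa [Finset.card_map])]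

lemma sgn_castSucc (j : Fin d) (J : Finset (Fin d)) :
    sgn j.castSucc (J.map Fin.castSuccEmb) = sgn j J := by
  unfold sgn
  rw [Finset.filter_map, Finset.card_map]
  congr 2

lemma castSucc_mem_map {j : Fin d} {J : Finset (Fin d)} :
    j.castSucc ∈ J.map Fin.castSuccEmb ↔ j ∈ J := by
  simp

lemma last_notMem_map (J : Finset (Fin d)) : Fin.last d ∉ J.map Fin.castSuccEmb := by
  simp

lemma pullExt_extMul_castSucc (j : Fin d) (v : Ext (d + 1)) :
    pullExt d (extMul j.castSucc v) = extMul j (pullExt d v) := by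
  ext J
  rw [pullExt_apply, extMul_apply, extMul_apply, pullExt_apply, sgn_castSucc, Finset.map_erase]
  simp only [castSucc_mem_map]
  rfl

lemma pullExt_intMul_castSucc (j : Fin d) (v : Ext (d + 1)) :
    pullExt d (intMul j.castSucc v) = intMul j (pullExt d v) := by
  ext J
  rw [pullExt_apply, intMul_apply, intMul_apply, pullExt_apply, sgn_castSucc, Finset.map_insert]
  simp only [castSucc_mem_map]
  rfl

lemma pullExt_extMul_last (v : Ext (d + 1)) : pullExt d (extMul (Fin.last d) v) = 0 := by
  ext J
  rw [pullExt_apply, extMul_apply, if_neg (last_notMem_map J)]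
  rfl

lemma pullExt_extVec_lift (x : Space d) (τ : ℝ) (v : Ext (d + 1)) :
    pullExt d (extVec (lift x τ) v) = extVec x (pullExt d v) := by
  simp only [extVec, _root_.add_apply, map_add, _root_.sum_apply, _root_.smul_apply, map_sum, map_smul,
    Fin.sum_univ_castSucc,
    lift_castSucc, lift_last, pullExt_extMul_castSucc, pullExt_extMul_last, smul_zero, add_zero]

lemma pullExt_intVec_lift (x : Space d) (τ : ℝ) {v : Ext (d + 1)}
    (hv : intMul (Fin.last d) v = 0) :
    pullExt d (intVec (lift x τ) v) = intVec x (pullExt d v) := by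
  simp only [intVec, _root_.add_apply, map_add, _root_.sum_apply, _root_.smul_apply, map_sum, map_smul,
    Fin.sum_univ_castSucc,
    lift_castSucc, lift_last, pullExt_intMul_castSucc, hv, map_zero, smul_zero, add_zero]

lemma intMul_last_of_nOp {v : Form (d + 1) p} (hv : nOp d p v = 0) :
    intMul (Fin.last d) (incl (d + 1) p v) = 0 := by
  have h := incl_nOp v
  rw [hv, map_zero] at h
  have h1 := int_ext_mul (Fin.last d) (intMul (Fin.last d) (incl (d + 1) p v))
  rw [← h, map_zero] at h1
  rw [intMul_intMul_self, map_zero, sub_zero] at h1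
  exact h1.symm

/-- The kernel of N consists of the forms without e_n, and the pullback forgets only coefficients
with e_n. The inverse on this kernel is `extForm`. -/
lemma eq_zero_of_pullForm {v : Form (d + 1) p} (hv : nOp d p v = 0) (h : pullForm d p v = 0) :
    v = 0 := by
  ext I
  by_cases hI : Fin.last d ∈ I.1
  · have h1 := congrArg (fun w : Ext (d + 1) => w (I.1.erase (Fin.last d))) (intMul_last_of_nOp hv)
    simp only [intMul_apply, Finset.notMem_erase, if_false, Finset.insert_erase hI, incl_apply, I.2,
      dif_pos] at h1
    rcases mul_eq_zero.1 h1 with h2 | h2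
    · have := sgn_sq (Fin.last d) (I.1.erase (Fin.last d))
      rw [Complex.ofReal_eq_zero.1 h2] at this
      simp at this
    · exact h2
  · have hJ : (Finset.univ.filter fun j : Fin d => j.castSucc ∈ I.1).map Fin.castSuccEmb = I.1 := by
      ext i
      refine Fin.lastCases ?_ (fun j => ?_) i
      · simp [hI]
      · simp
    have h1 := congrArg (fun w : Form d p => w ⟨_, by rw [← Finset.card_map Fin.castSuccEmb, hJ, I.2]⟩) h
    simp only [pullForm_apply, hJ] at h1
    exact h1

/-- The extension of forms on `ℝᵈ` to forms on `ℝ^{d+1}` which do not depend on `x_n`. -/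
def extForm (d p : ℕ) : Form d p →L[ℂ] Form (d + 1) p :=
  LinearMap.toContinuousLinearMap
    { toFun := fun w => WithLp.toLp 2 fun I =>
        ∑ J : {J : Finset (Fin d) // J.card = p}, if J.1.map Fin.castSuccEmb = I.1 then w J else 0
      map_add' := by
        intro v w; ext I
        simp only [PiLp.add_apply, ← Finset.sum_add_distrib]
        exact Finset.sum_congr rfl fun J _ => by split_ifs <;> simp
      map_smul' := by
        intro c v; ext I
        simp only [PiLp.smul_apply, Finset.smul_sum, RingHom.id_apply]
        exact Finset.sum_congr rfl fun J _ => by split_ifs <;> simp }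

lemma extForm_apply (w : Form d p) (I : {I : Finset (Fin (d + 1)) // I.card = p}) :
    extForm d p w I = ∑ J : {J : Finset (Fin d) // J.card = p},
      if J.1.map Fin.castSuccEmb = I.1 then w J else 0 := rfl

lemma pullForm_extForm (w : Form d p) : pullForm d p (extForm d p w) = w := by
  ext J
  rw [pullForm_apply, extForm_apply, Finset.sum_eq_single J]
  · simp
  · intro K _ hK
    rw [if_neg fun h => hK (Subtype.ext (Finset.map_injective _ h))]
  · simp

lemma nOp_extForm (w : Form d p) : nOp d p (extForm d p w) = 0 := by
  apply incl_injective
  rw [incl_nOp, map_zero]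
  have h : intMul (Fin.last d) (incl (d + 1) p (extForm d p w)) = 0 := by
    ext K
    rw [intMul_apply, incl_apply]
    split_ifs with h1 h2
    · rfl
    · rw [extForm_apply, Finset.sum_eq_zero, mul_zero]
      · rfl
      · intro J _
        refine if_neg fun h => last_notMem_map J.1 ?_
        rw [h]
        exact Finset.mem_insert_self _ _
    · rw [mul_zero]; rfl
  rw [h, map_zero]

/-- The operator `ε_x i_x` on `p`-forms. -/
def extIntForm (p : ℕ) (x : Space d) : Form d p →L[ℂ] Form d p :=
  proj d p ∘L (extVec x ∘L intVec x) ∘L incl d p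

lemma incl_extIntForm (x : Space d) (v : Form d p) :
    incl d p (extIntForm p x v) = extVec x (intVec x (incl d p v)) := by
  simp only [extIntForm, extVec, intVec, ContinuousLinearMap.comp_apply, _root_.sum_apply,
    _root_.smul_apply, map_sum, map_smul, incl_proj_extMul_intMul]

/-- Replacing i ε by 1 - ε i for the unit vector isolates the direction-dependent part with
coefficient -2s, making the symbol a multiple of the identity minus (2s/|ξ|²) ε_ξ i_ξ. -/
lemma incl_symbol_eq {n : ℕ} {ξ : Space n} (hξ : ξ ≠ 0) (s : ℝ) (v : Form n p) :
    incl n p (symbol n p s ξ v) = (((n : ℝ) / 2 - p + s : ℝ) : ℂ) • incl n p v -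
      ((2 * s * (‖ξ‖ ^ 2)⁻¹ : ℝ) : ℂ) • extVec ξ (intVec ξ (incl n p v)) := by
  have hn : ‖‖ξ‖⁻¹ • ξ‖ = 1 := by
    rw [norm_smul, norm_inv, norm_norm, inv_mul_cancel₀ (norm_ne_zero_iff.2 hξ)]
  rw [incl_symbol, int_ext_unit hn, extVec_smul, intVec_smul]
  simp only [_root_.smul_apply, map_smul, smul_sub, smul_smul]
  push_cast
  module

lemma symbol_eq {n : ℕ} {ξ : Space n} (hξ : ξ ≠ 0) (s : ℝ) (v : Form n p) :
    symbol n p s ξ v = (((n : ℝ) / 2 - p + s : ℝ) : ℂ) • v -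
      ((2 * s * (‖ξ‖ ^ 2)⁻¹ : ℝ) : ℂ) • extIntForm p ξ v := by
  apply incl_injective
  rw [incl_symbol_eq hξ, map_sub, map_smul, map_smul, incl_extIntForm]

/-- On forms without e_n the pullback intertwines ε_ξ i_ξ with ε_x i_x. The only remaining
dependence on τ is the scalar 1/r², so line integrals of the symbol reduce to two scalar integrals.
-/
lemma pullForm_symbol {x : Space d} (hx : x ≠ 0) (s τ : ℝ) {v : Form (d + 1) p}
    (hv : nOp d p v = 0) :
    pullForm d p (symbol (d + 1) p s (lift x τ) v) =
      ((((d + 1 : ℕ) : ℝ) / 2 - p + s : ℝ) : ℂ) • pullForm d p v -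
      ((2 * s * (‖x‖ ^ 2 + τ ^ 2)⁻¹ : ℝ) : ℂ) • extIntForm p x (pullForm d p v) := by
  have hl : lift x τ ≠ 0 := by
    intro h0
    have h1 := norm_lift_sq x τ
    rw [h0, norm_zero] at h1
    have := norm_pos_iff.2 hx
    nlinarith [sq_nonneg τ]
  apply incl_injective
  rw [incl_pullForm, incl_symbol_eq hl, map_sub, map_sub, map_smul, map_smul, map_smul, map_smul,
    incl_extIntForm, pullExt_extVec_lift, pullExt_intVec_lift x τ (intMul_last_of_nOp hv),
    incl_pullForm, norm_lift_sq]

end Pullback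

/-! ### Line integrals of powers of |x|² + τ² -/

section LineIntegrals

variable {d p : ℕ}

lemma integrable_rpow_neg {ρ s : ℝ} (hρ : 0 < ρ) (hs : 1 / 2 < s) :
    Integrable fun τ : ℝ => (ρ ^ 2 + τ ^ 2) ^ (-s) := by
  have h0 := integrable_rpow_neg_one_add_norm_sq (E := ℝ) (μ := volume) (r := 2 * s)
    (by rw [Module.finrank_self]; push_cast; linarith)
  refine ((h0.comp_div hρ.ne').const_mul (ρ ^ (-(2 * s)))).congr
    (Filter.Eventually.of_forall fun τ => ?_)
  have h2 : ρ ^ 2 + τ ^ 2 = ρ ^ 2 * (1 + ‖τ / ρ‖ ^ 2) := by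
    rw [Real.norm_eq_abs, sq_abs]
    field_simp
  beta_reduce
  rw [h2, Real.mul_rpow (by positivity) (by positivity), ← Real.rpow_natCast ρ,
    ← Real.rpow_mul hρ.le]
  congr 2
  · push_cast; ring
  · ring

lemma integral_rpow_neg {ρ s : ℝ} (hρ : 0 < ρ) :
    ∫ τ : ℝ, (ρ ^ 2 + τ ^ 2) ^ (-s) = ρ ^ (1 - 2 * s) * ∫ τ : ℝ, (1 + τ ^ 2) ^ (-s) := by
  have h1 : ∀ τ : ℝ, (ρ ^ 2 + τ ^ 2) ^ (-s) = ρ ^ (-(2 * s)) * (1 + (τ / ρ) ^ 2) ^ (-s) := by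
    intro τ
    have h2 : ρ ^ 2 + τ ^ 2 = ρ ^ 2 * (1 + (τ / ρ) ^ 2) := by field_simp
    rw [h2, Real.mul_rpow (by positivity) (by positivity), ← Real.rpow_natCast,
      ← Real.rpow_mul hρ.le]
    congr 2
    push_cast
    ring
  simp only [h1]
  rw [integral_const_mul, Measure.integral_comp_div (fun τ : ℝ => (1 + τ ^ 2) ^ (-s)),
    abs_of_pos hρ, smul_eq_mul, ← mul_assoc, ← Real.rpow_add_one hρ.ne']
  congr 2
  ring

lemma integral_rpow_neg_pos {s : ℝ} (hs : 1 / 2 < s) : 0 < ∫ τ : ℝ, (1 + τ ^ 2) ^ (-s) := by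
  have h := integrable_rpow_neg one_pos hs
  rw [one_pow] at h
  refine (integral_pos_iff_support_of_nonneg (fun τ => by positivity) h).2 ?_
  have : (Function.support fun τ : ℝ => (1 + τ ^ 2) ^ (-s)) = Set.univ := by
    refine Set.eq_univ_of_forall fun τ => ?_
    exact (Real.rpow_pos_of_pos (by positivity) _).ne'
  rw [this]
  simp

/-- Integrate the derivative of τ (ρ² + τ²)^{-s}, which tends to zero at both ends because 2s > 1.
-/
lemma integral_rpow_neg_inv {ρ s : ℝ} (hρ : 0 < ρ) (hs : 1 / 2 < s) :
    (Integrable fun τ : ℝ => (ρ ^ 2 + τ ^ 2) ^ (-s) * (ρ ^ 2 + τ ^ 2)⁻¹) ∧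
    2 * s * ρ ^ 2 * ∫ τ : ℝ, (ρ ^ 2 + τ ^ 2) ^ (-s) * (ρ ^ 2 + τ ^ 2)⁻¹ =
      (2 * s - 1) * ∫ τ : ℝ, (ρ ^ 2 + τ ^ 2) ^ (-s) := by
  have hi := integrable_rpow_neg hρ hs
  have hr : ∀ τ : ℝ, 0 < ρ ^ 2 + τ ^ 2 := fun τ => by positivity
  have heq : ∀ τ : ℝ, (ρ ^ 2 + τ ^ 2) ^ (-s) * (ρ ^ 2 + τ ^ 2)⁻¹ =
      (ρ ^ 2 + τ ^ 2) ^ (-(s + 1)) := by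
    intro τ
    rw [← Real.rpow_neg_one, ← Real.rpow_add (hr τ)]
    congr 1; ring
  have hi' : Integrable fun τ : ℝ => (ρ ^ 2 + τ ^ 2) ^ (-s) * (ρ ^ 2 + τ ^ 2)⁻¹ := by
    simp only [heq]
    exact integrable_rpow_neg hρ (by linarith)
  refine ⟨hi', ?_⟩
  have hd : ∀ τ : ℝ, HasDerivAt (fun τ : ℝ => τ * (ρ ^ 2 + τ ^ 2) ^ (-s))
      (2 * s * ρ ^ 2 * ((ρ ^ 2 + τ ^ 2) ^ (-s) * (ρ ^ 2 + τ ^ 2)⁻¹) -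
        (2 * s - 1) * (ρ ^ 2 + τ ^ 2) ^ (-s)) τ := by
    intro τ
    refine ((hasDerivAt_id τ).mul (hasDerivAt_rpow_sq_add_sq hρ (-s) τ)).congr_deriv ?_
    rw [Real.rpow_sub_one (hr τ).ne']
    have := (hr τ).ne'
    simp only [id]
    field_simp
    ring
  have hlim : ∀ l : Filter ℝ, Filter.Tendsto (fun τ : ℝ => |τ|) l Filter.atTop →
      Filter.Tendsto (fun τ : ℝ => τ * (ρ ^ 2 + τ ^ 2) ^ (-s)) l (nhds 0) := by
    intro l hl
    have h1 : Filter.Tendsto (fun τ : ℝ => |τ| ^ (-(2 * s - 1))) l (nhds 0) :=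
      (tendsto_rpow_neg_atTop (by linarith)).comp hl
    refine squeeze_zero_norm' ?_ h1
    filter_upwards [hl.eventually (Filter.eventually_gt_atTop 0)] with τ hτ
    rw [norm_mul, Real.norm_eq_abs, Real.norm_of_nonneg (by positivity)]
    have h2 : (ρ ^ 2 + τ ^ 2) ^ (-s) ≤ (|τ| ^ 2) ^ (-s) :=
      Real.rpow_le_rpow_of_nonpos (by positivity) (by rw [sq_abs]; nlinarith) (by linarith)
    refine (mul_le_mul_of_nonneg_left h2 hτ.le).trans_eq ?_
    rw [← Real.rpow_natCast, ← Real.rpow_mul hτ.le, ← Real.rpow_one_add' hτ.le]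
    · congr 1; push_cast; ring
    · push_cast; linarith
  have h0 := integral_of_hasDerivAt_of_tendsto hd
    ((hi'.const_mul (2 * s * ρ ^ 2)).sub (hi.const_mul (2 * s - 1)))
    (hlim _ Filter.tendsto_abs_atBot_atTop) (hlim _ Filter.tendsto_abs_atTop_atTop)
  rw [integral_sub (hi'.const_mul _) (hi.const_mul _), integral_const_mul, integral_const_mul,
    sub_zero, sub_eq_zero] at h0
  exact h0

/-- The boundary values of the kernel of `Δ_{a,p}`. -/
lemma integral_pullForm_symbol {s : ℝ} (hs : 1 / 2 < s) {x : Space d} (hx : x ≠ 0)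
    {v : Form (d + 1) p} (hv : nOp d p v = 0) :
    HasInt (fun τ : ℝ => (((‖x‖ ^ 2 + τ ^ 2) ^ (-s) : ℝ) : ℂ) •
      pullForm d p (symbol (d + 1) p (-s) (lift x τ) v))
      (((‖x‖ ^ (1 - 2 * s) * ∫ τ : ℝ, (1 + τ ^ 2) ^ (-s) : ℝ) : ℂ) •
        symbol d p (-(s - 1 / 2)) x (pullForm d p v)) := by
  have hρ := norm_pos_iff.2 hx
  obtain ⟨hi', h'⟩ := integral_rpow_neg_inv hρ hs
  have hi := integrable_rpow_neg hρ hs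
  have h1 : HasInt (fun τ : ℝ => (((‖x‖ ^ 2 + τ ^ 2) ^ (-s) : ℝ) : ℂ))
      ((∫ τ : ℝ, (‖x‖ ^ 2 + τ ^ 2) ^ (-s) : ℝ) : ℂ) := ⟨hi.ofReal, integral_ofReal⟩
  have h2 : HasInt (fun τ : ℝ => (((‖x‖ ^ 2 + τ ^ 2) ^ (-s) * (‖x‖ ^ 2 + τ ^ 2)⁻¹ : ℝ) : ℂ))
      ((∫ τ : ℝ, (‖x‖ ^ 2 + τ ^ 2) ^ (-s) * (‖x‖ ^ 2 + τ ^ 2)⁻¹ : ℝ) : ℂ) :=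
    ⟨hi'.ofReal, integral_ofReal⟩
  have hsm : ∀ {f : ℝ → ℂ} {c : ℂ} (w : Form d p), HasInt f c → HasInt (fun τ => f τ • w) (c • w) :=
    fun w h => ⟨h.1.smul_const w, by rw [integral_smul_const, h.2]⟩
  have h3 := (hsm (((((d + 1 : ℕ) : ℝ) / 2 - p - s : ℝ) : ℂ) • pullForm d p v) h1).add
    (hsm (((2 * s : ℝ) : ℂ) • extIntForm p x (pullForm d p v)) h2)
  rw [integral_rpow_neg hρ] at h3 h'
  set J : ℝ := ‖x‖ ^ (1 - 2 * s) * ∫ τ : ℝ, (1 + τ ^ 2) ^ (-s) with hJ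
  set J' : ℝ := ∫ τ : ℝ, (‖x‖ ^ 2 + τ ^ 2) ^ (-s) * (‖x‖ ^ 2 + τ ^ 2)⁻¹ with hJ'
  -- The coefficient 2s of the bulk symbol becomes 2s - 1 = 2(s - 1/2), and (d + 1)/2 - p - s = d/2
  -- - p - (s - 1/2). Integration over the line thus turns the symbol on ℝ^{d+1} of order -s into
  -- the symbol on ℝ^d of order -(s - 1/2).
  have h4 : 2 * s * J' = (2 * s - 1) * (‖x‖ ^ 2)⁻¹ * J := by
    field_simp
    linarith
  refine ⟨h3.1.congr (Filter.Eventually.of_forall fun τ => ?_), ?_⟩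
  · beta_reduce
    rw [pullForm_symbol hx _ _ hv]
    push_cast
    module
  · refine Eq.trans (integral_congr_ae (Filter.Eventually.of_forall fun τ => ?_)) (h3.2.trans ?_)
    · beta_reduce
      rw [pullForm_symbol hx _ _ hv]
      push_cast
      module
    · rw [symbol_eq hx, smul_smul ((J' : ℝ) : ℂ), ← Complex.ofReal_mul, mul_comm J', h4]
      push_cast
      module

end LineIntegrals

/-! ### The trace map on the Fourier side -/

section Trace

variable {n d p : ℕ} {s : ℝ}

lemma HSob.exists_of_hat (hs : |s| < (n : ℝ) / 2 - p) {g : Space n → Form n p}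
    (hg : AEStronglyMeasurable g volume) (hi : Integrable fun ξ => wt (2 * s) ξ * ‖g ξ‖ ^ 2) :
    ∃ u : HSob n p s hs, u.hat =ᵐ[volume] g := by
  obtain ⟨u, hu⟩ := HSob.exists_hat hs ((memLp_iff hg).1 hi)
  refine ⟨u, ?_⟩
  filter_upwards [hu, ae_ne_zero (dim_pos hs)] with ξ h hξ
  exact smul_right_injective _ (Complex.ofReal_ne_zero.2 (wt_pos s hξ).ne') h

variable {hs : |s| < ((d + 1 : ℕ) : ℝ) / 2 - p}

/-- The Fourier transform of the restriction of `u` to `ℝᵈ`. -/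
def HSob.trace (u : HSob (d + 1) p s hs) (x : Space d) : Form d p :=
  ∫ τ : ℝ, pullForm d p (u.hat (lift x τ))

lemma HSob.aestronglyMeasurable_hat_lift (u : HSob (d + 1) p s hs) :
    AEStronglyMeasurable (fun z : Space d × ℝ => u.hat (lift z.1 z.2)) (volume.prod volume) :=
  u.isRep_hat.1.comp_quasiMeasurePreserving (measurePreserving_lift d).quasiMeasurePreserving

lemma HSob.aestronglyMeasurable_trace (u : HSob (d + 1) p s hs) :
    AEStronglyMeasurable u.trace volume :=
  AEStronglyMeasurable.integral_prod_right' (f := fun z : Space d × ℝ =>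
    pullForm d p (u.hat (lift z.1 z.2)))
    ((pullForm d p).continuous.comp_aestronglyMeasurable u.aestronglyMeasurable_hat_lift)

/-- Cauchy-Schwarz for r^{-s} against r^{s} û. The integral of r^{-2s} over the line is finite
exactly because s > 1/2, and its size |x|^{1-2s} is the loss of half a derivative. -/
lemma HSob.ae_trace (h2 : 1 / 2 < s) (u : HSob (d + 1) p s hs) : ∀ᵐ x : Space d, x ≠ 0 →
    (Integrable fun τ => u.hat (lift x τ)) ∧
    ‖u.trace x‖ ^ 2 ≤ ‖pullForm d p‖ ^ 2 * ((‖x‖ ^ (1 - 2 * s) * ∫ τ : ℝ, (1 + τ ^ 2) ^ (-s)) *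
      ∫ τ, (‖x‖ ^ 2 + τ ^ 2) ^ s * ‖u.hat (lift x τ)‖ ^ 2) := by
  filter_upwards [u.ae_integrable_hat, u.aestronglyMeasurable_hat_lift.prodMk_left] with x hi hm hx
  have hρ := norm_pos_iff.2 hx
  have hr : ∀ τ : ℝ, 0 < ‖x‖ ^ 2 + τ ^ 2 := fun τ => by positivity
  set f : ℝ → ℝ := fun τ => (‖x‖ ^ 2 + τ ^ 2) ^ (-s / 2) with hf
  set g : ℝ → ℝ := fun τ => (‖x‖ ^ 2 + τ ^ 2) ^ (s / 2) * ‖u.hat (lift x τ)‖ with hg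
  have hf2 : ∀ τ, f τ ^ 2 = (‖x‖ ^ 2 + τ ^ 2) ^ (-s) := by
    intro τ
    rw [hf, ← Real.rpow_natCast, ← Real.rpow_mul (hr τ).le]
    congr 1; push_cast; ring
  have hg2 : ∀ τ, g τ ^ 2 = (‖x‖ ^ 2 + τ ^ 2) ^ s * ‖u.hat (lift x τ)‖ ^ 2 := by
    intro τ
    rw [hg]
    beta_reduce
    rw [mul_pow, ← Real.rpow_natCast (_ ^ _), ← Real.rpow_mul (hr τ).le]
    congr 2; push_cast; ring
  have hfg : ∀ τ, f τ * g τ = ‖u.hat (lift x τ)‖ := by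
    intro τ
    rw [hf, hg]
    beta_reduce
    rw [← mul_assoc, ← Real.rpow_add (hr τ), show -s / 2 + s / 2 = 0 by ring, Real.rpow_zero,
      one_mul]
  have hfL : MemLp f 2 volume := by
    refine (memLp_two_iff_integrable_sq
      (continuous_rpow_sq_add_sq hρ _).aestronglyMeasurable).2 ?_
    refine Integrable.congr ?_ (Filter.Eventually.of_forall fun τ => (hf2 τ).symm)
    exact integrable_rpow_neg hρ h2
  have hgL : MemLp g 2 volume := by
    refine (memLp_two_iff_integrable_sq
      ((continuous_rpow_sq_add_sq hρ _).aestronglyMeasurable.mul hm.norm)).2 ?_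
    exact hi.congr (Filter.Eventually.of_forall fun τ => (hg2 τ).symm)
  have hint : Integrable fun τ => ‖u.hat (lift x τ)‖ := by
    have := hfL.integrable_mul hgL
    refine this.congr (Filter.Eventually.of_forall fun τ => hfg τ)
  have hint' : Integrable fun τ => u.hat (lift x τ) := (integrable_norm_iff hm).1 hint
  refine ⟨hint', ?_⟩
  have hcs := integral_mul_sq_le (fun τ => by positivity) (fun τ => by positivity) hfL hgL
  simp only [hfg, hf2, hg2] at hcs
  rw [integral_rpow_neg hρ] at hcs
  have h4 : ‖u.trace x‖ ≤ ‖pullForm d p‖ * ∫ τ, ‖u.hat (lift x τ)‖ := by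
    rw [HSob.trace, ContinuousLinearMap.integral_comp_comm _ hint']
    exact ((pullForm d p).le_opNorm _).trans
      (mul_le_mul_of_nonneg_left (norm_integral_le_integral_norm _) (norm_nonneg _))
  calc ‖u.trace x‖ ^ 2 ≤ (‖pullForm d p‖ * ∫ τ, ‖u.hat (lift x τ)‖) ^ 2 :=
        pow_le_pow_left₀ (norm_nonneg _) h4 2
    _ = ‖pullForm d p‖ ^ 2 * (∫ τ, ‖u.hat (lift x τ)‖) ^ 2 := mul_pow _ _ _
    _ ≤ _ := mul_le_mul_of_nonneg_left hcs (sq_nonneg _)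

lemma HSob.trace_bound (h2 : 1 / 2 < s) (hd : 0 < d) : ∃ K : ℝ, 0 ≤ K ∧
    ∀ u : HSob (d + 1) p s hs,
      (Integrable fun x => wt (2 * (s - 1 / 2)) x * ‖u.trace x‖ ^ 2) ∧
      ∫ x, wt (2 * (s - 1 / 2)) x * ‖u.trace x‖ ^ 2 ≤
        K * ∫ ξ, wt (2 * s) ξ * ‖u.hat ξ‖ ^ 2 := by
  set K : ℝ := ‖pullForm d p‖ ^ 2 * (∫ τ : ℝ, (1 + τ ^ 2) ^ (-s)) * (2 * Real.pi)⁻¹ with hK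
  have hJ := integral_rpow_neg_pos h2
  refine ⟨K, by positivity, fun u => ?_⟩
  have hi := (memLp_iff u.isRep_hat.1).2 u.memLp_hat
  have hi' := integrable_lift.2 hi
  have hint : Integrable fun x : Space d => ∫ τ, wt (2 * s) (lift x τ) * ‖u.hat (lift x τ)‖ ^ 2 :=
    hi'.integral_prod_left
  have hle : ∀ᵐ x : Space d, ‖wt (2 * (s - 1 / 2)) x * ‖u.trace x‖ ^ 2‖ ≤
      K * ∫ τ, wt (2 * s) (lift x τ) * ‖u.hat (lift x τ)‖ ^ 2 := by
    filter_upwards [u.ae_trace h2, ae_ne_zero hd] with x hx hx0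
    have hρ := norm_pos_iff.2 hx0
    have hw := wt_nonneg (2 * (s - 1 / 2)) x
    rw [Real.norm_of_nonneg (by positivity)]
    refine (mul_le_mul_of_nonneg_left (hx hx0).2 hw).trans_eq ?_
    have h5 : ∀ τ, wt (2 * s) (lift x τ) * ‖u.hat (lift x τ)‖ ^ 2 =
        (2 * Real.pi) ^ (2 * s) * ((‖x‖ ^ 2 + τ ^ 2) ^ s * ‖u.hat (lift x τ)‖ ^ 2) := by
      intro τ
      rw [wt_lift, mul_div_cancel_left₀ s two_ne_zero, mul_assoc]
    simp only [h5]
    rw [integral_const_mul, wt, Real.mul_rpow (by positivity) hρ.le]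
    have h6 : ‖x‖ ^ (2 * (s - 1 / 2)) * ‖x‖ ^ (1 - 2 * s) = 1 := by
      rw [← Real.rpow_add hρ, show 2 * (s - 1 / 2) + (1 - 2 * s) = 0 by ring, Real.rpow_zero]
    have h7 : (2 * Real.pi) ^ (2 * (s - 1 / 2)) = (2 * Real.pi)⁻¹ * (2 * Real.pi) ^ (2 * s) := by
      rw [show 2 * (s - 1 / 2) = 2 * s - 1 by ring, Real.rpow_sub_one (by positivity)]
      ring
    rw [h7, hK]
    linear_combination (‖pullForm d p‖ ^ 2 * (∫ τ : ℝ, (1 + τ ^ 2) ^ (-s)) * (2 * Real.pi)⁻¹ *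
      (2 * Real.pi) ^ (2 * s) *
      ∫ τ, (‖x‖ ^ 2 + τ ^ 2) ^ s * ‖u.hat (lift x τ)‖ ^ 2) * h6
  have hm : AEStronglyMeasurable (fun x : Space d => wt (2 * (s - 1 / 2)) x * ‖u.trace x‖ ^ 2)
      volume :=
    (measurable_wt _).aestronglyMeasurable.mul (u.aestronglyMeasurable_trace.norm.pow 2)
  have hI := (hint.const_mul K).mono' hm hle
  refine ⟨hI, ?_⟩
  rw [integral_lift (fun ξ => wt (2 * s) ξ * ‖u.hat ξ‖ ^ 2), integral_prod _ hi',
    ← integral_const_mul]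
  refine integral_mono_ae hI (hint.const_mul K) ?_
  filter_upwards [hle] with x hx
  exact (le_abs_self _).trans hx

lemma HSob.norm_bounds {n : ℕ} {hs : |s| < (n : ℝ) / 2 - p} : ∃ C : ℝ, 0 ≤ C ∧
    ∀ u : HSob n p s hs, ‖u‖ ^ 2 ≤ C * ∫ ξ, wt (2 * s) ξ * ‖u.hat ξ‖ ^ 2 ∧
      ∫ ξ, wt (2 * s) ξ * ‖u.hat ξ‖ ^ 2 ≤ C * ‖u‖ ^ 2 := by
  obtain ⟨C, hC⟩ := HSob.upper (n := n) (p := p) (s := s) (hs := hs)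
  have hc : 0 < (n : ℝ) / 2 - p - |s| := by linarith
  have he : ∀ u : HSob n p s hs,
      ∫ ξ, ‖(wt s ξ : ℂ) • u.hat ξ‖ ^ 2 = ∫ ξ, wt (2 * s) ξ * ‖u.hat ξ‖ ^ 2 := by
    intro u
    simp only [norm_smul, Complex.norm_real, Real.norm_eq_abs, mul_pow, sq_abs, wt_sq]
  refine ⟨|C| + ((n : ℝ) / 2 - p - |s|)⁻¹, by positivity, fun u => ?_⟩
  have h1 := hC u
  have h2 := HSob.lower u
  rw [← HSob.norm_sq, he] at h1 h2
  have h0 : 0 ≤ ∫ ξ, wt (2 * s) ξ * ‖u.hat ξ‖ ^ 2 :=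
    integral_nonneg fun ξ => mul_nonneg (wt_nonneg _ _) (sq_nonneg _)
  constructor
  · refine h1.trans (mul_le_mul_of_nonneg_right ?_ h0)
    have := inv_pos.2 hc
    linarith [le_abs_self C]
  · rw [add_mul]
    have h3 : ∫ ξ, wt (2 * s) ξ * ‖u.hat ξ‖ ^ 2 ≤ ((n : ℝ) / 2 - p - |s|)⁻¹ * ‖u‖ ^ 2 := by
      rw [inv_mul_eq_div, le_div_iff₀ hc]
      linarith
    have h4 : 0 ≤ |C| * ‖u‖ ^ 2 := by positivity
    linarith

/-- Linearity holds almost everywhere from linearity of the integral, and boundedness comes from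
`HSob.trace_bound`. The order t is a variable of its own because (1 - a)/2 occurs in the type of the
target space. -/
lemma HSob.exists_trace_clm (h2 : 1 / 2 < s) {t : ℝ} (hts : t = s - 1 / 2)
    {ht : |t| < (d : ℝ) / 2 - p} :
    ∃ R : HSob (d + 1) p s hs →L[ℂ] HSob d p t ht, ∀ u, (R u).hat =ᵐ[volume] u.trace := by
  subst hts
  have hd := dim_pos ht
  obtain ⟨K, hK, hb⟩ := HSob.trace_bound (hs := hs) h2 hd
  obtain ⟨C, hC, hCu⟩ := HSob.norm_bounds (hs := hs)
  obtain ⟨C', hC', hCu'⟩ := HSob.norm_bounds (hs := ht)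
  choose R hR using fun u : HSob (d + 1) p s hs =>
    HSob.exists_of_hat ht u.aestronglyMeasurable_trace (hb u).1
  let L : HSob (d + 1) p s hs →ₗ[ℂ] HSob d p (s - 1 / 2) ht :=
    { toFun := R
      map_add' := by
        intro u v
        apply HSob.eq_of_hat
        filter_upwards [hR u, hR v, hR (u + v), HSob.hat_add (R u) (R v), ae_lift (HSob.hat_add u v),
          u.ae_trace h2, v.ae_trace h2, ae_ne_zero hd] with x hu hv huv hadd hl hiu hiv hx
        rw [huv, hadd, hu, hv, HSob.trace, HSob.trace, HSob.trace,
          ← integral_add ((pullForm d p).integrable_comp (hiu hx).1)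
            ((pullForm d p).integrable_comp (hiv hx).1)]
        refine integral_congr_ae ?_
        filter_upwards [hl] with τ hτ
        rw [hτ, map_add]
      map_smul' := by
        intro c u
        apply HSob.eq_of_hat
        filter_upwards [hR u, hR (c • u), HSob.hat_smul c (R u), ae_lift (HSob.hat_smul c u)]
          with x hu hcu hsm hl
        rw [RingHom.id_apply, hcu, hsm, hu, HSob.trace, HSob.trace, ← integral_smul]
        refine integral_congr_ae ?_
        filter_upwards [hl] with τ hτ
        rw [hτ, map_smul] }
  refine ⟨L.mkContinuous (Real.sqrt (C' * (K * C))) fun u => ?_, hR⟩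
  refine (sq_le_sq₀ (norm_nonneg _) (by positivity)).1 ?_
  rw [mul_pow, Real.sq_sqrt (by positivity)]
  change ‖R u‖ ^ 2 ≤ _
  have h5 : ∫ x, wt (2 * (s - 1 / 2)) x * ‖(R u).hat x‖ ^ 2 =
      ∫ x, wt (2 * (s - 1 / 2)) x * ‖u.trace x‖ ^ 2 :=
    integral_congr_ae ((hR u).mono fun x hx => by beta_reduce; rw [hx])
  calc ‖R u‖ ^ 2 ≤ C' * ∫ x, wt (2 * (s - 1 / 2)) x * ‖(R u).hat x‖ ^ 2 := (hCu' _).1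
    _ ≤ C' * (K * ∫ ξ, wt (2 * s) ξ * ‖u.hat ξ‖ ^ 2) := by
        rw [h5]; exact mul_le_mul_of_nonneg_left (hb u).2 hC'
    _ ≤ C' * (K * (C * ‖u‖ ^ 2)) := by
        have := (hCu u).2
        gcongr
    _ = _ := by ring

end Trace

/-! ### The trace map restricts Schwartz forms to the hyperplane -/

section Restriction

variable {d p : ℕ}

lemma inner_lift_lift_zero (x y : Space d) (τ : ℝ) :
    inner ℝ (lift x τ) (lift y 0) = inner ℝ x y := by
  simp [PiLp.inner_apply, Fin.sum_univ_castSucc]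

lemma hasInt_fourierInv_lift (φ : 𝓢(Space (d + 1), Form (d + 1) p)) (y : Space d) :
    HasInt (fun ξ : Space (d + 1) => Real.fourierChar (inner ℝ ξ (lift y 0)) •
      pullForm d p ((𝓕 φ : 𝓢(Space (d + 1), Form (d + 1) p)) ξ)) (pullForm d p (φ (lift y 0))) := by
  have h1 : HasInt (fun ξ : Space (d + 1) => Real.fourierChar (inner ℝ ξ (lift y 0)) •
      ((𝓕 φ : 𝓢(Space (d + 1), Form (d + 1) p)) ξ)) (φ (lift y 0)) := by
    have hF : Integrable (𝓕 φ : 𝓢(Space (d + 1), Form (d + 1) p)) :=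
      (𝓕 φ : 𝓢(Space (d + 1), Form (d + 1) p)).integrable
    constructor
    · simpa using (Real.fourierIntegral_convergent_iff (-lift y 0)).2 hF
    · have h2 : 𝓕⁻ (𝓕 φ : 𝓢(Space (d + 1), Form (d + 1) p)) = φ := by simp
      rw [← Real.fourierInv_eq, ← SchwartzMap.fourierInv_coe, h2]
  have h2 := h1.clm (pullForm d p)
  simpa only [Circle.smul_def, map_smul] using h2

/-- By Fourier inversion at (y, 0) the phase does not involve τ, so integrating τ out first exhibits
the restriction as the inverse transform of the trace. The multiplication formula then passes to
distributions. -/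
lemma HSob.toDist_eq_of_trace {s t : ℝ} {hs : |s| < ((d + 1 : ℕ) : ℝ) / 2 - p}
    {ht : |t| < (d : ℝ) / 2 - p} {u : HSob (d + 1) p s hs} {v : HSob d p t ht}
    (h : v.hat =ᵐ[volume] u.trace) {φ : 𝓢(Space (d + 1), Form (d + 1) p)}
    (hu : u.toDist = (φ : 𝓢'(Space (d + 1), Form (d + 1) p))) :
    IsRep v.toDist fun y => pullForm d p (φ (lift y 0)) := by
  have hi : Integrable fun ξ => pullForm d p ((𝓕 φ : 𝓢(Space (d + 1), Form (d + 1) p)) ξ) :=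
    (pullForm d p).integrable_comp (𝓕 φ : 𝓢(Space (d + 1), Form (d + 1) p)).integrable
  set G : Space d → Form d p := fun x =>
    ∫ τ, pullForm d p ((𝓕 φ : 𝓢(Space (d + 1), Form (d + 1) p)) (lift x τ)) with hG
  have hGi : Integrable G := (integrable_lift.2 hi).integral_prod_left
  have hv : v.hat =ᵐ[volume] G := by
    refine h.trans ?_
    filter_upwards [ae_lift (HSob.hat_schwartz hu)] with x hx
    refine integral_congr_ae ?_
    filter_upwards [hx] with τ hτ
    rw [hτ]
  have hG2 : ∀ y, VectorFourier.fourierIntegral Real.fourierChar volume (-innerₗ (Space d)) G y =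
      pullForm d p (φ (lift y 0)) := by
    intro y
    rw [← integral_fibers (hasInt_fourierInv_lift φ y)]
    refine integral_congr_ae ?_
    filter_upwards with x
    rw [hG]
    beta_reduce
    simp only [Circle.smul_def]
    rw [← integral_smul]
    refine integral_congr_ae (Filter.Eventually.of_forall fun τ => ?_)
    beta_reduce
    rw [inner_lift_lift_zero]
    simp
  have hc : Continuous fun y : Space d => pullForm d p (φ (lift y 0)) :=
    (pullForm d p).continuous.comp (φ.continuous.comp
      ((liftHomeo d).continuous.comp (by fun_prop : Continuous fun y : Space d => (y, (0 : ℝ)))))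
  refine ⟨hc.aestronglyMeasurable, fun ψ => ⟨?_, ?_⟩⟩
  · obtain ⟨C, hC0, hC⟩ := schwartz_lift_bound φ 0
    refine (ψ.integrable.norm.mul_const (‖pullForm d p‖ * C)).mono'
      (ψ.continuous.smul hc).aestronglyMeasurable (Filter.Eventually.of_forall fun y => ?_)
    rw [norm_smul]
    refine mul_le_mul_of_nonneg_left ?_ (norm_nonneg _)
    refine ((pullForm d p).le_opNorm _).trans (mul_le_mul_of_nonneg_left ?_ (norm_nonneg _))
    simpa using hC y 0
  · have h1 := VectorFourier.integral_fourierIntegral_smul_eq_flip (f := ψ) (g := G)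
      (μ := volume) (ν := volume) (L := -innerₗ (Space d))
      Real.continuous_fourierChar (by
        change Continuous fun q : Space d × Space d => -inner ℝ q.1 q.2
        fun_prop)
      ψ.integrable hGi
    have hfl : (-innerₗ (Space d)).flip = -innerₗ (Space d) := by
      ext x y
      simp [real_inner_comm]
    rw [hfl] at h1
    simp only [hG2] at h1
    rw [← h1]
    have h3 : v.toDist ψ = 𝓕 v.toDist (𝓕⁻ ψ) := by
      rw [TemperedDistribution.fourier_apply]
      simp
    rw [h3, (v.isRep_hat.2 _).2]
    refine integral_congr_ae (hv.mono fun x hx => ?_)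
    beta_reduce
    rw [hx, SchwartzMap.fourierInv_coe, Real.fourierInv_eq]
    congr 1
    simp [VectorFourier.fourierIntegral]

end Restriction

/-! ### Existence and uniqueness for the Dirichlet problem -/

section Dirichlet

variable {n d p : ℕ} {s t : ℝ}

lemma HSob.hat_eq_dualHat {hs : |s| < (n : ℝ) / 2 - p} (u : HSob n p s hs) {ξ : Space n}
    (hξ : ξ ≠ 0) : u.hat ξ =
      (((((n : ℝ) / 2 - p + s) * ((n : ℝ) / 2 - p - s))⁻¹ * wt (-(2 * s)) ξ : ℝ) : ℂ) •
        symbol n p (-s) ξ (u.dualHat ξ) := by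
  have hr := abs_lt.1 hs
  have hc : ((n : ℝ) / 2 - p + s) * ((n : ℝ) / 2 - p - s) ≠ 0 :=
    (mul_pos (by linarith) (by linarith)).ne'
  have h1 := symbol_symbol_neg hξ (-s) (u.hat ξ)
  rw [neg_neg, ← sub_eq_add_neg, sub_neg_eq_add, mul_comm ((n : ℝ) / 2 - p - s)] at h1
  have hw : wt (-(2 * s)) ξ * wt (2 * s) ξ = 1 := by
    unfold wt
    rw [← Real.rpow_add (by have := norm_pos_iff.2 hξ; positivity)]
    simp
  rw [HSob.dualHat, map_smul, h1, smul_smul, smul_smul, ← Complex.ofReal_mul, ← Complex.ofReal_mul]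
  rw [mul_assoc _ (wt (-(2 * s)) ξ), hw, mul_one, inv_mul_cancel₀ hc, Complex.ofReal_one, one_smul]

lemma HSob.integrable_dualHat {hs : |s| < (n : ℝ) / 2 - p} (u : HSob n p s hs) :
    Integrable fun ξ => wt (-(2 * s)) ξ * ‖u.dualHat ξ‖ ^ 2 := by
  obtain ⟨w, hw⟩ := u.exists_dual
  obtain ⟨C, hC⟩ := symbol_bounded n p s
  have hC0 : 0 ≤ C := (norm_nonneg _).trans (hC 0)
  have h := (memLp_iff u.isRep_hat.1).2 u.memLp_hat
  refine (h.const_mul (C ^ 2)).mono'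
    ((measurable_wt _).aestronglyMeasurable.mul (hw.1.norm.pow 2)) ?_
  filter_upwards [ae_ne_zero (dim_pos hs)] with ξ hξ
  have hw0 := wt_nonneg (2 * s) ξ
  have hw1 := wt_nonneg (-(2 * s)) ξ
  have hww : wt (-(2 * s)) ξ * wt (2 * s) ξ = 1 := by
    unfold wt
    rw [← Real.rpow_add (by have := norm_pos_iff.2 hξ; positivity)]
    simp
  have h1 : ‖symbol n p s ξ (u.hat ξ)‖ ≤ C * ‖u.hat ξ‖ := (symbol n p s ξ).le_of_opNorm_le (hC ξ) _
  rw [Real.norm_of_nonneg (by positivity), HSob.dualHat, norm_smul, Complex.norm_real,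
    Real.norm_of_nonneg hw0]
  calc wt (-(2 * s)) ξ * (wt (2 * s) ξ * ‖symbol n p s ξ (u.hat ξ)‖) ^ 2
      = (wt (-(2 * s)) ξ * wt (2 * s) ξ) * wt (2 * s) ξ * ‖symbol n p s ξ (u.hat ξ)‖ ^ 2 := by ring
    _ ≤ (wt (-(2 * s)) ξ * wt (2 * s) ξ) * wt (2 * s) ξ * (C * ‖u.hat ξ‖) ^ 2 := by gcongr
    _ = _ := by rw [hww]; ring

lemma lift_ne_zero {x : Space d} (hx : x ≠ 0) (τ : ℝ) : lift x τ ≠ 0 := by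
  intro h0
  have h1 := norm_lift_sq x τ
  rw [h0, norm_zero] at h1
  have := norm_pos_iff.2 hx
  nlinarith [sq_nonneg τ]

/-- The ratio of `(Ru)^` and `|ξ'|^{1-2s} S_{-t}` for `u` in the kernel of `Δ_{a,p}`. -/
def traceConst (d p : ℕ) (s : ℝ) : ℝ :=
  ((((d + 1 : ℕ) : ℝ) / 2 - p + s) * (((d + 1 : ℕ) : ℝ) / 2 - p - s))⁻¹ *
    (2 * Real.pi) ^ (-(2 * s)) * ∫ τ : ℝ, (1 + τ ^ 2) ^ (-s)

variable {hs : |s| < ((d + 1 : ℕ) : ℝ) / 2 - p}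

include hs in
lemma traceConst_ne_zero (h2 : 1 / 2 < s) : traceConst d p s ≠ 0 := by
  have hr := abs_lt.1 hs
  have h1 := integral_rpow_neg_pos h2
  have h3 : 0 < (((d + 1 : ℕ) : ℝ) / 2 - p + s) * (((d + 1 : ℕ) : ℝ) / 2 - p - s) :=
    mul_pos (by linarith) (by linarith)
  unfold traceConst
  positivity

/-- Recovering û from the constant dual function gives a multiple of |2πξ|^{-2s} S_{-s}(ξ) V. The
line integral of this was computed in `integral_pullForm_symbol`. -/
lemma HSob.trace_of_const (h2 : 1 / 2 < s) (u : HSob (d + 1) p s hs) {x : Space d} (hx : x ≠ 0)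
    {V : Form (d + 1) p} (h : (fun τ => u.dualHat (lift x τ)) =ᵐ[volume] fun _ => V)
    (hV : nOp d p V = 0) : u.trace x = ((traceConst d p s * ‖x‖ ^ (1 - 2 * s) : ℝ) : ℂ) •
      symbol d p (-(s - 1 / 2)) x (pullForm d p V) := by
  have h1 := (integral_pullForm_symbol h2 hx hV).smul
    ((((((d + 1 : ℕ) : ℝ) / 2 - p + s) * (((d + 1 : ℕ) : ℝ) / 2 - p - s))⁻¹ *
      (2 * Real.pi) ^ (-(2 * s)) : ℝ) : ℂ)
  refine Eq.trans (integral_congr_ae ?_) (h1.eq.trans ?_)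
  · filter_upwards [h] with τ hτ
    rw [u.hat_eq_dualHat (lift_ne_zero hx τ), hτ, map_smul, wt_lift, smul_smul,
      ← Complex.ofReal_mul, show -(2 * s) / 2 = -s by ring, mul_assoc]
  · rw [smul_smul, ← Complex.ofReal_mul, traceConst]
    congr 2
    ring

variable {a : ℝ} {hs : |(2 - a) / 2| < ((d + 1 : ℕ) : ℝ) / 2 - p}

/-- The dual function is a constant V on each line, in the kernel of N. The trace formula and
invertibility of the boundary symbol kill the pullback of V, and the pullback is injective on that
kernel. -/
lemma eq_zero_of_trace_eq_zero (hd : 0 < d) (ha : a < 1) (ht : |(1 - a) / 2| < (d : ℝ) / 2 - p)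
    {u : HSob (d + 1) p ((2 - a) / 2) hs} (hu : deltaOp d p a u.toDist = 0)
    (h0 : u.trace =ᵐ[volume] 0) : u = 0 := by
  have h2 : 1 / 2 < (2 - a) / 2 := by linarith
  refine HSob.eq_zero_of_dualHat_fibers hd ?_
  filter_upwards [ae_dualHat_const hd ha hu, h0] with x hx hx2 hx0
  obtain ⟨V, hV, hN⟩ := hx hx0
  have h1 := u.trace_of_const h2 hx0 hV hN
  rw [hx2, Pi.zero_apply] at h1
  have hρ := norm_pos_iff.2 hx0
  have h3 : ((traceConst d p ((2 - a) / 2) * ‖x‖ ^ (1 - 2 * ((2 - a) / 2)) : ℝ) : ℂ) ≠ 0 :=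
    Complex.ofReal_ne_zero.2 (mul_ne_zero (traceConst_ne_zero (hs := hs) h2)
      (Real.rpow_pos_of_pos hρ _).ne')
  have h4 := (smul_eq_zero.1 h1.symm).resolve_left h3
  have h5 := symbol_symbol_neg hx0 ((2 - a) / 2 - 1 / 2) (pullForm d p V)
  rw [h4, map_zero] at h5
  have hr := abs_lt.1 ht
  have h6 := (smul_eq_zero.1 h5.symm).resolve_left (Complex.ofReal_ne_zero.2
    (mul_pos (by linarith) (by linarith)).ne')
  have h7 := eq_zero_of_pullForm hN h6
  filter_upwards [hV] with τ hτ
  rw [hτ, h7]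

/-- For a function constant along the lines the integral of r^{-2s} contributes a multiple of
|x|^{1-2s}. The dual norm of order s in the bulk is therefore a multiple of the dual norm of order s
- 1/2 on the boundary. -/
lemma exists_integrable_extension (hd : 0 < d) (h2 : 1 / 2 < s) {V : Space d → Form (d + 1) p}
    (hVm : AEStronglyMeasurable V volume)
    (hVi : Integrable fun x => wt (-(2 * (s - 1 / 2))) x * ‖V x‖ ^ 2) :
    ∃ U : Space (d + 1) → Form (d + 1) p, (∀ x τ, U (lift x τ) = V x) ∧
      AEStronglyMeasurable U volume ∧ Integrable fun ξ => wt (-(2 * s)) ξ * ‖U ξ‖ ^ 2 := by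
  have hJ := integral_rpow_neg_pos h2
  have hUl : ∀ (x : Space d) (τ : ℝ), V ((liftHomeo d).symm (lift x τ)).1 = V x := fun x τ =>
    congrArg (fun z : Space d × ℝ => V z.1) ((liftHomeo d).symm_apply_apply (x, τ))
  have hUlm : AEStronglyMeasurable
      (fun z : Space d × ℝ => V ((liftHomeo d).symm (lift z.1 z.2)).1) (volume.prod volume) := by
    simp only [hUl]
    exact hVm.comp_fst
  refine ⟨fun ξ => V ((liftHomeo d).symm ξ).1, hUl, ((measurePreserving_lift d).aestronglyMeasurable_comp_iff
    (measurableEmbedding_lift d)).1 hUlm, ?_⟩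
  rw [← integrable_lift]
  have hwt : ∀ (x : Space d) (τ : ℝ), wt (-(2 * s)) (lift x τ) *
      ‖V ((liftHomeo d).symm (lift x τ)).1‖ ^ 2 = (2 * Real.pi) ^ (-(2 * s)) * ‖V x‖ ^ 2 *
        (‖x‖ ^ 2 + τ ^ 2) ^ (-s) := by
    intro x τ
    rw [hUl, wt_lift, show -(2 * s) / 2 = -s by ring]
    ring
  have hm : AEStronglyMeasurable (fun z : Space d × ℝ =>
      wt (-(2 * s)) (lift z.1 z.2) * ‖V ((liftHomeo d).symm (lift z.1 z.2)).1‖ ^ 2)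
      (volume.prod volume) :=
    ((measurable_wt _).comp (liftHomeo d).continuous.measurable).aestronglyMeasurable.mul
      (hUlm.norm.pow 2)
  refine (integrable_prod_iff hm).2 ⟨?_, ?_⟩
  · filter_upwards [ae_ne_zero hd] with x hx
    simp only [hwt]
    exact (integrable_rpow_neg (norm_pos_iff.2 hx) h2).const_mul _
  · refine (hVi.const_mul ((2 * Real.pi) ^ (-(2 * s)) * (2 * Real.pi) ^ (2 * s - 1) *
      ∫ τ : ℝ, (1 + τ ^ 2) ^ (-s))).congr ?_
    filter_upwards [ae_ne_zero hd] with x hx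
    have hρ := norm_pos_iff.2 hx
    have h3 : ∀ τ, ‖wt (-(2 * s)) (lift x τ) * ‖V ((liftHomeo d).symm (lift x τ)).1‖ ^ 2‖ =
        (2 * Real.pi) ^ (-(2 * s)) * ‖V x‖ ^ 2 * (‖x‖ ^ 2 + τ ^ 2) ^ (-s) := fun τ => by
      rw [Real.norm_of_nonneg (mul_nonneg (wt_nonneg _ _) (sq_nonneg _)), hwt]
    simp only [h3]
    have h6 : (2 * Real.pi) ^ (2 * s - 1) * (2 * Real.pi) ^ (-(2 * (s - 1 / 2))) = 1 := by
      rw [← Real.rpow_add (by positivity), show 2 * s - 1 + -(2 * (s - 1 / 2)) = 0 by ring,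
        Real.rpow_zero]
    rw [integral_const_mul, integral_rpow_neg hρ, wt, Real.mul_rpow (by positivity) hρ.le,
      show ‖x‖ ^ (-(2 * (s - 1 / 2))) = ‖x‖ ^ (1 - 2 * s) by congr 1; ring]
    linear_combination ((2 * Real.pi) ^ (-(2 * s)) * ‖V x‖ ^ 2 * ‖x‖ ^ (1 - 2 * s) *
      ∫ τ : ℝ, (1 + τ ^ 2) ^ (-s)) * h6

lemma pullForm_trace_eq {ht : |s - 1 / 2| < (d : ℝ) / 2 - p} (f : HSob d p (s - 1 / 2) ht)
    {x : Space d} (hx : x ≠ 0) (k K : ℝ) :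
    ((k * ‖x‖ ^ (1 - 2 * s) : ℝ) : ℂ) • symbol d p (-(s - 1 / 2)) x
      (pullForm d p ((K : ℂ) • extForm d p (f.dualHat x))) =
    ((k * K * (2 * Real.pi) ^ (2 * s - 1) * (((d : ℝ) / 2 - p + (s - 1 / 2)) *
      ((d : ℝ) / 2 - p - (s - 1 / 2))) : ℝ) : ℂ) • f.hat x := by
  have hρ := norm_pos_iff.2 hx
  have h3 := symbol_symbol_neg hx (-(s - 1 / 2)) (f.hat x)
  rw [neg_neg] at h3
  have h4 : wt (2 * (s - 1 / 2)) x * ‖x‖ ^ (1 - 2 * s) = (2 * Real.pi) ^ (2 * s - 1) := by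
    rw [wt, Real.mul_rpow (by positivity) hρ.le, mul_assoc, ← Real.rpow_add hρ,
      show 2 * (s - 1 / 2) + (1 - 2 * s) = 0 by ring, Real.rpow_zero, mul_one]
    congr 1
    ring
  rw [map_smul, pullForm_extForm, HSob.dualHat, map_smul, map_smul, h3, smul_smul, smul_smul,
    smul_smul, ← Complex.ofReal_mul, ← Complex.ofReal_mul, ← Complex.ofReal_mul, ← h4]
  congr 2
  ring

/-- The dual function of the solution is, up to a constant, the dual function of f regarded as a
form independent of τ. The boundary symbol in the trace formula then undoes the one in the dual
function of f. -/
lemma exists_trace_eq (h2 : 1 / 2 < s) {hs : |s| < ((d + 1 : ℕ) : ℝ) / 2 - p}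
    {ht : |s - 1 / 2| < (d : ℝ) / 2 - p} (f : HSob d p (s - 1 / 2) ht) :
    ∃ u : HSob (d + 1) p s hs, (∀ᵐ x : Space d, ∃ V : Form (d + 1) p,
      (fun τ => u.dualHat (lift x τ)) =ᵐ[volume] (fun _ => V) ∧ nOp d p V = 0) ∧
      u.trace =ᵐ[volume] f.hat := by
  have hd := dim_pos ht
  have hr := abs_lt.1 ht
  have hc : ((d : ℝ) / 2 - p + (s - 1 / 2)) * ((d : ℝ) / 2 - p - (s - 1 / 2)) ≠ 0 :=
    (mul_pos (by linarith) (by linarith)).ne'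
  -- K normalises the product of the trace constant, the power of 2π left by the weights, and the
  -- scalar S_t S_{-t} with t = s - 1/2.
  obtain ⟨K, hK⟩ : ∃ K : ℝ, traceConst d p s * K * (2 * Real.pi) ^ (2 * s - 1) *
      (((d : ℝ) / 2 - p + (s - 1 / 2)) * ((d : ℝ) / 2 - p - (s - 1 / 2))) = 1 := by
    have h1 := traceConst_ne_zero (hs := hs) h2
    have h3 : (2 * Real.pi) ^ (2 * s - 1) ≠ 0 := (Real.rpow_pos_of_pos (by positivity) _).ne'
    refine ⟨(traceConst d p s * (2 * Real.pi) ^ (2 * s - 1) *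
      (((d : ℝ) / 2 - p + (s - 1 / 2)) * ((d : ℝ) / 2 - p - (s - 1 / 2))))⁻¹, ?_⟩
    refine Eq.trans ?_ (mul_inv_cancel₀ (mul_ne_zero (mul_ne_zero h1 h3) hc))
    ring
  obtain ⟨w, hw⟩ := f.exists_dual
  obtain ⟨V, hV⟩ : ∃ V : Space d → Form (d + 1) p,
      ∀ x, V x = (K : ℂ) • extForm d p (f.dualHat x) := ⟨_, fun _ => rfl⟩
  have hVm : AEStronglyMeasurable V volume := by
    rw [funext hV]
    exact (continuous_const_smul (K : ℂ)).comp_aestronglyMeasurable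
      ((extForm d p).continuous.comp_aestronglyMeasurable hw.1)
  have hVi : Integrable fun x => wt (-(2 * (s - 1 / 2))) x * ‖V x‖ ^ 2 := by
    have hi := f.integrable_dualHat.const_mul ((|K| * ‖extForm d p‖) ^ 2)
    refine hi.mono' ((measurable_wt _).aestronglyMeasurable.mul (hVm.norm.pow 2))
      (Filter.Eventually.of_forall fun x => ?_)
    have h4 : ‖V x‖ ≤ |K| * ‖extForm d p‖ * ‖f.dualHat x‖ := by
      rw [hV, norm_smul, Complex.norm_real, Real.norm_eq_abs, mul_assoc]
      exact mul_le_mul_of_nonneg_left ((extForm d p).le_opNorm _) (abs_nonneg _)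
    have hw0 := wt_nonneg (-(2 * (s - 1 / 2))) x
    rw [Real.norm_of_nonneg (mul_nonneg hw0 (sq_nonneg _))]
    refine (mul_le_mul_of_nonneg_left (pow_le_pow_left₀ (norm_nonneg _) h4 2) hw0).trans_eq ?_
    ring
  obtain ⟨U, hU, hUm, hUi⟩ := exists_integrable_extension hd h2 hVm hVi
  obtain ⟨u, hu⟩ := HSob.exists_of_dualHat hs hUm hUi
  have hN : ∀ x, nOp d p (V x) = 0 := fun x => by
    rw [hV, map_smul, nOp_extForm, smul_zero]
  have hfib : ∀ᵐ x : Space d, (fun τ => u.dualHat (lift x τ)) =ᵐ[volume] fun _ => V x := by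
    filter_upwards [ae_lift hu] with x hx
    filter_upwards [hx] with τ hτ
    rw [hτ, hU]
  refine ⟨u, hfib.mono fun x hx => ⟨_, hx, hN x⟩, ?_⟩
  filter_upwards [hfib, ae_ne_zero hd] with x hx hx0
  rw [u.trace_of_const h2 hx0 hx (hN x), hV, pullForm_trace_eq f hx0, hK, Complex.ofReal_one,
    one_smul]

/-- A constant in the kernel of N solves the line equation with eigenvalue 0, so the adjoint kills
u. By essential self-adjointness (u, 0) is in the closed graph, and the closure acts as the
distributional operator. -/
lemma deltaOp_eq_zero_of_const (hd : 0 < d) {u : HSob (d + 1) p ((2 - a) / 2) hs}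
    (h : ∀ᵐ x : Space d, ∃ V : Form (d + 1) p,
      (fun τ => u.dualHat (lift x τ)) =ᵐ[volume] (fun _ => V) ∧ nOp d p V = 0) :
    deltaOp d p a u.toDist = 0 := by
  have h3 := deltaMin_adjoint_of_fibers hd (κ := 0) (u := u) (by
    filter_upwards [h] with x hx hx0
    obtain ⟨V, hV, hN⟩ := hx
    refine ⟨fun _ => V, fun _ => 0, fun _ => 0, hV,
      ⟨fun τ => hasDerivAt_const _ _, fun τ => hasDerivAt_const _ _, fun τ => ?_⟩,
      ‖V‖, 0, 0, 0, fun τ => by simp, fun τ => by simp⟩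
    beta_reduce
    rw [hN, map_zero, smul_zero, smul_zero, smul_zero, smul_zero, zero_smul]
    simp)
  have h5 : (u, (0 : HSob (d + 1) p ((2 - a) / 2) hs)) ∈ (deltaMin d p a hs).closure.graph :=
    mem_closure_graph_deltaMin hd fun φ => by rw [h3 φ, zero_mul, inner_zero_right]
  rw [deltaOp_eq_of_mem_closure hd h5, map_zero]

end Dirichlet

/-! ### Uniqueness of the restriction map and the final statement -/

section Uniqueness

variable {d p : ℕ} {s t : ℝ} {hs : |s| < ((d + 1 : ℕ) : ℝ) / 2 - p} {ht : |t| < (d : ℝ) / 2 - p}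

lemma IsRestriction.eq {R R' : HSob (d + 1) p s hs →L[ℂ] HSob d p t ht} (h : IsRestriction R)
    (h' : IsRestriction R') : R = R' := by
  refine ContinuousLinearMap.coeFn_injective
    (R.continuous.ext_on (dense_testForms hs) R'.continuous ?_)
  rintro u ⟨φ, hφ, hu⟩
  exact HSob.toDist_injective ((h φ hφ u hu).ext (h' φ hφ u hu) (Filter.EventuallyEq.refl _ _))

lemma exists_isRestriction (h2 : 1 / 2 < s) (hts : t = s - 1 / 2) :
    ∃ R : HSob (d + 1) p s hs →L[ℂ] HSob d p t ht,
      IsRestriction R ∧ ∀ u, (R u).hat =ᵐ[volume] u.trace := by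
  obtain ⟨R, hR⟩ := HSob.exists_trace_clm (hs := hs) (ht := ht) h2 hts
  exact ⟨R, fun φ _ u hu => HSob.toDist_eq_of_trace (hR u) hu, hR⟩

end Uniqueness

lemma dirichlet {d p : ℕ} {a : ℝ} {hs : |(2 - a) / 2| < ((d + 1 : ℕ) : ℝ) / 2 - p}
    {ht : |(1 - a) / 2| < (d : ℝ) / 2 - p} (ha : a < 1)
    {R : HSob (d + 1) p ((2 - a) / 2) hs →L[ℂ] HSob d p ((1 - a) / 2) ht} (hR : IsRestriction R)
    (f : HSob d p ((1 - a) / 2) ht) :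
    ∃! u : HSob (d + 1) p ((2 - a) / 2) hs, deltaOp d p a u.toDist = 0 ∧ R u = f := by
  have hd := dim_pos ht
  have hts : (1 - a) / 2 = (2 - a) / 2 - 1 / 2 := by ring
  have h2 : 1 / 2 < (2 - a) / 2 := by linarith
  obtain ⟨R', hR', hT⟩ := exists_isRestriction (hs := hs) (ht := ht) h2 hts
  -- Test forms are dense, so the given restriction is the map described by line integrals on the
  -- Fourier side.
  obtain rfl := hR.eq hR'
  obtain ⟨u, hu0, hu'⟩ : ∃ u : HSob (d + 1) p ((2 - a) / 2) hs,
      (∀ᵐ x : Space d, ∃ V : Form (d + 1) p,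
        (fun τ => u.dualHat (lift x τ)) =ᵐ[volume] (fun _ => V) ∧ nOp d p V = 0) ∧
      u.trace =ᵐ[volume] f.hat := by
    -- The order (1 - a)/2 sits inside the types of f and R. Dropping what depends on R allows it to
    -- be rewritten as s - 1/2.
    clear hT hR hR' R
    revert ht
    rw [hts]
    intro ht f
    exact exists_trace_eq h2 f
  have hu := deltaOp_eq_zero_of_const hd hu0
  refine ⟨u, ⟨hu, HSob.eq_of_hat ((hT u).trans hu')⟩, ?_⟩
  rintro v ⟨hv, hv'⟩
  rw [← sub_eq_zero]
  refine eq_zero_of_trace_eq_zero hd ha ht ?_ ((hT (v - u)).symm.trans ?_)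
  · rw [map_sub, map_sub, hu, hv, sub_zero]
  · have h0 : R (v - u) = 0 := by
      rw [map_sub, hv', HSob.eq_of_hat ((hT u).trans hu'), sub_self]
    refine (R (v - u)).isRep_hat.ae_eq ?_
    rw [h0, map_zero, FourierTransform.fourier_zero]
    exact IsRep.zero

end DiffForms

end

theorem theoremA (d p : ℕ) (hd : 1 ≤ d) (hp : 2 * p ≤ d + 1) (a : ℝ)
    (ha : 2 - ((d + 1 : ℕ) : ℝ) + 2 * p < a) :
    (∀ ha2 : a ≤ 2,
      DiffForms.IsEssentiallySelfAdjoint (DiffForms.deltaMin d p a (DiffForms.range_bulk ha ha2)) ∧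
      ∀ k : ℕ, (k : ℝ) < (1 - a) / 2 →
        (((k : ℝ) * (k + a - 1) : ℝ) : ℂ) ∈
          DiffForms.pointSpectrum (DiffForms.deltaMin d p a (DiffForms.range_bulk ha ha2)).closure) ∧
    (∀ ha1 : a < 1,
      (∃! R : DiffForms.HSob (d + 1) p ((2 - a) / 2)
            (DiffForms.range_bulk ha (ha1.le.trans one_le_two)) →L[ℂ]
          DiffForms.HSob d p ((1 - a) / 2) (DiffForms.range_boundary ha ha1), DiffForms.IsRestriction R) ∧
      ∀ R : DiffForms.HSob (d + 1) p ((2 - a) / 2)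
            (DiffForms.range_bulk ha (ha1.le.trans one_le_two)) →L[ℂ]
          DiffForms.HSob d p ((1 - a) / 2) (DiffForms.range_boundary ha ha1), DiffForms.IsRestriction R →
        ∀ f : DiffForms.HSob d p ((1 - a) / 2) (DiffForms.range_boundary ha ha1),
          ∃! u : DiffForms.HSob (d + 1) p ((2 - a) / 2)
              (DiffForms.range_bulk ha (ha1.le.trans one_le_two)),
            DiffForms.deltaOp d p a u.toDist = 0 ∧ R u = f) := by
  have hd0 : 0 < d := hd
  refine ⟨fun ha2 => ⟨DiffForms.deltaMin_essentiallySelfAdjoint hd0, fun k hk =>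
    DiffForms.eigenvalue_mem_pointSpectrum hd0 ha k hk⟩, fun ha1 => ⟨?_, fun R hR f =>
      DiffForms.dirichlet ha1 hR f⟩⟩
  obtain ⟨R, hR, -⟩ := DiffForms.exists_isRestriction
    (hs := DiffForms.range_bulk ha (ha1.le.trans one_le_two))
    (ht := DiffForms.range_boundary ha ha1) (by linarith) (by ring)
  exact ⟨R, hR, fun R' hR' => hR'.eq hR⟩
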